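/- **Conventions.** Log structures are taken for the étale topology and monoids are commutative with unit $1$. A *log point* $(k,Q)$ is $\operatorname{Spec} k$, $k$ a field, with the log structure associated to the homomorphism $Q\to k$ that sends $1$ to $1$ and every $q\neq 1$ to $0$. A morphism $g:(X,M)\to(Y,N)$ of log schemes is *sharp* if for every geometric point $x$ of $X$, with image $y=g(x)$, there is a chart $Q'\to P$ of $g$ at $x$ such that $P\to k(x)$ and $Q'\to k(y)$ are log points. It is *log smooth* if, étale locally on $X$ and $Y$, it has a chart $Q'\to P$ by fine monoids such that $\ker(Q'^{\mathrm{gp}}\to P^{\mathrm{gp}})$ and the torsion subgroup of $\operatorname{coker}(Q'^{\mathrm{gp}}\to P^{\mathrm{gp}})$ are finite groups of order invertible on $Y$, and the induced map $X\to Y\times_{\operatorname{Spec}\mathbb Z[Q']}\operatorname{Spec}\mathbb Z[P]$ is étale. **Theorem.** Let $(k,Q)$ be a log point, with $k$ any field and $Q$ a fine (that is, finitely generated and cancellative) monoid. Let $X$ be a $k$-scheme of finite type with a log structure $M$ and a morphism of log schemes $(X,M)\to(k,Q)$ over $X\to\operatorname{Spec}k$ that is sharp and log smooth, and let $f:X\to\mathbb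 P^n_k$ be an unramified morphism of $k$-schemes. Let $0\le r\le n+1$, and let $G$ be the Grassmannian of linear subspaces of codimension $r$ in $\mathbb P^n_k$, i.e. the scheme parametrising locally free quotients of rank $n+1-r$ of $\Gamma(\mathbb P^n_k,\mathcal O(1))$, with tautological quotient $\mathcal Q$. Let $$\mathcal H_X=\operatorname{Grass}_1(\mathcal Q)\times_{\mathbb P^n_k}X=\{(x,L)\in X\times_k G:\ f(x)\in L\},$$ where $\operatorname{Grass}_1(\mathcal Q)\subset\mathbb P^n_k\times_kG$ is the scheme of rank one quotients of $\mathcal Q$, and let $p:\mathcal H_X\to G$ be the projection. Endow $\mathcal H_X$ with the inverse image log structure of $M$ under the projection to $X$, and $G$ with the inverse image of the log structure of $(k,Q)$; then $p$ is a morphism of log schemes. There is a dense open $U\subset G$ such that $p|_U:\mathcal H_X|_U\to U$ is log smooth. In particular, for every extension field $K$ of $k$ and every linear subspace $L\in U(K)$, the linear section $f_K^{-1}(L)$ of $X_K$, with the inverse image log structure of $M$, is log smooth over the log point $(K,Q)$; for $r=1$, the generic hyperplane sections of $X$ are log smooth. -/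

import Mathlib

open CategoryTheory CategoryTheory.Limits AlgebraicGeometry Opposite

universe u

noncomputable section

/-!
### Log schemes
-/

/-- The scheme underlying an object of the small étale site of `X`. -/
abbrev EtSpace {X : Scheme.{u}} (V : X.Etale) : Scheme.{u} := ((Scheme.Etale.forget X).obj V).left

/-- Its étale structure morphism to `X`. -/
abbrev etStr {X : Scheme.{u}} (V : X.Etale) : EtSpace V ⟶ X := ((Scheme.Etale.forget X).obj V).hom

instance {X : Scheme.{u}} (V : X.Etale) : Etale (etStr V) := V.prop

/-- The morphism of schemes underlying a morphism of the small étale site. -/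
abbrev etMor {X : Scheme.{u}} {V V' : X.Etale} (j : V' ⟶ V) : EtSpace V' ⟶ EtSpace V :=
  ((Scheme.Etale.forget X).map j).left

/-- A log structure (for the étale topology) on a scheme `X`: a sheaf of commutative monoids `M` on
the small étale site with a homomorphism `α` to the multiplicative monoid of the structure sheaf,
such that `α⁻¹(𝒪*) ⟶ 𝒪*` is an isomorphism. In particular `M* = α⁻¹(𝒪*) = 𝒪*`. -/
structure LogStructure (X : Scheme.{u}) where
  sheaf : Sheaf X.smallEtaleTopology CommMonCat.{u}
  α (V : X.Etale) : sheaf.obj.obj (op V) →* Γ(EtSpace V, ⊤)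
  α_res {V V' : X.Etale} (j : V' ⟶ V) (m : sheaf.obj.obj (op V)) :
    α V' (sheaf.obj.map j.op m) = (etMor j).appTop (α V m)
  existsUnique_unit (V : X.Etale) (a : Γ(EtSpace V, ⊤)ˣ) : ∃! m, α V m = a

namespace LogStructure
variable {X : Scheme.{u}} (M : LogStructure X)

/-- Sections of the log structure over an étale `X`-scheme. -/
abbrev Sec (V : X.Etale) : Type u := M.sheaf.obj.obj (op V)

/-- Restriction of sections. -/
def res {V V' : X.Etale} (j : V' ⟶ V) : M.Sec V →* M.Sec V' := (M.sheaf.obj.map j.op).hom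

/-- `β : P → M(V)` is a chart of `M` over `V`: the induced morphism `Pᵃ → M` on `V` is an isomorphism,
where `Pᵃ` is the log structure associated to `P`, that is, the sheaf associated to
`(P × 𝒪*) / ∼` with `(p, a) ∼ (q, b)` if and only if there are `c, d ∈ P` with `α(β c)`, `α(β d)`
invertible, `p c = q d` and `α(β d) a = α(β c) b`. The two conditions express local surjectivity and
local injectivity, the sections of `𝒪*` being identified with the units of `M`. -/
def IsChart {P : Type u} [CommMonoid P] {V : X.Etale} (β : P →* M.Sec V) : Prop :=
  (∀ (V' : X.Etale) (j : V' ⟶ V) (m : M.Sec V') (v : EtSpace V'),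
    ∃ (V'' : X.Etale) (i : V'' ⟶ V') (_ : v ∈ Set.range (etMor i)) (p : P) (a : (M.Sec V'')ˣ),
      M.res i m = M.res (i ≫ j) (β p) * a) ∧
  (∀ (V' : X.Etale) (j : V' ⟶ V) (p q : P) (a b : (M.Sec V')ˣ) (v : EtSpace V'),
    M.res j (β p) * a = M.res j (β q) * b →
    ∃ (V'' : X.Etale) (i : V'' ⟶ V') (_ : v ∈ Set.range (etMor i)) (c d : P)
      (_ : IsUnit (M.res (i ≫ j) (β c))) (_ : IsUnit (M.res (i ≫ j) (β d))),
      p * c = q * d ∧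
        M.res (i ≫ j) (β d) * M.res i a = M.res (i ≫ j) (β c) * M.res i b)

/-- The morphism `V ⟶ Spec ℤ[P]` given by `α ∘ β : P → Γ(V, 𝒪)`. -/
def toSpecMonoidAlgebra {P : Type u} [CommMonoid P] {V : X.Etale} (β : P →* M.Sec V) :
    EtSpace V ⟶ Spec (.of (MonoidAlgebra ℤ P)) :=
  (EtSpace V).toSpecΓ ≫ Spec.map (CommRingCat.ofHom
    (MonoidAlgebra.lift ℤ Γ(EtSpace V, ⊤) P ((M.α V).comp β)).toRingHom)

end LogStructure

/-- For log structures `M` on `X` and `N` on `Y`, a morphism of log schemes `(X, M) ⟶ (Y, N)` over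
`f : X ⟶ Y`, that is, a morphism `f⁻¹ N → M` compatible with the maps to the structure sheaves. It is
given by its components `N(W) → M(V)` for all commutative squares formed by a morphism `V ⟶ W` over `f`,
for `V` étale over `X` and `W` étale over `Y`. -/
@[ext]
structure LogHom {X Y : Scheme.{u}} (M : LogStructure X) (N : LogStructure Y) (f : X ⟶ Y) where
  map {V : X.Etale} {W : Y.Etale} (g : EtSpace V ⟶ EtSpace W) (hg : g ≫ etStr W = etStr V ≫ f) :
    N.Sec W →* M.Sec V
  map_res {V V' : X.Etale} {W W' : Y.Etale} (g : EtSpace V ⟶ EtSpace W)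
    (hg : g ≫ etStr W = etStr V ≫ f) (g' : EtSpace V' ⟶ EtSpace W')
    (hg' : g' ≫ etStr W' = etStr V' ≫ f)
    (j : V' ⟶ V) (i : W' ⟶ W) (h : g' ≫ etMor i = etMor j ≫ g) (n : N.Sec W) :
    map g' hg' (N.res i n) = M.res j (map g hg n)
  α_map {V : X.Etale} {W : Y.Etale} (g : EtSpace V ⟶ EtSpace W) (hg : g ≫ etStr W = etStr V ≫ f)
    (n : N.Sec W) : M.α V (map g hg n) = g.appTop (N.α W n)

namespace LogHom
variable {X Y Z : Scheme.{u}} {M : LogStructure X} {N : LogStructure Y} {K : LogStructure Z}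
  {f : X ⟶ Y} {g : Y ⟶ Z}

/-- Composition of morphisms of log schemes, over a given composite `h = f ≫ g`. A morphism `V ⟶ W` over
`h` is factored through the étale `Y`-scheme `W ×_Z Y`. -/
def comp (φ : LogHom M N f) (ψ : LogHom N K g) {h : X ⟶ Z} (w : f ≫ g = h) : LogHom M K h where
  map {V W} a ha :=
    (φ.map (W := Scheme.Etale.mk (pullback.snd (etStr W) g))
      (pullback.lift a (etStr V ≫ f) (by rw [ha, Category.assoc, w]))
      (pullback.lift_snd _ _ _)).comp
    (ψ.map (V := Scheme.Etale.mk (pullback.snd (etStr W) g)) (pullback.fst (etStr W) g)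
      pullback.condition)
  map_res {V V' W W'} a ha a' ha' j i hij n := by
    have hi : etMor i ≫ etStr W = etStr W' := Over.w ((Scheme.Etale.forget Z).map i)
    have hj : etMor j ≫ etStr V = etStr V' := Over.w ((Scheme.Etale.forget X).map j)
    have hl' : a' ≫ etStr W' = (etStr V' ≫ f) ≫ g := by rw [ha', Category.assoc, w]
    have hl : a ≫ etStr W = (etStr V ≫ f) ≫ g := by rw [ha, Category.assoc, w]
    let t₀ : pullback (etStr W') g ⟶ pullback (etStr W) g :=
      pullback.lift (pullback.fst _ _ ≫ etMor i) (pullback.snd _ _)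
        (by rw [Category.assoc, hi, pullback.condition])
    have key : pullback.lift a' (etStr V' ≫ f) hl' ≫ t₀ =
        etMor j ≫ pullback.lift a (etStr V ≫ f) hl := by
      apply pullback.hom_ext
      · simp only [t₀, Category.assoc, pullback.lift_fst, pullback.lift_fst_assoc, hij]
      · simp only [t₀, Category.assoc, pullback.lift_snd, reassoc_of% hj]
    let u : (Scheme.Etale.forget Y).obj (Scheme.Etale.mk (pullback.snd (etStr W') g)) ⟶
        (Scheme.Etale.forget Y).obj (Scheme.Etale.mk (pullback.snd (etStr W) g)) :=
      Over.homMk (U := Over.mk (pullback.snd (etStr W') g))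
        (V := Over.mk (pullback.snd (etStr W) g)) t₀ (pullback.lift_snd _ _ _)
    let t := (Scheme.Etale.forgetFullyFaithful Y).preimage u
    have ht : etMor t = t₀ :=
      congrArg CommaMorphism.left ((Scheme.Etale.forgetFullyFaithful Y).map_preimage u)
    have e1 := ψ.map_res (V := Scheme.Etale.mk (pullback.snd (etStr W) g))
      (V' := Scheme.Etale.mk (pullback.snd (etStr W') g)) (pullback.fst (etStr W) g)
      pullback.condition (pullback.fst (etStr W') g) pullback.condition t i
      (by rw [ht]; exact (pullback.lift_fst _ _ _).symm) n
    refine (congrArg _ e1).trans (φ.map_res _ _ _ _ j t ?_ _)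
    rw [ht]
    exact key
  α_map {V W} a ha n := by
    have hl : a ≫ etStr W = (etStr V ≫ f) ≫ g := by rw [ha, Category.assoc, w]
    have key : (pullback.fst (etStr W) g).appTop ≫ (pullback.lift a (etStr V ≫ f) hl).appTop =
        a.appTop := by
      rw [← Scheme.Hom.comp_appTop, pullback.lift_fst]
    refine (φ.α_map _ _ _).trans ((congrArg _ (ψ.α_map _ _ _)).trans ?_)
    exact congrArg (fun t => t.hom (K.α W n)) key

/-- The morphism `(X, M) ⟶ (Y, N)` is strict, i.e. it identifies `M` with the inverse image log structure
`f^* N`, the log structure associated to `f⁻¹ N`. As for charts, the two conditions express that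
`(f⁻¹ N)ᵃ → M` is locally surjective and locally injective. -/
def IsStrict (φ : LogHom M N f) : Prop :=
  (∀ (V : X.Etale) (m : M.Sec V) (v : EtSpace V),
    ∃ (V' : X.Etale) (j : V' ⟶ V) (_ : v ∈ Set.range (etMor j)) (W : Y.Etale)
      (g : EtSpace V' ⟶ EtSpace W) (hg : g ≫ etStr W = etStr V' ≫ f) (n : N.Sec W)
      (a : (M.Sec V')ˣ),
      M.res j m = φ.map g hg n * a) ∧
  (∀ (V : X.Etale) (W : Y.Etale) (g : EtSpace V ⟶ EtSpace W) (hg : g ≫ etStr W = etStr V ≫ f)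
    (n n' : N.Sec W) (a b : (M.Sec V)ˣ) (v : EtSpace V), φ.map g hg n * a = φ.map g hg n' * b →
    ∃ (V' : X.Etale) (j : V' ⟶ V) (_ : v ∈ Set.range (etMor j)) (W' : Y.Etale) (i : W' ⟶ W)
      (g' : EtSpace V' ⟶ EtSpace W') (hg' : g' ≫ etStr W' = etStr V' ≫ f)
      (_ : g' ≫ etMor i = etMor j ≫ g) (c d : N.Sec W')
      (_ : IsUnit (φ.map g' hg' c)) (_ : IsUnit (φ.map g' hg' d)),
      N.res i n * c = N.res i n' * d ∧
        φ.map g' hg' d * M.res j a = φ.map g' hg' c * M.res j b)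

/-- A chart `Q → P` of the morphism over the étale neighbourhoods `V ⟶ W`: charts `P → M(V)` and
`Q → N(W)` and a homomorphism `Q → P` compatible with `N(W) → M(V)`. -/
structure Chart (φ : LogHom M N f) {V : X.Etale} {W : Y.Etale} (g : EtSpace V ⟶ EtSpace W)
    (hg : g ≫ etStr W = etStr V ≫ f) (Q P : Type u) [CommMonoid Q] [CommMonoid P] where
  source : P →* M.Sec V
  target : Q →* N.Sec W
  hom : Q →* P
  isChart_source : M.IsChart source
  isChart_target : N.IsChart target
  comm (q : Q) : source (hom q) = φ.map g hg (target q)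

/-- The morphism is sharp at the geometric point `x : Spec Ω ⟶ X`: in étale neighbourhoods there is a
chart `Q → P` such that `P → Ω` and `Q → Ω` are log points, i.e. all elements other than `1` map
to `0`. -/
def SharpAt (φ : LogHom M N f) {Ω : Type u} [Field Ω] (x : Spec (.of Ω) ⟶ X) : Prop :=
  ∃ (V : X.Etale) (W : Y.Etale) (g : EtSpace V ⟶ EtSpace W) (hg : g ≫ etStr W = etStr V ≫ f)
    (v : Spec (.of Ω) ⟶ EtSpace V) (Q P : Type u) (_ : CommMonoid Q) (_ : CommMonoid P)
    (c : φ.Chart g hg Q P),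
    v ≫ etStr V = x ∧
    (∀ p : P, p ≠ 1 → v.appTop (M.α V (c.source p)) = 0) ∧
    (∀ q : Q, q ≠ 1 → (v ≫ g).appTop (N.α W (c.target q)) = 0)

/-- The morphism is sharp, i.e. sharp at all geometric points. -/
def IsSharp (φ : LogHom M N f) : Prop :=
  ∀ (Ω : Type u) [Field Ω] [IsSepClosed Ω] (x : Spec (.of Ω) ⟶ X), φ.SharpAt x

end LogHom

/-- The homomorphism `Qᵍᵖ → Pᵍᵖ` induced by `θ : Q → P`. -/
def gpMap {Q P : Type u} [CommMonoid Q] [CommMonoid P] (θ : Q →* P) :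
    Algebra.GrothendieckGroup Q →* Algebra.GrothendieckGroup P :=
  Algebra.GrothendieckGroup.lift (Algebra.GrothendieckGroup.of.comp θ)

/-- The morphism `Spec ℤ[P] ⟶ Spec ℤ[Q]` induced by `θ : Q → P`. -/
def specMap {Q P : Type u} [CommMonoid Q] [CommMonoid P] (θ : Q →* P) :
    Spec (.of (MonoidAlgebra ℤ P)) ⟶ Spec (.of (MonoidAlgebra ℤ Q)) :=
  Spec.map (CommRingCat.ofHom (MonoidAlgebra.mapDomainRingHom ℤ θ))

namespace LogHom
variable {X Y : Scheme.{u}} {M : LogStructure X} {N : LogStructure Y} {f : X ⟶ Y}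

/-- The condition on a chart `Q → P` in the definition of log smoothness: `P` and `Q` are fine, the kernel
and the torsion subgroup of the cokernel of `Qᵍᵖ → Pᵍᵖ` are finite groups of invertible order, and the
induced morphism `V ⟶ W ×_{Spec ℤ[Q]} Spec ℤ[P]` is étale. -/
structure Chart.IsSmooth {φ : LogHom M N f} {V : X.Etale} {W : Y.Etale}
    {g : EtSpace V ⟶ EtSpace W}
    {hg : g ≫ etStr W = etStr V ≫ f} {Q P : Type u} [CommMonoid Q] [CommMonoid P]
    (c : φ.Chart g hg Q P) : Prop where
  fine_target : Monoid.FG Q ∧ IsCancelMul Q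
  fine_source : Monoid.FG P ∧ IsCancelMul P
  finite_ker : Finite (gpMap c.hom).ker
  isUnit_card_ker : IsUnit (Nat.card (gpMap c.hom).ker : Γ(EtSpace W, ⊤))
  finite_torsion : Finite (CommGroup.torsion (Algebra.GrothendieckGroup P ⧸ (gpMap c.hom).range))
  isUnit_card_torsion :
    IsUnit (Nat.card (CommGroup.torsion (Algebra.GrothendieckGroup P ⧸ (gpMap c.hom).range)) :
      Γ(EtSpace W, ⊤))
  exists_etale : ∃ e : EtSpace V ⟶ pullback (N.toSpecMonoidAlgebra c.target) (specMap c.hom),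
    e ≫ pullback.fst _ _ = g ∧ e ≫ pullback.snd _ _ = M.toSpecMonoidAlgebra c.source ∧ Etale e

/-- The morphism is log smooth at the geometric point `x : Spec Ω ⟶ X`. -/
def LogSmoothAt (φ : LogHom M N f) {Ω : Type u} [Field Ω] (x : Spec (.of Ω) ⟶ X) : Prop :=
  ∃ (V : X.Etale) (W : Y.Etale) (g : EtSpace V ⟶ EtSpace W) (hg : g ≫ etStr W = etStr V ≫ f)
    (v : Spec (.of Ω) ⟶ EtSpace V) (Q P : Type u) (_ : CommMonoid Q) (_ : CommMonoid P)
    (c : φ.Chart g hg Q P), v ≫ etStr V = x ∧ c.IsSmooth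

/-- The morphism is log smooth over the open `U ⊆ Y`, i.e. its restriction `X ×_Y U ⟶ U` is log smooth:
it is log smooth at all geometric points of `X` above `U`. -/
def LogSmoothOver (φ : LogHom M N f) (U : Y.Opens) : Prop :=
  ∀ (Ω : Type u) [Field Ω] [IsSepClosed Ω] (x : Spec (.of Ω) ⟶ X),
    Set.range (x ≫ f) ⊆ U → φ.LogSmoothAt x

/-- The morphism of (fine) log schemes is log smooth: étale locally it has charts as in
`Chart.IsSmooth`. -/
def LogSmooth (φ : LogHom M N f) : Prop :=
  ∀ (Ω : Type u) [Field Ω] [IsSepClosed Ω] (x : Spec (.of Ω) ⟶ X), φ.LogSmoothAt x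

end LogHom

/-- `(Spec k, N)` is the log point `(k, Q)`: the log structure `N` is the one associated to the map `Q → k`
with `1 ↦ 1` and `q ↦ 0` for `q ≠ 1`. -/
def IsLogPoint {k : Type u} [Field k] (N : LogStructure (Spec (.of k))) (Q : Type u)
    [CommMonoid Q] : Prop :=
  ∃ β : Q →* N.Sec (Scheme.Etale.mk (𝟙 _)), N.IsChart β ∧ ∀ q, q ≠ 1 → N.α _ (β q) = 0

/-!
### Grassmannians

The Grassmannian `Grass_q(𝒪^m)` over a field `k`, parametrising locally free quotients of rank `q` of
`𝒪^m`. A quotient is represented by a `q × m` matrix of maximal rank, up to the action of `GL_q` on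
the left. For each `q`-element subset `I` of the columns there is an affine chart, on which the matrix
is normalised so that its submatrix of columns in `I` is the identity.
-/

namespace Grass
variable (k : Type u) [Field k] {q m : ℕ}

/-- Coordinate ring of the chart at `I`: the free entries of a matrix normalised at `I`. -/
abbrev ChartRing (I : Fin q ↪o Fin m) : Type u :=
  MvPolynomial (Fin q × {l : Fin m // l ∉ Set.range I}) k

open scoped Classical in
/-- The universal `q × m` matrix over the chart at `I`; its columns in `I` form the identity. -/
def univMat (I : Fin q ↪o Fin m) : Matrix (Fin q) (Fin m) (ChartRing k I) :=
  fun j l => if h : l ∈ Set.range I then (if I j = l then 1 else 0)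
    else MvPolynomial.X (j, ⟨l, h⟩)

/-- The maximal minor with columns in `J` of the universal matrix over the chart at `I`. -/
def minor (I J : Fin q ↪o Fin m) : ChartRing k I :=
  ((univMat k I).submatrix id J).det

/-- Coordinate ring of the open subset of the chart at `I` where the minor at `J` is invertible. -/
abbrev OverlapRing (I J : Fin q ↪o Fin m) : Type u :=
  Localization.Away (minor k I J)

/-- The universal matrix over the overlap. -/
def overlapMat (I J : Fin q ↪o Fin m) : Matrix (Fin q) (Fin m) (OverlapRing k I J) :=
  (univMat k I).map (algebraMap _ _)

/-- The universal matrix over the overlap, renormalised at `J`. -/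
def transMat (I J : Fin q ↪o Fin m) : Matrix (Fin q) (Fin m) (OverlapRing k I J) :=
  ((overlapMat k I J).submatrix id J)⁻¹ * overlapMat k I J

/-- The coordinate change, sending the universal matrix at `J` to the renormalised matrix. -/
def chartTrans (I J : Fin q ↪o Fin m) : ChartRing k J →ₐ[k] OverlapRing k I J :=
  MvPolynomial.aeval fun p => transMat k I J p.1 p.2

variable {k}
lemma univMat_self (I : Fin q ↪o Fin m) : (univMat k I).submatrix id I = 1 := by
  ext i j
  simp [univMat, Matrix.one_apply]

lemma map_minor {R : Type*} [CommRing R] {I : Fin q ↪o Fin m} (J : Fin q ↪o Fin m)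
    (φ : ChartRing k I →+* R) :
    φ (minor k I J) = (((univMat k I).map φ).submatrix id J).det :=
  RingHom.map_det φ _

lemma det_overlapMat (I J : Fin q ↪o Fin m) :
    ((overlapMat k I J).submatrix id J).det = algebraMap _ _ (minor k I J) :=
  (map_minor J _).symm

lemma isUnit_det_overlapMat (I J : Fin q ↪o Fin m) :
    IsUnit ((overlapMat k I J).submatrix id J).det := by
  rw [det_overlapMat]
  exact IsLocalization.Away.algebraMap_isUnit _

lemma submatrix_mul_id {R : Type*} [CommRing R] (A : Matrix (Fin q) (Fin q) R)
    (B : Matrix (Fin q) (Fin m) R) (J : Fin q → Fin m) :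
    (A * B).submatrix id J = A * B.submatrix id J := rfl

/-- The chart map pulls the universal matrix back to the renormalized matrix. -/
lemma map_univMat {R : Type*} [CommRing R] (J : Fin q ↪o Fin m)
    (φ : ChartRing k J →+* R) (A : Matrix (Fin q) (Fin m) R)
    (hA : A.submatrix id J = 1)
    (h : ∀ p, φ (MvPolynomial.X p) = A p.1 p.2) : (univMat k J).map φ = A := by
  ext i l
  by_cases hl : l ∈ Set.range J
  · obtain ⟨j, rfl⟩ := hl
    have := congr_fun (congr_fun hA i) j
    simp only [Matrix.submatrix_apply, id, Matrix.one_apply] at this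
    rw [this]
    simp [univMat, apply_ite φ]
  · simp [univMat, hl, h, -Set.mem_range]

lemma transMat_self (I J : Fin q ↪o Fin m) : (transMat k I J).submatrix id J = 1 := by
  rw [transMat, submatrix_mul_id, Matrix.nonsing_inv_mul _ (isUnit_det_overlapMat I J)]

lemma map_chartTrans (I J : Fin q ↪o Fin m) :
    (univMat k J).map (chartTrans k I J).toRingHom = transMat k I J :=
  map_univMat J _ _ (transMat_self I J) fun p => by simp [chartTrans]

lemma isUnit_chartTrans_minor (I J : Fin q ↪o Fin m) :
    IsUnit ((chartTrans k I J).toRingHom (minor k J I)) := by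
  rw [map_minor, map_chartTrans, transMat, submatrix_mul_id, Matrix.det_mul]
  have h1 : (overlapMat k I J).submatrix id I = 1 := by
    change ((univMat k I).submatrix id I).map (algebraMap _ (OverlapRing k I J)) = 1
    rw [univMat_self]; simp
  rw [h1, Matrix.det_one, mul_one]
  exact Matrix.isUnit_nonsing_inv_det _ (isUnit_det_overlapMat I J)

variable (k)
/-- The coordinate change between the two descriptions of the overlap. -/
def transition (I J : Fin q ↪o Fin m) : OverlapRing k J I →+* OverlapRing k I J :=
  IsLocalization.Away.lift (minor k J I) (isUnit_chartTrans_minor I J)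

/-- The affine chart at `I`. -/
abbrev chart (I : Fin q ↪o Fin m) : Scheme.{u} := Spec (.of (ChartRing k I))
/-- The intersection of the charts at `I` and `J`, as an open subscheme of the former. -/
abbrev overlap (I J : Fin q ↪o Fin m) : Scheme.{u} := Spec (.of (OverlapRing k I J))
/-- Inclusion of the overlap in the chart at `I`. -/
abbrev incl (I J : Fin q ↪o Fin m) : overlap k I J ⟶ chart k I :=
  Spec.map (CommRingCat.ofHom (algebraMap (ChartRing k I) (OverlapRing k I J)))
/-- Transition isomorphism between the overlaps. -/
abbrev trans (I J : Fin q ↪o Fin m) : overlap k I J ⟶ overlap k J I :=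
  Spec.map (CommRingCat.ofHom (transition k I J))
/-- Structure morphism of a chart. -/
abbrev chartToSpec (I : Fin q ↪o Fin m) : chart k I ⟶ Spec (.of k) :=
  Spec.map (CommRingCat.ofHom (algebraMap k (ChartRing k I)))

instance (I J : Fin q ↪o Fin m) : IsOpenImmersion (incl k I J) :=
  IsOpenImmersion.of_isLocalization (minor k I J)

variable {k}
/-- The ring homomorphism corresponding to a `T`-point of a chart. -/
def coords {T : Scheme.{u}} {I : Fin q ↪o Fin m} (a : T ⟶ chart k I) :
    ChartRing k I →+* Γ(T, ⊤) :=
  ((Scheme.ΓSpecIso (.of (ChartRing k I))).inv ≫ a.appTop).hom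

/-- The matrix of global functions corresponding to a `T`-point of a chart. -/
def pmat {T : Scheme.{u}} {I : Fin q ↪o Fin m} (a : T ⟶ chart k I) :
    Matrix (Fin q) (Fin m) Γ(T, ⊤) := (univMat k I).map (coords a)

lemma pmat_self {T : Scheme.{u}} {I : Fin q ↪o Fin m} (a : T ⟶ chart k I) :
    (pmat a).submatrix id I = 1 := by
  change ((univMat k I).submatrix id I).map (coords a) = 1
  rw [univMat_self]; simp

lemma coords_C {T : Scheme.{u}} {I : Fin q ↪o Fin m} (a : T ⟶ chart k I) :
    (coords a).comp (algebraMap k _) =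
      ((Scheme.ΓSpecIso (.of k)).inv ≫ (a ≫ chartToSpec k I).appTop).hom := by
  rw [chartToSpec, Scheme.Hom.comp_appTop, ← Category.assoc, ← Scheme.ΓSpecIso_inv_naturality]
  rfl

lemma hom_ext {T : Scheme.{u}} {I : Fin q ↪o Fin m} {a b : T ⟶ chart k I}
    (h : a ≫ chartToSpec k I = b ≫ chartToSpec k I) (hm : pmat a = pmat b) : a = b := by
  have hc : coords a = coords b := by
    apply MvPolynomial.ringHom_ext'
    · have := (coords_C a).trans ((congrArg (fun f => ((Scheme.ΓSpecIso (.of k)).inv ≫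
        Scheme.Hom.appTop f).hom) h).trans (coords_C b).symm)
      exact this
    · rintro ⟨i, l, hl⟩
      have := congr_fun (congr_fun hm i) l
      simpa [pmat, univMat, hl, -Set.mem_range] using this
  have : IsAffine (chart k I) := inferInstanceAs (IsAffine (Spec _))
  refine ext_of_isAffine ?_
  rw [← cancel_epi (Scheme.ΓSpecIso (.of (ChartRing k I))).inv]
  exact CommRingCat.hom_ext hc

lemma coords_comp {T T' : Scheme.{u}} {I : Fin q ↪o Fin m} (b : T' ⟶ T) (a : T ⟶ chart k I) :
    coords (b ≫ a) = b.appTop.hom.comp (coords a) := by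
  rw [coords, Scheme.Hom.comp_appTop, ← Category.assoc]; rfl

lemma pmat_comp {T T' : Scheme.{u}} {I : Fin q ↪o Fin m} (b : T' ⟶ T) (a : T ⟶ chart k I) :
    pmat (b ≫ a) = (pmat a).map b.appTop.hom := by
  rw [pmat, coords_comp]; rfl

lemma trans_incl (I J : Fin q ↪o Fin m) : trans k I J ≫ incl k J I =
    Spec.map (CommRingCat.ofHom (chartTrans k I J).toRingHom) := by
  rw [trans, incl, ← Spec.map_comp, ← CommRingCat.ofHom_comp]
  congr 2
  exact IsLocalization.Away.lift_comp _ _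

lemma trans_over (I J : Fin q ↪o Fin m) :
    trans k I J ≫ incl k J I ≫ chartToSpec k J = incl k I J ≫ chartToSpec k I := by
  rw [← Category.assoc, trans_incl, chartToSpec, chartToSpec, incl, ← Spec.map_comp,
    ← Spec.map_comp, ← CommRingCat.ofHom_comp, ← CommRingCat.ofHom_comp]
  congr 2
  ext x
  simp only [RingHom.comp_apply]
  exact ((chartTrans k I J).commutes x).trans
    (IsScalarTower.algebraMap_apply k (ChartRing k I) (OverlapRing k I J) x)

lemma coords_Spec {I : Fin q ↪o Fin m} {R : Type u} [CommRing R] (φ : ChartRing k I →+* R) :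
    coords (T := Spec (.of R)) (Spec.map (CommRingCat.ofHom φ)) =
      ((Scheme.ΓSpecIso (.of R)).inv.hom).comp φ := by
  simp only [coords, ← Scheme.ΓSpecIso_inv_naturality]; rfl

lemma map_inv {R S : Type*} [CommRing R] [CommRing S] (φ : R →+* S)
    (A : Matrix (Fin q) (Fin q) R) (hA : IsUnit A.det) : (A⁻¹).map φ = (A.map φ)⁻¹ := by
  symm
  apply Matrix.inv_eq_left_inv
  rw [← Matrix.map_mul, Matrix.nonsing_inv_mul _ hA]
  simp

lemma pmat_trans {T : Scheme.{u}} {I J : Fin q ↪o Fin m} (a : T ⟶ overlap k I J) :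
    pmat (a ≫ trans k I J ≫ incl k J I) =
      ((pmat (a ≫ incl k I J)).submatrix id J)⁻¹ * pmat (a ≫ incl k I J) := by
  let ψ : OverlapRing k I J →+* Γ(T, ⊤) :=
    a.appTop.hom.comp (Scheme.ΓSpecIso (.of (OverlapRing k I J))).inv.hom
  have h1 : pmat (a ≫ incl k I J) = (overlapMat k I J).map ψ := by
    rw [pmat_comp, pmat, incl, coords_Spec]; rfl
  have h2 : pmat (a ≫ trans k I J ≫ incl k J I) = (transMat k I J).map ψ := by
    rw [trans_incl, pmat_comp, pmat, coords_Spec, ← map_chartTrans]; rfl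
  rw [h1, h2, transMat, Matrix.map_mul, map_inv _ _ (isUnit_det_overlapMat I J)]
  rfl

lemma isUnit_pmat {T : Scheme.{u}} {I J : Fin q ↪o Fin m} (a : T ⟶ overlap k I J) :
    IsUnit ((pmat (a ≫ incl k I J)).submatrix id J).det := by
  let ψ : OverlapRing k I J →+* Γ(T, ⊤) :=
    a.appTop.hom.comp (Scheme.ΓSpecIso (.of (OverlapRing k I J))).inv.hom
  have h1 : pmat (a ≫ incl k I J) = (overlapMat k I J).map ψ := by
    rw [pmat_comp, pmat, incl, coords_Spec]; rfl
  rw [h1]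
  have := (isUnit_det_overlapMat (k := k) I J).map ψ
  rwa [RingHom.map_det] at this

lemma exists_lift {T : Scheme.{u}} {I J : Fin q ↪o Fin m} (a : T ⟶ chart k I)
    (h : IsUnit ((pmat a).submatrix id J).det) : ∃ b : T ⟶ overlap k I J, b ≫ incl k I J = a := by
  have h' : IsUnit (coords a (minor k I J)) := by
    rw [map_minor]; exact h
  refine ⟨T.toSpecΓ ≫ Spec.map (CommRingCat.ofHom (IsLocalization.Away.lift (minor k I J) h')), ?_⟩
  rw [incl, Category.assoc, ← Spec.map_comp, ← CommRingCat.ofHom_comp,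
    IsLocalization.Away.lift_comp]
  simp only [coords, CommRingCat.ofHom_hom, Spec.map_comp]
  rw [← Scheme.toSpecΓ_naturality_assoc]
  erw [toSpecΓ_SpecMap_ΓSpecIso_inv]
  simp

/-- A `T`-point of the chart at `I` whose minor at `J` is invertible factors through the overlap. -/
def liftOverlap {T : Scheme.{u}} {I J : Fin q ↪o Fin m} (a : T ⟶ chart k I)
    (h : IsUnit ((pmat a).submatrix id J).det) : T ⟶ overlap k I J := (exists_lift a h).choose

@[simp]
lemma liftOverlap_incl {T : Scheme.{u}} {I J : Fin q ↪o Fin m} (a : T ⟶ chart k I)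
    (h : IsUnit ((pmat a).submatrix id J).det) : liftOverlap a h ≫ incl k I J = a :=
  (exists_lift a h).choose_spec

lemma incl_ext {T : Scheme.{u}} {I J : Fin q ↪o Fin m} {a b : T ⟶ overlap k I J}
    (h : a ≫ incl k I J = b ≫ incl k I J) : a = b := by
  rwa [cancel_mono] at h

lemma trans_self (I : Fin q ↪o Fin m) : trans k I I = 𝟙 _ := by
  apply incl_ext
  refine hom_ext ?_ ?_
  · rw [Category.assoc, trans_over, Category.id_comp]
  · have := pmat_trans (k := k) (I := I) (J := I) (𝟙 _)
    rw [Category.id_comp, Category.id_comp, pmat_self] at this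
    rw [this, Category.id_comp]; simp

lemma isUnit_pmat_trans {T : Scheme.{u}} {I J K : Fin q ↪o Fin m} (a : T ⟶ overlap k I J)
    (h : IsUnit ((pmat (a ≫ incl k I J)).submatrix id K).det) :
    IsUnit ((pmat (a ≫ trans k I J ≫ incl k J I)).submatrix id K).det := by
  rw [pmat_trans, submatrix_mul_id, Matrix.det_mul]
  exact (Matrix.isUnit_nonsing_inv_det _ (isUnit_pmat a)).mul h

lemma isUnit_pmat_pullback (I J K : Fin q ↪o Fin m) :
    IsUnit ((pmat ((pullback.fst (incl k I J) (incl k I K)) ≫ trans k I J ≫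
      incl k J I)).submatrix id K).det := by
  apply isUnit_pmat_trans
  rw [pullback.condition]
  exact isUnit_pmat _

variable (k) in
/-- The transition morphism on triple overlaps. -/
def trans' (I J K : Fin q ↪o Fin m) :
    pullback (incl k I J) (incl k I K) ⟶ pullback (incl k J K) (incl k J I) :=
  pullback.lift (liftOverlap _ (isUnit_pmat_pullback I J K))
    (pullback.fst _ _ ≫ trans k I J) (by simp)

lemma trans'_snd (I J K : Fin q ↪o Fin m) :
    trans' k I J K ≫ pullback.snd _ _ = pullback.fst _ _ ≫ trans k I J :=
  pullback.lift_snd _ _ _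

lemma trans'_base (I J K : Fin q ↪o Fin m) :
    trans' k I J K ≫ pullback.fst _ _ ≫ incl k J K =
      pullback.fst _ _ ≫ trans k I J ≫ incl k J I := by
  rw [trans', pullback.lift_fst_assoc, liftOverlap_incl]

/-- A renormalised matrix only depends on the row space. -/
lemma renorm {R : Type*} [CommRing R] (A : Matrix (Fin q) (Fin m) R)
    (C : Matrix (Fin q) (Fin q) R) (hC : IsUnit C.det) (K : Fin q → Fin m) :
    ((C * A).submatrix id K)⁻¹ * (C * A) = (A.submatrix id K)⁻¹ * A := by
  rw [submatrix_mul_id, Matrix.mul_inv_rev, Matrix.mul_assoc,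
    ← Matrix.mul_assoc C⁻¹, Matrix.nonsing_inv_mul _ hC, Matrix.one_mul]

lemma cocycle (I J K : Fin q ↪o Fin m) :
    trans' k I J K ≫ trans' k J K I ≫ trans' k K I J = 𝟙 _ := by
  have hstep : ∀ {T : Scheme.{u}} (I J K : Fin q ↪o Fin m)
      (a : T ⟶ pullback (incl k I J) (incl k I K)),
      pmat ((a ≫ trans' k I J K) ≫ pullback.fst _ _ ≫ incl k J K) =
        ((pmat (a ≫ pullback.fst _ _ ≫ incl k I J)).submatrix id J)⁻¹ *
          pmat (a ≫ pullback.fst _ _ ≫ incl k I J) := by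
    intro T I J K a
    rw [Category.assoc, trans'_base]
    have := pmat_trans (a ≫ pullback.fst (incl k I J) (incl k I K))
    simpa only [Category.assoc] using this
  have hu : ∀ {T : Scheme.{u}} (I J K : Fin q ↪o Fin m)
      (a : T ⟶ pullback (incl k I J) (incl k I K)),
      IsUnit ((pmat (a ≫ pullback.fst _ _ ≫ incl k I J)).submatrix id J).det := by
    intro T I J K a
    have := isUnit_pmat (a ≫ pullback.fst (incl k I J) (incl k I K))
    simpa only [Category.assoc] using this
  have hover : ∀ {T : Scheme.{u}} (I J K : Fin q ↪o Fin m)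
      (a : T ⟶ pullback (incl k I J) (incl k I K)),
      ((a ≫ trans' k I J K) ≫ pullback.fst _ _ ≫ incl k J K) ≫ chartToSpec k J =
        (a ≫ pullback.fst _ _ ≫ incl k I J) ≫ chartToSpec k I := by
    intro T I J K a
    rw [Category.assoc a, trans'_base]
    simp only [Category.assoc, trans_over]
  have key : (trans' k I J K ≫ trans' k J K I ≫ trans' k K I J) ≫
      pullback.fst _ _ ≫ incl k I J = 𝟙 _ ≫ pullback.fst _ _ ≫ incl k I J := by
    have e : trans' k I J K ≫ trans' k J K I ≫ trans' k K I J =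
      ((𝟙 _ ≫ trans' k I J K) ≫ trans' k J K I) ≫ trans' k K I J := by simp
    rw [e]
    refine hom_ext ?_ ?_
    · rw [hover, hover, hover]
    · have h1 := hstep I J K (𝟙 _)
      have h2 := hstep J K I (𝟙 _ ≫ trans' k I J K)
      have h3 := hstep K I J ((𝟙 _ ≫ trans' k I J K) ≫ trans' k J K I)
      have u1 := Matrix.isUnit_nonsing_inv_det _ (hu I J K (𝟙 _))
      have u2 := Matrix.isUnit_nonsing_inv_det _ (hu J K I (𝟙 _ ≫ trans' k I J K))
      rw [h3, h2, renorm _ _ u2, h1, renorm _ _ u1]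
      rw [pmat_self, inv_one, Matrix.one_mul]
  have hm : Mono (pullback.fst (incl k I J) (incl k I K) ≫ incl k I J) := inferInstance
  exact (cancel_mono _).1 key

variable (k q m) in
/-- The gluing data of the Grassmannian. -/
def glueData : Scheme.GlueData.{u} where
  J := ULift.{u} (Fin q ↪o Fin m)
  U I := chart k I.down
  V p := overlap k p.1.down p.2.down
  f I J := incl k I.down J.down
  f_id I := by
    have h : minor k I.down I.down = 1 := by rw [minor, univMat_self, Matrix.det_one]
    have : IsIso (CommRingCat.ofHom
        (algebraMap (ChartRing k I.down) (OverlapRing k I.down I.down))) := by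
      rw [ConcreteCategory.isIso_iff_bijective]
      exact (IsLocalization.atUnit _ _ (minor k I.down I.down) (h ▸ isUnit_one)).bijective
    infer_instance
  f_open _ _ := inferInstance
  t I J := trans k I.down J.down
  t_id I := trans_self I.down
  t' I J K := trans' k I.down J.down K.down
  t_fac I J K := trans'_snd _ _ _
  cocycle I J K := cocycle _ _ _

end Grass

/-- The Grassmannian `Grass_q(𝒪^m)` of locally free rank `q` quotients of `𝒪^m` over `k`. -/
def Grassmannian (k : Type u) [Field k] (q m : ℕ) : Scheme.{u} := (Grass.glueData k q m).glued

namespace Grassmannian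
variable (k : Type u) [Field k] {q m : ℕ}

/-- The open immersion of the chart at `I`. -/
def ι (I : Fin q ↪o Fin m) : Grass.chart k I ⟶ Grassmannian k q m :=
  (Grass.glueData k q m).ι ⟨I⟩

instance (I : Fin q ↪o Fin m) : IsOpenImmersion (ι k I) :=
  Scheme.GlueData.ι_isOpenImmersion (Grass.glueData k q m) ⟨I⟩

variable (q m) in
/-- The structure morphism. -/
def toSpec : Grassmannian k q m ⟶ Spec (.of k) :=
  Multicoequalizer.desc (Grass.glueData k q m).diagram _
    (fun I => Grass.chartToSpec k I.down) (by
      rintro ⟨I, J⟩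
      exact ((Category.assoc _ _ _).trans (Grass.trans_over I.down J.down)).symm)

lemma ι_toSpec (I : Fin q ↪o Fin m) : ι k I ≫ toSpec k q m = Grass.chartToSpec k I :=
  Multicoequalizer.π_desc _ _ _ _ _

end Grassmannian

/-!
### Projective space and the incidence scheme
-/

section Incidence

variable (k : Type u) [Field k]

attribute [local instance] MvPolynomial.gradedAlgebra

/-- Projective space `ℙⁿ` over `k`, as the homogeneous spectrum of `k[X₀, …, Xₙ]`. -/
abbrev ProjSpace (n : ℕ) : Scheme.{u} := Proj (MvPolynomial.homogeneousSubmodule (Fin (n + 1)) k)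

namespace ProjSpace

/-- The structure morphism. -/
def toSpec (n : ℕ) : ProjSpace k n ⟶ Spec (.of k) :=
  Proj.toSpecZero _ ≫ Spec.map (CommRingCat.ofHom
    (algebraMap k (MvPolynomial.homogeneousSubmodule (Fin (n + 1)) k 0)))

variable {k} {n : ℕ} {R : Type u} [CommRing R] [Algebra k R]

/-- Evaluation of polynomials at a vector, as a map to the global functions on `Spec R`. -/
def evalHom (x : Fin (n + 1) → R) : MvPolynomial (Fin (n + 1)) k →+* Γ(Spec (.of R), ⊤) :=
  (Scheme.ΓSpecIso (.of R)).inv.hom.comp (MvPolynomial.aeval (R := k) x).toRingHom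

lemma map_irrelevant (x : Fin (n + 1) → R) (hx : ∃ i, x i = 1) :
    (HomogeneousIdeal.irrelevant
      (MvPolynomial.homogeneousSubmodule (Fin (n + 1)) k)).toIdeal.map (evalHom x) = ⊤ := by
  obtain ⟨i, hi⟩ := hx
  rw [Ideal.eq_top_iff_one]
  have h : evalHom (k := k) x (MvPolynomial.X i) = 1 := by simp [evalHom, hi]
  rw [← h]
  apply Ideal.mem_map_of_mem
  exact HomogeneousIdeal.mem_irrelevant_of_mem _ one_pos
    ((MvPolynomial.mem_homogeneousSubmodule _ _).2 (MvPolynomial.isHomogeneous_X k i))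

/-- The `R`-point `[x₀ : … : xₙ]` of `ℙⁿ`, where one of the coordinates is `1`. -/
def ofVector (x : Fin (n + 1) → R) (hx : ∃ i, x i = 1) : Spec (.of R) ⟶ ProjSpace k n :=
  Proj.fromOfGlobalSections _ (evalHom x) (map_irrelevant x hx)

lemma ofVector_toSpec (x : Fin (n + 1) → R) (hx : ∃ i, x i = 1) :
    ofVector x hx ≫ toSpec k n = Spec.map (CommRingCat.ofHom (algebraMap k R)) := by
  rw [ofVector, toSpec, Proj.fromOfGlobalSections_toSpecZero_assoc, ← Spec.map_comp,
    ← CommRingCat.ofHom_comp]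
  have : ((evalHom (k := k) x).comp (algebraMap _ _)).comp (algebraMap k
      (MvPolynomial.homogeneousSubmodule (Fin (n + 1)) k 0)) =
      (Scheme.ΓSpecIso (.of R)).inv.hom.comp (algebraMap k R) := by
    ext a
    simp only [RingHom.comp_apply, evalHom]
    congr 1
    exact (MvPolynomial.aeval (R := k) x).commutes a
  rw [this, CommRingCat.ofHom_comp, CommRingCat.ofHom_hom, Spec.map_comp]
  erw [toSpecΓ_SpecMap_ΓSpecIso_inv_assoc]

end ProjSpace

namespace Incidence
variable {k} {n q : ℕ}

/-- Over the chart of the Grassmannian at `I`, the tautological quotient `𝒬` is free of rank `q`, so that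
the bundle `Grass_1(𝒬)` is `ℙ^(q-1)` over the chart. This is the coordinate ring of its standard chart
where the `j`-th homogeneous coordinate is `1`. -/
abbrev ChartRing (I : Fin q ↪o Fin (n + 1)) (j : Fin q) : Type u :=
  MvPolynomial {l : Fin q // l ≠ j} (Grass.ChartRing k I)

/-- The universal rank one quotient of `𝒬` over this chart, as a row vector with `j`-th entry `1`. -/
def coeff (I : Fin q ↪o Fin (n + 1)) (j : Fin q) : Fin q → ChartRing (k := k) I j :=
  fun l => if h : l = j then 1 else MvPolynomial.X ⟨l, h⟩

/-- The composite `𝒪^(n+1) → 𝒬 → 𝒪`, as a row vector. -/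
def point (I : Fin q ↪o Fin (n + 1)) (j : Fin q) : Fin (n + 1) → ChartRing (k := k) I j :=
  Matrix.vecMul (coeff I j) ((Grass.univMat k I).map MvPolynomial.C)

lemma point_eq_one (I : Fin q ↪o Fin (n + 1)) (j : Fin q) :
    point (k := k) I j (I j) = 1 := by
  simp [point, Matrix.vecMul, dotProduct, Grass.univMat, apply_ite MvPolynomial.C, coeff]

/-- The restriction to this chart of the closed immersion `Grass_1(𝒬) ⟶ ℙⁿ × G`. -/
def chartMap (I : Fin q ↪o Fin (n + 1)) (j : Fin q) :
    Spec (.of (ChartRing (k := k) I j)) ⟶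
      pullback (ProjSpace.toSpec k n) (Grassmannian.toSpec k q (n + 1)) :=
  pullback.lift (ProjSpace.ofVector (point I j) ⟨I j, point_eq_one I j⟩)
    (Spec.map (CommRingCat.ofHom MvPolynomial.C) ≫ Grassmannian.ι k I) (by
      rw [ProjSpace.ofVector_toSpec, Category.assoc, Grassmannian.ι_toSpec, Grass.chartToSpec,
        ← Spec.map_comp, ← CommRingCat.ofHom_comp]
      rfl)

end Incidence

/-- The incidence scheme `Grass_1(𝒬) ⊆ ℙⁿ × G` of pairs `(x, L)` with `x ∈ L`, where `G` is the
Grassmannian of rank `q` quotients of `𝒪^(n+1)` (linear subspaces of `ℙⁿ` of codimension `n + 1 - q`).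
As `Grass_1(𝒬) ⟶ ℙⁿ × G` is a closed immersion and the charts above form an open cover of `Grass_1(𝒬)`,
it is the scheme-theoretic image of the disjoint union of the charts. -/
def incidence (q n : ℕ) : Scheme.{u} :=
  (Sigma.desc fun c : (Fin q ↪o Fin (n + 1)) × Fin q =>
    Incidence.chartMap (k := k) c.1 c.2).image

namespace incidence
variable (q n : ℕ)
/-- The closed immersion into `ℙⁿ × G`. -/
def emb : incidence k q n ⟶ pullback (ProjSpace.toSpec k n) (Grassmannian.toSpec k q (n + 1)) :=
  Scheme.Hom.imageι _

/-- The projection to `ℙⁿ`. -/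
def toProj : incidence k q n ⟶ ProjSpace k n := emb k q n ≫ pullback.fst _ _

/-- The projection to the Grassmannian. -/
def toGrass : incidence k q n ⟶ Grassmannian k q (n + 1) := emb k q n ≫ pullback.snd _ _

end incidence

variable {k}

lemma incidence.toProj_toSpec (q n : ℕ) :
    incidence.toProj k q n ≫ ProjSpace.toSpec k n =
      incidence.toGrass k q n ≫ Grassmannian.toSpec k q (n + 1) := by
  rw [toProj, toGrass, Category.assoc, pullback.condition, Category.assoc]

/-- For `f : X ⟶ ℙⁿ`, the scheme `ℋ_X = Grass_1(𝒬) ×_{ℙⁿ} X` of pairs `(x, L)` with `f(x) ∈ L`. Its fibre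
over `L` is the linear section `f⁻¹(L)`. -/
abbrev sectionScheme {X : Scheme.{u}} {n : ℕ} (f : X ⟶ ProjSpace k n) (q : ℕ) : Scheme.{u} :=
  pullback (incidence.toProj k q n) f

namespace sectionScheme
variable {X : Scheme.{u}} {n : ℕ} (f : X ⟶ ProjSpace k n) (q : ℕ)

/-- The projection `ℋ_X ⟶ X`. -/
def toX : sectionScheme f q ⟶ X := pullback.snd _ _

/-- The projection `ℋ_X ⟶ G`. -/
def toGrass : sectionScheme f q ⟶ Grassmannian k q (n + 1) :=
  pullback.fst _ _ ≫ incidence.toGrass k q n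

variable {f}
lemma comm {s : X ⟶ Spec (.of k)} (hf : f ≫ ProjSpace.toSpec k n = s) :
    toX f q ≫ s = toGrass f q ≫ Grassmannian.toSpec k q (n + 1) := by
  rw [toX, toGrass, Category.assoc, ← incidence.toProj_toSpec, pullback.condition_assoc, hf]

lemma fiber_comm {s : X ⟶ Spec (.of k)} (hf : f ≫ ProjSpace.toSpec k n = s) {S : Scheme.{u}}
    (t : S ⟶ Grassmannian k q (n + 1)) :
    (pullback.fst (toGrass f q) t ≫ toX f q) ≫ s =
      pullback.snd (toGrass f q) t ≫ t ≫ Grassmannian.toSpec k q (n + 1) := by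
  rw [Category.assoc, comm q hf, pullback.condition_assoc]

end sectionScheme

end Incidence

end

/-! Let z be a point of the section scheme over the generic point of the Grassmannian, and x its
image in X. Near x there are a sharp chart Q → P and a smooth chart Q₁ → P₁, and the sharp one is a
quotient of the smooth one up to units: α₁(p) = α(π p) u(p) (`LogHom.exists_comparison`, abstracted
to rings in `ChartPair`). Let O be the ring of the étale neighbourhood of x and kW that of the
target. Then O is étale over kW ⊗_{ℤ[Q₁]} ℤ[P₁]; put B = kW ⊗_{ℤ[Q]} ℤ[P]. In standard coordinates
the section scheme is Spec O[U_{jl} : j ≠ j₀], the missing row being given by the incidence relation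
U_{j₀l} = y_l - ∑ z_j U_{jl}, where y_l and z_j are the affine coordinates of f. The heart of the
proof is that this ring is smooth at z over B[U_{jl} : all j, l].

The units u live on the kernel of P₁ᵍᵖ → Pᵍᵖ. Let Λ be this kernel modulo the image of the kernel of
Q₁ᵍᵖ → Qᵍᵖ. Since the smooth chart is étale, every homomorphism h from Λ to a field at which the
chart is sharp gives a derivation of O over kW with D(u) = h(u) u that kills α(P)
(`ChartPair.IsSharpAt.exists_derivation`). These logarithmic derivations show that tameness of Q₁ →
P₁ passes to Q → P (`ChartPair.IsSharpAt.isTame`). They also yield the smoothness.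

Smoothness at z can be tested by lifting to extensions by the residue field K
(`Algebra.IsSmoothAt.of_splits_residueField`). Tameness lets O be lifted compatibly with B
(`ChartPair.IsSharpAt.exists_lift`), but the lift need not respect the incidence relations. The
errors lie in K and can be removed by adding a derivation, as soon as there are derivations D_l
killing α(P) with D_l(y_{l'}) - ∑ U_{jl'} D_l(z_j) = δ_{ll'} (`ChartPair.isSmoothAt`).

To find them, let d be the rank of Λ. The image of O in K is algebraic over d units; let F be the
algebraic closure of these units in K. A basis of Λ modulo torsion gives d derivations D_i with
values in F, and as f is unramified their values on the y_l and z_j are d linear forms independent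
over F. Since z lies over the generic point, all the U_{jl} are algebraically independent over k. A
linear relation between the columns of the matrix D_i(y_l) - ∑ U_{jl} D_i(z_j) would make their
transcendence degree too small by one (`eq_zero_of_algebraicIndependent`). So the matrix has a left
inverse, which gives the D_l. The derivations come from the log structure and not from separability
of K, so the argument is independent of the characteristic.

Smoothness over the base of a tame chart is an open condition on the section scheme, so it spreads
from the generic fibre to the fibres over a dense open subset
(`sectionScheme.exists_dense_of_isOpen`). It is stable under base change, which handles the
individual linear sections, and it implies log smoothness: étale coordinates that are units are
absorbed into the chart by replacing P with P × ℤᵐ (`LogHom.SmoothOverChartAt.logSmoothAt`). -/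

open CategoryTheory CategoryTheory.Limits AlgebraicGeometry Opposite

noncomputable section

/-! ### A lifting criterion for smoothness at a point -/

section SmoothCriterion

open TensorProduct IsLocalRing KaehlerDifferential

/-- A local algebra with a presentation by a smooth algebra is formally smooth if all its extensions by its
residue field split. -/
theorem Algebra.FormallySmooth.of_splits_residueField_aux {R S P : Type u} [CommRing R] [CommRing S]
    [IsLocalRing S] [Algebra R S] [CommRing P] [Algebra R P] [Algebra P S] [IsScalarTower R P S]
    [FormallySmooth R P] [Module.Free P Ω[P⁄R]] [Module.Finite P Ω[P⁄R]]
    (h₁ : Function.Surjective (algebraMap P S)) (h₂ : (RingHom.ker (algebraMap P S)).FG)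
    (h : ∀ (T : Type u) [CommRing T] [Algebra R T] (g : T →ₐ[R] S) (ι : ResidueField S →+ T),
      Function.Surjective g → Function.Injective ι → (∀ t, g t = 0 ↔ t ∈ Set.range ι) →
      (∀ t a, ι (residue S (g t) * a) = t * ι a) → ∃ s : S →ₐ[R] T, ∀ x, g (s x) = x) :
    Algebra.FormallySmooth R S := by
  rw [FormallySmooth.iff_injective_cotangentComplexBaseChange_residueField P h₁ h₂]
  set K := ResidueField S
  rw [injective_iff_map_eq_zero]
  intro x hx
  rw [← Module.forall_dual_apply_eq_zero_iff K]
  intro f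
  let I := RingHom.ker (algebraMap P S)
  -- Injectivity into `K ⊗ Ω` is tested on functionals: each functional `f` on `K ⊗ I` will be
  -- extended over the cotangent map, so that it kills the kernel.
  let ℓ : I →ₗ[P] K := (f.restrictScalars P).comp (TensorProduct.mk P K I 1)
  have hℓ : ∀ b, ℓ b = f (1 ⊗ₜ b) := fun b => rfl
  by_cases hz : ∀ b, ℓ b = 0
  · have : f = 0 := by
      ext b
      exact hz b
    simp [this]
  push Not at hz
  obtain ⟨b₀, hb₀⟩ := hz
  have hPK : ∀ a : K, ∃ y : P, algebraMap P K y = a := by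
    intro a
    obtain ⟨s, rfl⟩ := residue_surjective a
    obtain ⟨y, rfl⟩ := h₁ s
    exact ⟨y, IsScalarTower.algebraMap_apply P S K y⟩
  have hℓs : Function.Surjective ℓ := by
    intro a
    obtain ⟨y, hy⟩ := hPK (a / ℓ b₀)
    refine ⟨y • b₀, ?_⟩
    rw [map_smul, Algebra.smul_def, hy, div_mul_cancel₀ _ hb₀]
  -- `P ⧸ N` is the pushout of the extension `0 → I → P → S → 0` along `ℓ`. As `ℓ` is onto, its
  -- kernel over `S` is the whole of `K`.
  let N : Ideal P := Submodule.map I.subtype (LinearMap.ker ℓ)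
  have hNI : N ≤ I := Submodule.map_subtype_le _ _
  have hN : ∀ b : I, (b : P) ∈ N ↔ ℓ b = 0 := by
    intro b
    constructor
    · rintro ⟨c, hc, hcb⟩
      rw [← Subtype.ext hcb]; exact hc
    · intro hb
      exact ⟨b, hb, rfl⟩
  let g : (P ⧸ N) →ₐ[R] S := Ideal.Quotient.liftₐ N (IsScalarTower.toAlgHom R P S) hNI
  have hg : ∀ y, g (Ideal.Quotient.mk N y) = algebraMap P S y := fun y => rfl
  let c : K → I := Function.surjInv hℓs
  have hc : ∀ a, ℓ (c a) = a := Function.surjInv_eq hℓs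
  have hmk : ∀ b b' : I, ℓ b = ℓ b' → Ideal.Quotient.mk N (b : P) = Ideal.Quotient.mk N (b' : P) := by
    intro b b' e
    rw [Ideal.Quotient.eq]
    have : (b : P) - b' = ((b - b' : I) : P) := rfl
    rw [this, hN, map_sub, e, sub_self]
  let ι : K →+ (P ⧸ N) :=
    { toFun := fun a => Ideal.Quotient.mk N (c a : P)
      map_zero' := by
        rw [hmk (c 0) 0 (by rw [hc, map_zero])]
        simp
      map_add' := fun a b => by
        rw [hmk (c (a + b)) (c a + c b) (by rw [map_add, hc, hc, hc])]
        simp }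
  have hι : ∀ b : I, ι (ℓ b) = Ideal.Quotient.mk N (b : P) := fun b => hmk _ _ (hc _)
  have hιinj : Function.Injective ι := by
    rw [injective_iff_map_eq_zero]
    intro a ha
    rw [← hc a, hι, Ideal.Quotient.eq_zero_iff_mem, hN, hc] at ha
    exact ha
  have hker : ∀ t, g t = 0 ↔ t ∈ Set.range ι := by
    intro t
    obtain ⟨y, rfl⟩ := Ideal.Quotient.mk_surjective t
    constructor
    · intro hy
      exact ⟨ℓ ⟨y, hy⟩, hι _⟩
    · rintro ⟨a, ha⟩
      rw [← ha, ← hc a, hι, hg]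
      exact (c a).2
  obtain ⟨s, hs⟩ := h (P ⧸ N) g ι (fun x => by
      obtain ⟨y, rfl⟩ := h₁ x
      exact ⟨Ideal.Quotient.mk N y, hg y⟩) hιinj hker (fun t a => by
      obtain ⟨y, rfl⟩ := Ideal.Quotient.mk_surjective t
      rw [← hc a, hι, hg, ← map_mul]
      have : residue S (algebraMap P S y) * ℓ (c a) = ℓ (y • c a) := by
        rw [map_smul, Algebra.smul_def, IsScalarTower.algebraMap_apply P S K y]; rfl
      rw [this, hι]; rfl)
  -- A splitting `s` yields two maps `P → P ⧸ N` over `S`. Their difference is a derivation with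
  -- values in `K`, and on `I` it equals `ℓ` because `s` contributes nothing there.
  have hD : ∀ y : P, ∃ a : K, ι a = Ideal.Quotient.mk N y - s (algebraMap P S y) := by
    intro y
    have := (hker (Ideal.Quotient.mk N y - s (algebraMap P S y))).1 (by
      rw [map_sub, hs, hg, sub_self])
    exact this
  choose d hd using hD
  have hιsmul : ∀ (t : P ⧸ N) (y : P) (a : K), g t = algebraMap P S y → ι (y • a) = t * ι a := by
    intro t y a e
    obtain ⟨z, rfl⟩ := Ideal.Quotient.mk_surjective t
    rw [hg] at e
    rw [← hc a, hι, ← map_mul, ← map_smul, hι, Ideal.Quotient.eq]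
    have : ((y • c a : I) : P) - z * (c a : P) = (((y - z) • c a : I) : P) := by
      simp [sub_mul]
    rw [this, hN, map_smul, Algebra.smul_def, IsScalarTower.algebraMap_apply P S K, map_sub, e]
    simp
  let Dlin : P →ₗ[R] K :=
    { toFun := d
      map_add' := fun x y => hιinj (by rw [map_add, hd, hd, hd]; simp only [map_add]; ring)
      map_smul' := fun r x => hιinj (by
        rw [RingHom.id_apply, ← algebraMap_smul P r (d x),
          hιsmul (algebraMap R _ r) (algebraMap R P r) (d x) (by
            rw [AlgHom.commutes]; exact IsScalarTower.algebraMap_apply R P S r),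
          hd, hd, Algebra.smul_def]
        simp only [map_mul, mul_sub, ← IsScalarTower.algebraMap_apply R P S, AlgHom.commutes]
        rfl) }
  let D : Derivation R P K := Derivation.mk' Dlin (fun x y => hιinj (by
    change ι (d (x * y)) = ι (x • d y + y • d x)
    rw [hd, map_add, hιsmul (Ideal.Quotient.mk N x) x _ (hg x),
      hιsmul (s (algebraMap P S y)) y _ (hs _), hd, hd]
    simp only [map_mul]
    ring))
  have hDI : ∀ b : I, D (b : P) = ℓ b := by
    intro b
    apply hιinj
    change ι (d b) = _
    rw [hd, hι, show algebraMap P S (b : P) = 0 from b.2, map_zero, sub_zero]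
  -- The linear form on differentials given by the derivation is the required extension of `f`.
  let L : K ⊗[P] Ω[P⁄R] →ₗ[K] K := LinearMap.liftBaseChange K D.liftKaehlerDifferential
  have hL : L.comp (cotangentComplexBaseChange R S P K) = f := by
    ext b
    simp only [LinearMap.coe_comp, Function.comp_apply, AlgebraTensorModule.curry_apply,
      LinearMap.restrictScalars_comp, TensorProduct.curry_apply, LinearMap.coe_restrictScalars]
    rw [cotangentComplexBaseChange_tmul, one_smul, kerToTensor_apply,
      LinearMap.liftBaseChange_tmul, one_smul, Derivation.liftKaehlerDifferential_comp_D, hDI, hℓ]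
  rw [← hL, LinearMap.comp_apply, hx, map_zero]

/-- A finitely presented algebra is smooth at a prime if all extensions of the local ring by its residue
field split. -/
theorem Algebra.IsSmoothAt.of_splits_residueField {R A : Type u} [CommRing R] [CommRing A]
    [Algebra R A] [Algebra.FinitePresentation R A] (p : Ideal A) [p.IsPrime]
    (h : ∀ (T : Type u) [CommRing T] [Algebra R T] (g : T →ₐ[R] Localization.AtPrime p)
      (ι : p.ResidueField →+ T),
      Function.Surjective g → Function.Injective ι → (∀ t, g t = 0 ↔ t ∈ Set.range ι) →
      (∀ t a, ι (residue _ (g t) * a) = t * ι a) →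
      ∃ s : A →ₐ[R] T, ∀ x, g (s x) = algebraMap A _ x) :
    Algebra.IsSmoothAt R p := by
  let S := Localization.AtPrime p
  obtain ⟨n, f₀, hf₀⟩ := Algebra.FiniteType.iff_quotient_mvPolynomial''.mp
    (inferInstance : Algebra.FiniteType R A)
  let M := p.primeCompl
  -- `P'` is the local ring of affine space at the image of the point: formally smooth, with free
  -- differentials, and mapping onto the local ring of `A`.
  let M' := M.comap f₀
  let P' := Localization M'
  let fP : P' →ₐ[R] S := IsLocalization.liftAlgHom (M := M')
      (f := (IsScalarTower.toAlgHom R A S).comp f₀) fun x ↦ by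
    simpa using IsLocalization.map_units (M := M) S ⟨f₀ x.1, x.2⟩
  have hf₁ : Function.Surjective fP := by
    intro x
    obtain ⟨x, ⟨s, hs⟩, rfl⟩ := IsLocalization.exists_mk'_eq M x
    obtain ⟨x, rfl⟩ := hf₀ x
    obtain ⟨s, rfl⟩ := hf₀ s
    refine ⟨IsLocalization.mk' (M := M') _ x ⟨s, hs⟩, ?_⟩
    simp [fP, IsLocalization.lift_mk', Units.mul_inv_eq_iff_eq_mul, IsUnit.liftRight]
  have hfP : (RingHom.ker fP).FG := by
    have := Algebra.FinitePresentation.ker_fG_of_surjective _ hf₀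
    convert! this.map (algebraMap _ P')
    refine le_antisymm ?_ (Ideal.map_le_iff_le_comap.mpr fun x hx ↦ by simp_all [fP])
    intro x hx
    obtain ⟨x, s, rfl⟩ := IsLocalization.exists_mk'_eq M' x
    obtain ⟨a, ha, e⟩ : ∃ a ∈ M, a * f₀ x = 0 := by
      simpa [fP, IsLocalization.lift_mk', IsLocalization.map_eq_zero_iff M] using hx
    obtain ⟨a, rfl⟩ := hf₀ a
    rw [IsLocalization.mk'_mem_map_algebraMap_iff]
    exact ⟨a, ha, by simpa⟩
  algebraize [fP.toRingHom]
  have : FormallyEtale (MvPolynomial (Fin n) R) P' := .of_isLocalization M'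
  have : FormallySmooth R P' := .comp _ (MvPolynomial (Fin n) R) _
  have : Module.Free P' Ω[P'⁄R] :=
    .of_equiv (KaehlerDifferential.tensorKaehlerEquivOfFormallyEtale R (MvPolynomial (Fin n) R) P')
  refine Algebra.FormallySmooth.of_splits_residueField_aux (S := S) (P := P') hf₁ hfP ?_
  intro T _ _ g ι hg hι hker hmul
  obtain ⟨s, hs⟩ := h T g ι hg hι hker hmul
  -- The kernel of `g` has square zero, so elements over units are units, and a section given on `A`
  -- alone extends to the local ring.
  have hsq : ∀ t, g t = 0 → t * t = 0 := by
    intro t ht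
    obtain ⟨a, rfl⟩ := (hker t).1 ht
    rw [← hmul, ht, map_zero, zero_mul, map_zero]
  have hunit : ∀ t, IsUnit (g t) → IsUnit t := by
    intro t ht
    obtain ⟨v, hv⟩ := ht.exists_right_inv
    obtain ⟨w, rfl⟩ := hg v
    have h1 := hsq (t * w - 1) (by rw [map_sub, map_mul, hv, map_one, sub_self])
    refine IsUnit.of_mul_eq_one (w * (1 - (t * w - 1))) ?_
    linear_combination -h1
  refine ⟨IsLocalization.liftAlgHom (M := p.primeCompl) (f := s) (fun y => hunit _ (by
    rw [hs]; exact IsLocalization.map_units (M := M) S y)), fun x => ?_⟩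
  have : (g.comp (IsLocalization.liftAlgHom (M := p.primeCompl) (f := s) (fun y => hunit _ (by
    rw [hs]; exact IsLocalization.map_units (M := M) S y)) : S →ₐ[R] T)).toRingHom =
      RingHom.id S := by
    apply IsLocalization.ringHom_ext p.primeCompl
    ext a
    simp [hs]
    rfl
  exact congr($this x)

end SmoothCriterion

/-! ### A transcendence degree estimate -/

section Transcendence

/-- A vector on which `m` independent linear forms over a subfield take values in the subfield is determined
over the subfield by all but `m` of its coordinates. -/
lemma exists_finset_mem_span_of_linearForms {F K ι : Type*} [Field F] [Field K] [Algebra F K]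
    [Fintype ι] [DecidableEq ι] {m : ℕ} (ρ : Fin m → ι → F) (hρ : LinearIndependent F ρ) (s : ι → K)
    (hs : ∀ i, ∑ j, ρ i j • s j ∈ Set.range (algebraMap F K)) :
    ∃ T : Finset ι, T.card + m = Fintype.card ι ∧
      ∀ j, s j ∈ Submodule.span F (insert 1 (s '' (T : Set ι))) := by
  classical
  -- Complete the forms `ρ` to a basis by standard vectors. Evaluation at `s` sends the forms into
  -- `F` and the standard vectors to coordinates, so the coordinates of the `card ι - m` vectors
  -- added suffice.
  let v : Fin m ⊕ ι → (ι → F) := Sum.elim ρ (fun j => Pi.single j 1)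
  have h0 : LinearIndepOn F v (Set.range Sum.inl) := by
    rw [linearIndepOn_range_iff Sum.inl_injective]
    exact hρ
  obtain ⟨b, -, hb1, hb2, hb3⟩ := exists_linearIndepOn_extension h0 (Set.subset_univ _)
  have hspan : ⊤ ≤ Submodule.span F (Set.range fun x : b => v x) := by
    rw [← Pi.basisFun F ι |>.span_eq, Submodule.span_le]
    rintro _ ⟨j, rfl⟩
    rw [Pi.basisFun_apply]
    have : v '' b = Set.range fun x : b => v x := by rw [Set.image_eq_range]
    rw [← this]
    exact hb2 ⟨Sum.inr j, trivial, rfl⟩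
  let B := Module.Basis.mk hb3 hspan
  have hcard : Fintype.card b = Fintype.card ι := by
    rw [← Module.finrank_eq_card_basis B, Module.finrank_fintype_fun_eq_card]
  let T : Finset ι := Finset.univ.filter fun j => Sum.inr j ∈ b
  refine ⟨T, ?_, ?_⟩
  · rw [← hcard]
    let e : (T ⊕ Fin m) ≃ b := Equiv.ofBijective
      (Sum.elim (fun j => ⟨Sum.inr j.1, (Finset.mem_filter.1 j.2).2⟩)
        (fun i => ⟨Sum.inl i, hb1 ⟨i, rfl⟩⟩)) (by
        constructor
        · rintro (⟨j, hj⟩ | i) (⟨j', hj'⟩ | i') h <;> simp at h <;> simp [h]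
        · rintro ⟨i | j, h⟩
          · exact ⟨Sum.inr i, rfl⟩
          · exact ⟨Sum.inl ⟨j, by simp [T, h]⟩, rfl⟩)
    rw [← Fintype.card_congr e, Fintype.card_sum, Fintype.card_coe, Fintype.card_fin]
  · let φ : (ι → F) →ₗ[F] K := Fintype.linearCombination F s
    have hφ : ∀ w, φ w = ∑ j, w j • s j := fun w => rfl
    have hφ1 : ∀ j, φ (Pi.single j 1) = s j := fun j => by
      rw [hφ, Finset.sum_eq_single j] <;> simp +contextual
    have key : Submodule.map φ (Submodule.span F (v '' b)) ≤
        Submodule.span F (insert 1 (s '' (T : Set ι))) := by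
      rw [Submodule.map_span, Submodule.span_le]
      rintro _ ⟨_, ⟨x, hx, rfl⟩, rfl⟩
      rcases x with i | j
      · obtain ⟨a, ha⟩ := hs i
        change φ (ρ i) ∈ _
        rw [hφ, ← ha, Algebra.algebraMap_eq_smul_one]
        exact Submodule.smul_mem _ _ (Submodule.subset_span (Set.mem_insert _ _))
      · change φ (Pi.single j 1) ∈ _
        rw [hφ1]
        exact Submodule.subset_span (Set.mem_insert_of_mem _ ⟨j, by simp [T, hx], rfl⟩)
    intro j
    rw [← hφ1]
    exact key ⟨_, hb2 ⟨Sum.inr j, trivial, rfl⟩, rfl⟩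

variable (k : Type*) {K : Type*} [Field k] [Field K] [Algebra k K]

/-- The subfield of elements algebraic over the subfield generated by a set. -/
def algebraicSpan (S : Set K) : Subfield K where
  __ := (Subalgebra.algebraicClosure (Algebra.adjoin k S) K).toSubring
  inv_mem' x hx := by
    have hx' : x ∈ Subalgebra.algebraicClosure (Algebra.adjoin k S) K := hx
    change x⁻¹ ∈ Subalgebra.algebraicClosure (Algebra.adjoin k S) K
    rw [Subalgebra.mem_algebraicClosure] at *
    exact hx'.inv

variable {k}

lemma mem_algebraicSpan {S : Set K} {x : K} :
    x ∈ algebraicSpan k S ↔ IsAlgebraic (Algebra.adjoin k S) x :=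
  Subalgebra.mem_algebraicClosure _ _

/-- Identifies the span with a matroid closure, so that transitivity of algebraic dependence and the
exchange property become available. -/
lemma coe_algebraicSpan (S : Set K) :
    (algebraicSpan k S : Set K) = (AlgebraicIndependent.matroid k K).closure S :=
  AlgebraicIndependent.matroid_closure_eq.symm

lemma subset_algebraicSpan (S : Set K) : S ⊆ algebraicSpan k S := by
  rw [coe_algebraicSpan]
  exact Matroid.subset_closure _ _ (Set.subset_univ _)

lemma algebraicSpan_le {S T : Set K} (h : S ⊆ algebraicSpan k T) :
    algebraicSpan k S ≤ algebraicSpan k T := by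
  rw [← SetLike.coe_subset_coe]
  rw [coe_algebraicSpan] at *
  rw [coe_algebraicSpan]
  exact Matroid.closure_subset_closure_of_subset_closure h

lemma algebraMap_mem_algebraicSpan (S : Set K) (a : k) :
    algebraMap k K a ∈ algebraicSpan k S := by
  rw [mem_algebraicSpan, IsScalarTower.algebraMap_apply k (Algebra.adjoin k S) K]
  exact isAlgebraic_algebraMap _

/-- The algebraic span is algebraically closed in the field. -/
lemma mem_algebraicSpan_of_isAlgebraic {S : Set K} {R : Subalgebra k K}
    (hR : (R : Set K) ⊆ algebraicSpan k S) {x : K} (hx : IsAlgebraic R x) :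
    x ∈ algebraicSpan k S := by
  refine algebraicSpan_le (S := (R : Set K)) hR ?_
  rw [mem_algebraicSpan, Algebra.adjoin_eq]
  exact hx

/-- An independent set in a closure has at most the rank of the closure, which is at most the size
of any spanning set. -/
lemma AlgebraicIndependent.card_le_of_mem_algebraicSpan {ι : Type*} [Fintype ι] {x : ι → K}
    (hx : AlgebraicIndependent k x) {S : Set K} (h : ∀ i, x i ∈ algebraicSpan k S) :
    (Fintype.card ι : ℕ∞) ≤ S.encard := by
  have h1 : (AlgebraicIndependent.matroid k K).Indep (Set.range x) :=
    AlgebraicIndependent.matroid_indep_iff.2 (hx.coe_range)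
  have h2 : Set.range x ⊆ (AlgebraicIndependent.matroid k K).closure S := by
    rw [← coe_algebraicSpan]
    rintro _ ⟨i, rfl⟩
    exact h i
  have h3 := h1.encard_le_eRk_of_subset h2
  rw [Matroid.eRk_closure_eq] at h3
  have h4 : (Set.range x).encard = Fintype.card ι := by
    rw [← Set.image_univ, hx.injective.encard_image, Set.encard_univ, ENat.card_eq_coe_fintype_card]
  rw [← h4]
  exact h3.trans (Matroid.eRk_le_encard _ _)

/-- Let `y`, `z` be algebraic over `d` elements, and let `y l - ∑ j, z j * U j l` and the `U j l` be
algebraically independent. For `d` independent linear forms `ρ` over the algebraic span of the `d` elements,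
the `d × L` matrix `ρ (y l) - ∑ j, U j l * ρ (z j)` has independent columns. -/
theorem eq_zero_of_algebraicIndependent {J L : Type*} [Fintype J] [Fintype L] [DecidableEq J]
    [DecidableEq L] (y : L → K) (z : J → K) (U : J → L → K) {d : ℕ} (s₀ : Fin d → K)
    (F : Subfield K) (hF : F = algebraicSpan k (Set.range s₀)) (hy : ∀ l, y l ∈ F) (hz : ∀ j, z j ∈ F)
    (hU : AlgebraicIndependent k (Sum.elim (fun l => y l - ∑ j, z j * U j l)
      (fun p : J × L => U p.1 p.2)))
    (ρ : Fin d → L ⊕ J → F) (hρ : LinearIndependent F ρ) (c : L → K)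
    (hc : ∀ i, ∑ l, c l * ((ρ i (Sum.inl l) : K) - ∑ j, U j l * ρ i (Sum.inr j)) = 0) : c = 0 := by
  classical
  by_contra hne
  obtain ⟨l₀, hl₀⟩ : ∃ l, c l ≠ 0 := by
    by_contra h; push Not at h; exact hne (funext h)
  wlog h1 : c l₀ = 1 generalizing c
  · refine this (fun l => (c l₀)⁻¹ * c l) (fun i => ?_) (fun h => ?_) ?_ ?_
    · simp only [mul_assoc]
      rw [← Finset.mul_sum, hc, mul_zero]
    · have := congr_fun h l₀
      simp [hl₀] at this
    · simp [hl₀]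
    · simp [hl₀]
  -- Regarding `c` and `w` as one vector `s` turns the relations into vanishing of forms `ρ i` with
  -- coefficients in `F`, without the transcendental `U`.
  let w : J → K := fun j => - ∑ l, c l * U j l
  let s : L ⊕ J → K := Sum.elim c w
  have hs : ∀ i, ∑ a, ρ i a • s a = 0 := by
    intro i
    rw [← hc i, Fintype.sum_sum_type]
    have e : ∀ l, c l * ((ρ i (Sum.inl l) : K) - ∑ j, U j l * ρ i (Sum.inr j)) =
        ρ i (Sum.inl l) * c l - ∑ j, c l * U j l * ρ i (Sum.inr j) := fun l => by
      rw [mul_sub, Finset.mul_sum, mul_comm]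
      simp only [mul_assoc]
    simp only [e, Finset.sum_sub_distrib]
    rw [Finset.sum_comm, sub_eq_add_neg]
    congr 1
    rw [← Finset.sum_neg_distrib]
    refine Finset.sum_congr rfl fun j _ => ?_
    change (ρ i (Sum.inr j) : K) * - ∑ l, c l * U j l = _
    rw [← Finset.sum_mul]
    ring
  let φ : (L ⊕ J → F) →ₗ[F] K := Fintype.linearCombination F s
  have hφ : ∀ i, φ (ρ i) = 0 := hs
  have hφ1 : φ (Pi.single (Sum.inl l₀) 1) = 1 := by
    change ∑ a, (Pi.single (Sum.inl l₀) 1 : L ⊕ J → F) a • s a = 1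
    rw [Finset.sum_eq_single (Sum.inl l₀)] <;> simp +contextual [s, h1]
  -- The normalisation `c l₀ = 1` is one further linear form with value in `F`. It is independent of
  -- the others because it does not vanish at `s`. This extra form produces the contradiction.
  let ρ' : Fin (d + 1) → (L ⊕ J → F) := Fin.cons (Pi.single (Sum.inl l₀) 1) ρ
  have hρ' : LinearIndependent F ρ' := by
    rw [linearIndependent_finCons]
    refine ⟨hρ, fun hmem => ?_⟩
    have : Submodule.span F (Set.range ρ) ≤ LinearMap.ker φ := by
      rw [Submodule.span_le]
      rintro _ ⟨i, rfl⟩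
      exact hφ i
    have h2 := this hmem
    rw [LinearMap.mem_ker, hφ1] at h2
    exact one_ne_zero h2
  obtain ⟨T, hT, hspan⟩ := exists_finset_mem_span_of_linearForms ρ' hρ' s (by
    intro i
    refine Fin.cases ?_ (fun i => ?_) i
    · exact ⟨1, by rw [map_one]; exact hφ1.symm⟩
    · exact ⟨0, by rw [map_zero]; exact (hφ i).symm⟩)
  -- The column of `U` at `l₀` can be left out: by the definition of `w` and `c l₀ = 1` it is
  -- determined by the other columns and `s`.
  let S : Set K := Set.range s₀ ∪ ((fun p : J × L => U p.1 p.2) ''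
    ((Finset.univ ×ˢ (Finset.univ.erase l₀) : Finset (J × L)) : Set (J × L))) ∪ s '' (T : Set _)
  have hFS : F ≤ algebraicSpan k S := hF ▸ algebraicSpan_le
    ((Set.subset_union_left.trans Set.subset_union_left).trans (subset_algebraicSpan S))
  have hUS : ∀ j l, l ≠ l₀ → U j l ∈ algebraicSpan k S := by
    intro j l hl
    exact subset_algebraicSpan S (Or.inl (Or.inr ⟨(j, l), by simp [hl], rfl⟩))
  have hsS : ∀ a, s a ∈ algebraicSpan k S := by
    intro a
    have h2 : Submodule.span F (insert 1 (s '' (T : Set (L ⊕ J)))) ≤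
        ({ (algebraicSpan k S).toAddSubgroup with
            smul_mem' := fun r x hx => mul_mem (hFS r.2) hx } : Submodule F K) := by
      rw [Submodule.span_le]
      rintro x (rfl | hx)
      · exact one_mem (algebraicSpan k S)
      · exact subset_algebraicSpan S (Or.inr hx)
    exact h2 (hspan a)
  have hU0 : ∀ j, U j l₀ ∈ algebraicSpan k S := by
    intro j
    have h3 : U j l₀ = - (w j + ∑ l ∈ Finset.univ.erase l₀, c l * U j l) := by
      have := Finset.add_sum_erase Finset.univ (fun l => c l * U j l) (Finset.mem_univ l₀)
      simp only [w]
      rw [← this, h1]; ring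
    rw [h3]
    refine neg_mem (add_mem (hsS (Sum.inr j)) (sum_mem fun l hl => ?_))
    exact mul_mem (hsS (Sum.inl l)) (hUS j l (Finset.ne_of_mem_erase hl))
  have hU' : ∀ j l, U j l ∈ algebraicSpan k S := by
    intro j l
    by_cases hl : l = l₀
    · rw [hl]; exact hU0 j
    · exact hUS j l hl
  have hcard := hU.card_le_of_mem_algebraicSpan (S := S) (by
    rintro (l | ⟨j, l⟩)
    · exact sub_mem (hFS (hy l)) (sum_mem fun j _ => mul_mem (hFS (hz j)) (hU' j l))
    · exact hU' j l)
  have hS : S.encard ≤ ((d + Fintype.card J * (Fintype.card L - 1) + T.card : ℕ) : ℕ∞) := by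
    push_cast
    refine (Set.encard_union_le _ _).trans (add_le_add ((Set.encard_union_le _ _).trans
      (add_le_add ?_ ?_)) ?_)
    · rw [← Set.image_univ]
      refine (Set.encard_image_le _ _).trans ?_
      simp
    · refine (Set.encard_image_le _ _).trans ?_
      rw [Set.encard_coe_eq_coe_finsetCard, Finset.card_product, Finset.card_erase_of_mem
        (Finset.mem_univ _)]
      simp
    · refine (Set.encard_image_le _ _).trans ?_
      rw [Set.encard_coe_eq_coe_finsetCard]
  -- The count: `|L| + |J||L|` independent elements lie in the span of `d + |J|(|L| - 1) + (|L| +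
  -- |J| - d - 1) = |J||L| + |L| - 1` elements.
  have h5 := hcard.trans hS
  rw [Nat.cast_le] at h5
  simp only [Fintype.card_sum, Fintype.card_prod] at h5 hT
  have hL : 0 < Fintype.card L := Fintype.card_pos_iff.2 ⟨l₀⟩
  obtain ⟨n, hn⟩ : ∃ n, Fintype.card L = n + 1 := ⟨_, (Nat.succ_pred_eq_of_pos hL).symm⟩
  rw [hn] at h5 hT
  simp only [Nat.add_sub_cancel, mul_add, mul_one] at h5
  omega

end Transcendence

/-! ### Finitely generated commutative groups -/

section Groups

/-- A finitely generated commutative group has a basis modulo torsion, with a dual basis. -/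
lemma AddCommGroup.exists_dual_families (Λ : Type*) [AddCommGroup Λ] [Module.Finite ℤ Λ] :
    ∃ (d : ℕ) (b : Fin d → Λ) (h : Fin d → Λ →+ ℤ), (∀ i j, h i (b j) = if i = j then 1 else 0) ∧
      ∀ x, ∃ m : ℕ, m ≠ 0 ∧ m • x = m • ∑ i, h i x • b i := by
  let T := Submodule.torsion ℤ Λ
  let B := Module.Free.chooseBasis ℤ (Λ ⧸ T)
  let e := Fintype.equivFin (Module.Free.ChooseBasisIndex ℤ (Λ ⧸ T))
  let B' := B.reindex e
  choose b hb using fun i => Submodule.mkQ_surjective T (B' i)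
  let h : Fin (Fintype.card _) → Λ →+ ℤ := fun i => ((B'.coord i).comp T.mkQ).toAddMonoidHom
  have hh : ∀ i x, h i x = B'.repr (T.mkQ x) i := fun i x => rfl
  refine ⟨_, b, h, fun i j => ?_, fun x => ?_⟩
  · rw [hh, hb, Module.Basis.repr_self, Finsupp.single_apply]
    simp [eq_comm]
  · have : x - ∑ i, h i x • b i ∈ T := by
      refine (Submodule.Quotient.mk_eq_zero T).1 ?_
      change T.mkQ _ = 0
      rw [map_sub, map_sum]
      simp only [map_smul, hb, hh]
      rw [B'.sum_repr, sub_self]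
    obtain ⟨⟨a, ha⟩, hax⟩ := (Submodule.mem_torsion_iff _).1 this
    have hax' : a • (x - ∑ i, h i x • b i) = 0 := hax
    refine ⟨a.natAbs, Int.natAbs_ne_zero.2 (nonZeroDivisors.ne_zero ha), ?_⟩
    rw [← sub_eq_zero, ← nsmul_sub]
    rcases Int.natAbs_eq a with h' | h'
    · rw [h', natCast_zsmul] at hax'
      exact hax'
    · rw [h', neg_smul, natCast_zsmul, neg_eq_zero] at hax'
      exact hax'

/-- An element on which all homomorphisms to a field of characteristic zero vanish is torsion. -/
lemma AddCommGroup.exists_nsmul_eq_zero {Λ K : Type*} [AddCommGroup Λ] [Module.Finite ℤ Λ] [Field K]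
    [CharZero K] {x : Λ} (hx : ∀ h : Λ →+ K, h x = 0) : ∃ m : ℕ, m ≠ 0 ∧ m • x = 0 := by
  obtain ⟨d, b, h, -, hb⟩ := AddCommGroup.exists_dual_families Λ
  obtain ⟨m, hm, hmx⟩ := hb x
  refine ⟨m, hm, ?_⟩
  have : ∀ i, h i x = 0 := fun i => by
    have := hx ((Int.castAddHom K).comp (h i))
    simpa using this
  simpa [this] using hmx

lemma AddCommGroup.exists_hom_zmod_ne_zero {G : Type*} [AddCommGroup G] {p : ℕ} [Fact p.Prime]
    [Module (ZMod p) G] {x : G} (hx : x ≠ 0) : ∃ f : G →+ ZMod p, f x ≠ 0 := by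
  obtain ⟨f, hf⟩ := Module.Projective.exists_dual_ne_zero (ZMod p) hx
  exact ⟨f.toAddMonoidHom, hf⟩

/-- An element on which all homomorphisms to a field of characteristic `p` vanish is divisible by `p`. -/
lemma AddCommGroup.exists_nsmul_eq {Λ K : Type*} [AddCommGroup Λ] [Field K] {p : ℕ} [Fact p.Prime]
    [CharP K p] {x : Λ} (hx : ∀ h : Λ →+ K, h x = 0) : ∃ y : Λ, p • y = x := by
  -- `Λ / pΛ` is a vector space over the prime field, so a nonzero class is detected by a
  -- functional, which is then composed with the inclusion of the prime field in `K`.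
  let N : AddSubgroup Λ := (nsmulAddMonoidHom p : Λ →+ Λ).range
  by_contra hne
  have hN : ∀ y : Λ ⧸ N, p • y = 0 := fun y => by
    obtain ⟨y, rfl⟩ := QuotientAddGroup.mk_surjective y
    rw [← QuotientAddGroup.mk_nsmul, QuotientAddGroup.eq_zero_iff]
    exact ⟨y, rfl⟩
  obtain ⟨f, hf⟩ := @AddCommGroup.exists_hom_zmod_ne_zero _ _ p _ (AddCommGroup.zmodModule hN)
    (QuotientAddGroup.mk' N x) (fun h => hne ((QuotientAddGroup.eq_zero_iff x).1 h))
  refine hf ((ZMod.castHom (dvd_refl p) K).injective ?_)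
  rw [map_zero]
  exact hx (((ZMod.castHom (dvd_refl p) K).toAddMonoidHom.comp f).comp (QuotientAddGroup.mk' N))

/-- A finitely generated `p`-divisible commutative group is finite of order prime to `p`. -/
lemma AddCommGroup.finite_and_not_dvd_card (K : Type*) [AddCommGroup K] [Module.Finite ℤ K] (p : ℕ)
    [Fact p.Prime] (h : ∀ x : K, ∃ y, p • y = x) : Finite K ∧ ¬ p ∣ Nat.card K := by
  -- Nakayama's lemma for `pK = K`: some integer `r ≡ 1` modulo `p` kills the group.
  obtain ⟨r, hr, hr'⟩ := Submodule.exists_sub_one_mem_and_smul_eq_zero_of_fg_of_le_smul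
    (Ideal.span {(p : ℤ)}) (⊤ : Submodule ℤ K) Module.Finite.fg_top (fun x _ => by
      obtain ⟨y, rfl⟩ := h x
      rw [← natCast_zsmul]
      exact Submodule.smul_mem_smul (Ideal.mem_span_singleton_self _) trivial)
  have hp : p.Prime := Fact.out
  have hr0 : r ≠ 0 := by
    rintro rfl
    rw [Ideal.mem_span_singleton, zero_sub, dvd_neg] at hr
    exact hp.one_lt.ne' (by exact_mod_cast Int.eq_one_of_dvd_one (by positivity) hr)
  have hfin : Finite K := by
    have : Module.IsTorsion ℤ K := fun {x} =>
      ⟨⟨r, mem_nonZeroDivisors_of_ne_zero hr0⟩, hr' x trivial⟩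
    exact Module.finite_of_fg_torsion K this
  refine ⟨hfin, fun hdvd => ?_⟩
  obtain ⟨x, hx⟩ := exists_prime_addOrderOf_dvd_card' p hdvd
  have h1 : ((addOrderOf x : ℕ) : ℤ) ∣ r := addOrderOf_dvd_iff_zsmul_eq_zero.2 (hr' x trivial)
  rw [hx] at h1
  rw [Ideal.mem_span_singleton] at hr
  have h2 : (p : ℤ) ∣ 1 := by
    have := dvd_sub h1 hr
    simpa using this
  exact hp.one_lt.ne' (by exact_mod_cast Int.eq_one_of_dvd_one (by positivity) h2)

/-- Extension of a lifting of a homomorphism along `p : E → E'`, if the kernel of `p` is uniquely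
divisible by the torsion of the kernel and cokernel of `θ`. -/
theorem MonoidHom.exists_lift_of_torsion {Q P E E' : Type*} [CommGroup Q] [CommGroup P] [CommGroup E]
    [CommGroup E'] (θ : Q →* P) [Group.FG P] (p : E →* E') (hp : Function.Surjective p) (n : ℕ)
    (hdiv : ∀ e, p e = 1 → ∃ e', p e' = 1 ∧ e' ^ n = e)
    (hinj : ∀ e, p e = 1 → e ^ n = 1 → e = 1)
    (hker : ∀ x, θ x = 1 → x ^ n = 1)
    (hcoker : ∀ (g : P) (m : ℕ), m ≠ 0 → g ^ m ∈ θ.range → g ^ n ∈ θ.range)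
    (u : P →* E') (v : Q →* E) (huv : ∀ x, p (v x) = u (θ x)) :
    ∃ w : P →* E, (∀ g, p (w g) = u g) ∧ ∀ x, w (θ x) = v x := by
  -- For `n = 0` the hypothesis `hinj` says that `p` is injective, so there is nothing to choose.
  by_cases hn : n = 0
  · subst hn
    have hpi : Function.Injective p := by
      rw [injective_iff_map_eq_one]
      intro e he
      exact hinj e he (pow_zero e)
    let e := MulEquiv.ofBijective p ⟨hpi, hp⟩
    have he : ∀ x, p (e.symm x) = x := fun x => e.apply_symm_apply x
    refine ⟨e.symm.toMonoidHom.comp u, fun g => he _, fun x => hpi ?_⟩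
    rw [huv]
    exact he _
  -- On `H` the lift is forced: it must lie over `u` and its `n`-th power is prescribed by `v`, and
  -- unique divisibility of the kernel of `p` leaves exactly one solution. The rest of `P` is free
  -- over `H`.
  let H : Subgroup P := θ.range.comap (powMonoidHom n)
  have hH : ∀ g, g ∈ H ↔ g ^ n ∈ θ.range := fun g => Iff.rfl
  have huniq : ∀ a b : E, p a = p b → a ^ n = b ^ n → a = b := by
    intro a b h1 h2
    rw [← div_eq_one]
    exact hinj _ (by rw [map_div, h1, div_self']) (by rw [div_pow, h2, div_self'])
  have hv : ∀ x, θ x = 1 → v x = 1 := by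
    intro x hx
    refine hinj _ (by rw [huv, hx, map_one]) (by rw [← map_pow, hker x hx, map_one])
  have hex : ∀ g : H, ∃ e, p e = u g ∧ ∀ x, θ x = (g : P) ^ n → e ^ n = v x := by
    intro g
    obtain ⟨x, hx⟩ := g.2
    obtain ⟨e₀, he₀⟩ := hp (u g)
    obtain ⟨e', he', he''⟩ := hdiv (e₀ ^ n / v x) (by
      rw [map_div, map_pow, he₀, huv, hx, powMonoidHom_apply, map_pow, div_self'])
    refine ⟨e₀ / e', by rw [map_div, he', he₀, div_one], fun y hy => ?_⟩
    have : v y = v x := by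
      rw [← div_eq_one, ← map_div]
      refine hv _ ?_
      rw [map_div, hy, hx]
      exact div_self' _
    rw [div_pow, he'', this, div_div_cancel]
  choose w hw1 hw2 using hex
  let wH : H →* E := MonoidHom.mk' w (fun a b => by
    obtain ⟨x, hx⟩ := a.2
    obtain ⟨y, hy⟩ := b.2
    refine huniq _ _ (by rw [map_mul, hw1, hw1, hw1, ← map_mul]; rfl) ?_
    rw [mul_pow, hw2 a x hx, hw2 b y hy, hw2 (a * b) (x * y), map_mul]
    rw [map_mul, hx, hy]
    simp [mul_pow])
  have hwH : ∀ g, p (wH g) = u g := hw1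
  -- If a nonzero power of `g` is in `H`, then a nonzero power is in the range of `θ`, and `hcoker`
  -- gives `g ^ n` in the range.
  have htf : Module.IsTorsionFree ℤ (Additive (P ⧸ H)) := by
    rw [Module.isTorsionFree_iff_smul_eq_zero]
    intro r x hrx
    obtain ⟨g, hg⟩ := QuotientGroup.mk_surjective (Additive.toMul x)
    by_contra! hcon
    obtain ⟨hr, hx⟩ := hcon
    apply hx
    have h1 : g ^ r ∈ H := by
      rw [← QuotientGroup.eq_one_iff, QuotientGroup.mk_zpow, hg]
      exact hrx
    have h2 : g ^ r.natAbs ∈ H := by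
      rcases Int.natAbs_eq r with h' | h'
      · rw [h', zpow_natCast] at h1
        exact h1
      · rw [h', zpow_neg, zpow_natCast] at h1
        exact (inv_mem_iff).1 h1
    have h3 : g ∈ H := hcoker g (r.natAbs * n) (mul_ne_zero (Int.natAbs_ne_zero.2 hr) hn) (by
      rw [pow_mul]; exact h2)
    rw [← QuotientGroup.eq_one_iff, hg] at h3
    exact h3
  have hfg : Module.Finite ℤ (Additive (P ⧸ H)) := by
    rw [Module.Finite.iff_addGroup_fg]
    infer_instance
  let F := Additive (P ⧸ H)
  have hfree : Module.Free ℤ F := inferInstance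
  let π : Additive P →ₗ[ℤ] F := (QuotientGroup.mk' H).toAdditive.toIntLinearMap
  obtain ⟨σ, hσ⟩ := Module.projective_lifting_property π LinearMap.id (fun x =>
    QuotientGroup.mk_surjective (s := H) x)
  obtain ⟨τ, hτ⟩ := Module.projective_lifting_property p.toAdditive.toIntLinearMap
    (u.toAdditive.toIntLinearMap.comp σ) hp
  let s : P →* P := MonoidHom.toAdditive.symm (σ.comp π).toAddMonoidHom
  let t : P →* E := MonoidHom.toAdditive.symm (τ.comp π).toAddMonoidHom
  have hs : ∀ g, g / s g ∈ H := by
    intro g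
    rw [← QuotientGroup.eq_one_iff, QuotientGroup.mk_div, div_eq_one]
    exact congr(Additive.toMul ($hσ (π (Additive.ofMul g)))).symm
  have ht : ∀ g, p (t g) = u (s g) := fun g => congr(Additive.toMul ($hτ (π (Additive.ofMul g))))
  have hπ : ∀ g ∈ H, π (Additive.ofMul g) = 0 := fun g hg => (QuotientGroup.eq_one_iff g).2 hg
  have hs1 : ∀ g ∈ H, s g = 1 := fun g hg => by
    change (σ (π (Additive.ofMul g))).toMul = 1
    rw [hπ g hg, map_zero]; rfl
  have ht1 : ∀ g ∈ H, t g = 1 := fun g hg => by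
    change (τ (π (Additive.ofMul g))).toMul = 1
    rw [hπ g hg, map_zero]; rfl
  -- Glue along the splitting of `P → P / H`: the component in `H` is lifted by `wH` and the free
  -- component by `t`.
  refine ⟨MonoidHom.mk' (fun g => wH ⟨g / s g, hs g⟩ * t g) (fun a b => ?_), fun g => ?_, fun x => ?_⟩
  · have : (⟨a * b / s (a * b), hs _⟩ : H) = ⟨a / s a, hs a⟩ * ⟨b / s b, hs b⟩ :=
      Subtype.ext (by
        change a * b / s (a * b) = a / s a * (b / s b)
        rw [map_mul, mul_div_mul_comm])
    rw [this, map_mul, map_mul, mul_mul_mul_comm]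
  · change p (wH ⟨g / s g, hs g⟩ * t g) = u g
    rw [map_mul, hwH, ht, ← map_mul]
    simp
  · have hx : θ x ∈ H := ⟨x ^ n, by rw [map_pow]; rfl⟩
    have : (⟨θ x / s (θ x), hs _⟩ : H) = ⟨θ x, hx⟩ := Subtype.ext (by
      change θ x / s (θ x) = θ x
      rw [hs1 _ hx, div_one])
    change wH ⟨θ x / s (θ x), hs _⟩ * t (θ x) = v x
    rw [this, ht1 _ hx, mul_one]
    refine huniq _ _ (by rw [hwH, huv]) ?_
    rw [← map_pow v]
    exact hw2 _ _ (map_pow θ x n)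

end Groups

/-! ### Two charts of a log smooth morphism, in terms of rings -/

section GrothendieckGroup

open Algebra.GrothendieckGroup

variable {P Q : Type u} [CommMonoid P] [CommMonoid Q]

lemma gpMap_of (θ : Q →* P) (q : Q) : gpMap θ (of q) = of (θ q) := by
  have := (Algebra.GrothendieckGroup.lift (M := Q)).symm_apply_apply (of.comp θ)
  exact congr($this q)

lemma Algebra.GrothendieckGroup.exists_eq_div (x : Algebra.GrothendieckGroup P) :
    ∃ p q : P, x = of p / of q := by
  obtain ⟨⟨p, q⟩, hx⟩ := (Localization.monoidOf (⊤ : Submonoid P)).surj x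
  exact ⟨p, q, eq_div_of_mul_eq' hx⟩

lemma Algebra.GrothendieckGroup.hom_ext' {G : Type*} [CommGroup G]
    {f g : Algebra.GrothendieckGroup P →* G} (h : ∀ p, f (of p) = g (of p)) : f = g := by
  ext x
  obtain ⟨p, q, rfl⟩ := exists_eq_div x
  rw [map_div, map_div, h, h]

lemma Algebra.GrothendieckGroup.lift_of {G : Type*} [CommGroup G] (f : P →* G) (p : P) :
    Algebra.GrothendieckGroup.lift f (of p) = f p := by
  have := (Algebra.GrothendieckGroup.lift (M := P)).symm_apply_apply f
  exact congr($this p)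

lemma gpMap_surjective {θ : Q →* P} (h : Function.Surjective θ) :
    Function.Surjective (gpMap θ) := by
  intro x
  obtain ⟨p, q, rfl⟩ := exists_eq_div x
  obtain ⟨p, rfl⟩ := h p
  obtain ⟨q, rfl⟩ := h q
  exact ⟨of p / of q, by rw [map_div, gpMap_of, gpMap_of]⟩

end GrothendieckGroup

/-- Two charts `Q → P` and `Q₁ → P₁` of a morphism of affine log schemes, the first of which is a quotient of
the second up to units, while the second is étale. -/
structure ChartPair (kW O P₁ Q₁ P Q : Type u) [CommRing kW] [CommRing O] [Algebra kW O]
    [CommMonoid P₁] [CommMonoid Q₁] [CommMonoid P] [CommMonoid Q] where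
  θ₁ : Q₁ →* P₁
  θ : Q →* P
  π : P₁ →* P
  πQ : Q₁ →* Q
  π_θ₁ (q : Q₁) : π (θ₁ q) = θ (πQ q)
  π_surjective : Function.Surjective π
  πQ_surjective : Function.Surjective πQ
  αN₁ : Q₁ →* kW
  αN : Q →* kW
  α₁ : P₁ →* O
  α : P →* O
  uM : P₁ →* Oˣ
  uN : Q₁ →* kWˣ
  α₁_eq (p : P₁) : α₁ p = α (π p) * uM p
  αN₁_eq (q : Q₁) : αN₁ q = αN (πQ q) * uN q
  uM_θ₁ (q : Q₁) : (uM (θ₁ q) : O) = algebraMap kW O (uN q)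
  α_θ (q : Q) : α (θ q) = algebraMap kW O (αN q)
  exists_of_π_eq (p p' : P₁) : π p = π p' → ∃ c d, π c = 1 ∧ π d = 1 ∧ p * c = p' * d
  exists_of_πQ_eq (q q' : Q₁) : πQ q = πQ q' → ∃ c d, πQ c = 1 ∧ πQ d = 1 ∧ q * c = q' * d
  exists_lift {T T' : Type u} [CommRing T] [CommRing T'] (g : T →+* T')
    (hg : Function.Surjective g) (hg' : ∀ x y, g x = 0 → g y = 0 → x * y = 0) (φ : O →+* T')
    (a : kW →+* T) (b : P₁ →* T) (hab : ∀ q, a (αN₁ q) = b (θ₁ q))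
    (ha : ∀ x, g (a x) = φ (algebraMap kW O x)) (hb : ∀ p, g (b p) = φ (α₁ p)) :
    ∃ ψ : O →+* T, (∀ x, g (ψ x) = φ x) ∧ (∀ x, ψ (algebraMap kW O x) = a x) ∧
      ∀ p, ψ (α₁ p) = b p

namespace ChartPair

open Algebra.GrothendieckGroup

variable {kW O P₁ Q₁ P Q : Type u} [CommRing kW] [CommRing O] [Algebra kW O]
    [CommMonoid P₁] [CommMonoid Q₁] [CommMonoid P] [CommMonoid Q] (c : ChartPair kW O P₁ Q₁ P Q)

include c in
lemma fg_source [Monoid.FG P₁] : Monoid.FG P := Monoid.fg_of_surjective c.π c.π_surjective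

include c in
lemma fg_target [Monoid.FG Q₁] : Monoid.FG Q := Monoid.fg_of_surjective c.πQ c.πQ_surjective

include c in
-- An equality in `P` lifts to `P₁` up to factors with trivial image in `P`, so one can cancel in
-- `P₁` and project back.
lemma isCancelMul_source [IsCancelMul P₁] : IsCancelMul P := by
  have : IsLeftCancelMul P := ⟨fun s a b h => by
    obtain ⟨s, rfl⟩ := c.π_surjective s
    obtain ⟨a, rfl⟩ := c.π_surjective a
    obtain ⟨b, rfl⟩ := c.π_surjective b
    have h' : c.π s * c.π a = c.π s * c.π b := h
    rw [← map_mul, ← map_mul] at h'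
    obtain ⟨x, y, hx, hy, e⟩ := c.exists_of_π_eq _ _ h'
    rw [mul_assoc, mul_assoc] at e
    have := congr(c.π $(mul_left_cancel e))
    rwa [map_mul, map_mul, hx, hy, mul_one, mul_one] at this⟩
  exact CommMagma.IsLeftCancelMul.toIsCancelMul P

include c in
lemma isCancelMul_target [IsCancelMul Q₁] : IsCancelMul Q := by
  have : IsLeftCancelMul Q := ⟨fun s a b h => by
    obtain ⟨s, rfl⟩ := c.πQ_surjective s
    obtain ⟨a, rfl⟩ := c.πQ_surjective a
    obtain ⟨b, rfl⟩ := c.πQ_surjective b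
    have h' : c.πQ s * c.πQ a = c.πQ s * c.πQ b := h
    rw [← map_mul, ← map_mul] at h'
    obtain ⟨x, y, hx, hy, e⟩ := c.exists_of_πQ_eq _ _ h'
    rw [mul_assoc, mul_assoc] at e
    have := congr(c.πQ $(mul_left_cancel e))
    rwa [map_mul, map_mul, hx, hy, mul_one, mul_one] at this⟩
  exact CommMagma.IsLeftCancelMul.toIsCancelMul Q

lemma gpMap_π_θ₁ (x : Algebra.GrothendieckGroup Q₁) :
    gpMap c.π (gpMap c.θ₁ x) = gpMap c.θ (gpMap c.πQ x) := by
  have : (gpMap c.π).comp (gpMap c.θ₁) = (gpMap c.θ).comp (gpMap c.πQ) :=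
    hom_ext' fun q => by
      simp only [MonoidHom.comp_apply, gpMap_of, c.π_θ₁]
  exact congr($this x)

/-- The units relating the two charts of the source, on the group generated by `P₁`. -/
def uMgp : Algebra.GrothendieckGroup P₁ →* Oˣ := Algebra.GrothendieckGroup.lift c.uM

/-- The units relating the two charts of the target, on the group generated by `Q₁`. -/
def uNgp : Algebra.GrothendieckGroup Q₁ →* kWˣ := Algebra.GrothendieckGroup.lift c.uN

lemma uMgp_of (p : P₁) : c.uMgp (of p) = c.uM p := lift_of _ _

lemma uNgp_of (p : Q₁) : c.uNgp (of p) = c.uN p := lift_of _ _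

lemma uMgp_θ₁ (x : Algebra.GrothendieckGroup Q₁) :
    c.uMgp (gpMap c.θ₁ x) = Units.map (algebraMap kW O).toMonoidHom (c.uNgp x) := by
  have : c.uMgp.comp (gpMap c.θ₁) = (Units.map (algebraMap kW O).toMonoidHom).comp c.uNgp :=
    hom_ext' fun q => by
      apply Units.ext
      simp only [MonoidHom.comp_apply, gpMap_of, uMgp_of, uNgp_of]
      exact c.uM_θ₁ q
  exact congr($this x)

/-- Allows the units on the kernel of `P₁ᵍᵖ → Pᵍᵖ` to be computed from elements of `P₁` itself,
where `α₁` and the unit agree. -/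
lemma exists_of_gpMap_π_eq_one [IsCancelMul P₁] (x : Algebra.GrothendieckGroup P₁)
    (hx : gpMap c.π x = 1) : ∃ p p', c.π p = 1 ∧ c.π p' = 1 ∧ x = of p / of p' := by
  have := c.isCancelMul_source
  obtain ⟨p, p', rfl⟩ := exists_eq_div x
  rw [map_div, gpMap_of, gpMap_of, div_eq_one] at hx
  obtain ⟨a, b, ha, hb, e⟩ := c.exists_of_π_eq _ _ (of_injective hx)
  refine ⟨b, a, hb, ha, ?_⟩
  rw [div_eq_div_iff_mul_eq_mul, ← map_mul, ← map_mul, e, mul_comm]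

/-- The kernel of `P₁ᵍᵖ → Pᵍᵖ` modulo the kernel of `Q₁ᵍᵖ → Qᵍᵖ`. -/
abbrev Lam : Type u := Additive ((gpMap c.π).ker ⧸
  ((gpMap c.πQ).ker.map (gpMap c.θ₁)).subgroupOf (gpMap c.π).ker)

/-- The class of an element of the kernel of `P₁ᵍᵖ → Pᵍᵖ`. -/
def cls (x : Algebra.GrothendieckGroup P₁) (hx : gpMap c.π x = 1) : c.Lam :=
  Additive.ofMul (QuotientGroup.mk ⟨x, hx⟩)

lemma cls_mul {x y : Algebra.GrothendieckGroup P₁} (hx : gpMap c.π x = 1) (hy : gpMap c.π y = 1) :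
    c.cls (x * y) (by rw [map_mul, hx, hy, one_mul]) = c.cls x hx + c.cls y hy := rfl

lemma cls_surjective (x : c.Lam) : ∃ y hy, c.cls y hy = x := by
  obtain ⟨⟨y, hy⟩, h⟩ := QuotientGroup.mk_surjective x.toMul
  exact ⟨y, hy, h⟩

lemma cls_eq_zero {x : Algebra.GrothendieckGroup P₁} (hx : gpMap c.π x = 1) :
    c.cls x hx = 0 ↔ ∃ y, gpMap c.πQ y = 1 ∧ gpMap c.θ₁ y = x :=
  (QuotientGroup.eq_one_iff (⟨x, hx⟩ : (gpMap c.π).ker)).trans Iff.rfl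

lemma cls_pow {x : Algebra.GrothendieckGroup P₁} (hx : gpMap c.π x = 1) (n : ℕ) :
    c.cls (x ^ n) (by rw [map_pow, hx, one_pow]) = n • c.cls x hx := rfl

lemma cls_sub {x y : Algebra.GrothendieckGroup P₁} (hx : gpMap c.π x = 1) (hy : gpMap c.π y = 1) :
    c.cls (x / y) (by rw [map_div, hx, hy, one_div_one]) = c.cls x hx - c.cls y hy := rfl

instance finite_lam [Monoid.FG P₁] : Module.Finite ℤ c.Lam := by
  have h1 : Module.Finite ℤ (Additive (Algebra.GrothendieckGroup P₁)) := by
    rw [Module.Finite.iff_addGroup_fg]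
    have : Group.FG (Algebra.GrothendieckGroup P₁) := Group.fg_iff_monoid_fg.2 inferInstance
    infer_instance
  have h2 : IsNoetherian ℤ (Additive (Algebra.GrothendieckGroup P₁)) := inferInstance
  have h3 : Module.Finite ℤ (Additive (gpMap c.π).ker) :=
    Module.Finite.of_injective (((gpMap c.π).ker.subtype).toAdditive.toIntLinearMap)
      fun x y h => Subtype.ext h
  exact Module.Finite.of_surjective ((QuotientGroup.mk' (((gpMap c.πQ).ker.map
    (gpMap c.θ₁)).subgroupOf (gpMap c.π).ker)).toAdditive.toIntLinearMap)
    fun x => QuotientGroup.mk_surjective x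

section Point

variable {κ : Type u} [Field κ] [Algebra O κ] [Algebra kW κ] [IsScalarTower kW O κ]

/-- All elements other than `1` of the monoids `P` and `Q` vanish at the point. -/
structure IsSharpAt (κ : Type u) [Field κ] [Algebra O κ] [Algebra kW κ] : Prop where
  source (p : P) : p ≠ 1 → algebraMap O κ (c.α p) = 0
  target (q : Q) : q ≠ 1 → algebraMap kW κ (c.αN q) = 0

variable {c} (hc : c.IsSharpAt κ)
include hc

/-- If `θ q` is trivial then `αN q` maps to `1`, whereas sharpness would make it vanish in `κ`. -/
lemma IsSharpAt.θ_eq_one {q : Q} (h : c.θ q = 1) : q = 1 := by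
  by_contra hq
  have h1 := c.α_θ q
  rw [h, map_one] at h1
  have := congr(algebraMap O κ $h1)
  rw [map_one, ← IsScalarTower.algebraMap_apply, hc.target q hq] at this
  exact one_ne_zero this

open scoped Classical in
/-- A homomorphism from the units to the residue field gives a derivation. -/
theorem IsSharpAt.exists_derivation (h : c.Lam →+ κ) : ∃ D : Derivation kW O κ,
    (∀ p (hp : c.π p = 1), D (c.α₁ p) = h (c.cls (of p) (by rw [gpMap_of, hp, map_one])) *
      algebraMap O κ (c.α₁ p)) ∧ ∀ p, c.π p ≠ 1 → D (c.α₁ p) = 0 := by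
  let g : TrivSqZeroExt κ κ →+* κ := (TrivSqZeroExt.fstHom κ κ κ).toRingHom
  have hg : ∀ x : TrivSqZeroExt κ κ, g x = x.fst := fun x => rfl
  -- The deformation of `α₁` to the dual numbers: the units `α₁ p` with `π p = 1` become `α₁ p * (1
  -- + ε h(p))`, and the other elements, which vanish at the point, stay zero.
  let b₀ : P₁ → TrivSqZeroExt κ κ := fun p => if hp : c.π p = 1 then
    (TrivSqZeroExt.inl (algebraMap O κ (c.α₁ p)) + TrivSqZeroExt.inr
      (h (c.cls (of p) (by rw [gpMap_of, hp, map_one])) * algebraMap O κ (c.α₁ p))) else 0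
  have hb₀ : ∀ p (hp : c.π p = 1), b₀ p = TrivSqZeroExt.inl (algebraMap O κ (c.α₁ p)) +
    TrivSqZeroExt.inr (h (c.cls (of p) (by rw [gpMap_of, hp, map_one])) *
      algebraMap O κ (c.α₁ p)) := fun p hp => dif_pos hp
  have hb₁ : ∀ p, c.π p ≠ 1 → b₀ p = 0 := fun p hp => dif_neg hp
  have hz : ∀ p, c.π p ≠ 1 → algebraMap O κ (c.α₁ p) = 0 := fun p hp => by
    rw [c.α₁_eq, map_mul, hc.source _ hp, zero_mul]
  have hnz : ∀ p, c.π p = 1 → algebraMap O κ (c.α₁ p) ≠ 0 := fun p hp => by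
    rw [c.α₁_eq, hp, map_one, one_mul]
    exact ((c.uM p).map (algebraMap O κ).toMonoidHom).ne_zero
  let b : P₁ →* TrivSqZeroExt κ κ :=
    { toFun := b₀
      map_one' := by
        rw [hb₀ 1 (map_one _)]
        have : h (c.cls (of 1) (by rw [gpMap_of, map_one, map_one])) = 0 := by
          rw [(c.cls_eq_zero _).2 ⟨1, map_one _, by rw [map_one, map_one]⟩, map_zero]
        rw [this, map_one, map_one, zero_mul, TrivSqZeroExt.inr_zero, add_zero]
        rfl
      map_mul' := fun p p' => by
        by_cases hp : c.π p = 1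
        · by_cases hp' : c.π p' = 1
          · have hpp : c.π (p * p') = 1 := by rw [map_mul, hp, hp', one_mul]
            have e : c.cls (of (p * p')) (by rw [gpMap_of, hpp, map_one]) =
              c.cls (of p) (by rw [gpMap_of, hp, map_one]) +
                c.cls (of p') (by rw [gpMap_of, hp', map_one]) := by
              rw [← cls_mul]
              congr 1
              exact map_mul _ _ _
            rw [hb₀ _ hp, hb₀ _ hp', hb₀ _ hpp, e]
            ext
            · simp only [TrivSqZeroExt.fst_mul, TrivSqZeroExt.fst_add, TrivSqZeroExt.fst_inl,
                TrivSqZeroExt.fst_inr, map_mul, add_zero]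
            · simp only [TrivSqZeroExt.snd_mul, TrivSqZeroExt.fst_add, TrivSqZeroExt.snd_add,
                TrivSqZeroExt.fst_inl, TrivSqZeroExt.snd_inl, TrivSqZeroExt.fst_inr, TrivSqZeroExt.snd_inr, map_mul, add_zero, zero_add, smul_eq_mul, MulOpposite.smul_eq_mul_unop,
                MulOpposite.unop_op, map_add h]
              ring
          · have hpp : c.π (p * p') ≠ 1 := by rwa [map_mul, hp, one_mul]
            rw [hb₁ _ hp', hb₁ _ hpp, mul_zero]
        · have hpp : c.π (p * p') ≠ 1 := fun e => by
            have h1 := hnz _ e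
            rw [map_mul, map_mul, hz p hp, zero_mul] at h1
            exact h1 rfl
          rw [hb₁ _ hp, hb₁ _ hpp, zero_mul] }
  have hb : ∀ p, b p = b₀ p := fun p => rfl
  let a : kW →+* TrivSqZeroExt κ κ := (TrivSqZeroExt.inlHom κ κ).comp (algebraMap kW κ)
  have ha : ∀ x, a x = TrivSqZeroExt.inl (algebraMap kW κ x) := fun x => rfl
  -- Étaleness of the smooth chart lifts the point `O → κ` to the dual numbers, and the derivation
  -- is the `ε`-part. Compatibility on `Q₁` holds because `h` is trivial on classes coming from the
  -- kernel of `Q₁ᵍᵖ → Qᵍᵖ`, while elements with nontrivial image in `Q` vanish on both sides.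
  obtain ⟨ψ, hψ1, hψ2, hψ3⟩ := c.exists_lift g (fun x => ⟨TrivSqZeroExt.inl x, rfl⟩)
    (fun x y hx hy => by
      rw [hg] at hx hy
      ext <;> simp [hx, hy]) (algebraMap O κ) a b (fun q => by
      rw [ha, hb]
      by_cases hq : c.πQ q = 1
      · have hp : c.π (c.θ₁ q) = 1 := by rw [c.π_θ₁, hq, map_one]
        rw [hb₀ _ hp]
        have : h (c.cls (of (c.θ₁ q)) (by rw [gpMap_of, hp, map_one])) = 0 := by
          rw [(c.cls_eq_zero _).2 ⟨of q, by rw [gpMap_of, hq, map_one], gpMap_of _ _⟩, map_zero]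
        rw [this, zero_mul, TrivSqZeroExt.inr_zero, add_zero, c.α₁_eq, c.αN₁_eq, hp, hq, map_one,
          map_one, one_mul, one_mul, c.uM_θ₁, ← IsScalarTower.algebraMap_apply]
      · have hp : c.π (c.θ₁ q) ≠ 1 := fun e => hq (hc.θ_eq_one (by rw [← c.π_θ₁, e]))
        rw [hb₁ _ hp, c.αN₁_eq, map_mul, hc.target _ hq, zero_mul, TrivSqZeroExt.inl_zero]) (fun x => by
      rw [ha, hg, TrivSqZeroExt.fst_inl, IsScalarTower.algebraMap_apply kW O κ]) (fun p => by
      rw [hg, hb]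
      by_cases hp : c.π p = 1
      · rw [hb₀ _ hp, TrivSqZeroExt.fst_add, TrivSqZeroExt.fst_inl, TrivSqZeroExt.fst_inr, add_zero]
      · rw [hb₁ _ hp, hz _ hp]; rfl)
  have hfst : ∀ x, (ψ x).fst = algebraMap O κ x := hψ1
  let Dl : O →ₗ[kW] κ :=
    { toFun := fun x => (ψ x).snd
      map_add' := fun x y => by simp
      map_smul' := fun r x => by
        rw [Algebra.smul_def, map_mul, TrivSqZeroExt.snd_mul, hψ2, ha]
        simp [Algebra.smul_def] }
  let D : Derivation kW O κ := Derivation.mk' Dl (fun x y => by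
    change (ψ (x * y)).snd = x • (ψ y).snd + y • (ψ x).snd
    rw [map_mul, TrivSqZeroExt.snd_mul, hfst, hfst]
    simp [Algebra.smul_def, mul_comm])
  refine ⟨D, fun p hp => ?_, fun p hp => ?_⟩
  · change (ψ (c.α₁ p)).snd = _
    rw [hψ3, hb, hb₀ p hp, TrivSqZeroExt.snd_add, TrivSqZeroExt.snd_inl, TrivSqZeroExt.snd_inr,
      zero_add]
  · change (ψ (c.α₁ p)).snd = _
    rw [hψ3, hb, hb₁ p hp]; rfl

end Point

end ChartPair

/-! ### Tame homomorphisms, and the passage of tameness to the sharp chart. -/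

/-- The kernel and the torsion of the cokernel are finite of order invertible in `κ`. -/
structure MonoidHom.IsTame {A B : Type*} [CommGroup A] [CommGroup B] (f : A →* B)
    (κ : Type*) [Field κ] : Prop where
  finite_ker : Finite f.ker
  card_ker_ne_zero : (Nat.card f.ker : κ) ≠ 0
  finite_torsion : Finite (CommGroup.torsion (B ⧸ f.range))
  card_torsion_ne_zero : (Nat.card (CommGroup.torsion (B ⧸ f.range)) : κ) ≠ 0

namespace MonoidHom.IsTame

variable {A B : Type*} [CommGroup A] [CommGroup B] {f : A →* B} {κ : Type*} [Field κ]
  (hf : f.IsTame κ)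
include hf

lemma pow_card_ker {z : A} (hz : f z = 1) : z ^ Nat.card f.ker = 1 := by
  have := hf.finite_ker
  have h : (⟨z, hz⟩ : f.ker) ^ Nat.card f.ker = 1 := pow_card_eq_one'
  exact congr(Subtype.val $h)

lemma pow_card_torsion_mem {y : B} {m : ℕ} (hm : m ≠ 0) (hy : y ^ m ∈ f.range) :
    y ^ Nat.card (CommGroup.torsion (B ⧸ f.range)) ∈ f.range := by
  have := hf.finite_torsion
  have h0 : (y : B ⧸ f.range) ∈ CommGroup.torsion (B ⧸ f.range) := by
    rw [CommGroup.mem_torsion, isOfFinOrder_iff_pow_eq_one]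
    exact ⟨m, Nat.pos_of_ne_zero hm, (QuotientGroup.eq_one_iff (y ^ m)).2 hy⟩
  have h : (⟨_, h0⟩ : CommGroup.torsion (B ⧸ f.range)) ^
    Nat.card (CommGroup.torsion (B ⧸ f.range)) = 1 := pow_card_eq_one'
  exact (QuotientGroup.eq_one_iff (y ^ _)).1 congr(Subtype.val $h)

/-- The kernel has order prime to `p`, so raising to the power `p` permutes it. -/
lemma exists_pow_eq (p : ℕ) [CharP κ p] [Fact p.Prime] {z : A} (hz : f z = 1) :
    ∃ w, f w = 1 ∧ w ^ p = z := by
  have := hf.finite_ker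
  have hp : (Nat.card f.ker).Coprime p := by
    rw [Nat.coprime_comm, (Fact.out : p.Prime).coprime_iff_not_dvd, ← CharP.cast_eq_zero_iff κ p]
    exact hf.card_ker_ne_zero
  obtain ⟨w, hw⟩ := (powCoprime hp).surjective ⟨z, hz⟩
  exact ⟨w, w.2, congr(Subtype.val $hw)⟩

/-- The order of the class of `y` in the cokernel divides `p` and also the order of the torsion,
which is prime to `p`. -/
lemma mem_range_of_pow (p : ℕ) [CharP κ p] [Fact p.Prime] {y : B} (hy : y ^ p ∈ f.range) :
    y ∈ f.range := by
  have hp : p.Coprime (Nat.card (CommGroup.torsion (B ⧸ f.range))) := by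
    rw [(Fact.out : p.Prime).coprime_iff_not_dvd, ← CharP.cast_eq_zero_iff κ p]
    exact hf.card_torsion_ne_zero
  have h2 := hf.pow_card_torsion_mem (Fact.out : p.Prime).ne_zero hy
  have h1 : (y : B ⧸ f.range) ^ p = 1 := (QuotientGroup.eq_one_iff (y ^ p)).2 hy
  have h2' : (y : B ⧸ f.range) ^ _ = 1 := (QuotientGroup.eq_one_iff (y ^ _)).2 h2
  have h3 := Nat.dvd_gcd (orderOf_dvd_of_pow_eq_one h1) (orderOf_dvd_of_pow_eq_one h2')
  rw [Nat.Coprime.gcd_eq_one hp, Nat.dvd_one, orderOf_eq_one_iff, QuotientGroup.eq_one_iff] at h3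
  exact h3

end MonoidHom.IsTame

lemma CommGroup.finite_torsion_of_fg (G : Type*) [CommGroup G] [Group.FG G] :
    Finite (CommGroup.torsion G) := by
  have h1 : Module.Finite ℤ (Additive G) := by
    rw [Module.Finite.iff_addGroup_fg]
    infer_instance
  have h2 : IsNoetherian ℤ (Additive G) := inferInstance
  have h3 : Module.Finite ℤ (Additive (CommGroup.torsion G)) :=
    Module.Finite.of_injective (((CommGroup.torsion G).subtype).toAdditive.toIntLinearMap)
      fun x y h => Subtype.ext h
  rw [Module.Finite.iff_addGroup_fg] at h3
  have : Group.FG (CommGroup.torsion G) := GroupFG.iff_add_fg.2 h3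
  exact CommGroup.finite_of_fg_isMulTorsion (G := CommGroup.torsion G)
    (CommMonoid.torsion.isMulTorsion (G := G))

lemma CommGroup.finite_and_not_dvd_card (K : Type*) [CommGroup K] [Group.FG K] (p : ℕ)
    [Fact p.Prime] (h : ∀ x : K, ∃ y, y ^ p = x) : Finite K ∧ ¬ p ∣ Nat.card K := by
  have h1 : Module.Finite ℤ (Additive K) := by
    rw [Module.Finite.iff_addGroup_fg]
    infer_instance
  exact AddCommGroup.finite_and_not_dvd_card (Additive K) p h

lemma Subgroup.fg_of_group_fg {G : Type*} [CommGroup G] [Group.FG G] (H : Subgroup G) :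
    Group.FG H := by
  have h1 : Module.Finite ℤ (Additive G) := by
    rw [Module.Finite.iff_addGroup_fg]
    infer_instance
  have h2 : IsNoetherian ℤ (Additive G) := inferInstance
  have h3 : Module.Finite ℤ (Additive H) :=
    Module.Finite.of_injective (H.subtype.toAdditive.toIntLinearMap) fun x y h => Subtype.ext h
  rw [Module.Finite.iff_addGroup_fg] at h3
  exact GroupFG.iff_add_fg.2 h3

instance Algebra.GrothendieckGroup.group_fg (P : Type*) [CommMonoid P] [Monoid.FG P] :
    Group.FG (Algebra.GrothendieckGroup P) := Group.fg_iff_monoid_fg.2 inferInstance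

namespace ChartPair

open Algebra.GrothendieckGroup

variable {kW O P₁ Q₁ P Q : Type u} [CommRing kW] [CommRing O] [Algebra kW O]
    [CommMonoid P₁] [CommMonoid Q₁] [CommMonoid P] [CommMonoid Q] {c : ChartPair kW O P₁ Q₁ P Q}
    {κ : Type u} [Field κ] [Algebra O κ] [Algebra kW κ] [IsScalarTower kW O κ]

variable (hc : c.IsSharpAt κ)

namespace IsSharpAt

/-- The derivation attached to a homomorphism from the units to the residue field. -/
def deriv (h : c.Lam →+ κ) : Derivation kW O κ := (hc.exists_derivation h).choose

lemma algebraMap_unit_ne_zero (a : Oˣ) : algebraMap O κ a ≠ 0 :=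
  (a.map (algebraMap O κ).toMonoidHom).ne_zero

/-- The derivation is logarithmic on units: the formula holds on elements of `P₁` by construction,
and the quotient rule extends it to the group. -/
lemma deriv_uMgp [IsCancelMul P₁] (h : c.Lam →+ κ) (x : Algebra.GrothendieckGroup P₁)
    (hx : gpMap c.π x = 1) :
    hc.deriv h (c.uMgp x : O) = h (c.cls x hx) * algebraMap O κ (c.uMgp x : O) := by
  obtain ⟨a, b, ha, hb, rfl⟩ := c.exists_of_gpMap_π_eq_one x hx
  have h1 := (hc.exists_derivation h).choose_spec.1
  have ha' : gpMap c.π (of a) = 1 := by rw [gpMap_of, ha, map_one]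
  have hb' : gpMap c.π (of b) = 1 := by rw [gpMap_of, hb, map_one]
  have e : c.cls (of a / of b) hx = c.cls (of a) ha' - c.cls (of b) hb' := rfl
  have hα : ∀ p, c.π p = 1 → c.α₁ p = (c.uM p : O) := fun p hp => by
    rw [c.α₁_eq, hp, map_one, one_mul]
  have hDa := h1 a ha
  have hDb := h1 b hb
  rw [hα a ha] at hDa
  rw [hα b hb] at hDb
  have hu : (c.uMgp (of a / of b) : O) * c.uM b = c.uM a := by
    rw [← uMgp_of, ← uMgp_of, ← Units.val_mul, ← map_mul, div_mul_cancel]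
  have hD := congr(hc.deriv h $hu)
  have hpt := congr(algebraMap O κ $hu)
  have hDa' : hc.deriv h (c.uM a : O) = h (c.cls (of a) ha') * algebraMap O κ (c.uM a : O) := hDa
  have hDb' : hc.deriv h (c.uM b : O) = h (c.cls (of b) hb') * algebraMap O κ (c.uM b : O) := hDb
  rw [Derivation.leibniz, hDa', hDb', ← hpt, map_mul, Algebra.smul_def, Algebra.smul_def] at hD
  rw [e, map_sub]
  apply mul_left_cancel₀ (algebraMap_unit_ne_zero (κ := κ) (c.uM b))
  linear_combination hD

/-- Apply the Leibniz rule to `α₁ = α u`. The left side has derivative zero, and the term with `D u`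
has the factor `α`, which vanishes at the point; the unit `u` can be divided out. -/
lemma deriv_α (h : c.Lam →+ κ) (p : P) : hc.deriv h (c.α p) = 0 := by
  by_cases hp : p = 1
  · rw [hp, map_one, Derivation.map_one_eq_zero]
  · obtain ⟨p, rfl⟩ := c.π_surjective p
    have h1 : hc.deriv h (c.α₁ p) = 0 := (hc.exists_derivation h).choose_spec.2 p hp
    rw [c.α₁_eq, Derivation.leibniz, Algebra.smul_def, Algebra.smul_def, hc.source _ hp, zero_mul,
      zero_add] at h1
    exact (mul_eq_zero.1 h1).resolve_left (algebraMap_unit_ne_zero _)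

include hc

lemma hom_cls_eq_zero [IsCancelMul P₁] {x : Algebra.GrothendieckGroup P₁} (hx : gpMap c.π x = 1)
    (H : ∀ D : Derivation kW O κ, D (c.uMgp x : O) = 0) (h : c.Lam →+ κ) : h (c.cls x hx) = 0 := by
  have := hc.deriv_uMgp h x hx
  rw [H] at this
  exact (mul_eq_zero.1 this.symm).resolve_right (algebraMap_unit_ne_zero _)

/-- The logarithmic derivations realise all homomorphisms from `c.Lam` to `κ`. If all of them vanish
on the class of `x`, the class is divisible by `p`. -/
lemma exists_eq_pow_mul [IsCancelMul P₁] (p : ℕ) [Fact p.Prime] [CharP κ p]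
    {x : Algebra.GrothendieckGroup P₁} (hx : gpMap c.π x = 1)
    (H : ∀ D : Derivation kW O κ, D (c.uMgp x : O) = 0) :
    ∃ y z, gpMap c.π y = 1 ∧ gpMap c.πQ z = 1 ∧ x = y ^ p * gpMap c.θ₁ z := by
  obtain ⟨y, hy⟩ := AddCommGroup.exists_nsmul_eq (p := p) (hc.hom_cls_eq_zero hx H)
  obtain ⟨y, hy', rfl⟩ := c.cls_surjective y
  have hxy : c.cls (x / y ^ p) (by rw [map_div, map_pow, hx, hy', one_pow, div_one]) = 0 := by
    rw [cls_sub c hx (by rw [map_pow, hy', one_pow]), cls_pow c hy', hy, sub_self]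
  obtain ⟨z, hz, e⟩ := (c.cls_eq_zero _).1 hxy
  exact ⟨y, z, hy', hz, by rw [e, mul_div_cancel]⟩

lemma exists_pow_eq [IsCancelMul P₁] [Monoid.FG P₁] [CharZero κ]
    {x : Algebra.GrothendieckGroup P₁} (hx : gpMap c.π x = 1)
    (H : ∀ D : Derivation kW O κ, D (c.uMgp x : O) = 0) :
    ∃ (m : ℕ) (z : _), m ≠ 0 ∧ gpMap c.πQ z = 1 ∧ x ^ m = gpMap c.θ₁ z := by
  obtain ⟨m, hm, hy⟩ := AddCommGroup.exists_nsmul_eq_zero (hc.hom_cls_eq_zero hx H)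
  rw [← cls_pow, cls_eq_zero] at hy
  obtain ⟨z, hz, e⟩ := hy
  exact ⟨m, z, hm, hz, e.symm⟩

lemma derivation_uMgp_θ₁ (D : Derivation kW O κ) (q : Algebra.GrothendieckGroup Q₁) :
    D (c.uMgp (gpMap c.θ₁ q) : O) = 0 := by
  rw [uMgp_θ₁]
  exact D.map_algebraMap _

/-- The `p`-th powers have derivative zero in characteristic `p`, and the units from `Q₁` are
constants. -/
lemma derivation_uMgp_pow_div (p : ℕ) [Fact p.Prime] [CharP κ p] (D : Derivation kW O κ)
    (g : Algebra.GrothendieckGroup P₁) (q : Algebra.GrothendieckGroup Q₁) :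
    D (c.uMgp (g ^ p / gpMap c.θ₁ q) : O) = 0 := by
  rw [div_eq_mul_inv, ← map_inv, map_mul, Units.val_mul, Derivation.leibniz,
    derivation_uMgp_θ₁ hc, smul_zero, zero_add, map_pow, Units.val_pow_eq_pow_val,
    Derivation.leibniz_pow]
  have : ∀ x : κ, (p : ℕ) • x = 0 := fun x => by
    rw [nsmul_eq_mul, CharP.cast_eq_zero, zero_mul]
  rw [this, smul_zero]

omit hc [Algebra kW κ] [Algebra O κ] [IsScalarTower kW O κ] in
lemma gpMap_θ_eq_one {q₁ : Algebra.GrothendieckGroup Q₁} (h : gpMap c.θ (gpMap c.πQ q₁) = 1) :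
    gpMap c.π (gpMap c.θ₁ q₁) = 1 := by rw [gpMap_π_θ₁, h]

/-- It suffices that the kernel of `θ` on groups is `p`-divisible and that its cokernel has no
element of order `p`. In both cases a unit on which all derivations vanish is written as a `p`-th
power times an element from `Q₁`, and the tameness of `θ₁` extracts the root. -/
theorem isTame_aux_charP [IsCancelMul P₁] [Monoid.FG P₁] [Monoid.FG Q₁] (p : ℕ) [Fact p.Prime]
    [CharP κ p] (h : (gpMap c.θ₁).IsTame κ) : (gpMap c.θ).IsTame κ := by
  have := c.fg_source
  have := c.fg_target
  have hker := (gpMap c.θ).ker.fg_of_group_fg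
  have htors := CommGroup.finite_torsion_of_fg (Algebra.GrothendieckGroup P ⧸ (gpMap c.θ).range)
  obtain ⟨h1, h2⟩ := CommGroup.finite_and_not_dvd_card (gpMap c.θ).ker p (by
    rintro ⟨q, hq⟩
    obtain ⟨q₁, rfl⟩ := gpMap_surjective c.πQ_surjective q
    obtain ⟨y, q₂, hy, hq₂, e⟩ := hc.exists_eq_pow_mul p (gpMap_θ_eq_one hq)
      (fun D => derivation_uMgp_θ₁ hc D _)
    -- `y ^ p` comes from `Q₁`, hence so does `y`, since the cokernel of `θ₁` has no `p`-torsion.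
    -- What remains lies in the kernel of `θ₁`, where `p`-th roots exist.
    obtain ⟨q₃, rfl⟩ := h.mem_range_of_pow p (y := y) ⟨q₁ / q₂, by
      rw [map_div, e, mul_div_cancel_right]⟩
    obtain ⟨w, hw, hw'⟩ := h.exists_pow_eq p (z := q₁ / (q₃ ^ p * q₂)) (by
      rw [map_div, e, map_mul, map_pow, div_self'])
    have hw'' : gpMap c.π (gpMap c.θ₁ w) = 1 := by rw [hw, map_one]
    refine ⟨⟨gpMap c.πQ (q₃ * w), ?_⟩, Subtype.ext ?_⟩
    · rw [MonoidHom.mem_ker, ← gpMap_π_θ₁, map_mul, map_mul, hy, hw'', one_mul]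
    · change gpMap c.πQ (q₃ * w) ^ p = gpMap c.πQ q₁
      rw [← map_pow, mul_pow, hw', mul_div_left_comm, div_mul_eq_div_div, div_self', map_mul, map_div,
        hq₂, map_one, div_eq_mul_inv, one_mul, inv_one, mul_one])
  -- A class of order `p` in the cokernel has a representative whose `p`-th power comes from `Q`.
  -- Correcting a lift to `P₁` by `y` puts it in the range of `θ₁`, so the class is trivial.
  refine ⟨h1, fun h => h2 ((CharP.cast_eq_zero_iff κ p _).1 h), htors, fun h0 => ?_⟩
  obtain ⟨⟨x, hx⟩, hx'⟩ := exists_prime_orderOf_dvd_card' p ((CharP.cast_eq_zero_iff κ p _).1 h0)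
  rw [Subgroup.orderOf_mk] at hx'
  obtain ⟨g, rfl⟩ := QuotientGroup.mk_surjective x
  have hg := pow_orderOf_eq_one (g : Algebra.GrothendieckGroup P ⧸ (gpMap c.θ).range)
  rw [hx', ← QuotientGroup.mk_pow, QuotientGroup.eq_one_iff] at hg
  obtain ⟨q, hq⟩ := hg
  obtain ⟨q₁, rfl⟩ := gpMap_surjective c.πQ_surjective q
  obtain ⟨g₁, rfl⟩ := gpMap_surjective c.π_surjective g
  obtain ⟨y, q₂, hy, hq₂, e⟩ := hc.exists_eq_pow_mul p (x := g₁ ^ p / gpMap c.θ₁ q₁)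
    (by rw [map_div, map_pow, gpMap_π_θ₁, hq, div_self'])
    (fun D => derivation_uMgp_pow_div hc p D _ _)
  obtain ⟨q₃, e₃⟩ := h.mem_range_of_pow p (y := g₁ / y) ⟨q₁ * q₂, by
    rw [div_pow, map_mul, ← div_mul_cancel (g₁ ^ p) (gpMap c.θ₁ q₁), e, mul_comm (y ^ p), mul_assoc, mul_comm (y ^ p), ← mul_assoc, mul_div_cancel_right, mul_comm]⟩
  have : (QuotientGroup.mk (gpMap c.π g₁) : Algebra.GrothendieckGroup P ⧸ (gpMap c.θ).range) = 1 := by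
    rw [QuotientGroup.eq_one_iff]
    exact ⟨gpMap c.πQ q₃, by rw [← gpMap_π_θ₁, e₃, map_div, hy, div_one]⟩
  rw [this, orderOf_one] at hx'
  exact (Fact.out : p.Prime).one_lt.ne hx'

/-- In characteristic zero only finiteness matters, and the torsion of a finitely generated group is
finite anyway. The kernel is torsion because a power of `θ₁ q₁` comes from the kernel of `Q₁ᵍᵖ →
Qᵍᵖ`, and the kernel of `θ₁` is finite. -/
theorem isTame_aux_charZero [IsCancelMul P₁] [Monoid.FG P₁] [Monoid.FG Q₁] [CharZero κ]
    (h : (gpMap c.θ₁).IsTame κ) : (gpMap c.θ).IsTame κ := by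
  have := c.fg_source
  have := c.fg_target
  have hker := (gpMap c.θ).ker.fg_of_group_fg
  have htors := CommGroup.finite_torsion_of_fg (Algebra.GrothendieckGroup P ⧸ (gpMap c.θ).range)
  have hfin : Finite (gpMap c.θ).ker := by
    apply CommGroup.finite_of_fg_isMulTorsion
    rintro ⟨q, hq⟩
    obtain ⟨q₁, rfl⟩ := gpMap_surjective c.πQ_surjective q
    obtain ⟨m, q₂, hm, hq₂, e⟩ := hc.exists_pow_eq (gpMap_θ_eq_one hq)
      (fun D => derivation_uMgp_θ₁ hc D _)
    have h1 := h.pow_card_ker (z := q₁ ^ m / q₂) (by rw [map_div, map_pow, e, div_self'])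
    have := h.finite_ker
    rw [isOfFinOrder_iff_pow_eq_one]
    refine ⟨m * Nat.card (gpMap c.θ₁).ker, Nat.pos_of_ne_zero (mul_ne_zero hm Nat.card_pos.ne'),
      Subtype.ext ?_⟩
    have h2 := congr(gpMap c.πQ $h1)
    rw [map_pow, map_div, map_pow, hq₂, div_one, map_one, ← pow_mul] at h2
    exact h2
  exact ⟨hfin, Nat.cast_ne_zero.2 Nat.card_pos.ne', htors, Nat.cast_ne_zero.2 Nat.card_pos.ne'⟩

/-- Tameness passes to the sharp chart. -/
theorem isTame [IsCancelMul P₁] [Monoid.FG P₁] [Monoid.FG Q₁]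
    (h : (gpMap c.θ₁).IsTame κ) : (gpMap c.θ).IsTame κ := by
  obtain ⟨p, hp⟩ := CharP.exists κ
  rcases CharP.char_is_prime_or_zero κ p with hp' | rfl
  · have := Fact.mk hp'
    exact isTame_aux_charP hc p h
  · have := CharP.charP_to_charZero κ
    exact isTame_aux_charZero hc h

end IsSharpAt

end ChartPair

/-! ### Extensions by a residue field -/

/-- A surjective ring homomorphism `g : T → A` whose kernel is identified with a residue field of `A`. -/
structure ResidueExtension {T A κ : Type*} [CommRing T] [CommRing A] [Field κ] (g : T →+* A)
    (res : A →+* κ) (ι : κ →+ T) : Prop where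
  surjective : Function.Surjective g
  injective : Function.Injective ι
  eq_zero_iff (t : T) : g t = 0 ↔ t ∈ Set.range ι
  ι_mul (t : T) (a : κ) : ι (res (g t) * a) = t * ι a

namespace ResidueExtension

variable {T A κ : Type*} [CommRing T] [CommRing A] [Field κ] {g : T →+* A}
    {res : A →+* κ} {ι : κ →+ T} (h : ResidueExtension g res ι)
include h

lemma apply_ι (a : κ) : g (ι a) = 0 := (h.eq_zero_iff _).2 ⟨a, rfl⟩

lemma mul_eq_zero_of_apply {x y : T} (hx : g x = 0) (hy : g y = 0) : x * y = 0 := by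
  obtain ⟨a, rfl⟩ := (h.eq_zero_iff y).1 hy
  rw [← h.ι_mul, hx, map_zero, zero_mul, map_zero]

lemma exists_add_ι {x y : T} (hxy : g x = g y) : ∃ a, x = y + ι a := by
  obtain ⟨a, ha⟩ := (h.eq_zero_iff (x - y)).1 (by rw [map_sub, hxy, sub_self])
  exact ⟨a, by rw [ha]; ring⟩

/-- The unit `1 + ι a`. -/
def oneAdd (a : κ) : Tˣ where
  val := 1 + ι a
  inv := 1 - ι a
  val_inv := by linear_combination -h.mul_eq_zero_of_apply (h.apply_ι a) (h.apply_ι a)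
  inv_val := by linear_combination -h.mul_eq_zero_of_apply (h.apply_ι a) (h.apply_ι a)

lemma isUnit_of_apply {t : T} (ht : IsUnit (g t)) : IsUnit t := by
  obtain ⟨s, hs⟩ := h.surjective (ht.unit⁻¹ : Aˣ)
  obtain ⟨a, ha⟩ := h.exists_add_ι (x := t * s) (y := 1) (by
    rw [map_mul, hs, map_one, IsUnit.mul_val_inv])
  have : IsUnit (t * s) := by
    rw [ha]
    exact (h.oneAdd a).isUnit
  exact isUnit_of_mul_isUnit_left this

lemma units_map_surjective : Function.Surjective (Units.map (g : T →* A)) := fun e => by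
  obtain ⟨t, ht⟩ := h.surjective e
  have : IsUnit t := h.isUnit_of_apply (ht ▸ e.isUnit)
  exact ⟨this.unit, Units.ext ht⟩

lemma exists_oneAdd {e : Tˣ} (he : Units.map (g : T →* A) e = 1) : ∃ a, e = h.oneAdd a := by
  obtain ⟨a, ha⟩ := h.exists_add_ι (x := e) (y := 1) (by
    rw [map_one]; exact congr(Units.val $he))
  exact ⟨a, Units.ext ha⟩

lemma map_oneAdd (a : κ) : Units.map (g : T →* A) (h.oneAdd a) = 1 := Units.ext (by
  change g (1 + ι a) = 1
  rw [map_add, map_one, h.apply_ι, add_zero])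

/-- As the kernel has square zero, powers of `1 + ι a` are multiples of `a`; so the units over `1`
are uniquely divisible by every `n` that is nonzero in `κ`. -/
lemma oneAdd_pow (a : κ) (n : ℕ) : h.oneAdd a ^ n = h.oneAdd (n * a) := by
  induction n with
  | zero => exact Units.ext (by simp [oneAdd])
  | succ n ih =>
    rw [pow_succ, ih]
    apply Units.ext
    change (1 + ι _) * (1 + ι _) = 1 + ι _
    have := h.mul_eq_zero_of_apply (h.apply_ι (n * a)) (h.apply_ι a)
    have e : ((n + 1 : ℕ) : κ) * a = n * a + a := by rw [Nat.cast_succ]; ring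
    rw [e, map_add]
    linear_combination this

lemma oneAdd_eq_one {a : κ} (ha : h.oneAdd a = 1) : a = 0 := by
  have h1 : 1 + ι a = 1 := congr(Units.val $ha)
  exact h.injective (by rw [map_zero]; linear_combination h1)

end ResidueExtension

/-- Lifting of homomorphisms along a tame homomorphism. -/
lemma ResidueExtension.exists_units_lift {T A κ : Type*} [CommRing T] [CommRing A] [Field κ]
    {g : T →+* A} {res : A →+* κ} {ι : κ →+ T} (h : ResidueExtension g res ι)
    {Q P : Type*} [CommGroup Q] [CommGroup P] [Group.FG P] {θ : Q →* P} (hθ : θ.IsTame κ)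
    (u : P →* Aˣ) (v : Q →* Tˣ) (huv : ∀ x, Units.map (g : T →* A) (v x) = u (θ x)) :
    ∃ w : P →* Tˣ, (∀ x, Units.map (g : T →* A) (w x) = u x) ∧ ∀ x, w (θ x) = v x := by
  -- This exponent kills the kernel, takes the torsion of the cokernel into the range, and is
  -- nonzero in `κ`, so that `1 + κ` is uniquely `n`-divisible.
  let n := Nat.card θ.ker * Nat.card (CommGroup.torsion (P ⧸ θ.range))
  have hn : (n : κ) ≠ 0 := by
    rw [Nat.cast_mul]
    exact mul_ne_zero hθ.card_ker_ne_zero hθ.card_torsion_ne_zero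
  refine MonoidHom.exists_lift_of_torsion θ _ h.units_map_surjective n (fun e he => ?_)
    (fun e he hen => ?_) (fun x hx => ?_) (fun x m hm hx => ?_) u v huv
  · obtain ⟨a, rfl⟩ := h.exists_oneAdd he
    exact ⟨h.oneAdd (a / n), h.map_oneAdd _, by rw [h.oneAdd_pow, mul_div_cancel₀ _ hn]⟩
  · obtain ⟨a, rfl⟩ := h.exists_oneAdd he
    rw [h.oneAdd_pow] at hen
    rw [(mul_eq_zero.1 (h.oneAdd_eq_one hen)).resolve_left hn]
    exact Units.ext (by simp [oneAdd])
  · rw [pow_mul, hθ.pow_card_ker hx, one_pow]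
  · change x ^ (_ * _) ∈ _
    rw [mul_comm, pow_mul]
    exact pow_mem (hθ.pow_card_torsion_mem hm hx) _

/-! ### Lifting along the sharp chart, and the smoothness criterion. -/

namespace ChartPair

open Algebra.GrothendieckGroup

variable {kW O P₁ Q₁ P Q : Type u} [CommRing kW] [CommRing O] [Algebra kW O]
    [CommMonoid P₁] [CommMonoid Q₁] [CommMonoid P] [CommMonoid Q] {c : ChartPair kW O P₁ Q₁ P Q}
    {κ : Type u} [Field κ] [Algebra O κ] [Algebra kW κ] [IsScalarTower kW O κ]

/-- Lifting of `O` to an extension, compatibly with the sharp chart. -/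
theorem IsSharpAt.exists_lift (hc : c.IsSharpAt κ) [Monoid.FG P₁]
    (hθ : (gpMap c.θ₁).IsTame κ) {T A : Type u} [CommRing T] [CommRing A] {g : T →+* A}
    {res : A →+* κ} {ι : κ →+ T} (h : ResidueExtension g res ι) (φ : O →+* A)
    (hφ : ∀ x, res (φ x) = algebraMap O κ x) (a : kW →+* T) (b : P →* T)
    (hab : ∀ q, a (c.αN q) = b (c.θ q)) (ha : ∀ x, g (a x) = φ (algebraMap kW O x))
    (hb : ∀ p, g (b p) = φ (c.α p)) :
    ∃ ψ : O →+* T, (∀ x, g (ψ x) = φ x) ∧ (∀ x, ψ (algebraMap kW O x) = a x) ∧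
      ∀ p, ψ (c.α p) = b p := by
  obtain ⟨w, hw, hwθ⟩ := h.exists_units_lift hθ ((Units.map (φ : O →* A)).comp c.uMgp)
    ((Units.map (a : kW →* T)).comp c.uNgp) (fun x => Units.ext (by
      rw [MonoidHom.comp_apply, MonoidHom.comp_apply, uMgp_θ₁]
      exact ha _))
  have hw' : ∀ p, g (w (of p) : T) = φ (c.uM p) := fun p => by
    have := congr(Units.val $(hw (of p)))
    rw [MonoidHom.comp_apply, uMgp_of] at this
    exact this
  have hwθ' : ∀ q, (w (of (c.θ₁ q)) : T) = a (c.uN q) := fun q => by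
    have := congr(Units.val $(hwθ (of q)))
    rw [MonoidHom.comp_apply, uNgp_of, gpMap_of] at this
    exact this
  -- The prescribed values on `P` together with lifted units `w` determine values on the smooth
  -- chart, to which its étale lifting property applies.
  let b₁ : P₁ →* T := (b.comp c.π) * ((Units.coeHom T).comp (w.comp of))
  have hb₁ : ∀ p, b₁ p = b (c.π p) * w (of p) := fun p => rfl
  obtain ⟨ψ, hψ1, hψ2, hψ3⟩ := c.exists_lift g h.surjective (fun x y => h.mul_eq_zero_of_apply) φ a b₁
    (fun q => by
      rw [hb₁, c.π_θ₁, ← hab, hwθ', c.αN₁_eq, map_mul]) ha (fun p => by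
      rw [hb₁, c.α₁_eq, map_mul, map_mul, hb, hw'])
  refine ⟨ψ, hψ1, hψ2, fun p => ?_⟩
  by_cases hp : p = 1
  · rw [hp, map_one, map_one, map_one]
  obtain ⟨p, rfl⟩ := c.π_surjective p
  have h1 := hψ3 p
  rw [hb₁, c.α₁_eq, map_mul] at h1
  -- The lift need not send the unit `u` to `w`, only up to an element of the kernel. For `p ≠ 1`
  -- that error is multiplied by `α (π p)`, which vanishes in `κ`, so it disappears.
  obtain ⟨e, he⟩ := h.exists_add_ι (x := ψ (c.uM p)) (y := w (of p)) (by rw [hψ1, hw'])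
  have h2 : ψ (c.α (c.π p)) * ι e = 0 := by
    rw [← h.ι_mul, hψ1, hφ, hc.source _ hp, zero_mul, map_zero]
  rw [he, mul_add, h2, add_zero] at h1
  exact (Units.isUnit _).mul_right_cancel h1

end ChartPair

/-- Adding a derivation to a lift. -/
def ResidueExtension.addDerivation {k O T A κ : Type*} [CommRing k] [CommRing O] [Algebra k O]
    [CommRing T] [CommRing A] [Field κ] [Algebra O κ] [Algebra k κ] {g : T →+* A} {res : A →+* κ}
    {ι : κ →+ T} (h : ResidueExtension g res ι) (ψ : O →+* T)
    (hψ : ∀ x, res (g (ψ x)) = algebraMap O κ x) (D : Derivation k O κ) : O →+* T :=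
  RingHom.mk' { toFun := fun x => ψ x + ι (D x)
                map_one' := by rw [map_one, D.map_one_eq_zero, map_zero, add_zero]
                map_mul' := fun x y => by
                  have h1 := h.mul_eq_zero_of_apply (h.apply_ι (D x)) (h.apply_ι (D y))
                  rw [D.leibniz, map_add ι, map_mul, Algebra.smul_def, Algebra.smul_def, ← hψ, ← hψ,
                    h.ι_mul, h.ι_mul]
                  linear_combination -h1 }
    (fun x y => by
      change ψ (x + y) + ι (D (x + y)) = ψ x + ι (D x) + (ψ y + ι (D y))
      rw [map_add, map_add, map_add]
      ring)

namespace ChartPair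

variable {kW O P₁ Q₁ P Q : Type u} [CommRing kW] [CommRing O] [Algebra kW O]
    [CommMonoid P₁] [CommMonoid Q₁] [CommMonoid P] [CommMonoid Q] {c : ChartPair kW O P₁ Q₁ P Q}

/-- The smoothness criterion for the family of linear sections. -/
theorem isSmoothAt {J L : Type} [Fintype J] [Fintype L] [DecidableEq L] [Monoid.FG P₁]
    (𝔷 : Ideal (MvPolynomial (J × L) O)) [𝔷.IsPrime] (hc : c.IsSharpAt 𝔷.ResidueField)
    (hθ : (gpMap c.θ₁).IsTame 𝔷.ResidueField) (y : L → O) (z : J → O)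
    (hD : ∀ l, ∃ D : Derivation kW O 𝔷.ResidueField, (∀ p, D (c.α p) = 0) ∧
      ∀ l', D (y l') - ∑ j, algebraMap _ 𝔷.ResidueField (MvPolynomial.X (R := O) (j, l')) * D (z j) =
        if l' = l then 1 else 0)
    {R₀ : Type u} [CommRing R₀] [Algebra R₀ (MvPolynomial (J × L) O)]
    [Algebra.FinitePresentation R₀ (MvPolynomial (J × L) O)] (cR : kW →+* R₀) (aR : P →* R₀)
    (UR : J → L → R₀) (U₀ : L → R₀)
    (hgen : ∀ {T : Type u} [CommRing T] (f g : R₀ →+* T), (∀ x, f (cR x) = g (cR x)) →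
      (∀ p, f (aR p) = g (aR p)) → (∀ j l, f (UR j l) = g (UR j l)) → (∀ l, f (U₀ l) = g (U₀ l)) →
      f = g)
    (hab : ∀ q, cR (c.αN q) = aR (c.θ q))
    (h1 : ∀ x, algebraMap R₀ (MvPolynomial (J × L) O) (cR x) = MvPolynomial.C (algebraMap kW O x))
    (h2 : ∀ p, algebraMap R₀ (MvPolynomial (J × L) O) (aR p) = MvPolynomial.C (c.α p))
    (h3 : ∀ j l, algebraMap R₀ (MvPolynomial (J × L) O) (UR j l) = MvPolynomial.X (j, l))
    (h4 : ∀ l, algebraMap R₀ (MvPolynomial (J × L) O) (U₀ l) =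
      MvPolynomial.C (y l) - ∑ j, MvPolynomial.C (z j) * MvPolynomial.X (j, l)) :
    Algebra.IsSmoothAt R₀ 𝔷 := by
  apply Algebra.IsSmoothAt.of_splits_residueField
  intro T _ _ g ι hg hι hker hmul
  let S := MvPolynomial (J × L) O
  let κ := 𝔷.ResidueField
  let loc : S →+* Localization.AtPrime 𝔷 := algebraMap _ _
  have h : ResidueExtension (g : T →+* Localization.AtPrime 𝔷)
    (IsLocalRing.residue (Localization.AtPrime 𝔷)) ι := ⟨hg, hι, hker, hmul⟩
  have hgal : ∀ x, g (algebraMap R₀ T x) = loc (algebraMap R₀ S x) := fun x => by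
    rw [AlgHom.commutes]
    exact IsScalarTower.algebraMap_apply R₀ S _ x
  -- This lift of `O` respects `kW` and `P`. The images of `UR` are prescribed, so the only
  -- obstruction left is the failure `δ` of the relations defining `U₀`.
  obtain ⟨ψ, hψ1, hψ2, hψ3⟩ := hc.exists_lift hθ h (loc.comp MvPolynomial.C) (fun x => rfl)
    ((algebraMap R₀ T).comp cR) ((algebraMap R₀ T : R₀ →* T).comp aR)
    (fun q => congrArg (algebraMap R₀ T) (hab q))
    (fun x => (hgal _).trans congr(loc $(h1 x))) (fun p => (hgal _).trans congr(loc $(h2 p)))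
  have hψ1' : ∀ x, g (ψ x) = loc (MvPolynomial.C x) := hψ1
  choose D hDα hD using hD
  have hδ : ∀ l, ∃ a, algebraMap R₀ T (U₀ l) =
      (ψ (y l) - ∑ j, ψ (z j) * algebraMap R₀ T (UR j l)) + ι a := fun l => by
    apply h.exists_add_ι
    change g _ = g _
    rw [hgal, h4, map_sub, map_sub, map_sum, map_sum, hψ1']
    congr 1
    refine Finset.sum_congr rfl fun j _ => ?_
    rw [map_mul, map_mul, hψ1', hgal, h3]
  choose δ hδ using hδ
  -- The normalisation of the `D l` makes this combination change the `l`-th relation by exactly `δ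
  -- l`, while the values on `kW` and `P` are untouched.
  let E : Derivation kW O κ := ∑ l, δ l • D l
  have hE : ∀ x, E x = ∑ l, δ l * D l x := fun x => by
    have := congr($(map_sum (Derivation.coeFnAddMonoidHom (R := kW) (A := O) (M := κ))
      (fun l => δ l • D l) Finset.univ) x)
    rw [Finset.sum_apply] at this
    exact this
  let ψ' := h.addDerivation ψ (fun x => by rw [hψ1]; rfl) E
  have hψ' : ∀ x, ψ' x = ψ x + ι (E x) := fun x => rfl
  have hUR : ∀ j l (a : κ), ι (algebraMap S κ (MvPolynomial.X (j, l)) * a) =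
      algebraMap R₀ T (UR j l) * ι a := fun j l a => by
    rw [← hmul, hgal, h3]
    rfl
  let s : S →+* T := MvPolynomial.eval₂Hom ψ' (fun p => algebraMap R₀ T (UR p.1 p.2))
  have hsC : ∀ x, s (MvPolynomial.C x) = ψ' x := fun x => MvPolynomial.eval₂Hom_C _ _ _
  have hsX : ∀ j l, s (MvPolynomial.X (j, l)) = algebraMap R₀ T (UR j l) :=
    fun j l => MvPolynomial.eval₂Hom_X' _ _ _
  have hs : s.comp (algebraMap R₀ S) = algebraMap R₀ T := by
    apply hgen
    · intro x
      rw [RingHom.comp_apply, h1, hsC, hψ', hψ2, E.map_algebraMap, map_zero, add_zero]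
      rfl
    · intro p
      rw [RingHom.comp_apply, h2, hsC, hψ', hψ3, hE, Finset.sum_eq_zero, map_zero, add_zero]
      · rfl
      · intro l _
        rw [hDα, mul_zero]
    · intro j l
      rw [RingHom.comp_apply, h3, hsX]
    · intro l
      rw [RingHom.comp_apply, h4, map_sub, map_sum, hsC, hψ', hδ l]
      have e1 : ∀ j, s (MvPolynomial.C (z j) * MvPolynomial.X (j, l)) =
          ψ (z j) * algebraMap R₀ T (UR j l) +
            ι (algebraMap S κ (MvPolynomial.X (j, l)) * E (z j)) := fun j => by
        rw [map_mul, hsC, hsX, hψ', hUR]; ring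
      have e2 : E (y l) - ∑ j, algebraMap S κ (MvPolynomial.X (j, l)) * E (z j) = δ l := by
        have : ∀ j, algebraMap S κ (MvPolynomial.X (j, l)) * E (z j) =
            ∑ l', δ l' * (algebraMap S κ (MvPolynomial.X (j, l)) * D l' (z j)) := fun j => by
          rw [hE, Finset.mul_sum]
          exact Finset.sum_congr rfl fun l' _ => mul_left_comm _ _ _
        rw [Finset.sum_congr rfl fun j _ => this j, Finset.sum_comm, hE, ← Finset.sum_sub_distrib]
        rw [Finset.sum_congr rfl fun l' _ => by rw [← Finset.mul_sum, ← mul_sub, hD l' l]]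
        simp
      rw [Finset.sum_congr rfl fun j _ => e1 j, Finset.sum_add_distrib, ← map_sum, ← e2, map_sub]
      ring
  refine ⟨{ s with commutes' := fun x => congr($hs x) }, fun x => ?_⟩
  have : (g : T →+* _).comp s = loc := by
    apply MvPolynomial.ringHom_ext
    · intro x
      change g (s (MvPolynomial.C x)) = _
      rw [hsC, hψ', map_add, hψ1']
      have : g (ι (E x)) = 0 := h.apply_ι _
      rw [this, add_zero]
    · rintro ⟨j, l⟩
      change g (s (MvPolynomial.X (j, l))) = _
      rw [hsX, hgal, h3]
  exact congr($this x)

end ChartPair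

/-! ### Logarithmic derivations over the generic linear subspace. -/

namespace ChartPair

open Algebra.GrothendieckGroup

variable {kW O P₁ Q₁ P Q : Type u} [CommRing kW] [CommRing O] [Algebra kW O]
    [CommMonoid P₁] [CommMonoid Q₁] [CommMonoid P] [CommMonoid Q] {c : ChartPair kW O P₁ Q₁ P Q}
    {k K : Type u} [Field k] [Field K] [Algebra k K] [Algebra O K] [Algebra kW K]
    [IsScalarTower kW O K]

/-- The residue field is algebraic over the field generated by a basis of the units. -/
lemma IsSharpAt.algebraMap_mem_algebraicSpan (hc : c.IsSharpAt K) [IsCancelMul P₁]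
    (hkW : ∀ x : kW, IsAlgebraic k (algebraMap kW K x))
    (hO : ∀ x : O, IsAlgebraic (Algebra.adjoin k (Set.range (algebraMap kW K) ∪
      Set.range fun p => algebraMap O K (c.α₁ p))) (algebraMap O K x))
    {d : ℕ} (b : Fin d → c.Lam) (h : Fin d → c.Lam →+ ℤ)
    (hb : ∀ x, ∃ m : ℕ, m ≠ 0 ∧ m • x = m • ∑ i, h i x • b i)
    (l : Fin d → Algebra.GrothendieckGroup P₁) (hl : ∀ i, gpMap c.π (l i) = 1)
    (hlb : ∀ i, c.cls (l i) (hl i) = b i) (x : O) :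
    algebraMap O K x ∈ algebraicSpan k (Set.range fun i => algebraMap O K (c.uMgp (l i) : O)) := by
  set F := algebraicSpan k (Set.range fun i => algebraMap O K (c.uMgp (l i) : O)) with hF
  have hkW' : ∀ x : kW, algebraMap kW K x ∈ F := fun x => by
    rw [hF, mem_algebraicSpan]
    exact (hkW x).extendScalars (FaithfulSMul.algebraMap_injective k _)
  -- The algebraic span is closed under roots, so the torsion of `c.Lam` plays no role.
  have hpow : ∀ (a : K) (m : ℕ), m ≠ 0 → a ^ m ∈ F → a ∈ F := fun a m hm ha => by
    refine algebraicSpan_le (S := {a ^ m}) (by simpa using ha) ?_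
    rw [mem_algebraicSpan]
    refine ⟨Polynomial.X ^ m - Polynomial.C ⟨a ^ m, Algebra.subset_adjoin rfl⟩,
      Polynomial.X_pow_sub_C_ne_zero (Nat.pos_of_ne_zero hm) _, ?_⟩
    rw [map_sub, map_pow, Polynomial.aeval_X, Polynomial.aeval_C]
    exact sub_self _
  let ev : Algebra.GrothendieckGroup P₁ →* Kˣ := (Units.map (algebraMap O K : O →* K)).comp c.uMgp
  have hev : ∀ x, (ev x : K) = algebraMap O K (c.uMgp x : O) := fun x => rfl
  have hevl : ∀ i, (ev (l i) : K) ∈ F := fun i => subset_algebraicSpan _ ⟨i, rfl⟩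
  have hzpow : ∀ (v : Kˣ) (n : ℤ), (v : K) ∈ F → ((v ^ n : Kˣ) : K) ∈ F := fun v n hv => by
    rw [Units.val_zpow_eq_zpow_val]
    exact zpow_mem hv n
  -- A power of `g` is a monomial in the `l i` times an element of `Q₁ᵍᵖ`, whose unit comes from
  -- `kW` and is therefore algebraic over `k`.
  have hmem : ∀ g, gpMap c.π g = 1 → (ev g : K) ∈ F := fun g hg => by
    obtain ⟨m, hm, e⟩ := hb (c.cls g hg)
    have hg' : gpMap c.π (∏ i, l i ^ h i (c.cls g hg)) = 1 := by
      rw [map_prod]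
      exact Finset.prod_eq_one fun i _ => by rw [map_zpow, hl, one_zpow]
    have hcls : c.cls (∏ i, l i ^ h i (c.cls g hg)) hg' = ∑ i, h i (c.cls g hg) • b i := by
      simp only [← hlb]
      let φ : (gpMap c.π).ker →* Multiplicative c.Lam := QuotientGroup.mk' _
      have e2 : (⟨∏ i, l i ^ h i (c.cls g hg), hg'⟩ : (gpMap c.π).ker) =
        ∏ i, (⟨l i, hl i⟩ : (gpMap c.π).ker) ^ h i (c.cls g hg) := Subtype.ext (by
          rw [Subgroup.val_finsetProd]; rfl)
      have e3 := congr(φ $e2)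
      rw [map_prod] at e3
      simp only [map_zpow] at e3
      have e4 := congr(Multiplicative.toAdd $e3)
      rw [toAdd_prod] at e4
      exact e4
    have e0 : c.cls (g ^ m / (∏ i, l i ^ h i (c.cls g hg)) ^ m)
        (by rw [map_div, map_pow, map_pow, hg, hg', div_self']) = 0 := by
      rw [cls_sub c (by rw [map_pow, hg, one_pow]) (by rw [map_pow, hg', one_pow]), cls_pow c hg,
        cls_pow c hg', hcls, e, sub_self]
    obtain ⟨q, -, hq⟩ := (c.cls_eq_zero _).1 e0
    refine hpow _ m hm ?_
    have e5 : g ^ m = gpMap c.θ₁ q * (∏ i, l i ^ h i (c.cls g hg)) ^ m := by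
      rw [hq, div_mul_cancel]
    rw [← Units.val_pow_eq_pow_val, ← map_pow, e5, map_mul, map_pow, map_prod, Units.val_mul,
      Units.val_pow_eq_pow_val, Units.coe_prod]
    refine mul_mem ?_ (pow_mem (prod_mem fun i _ => ?_) _)
    · rw [hev, uMgp_θ₁]
      have : algebraMap O K (algebraMap kW O (c.uNgp q : kW)) ∈ F := by
        rw [← IsScalarTower.algebraMap_apply]
        exact hkW' _
      exact this
    · rw [map_zpow]
      exact hzpow _ _ (hevl i)
  refine algebraicSpan_le (S := Set.range (algebraMap kW K) ∪
    Set.range fun p => algebraMap O K (c.α₁ p)) ?_ ((mem_algebraicSpan).2 (hO x))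
  rintro _ (⟨x, rfl⟩ | ⟨p, rfl⟩)
  · exact hkW' x
  · by_cases hp : c.π p = 1
    · have := hmem (of p) (by rw [gpMap_of, hp, map_one])
      rw [hev, uMgp_of] at this
      change algebraMap O K (c.α₁ p) ∈ F
      rwa [c.α₁_eq, hp, map_one, one_mul]
    · change algebraMap O K (c.α₁ p) ∈ F
      rw [c.α₁_eq, map_mul, hc.source _ hp, zero_mul]
      exact zero_mem F

/-- The derivations needed in the smoothness criterion exist when the coefficients of the linear section
are generic. -/
theorem IsSharpAt.exists_derivation_family (hc : c.IsSharpAt K) [IsCancelMul P₁] [Monoid.FG P₁]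
    (hkW : ∀ x : kW, IsAlgebraic k (algebraMap kW K x))
    (hO : ∀ x : O, IsAlgebraic (Algebra.adjoin k (Set.range (algebraMap kW K) ∪
      Set.range fun p => algebraMap O K (c.α₁ p))) (algebraMap O K x))
    {J L : Type} [Fintype J] [Fintype L] [DecidableEq J] [DecidableEq L] (y : L → O) (z : J → O)
    (hunr : ∀ D : Derivation kW O K, (∀ l, D (y l) = 0) → (∀ j, D (z j) = 0) → D = 0)
    (U : J → L → K) (hU : AlgebraicIndependent k (Sum.elim
      (fun l => algebraMap O K (y l) - ∑ j, algebraMap O K (z j) * U j l)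
      (fun p : J × L => U p.1 p.2))) (l : L) :
    ∃ D : Derivation kW O K, (∀ p, D (c.α p) = 0) ∧
      ∀ l', D (y l') - ∑ j, U j l' * D (z j) = if l' = l then 1 else 0 := by
  obtain ⟨d, b, h, hhb, hb⟩ := AddCommGroup.exists_dual_families c.Lam
  choose g hg hgb using fun i => c.cls_surjective (b i)
  have hmem := hc.algebraMap_mem_algebraicSpan hkW hO b h hb g hg hgb
  set F := algebraicSpan k (Set.range fun i => algebraMap O K (c.uMgp (g i) : O)) with hF
  let _ : Algebra O F := ((algebraMap O K).codRestrict F hmem).toAlgebra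
  let _ : Algebra kW F := ((algebraMap O F).comp (algebraMap kW O)).toAlgebra
  have : IsScalarTower kW O F := .of_algebraMap_eq fun x => rfl
  have hOF : ∀ x : O, ((algebraMap O F x : F) : K) = algebraMap O K x := fun x => rfl
  have : IsScalarTower O F K := .of_algebraMap_eq fun x => rfl
  have : IsScalarTower kW F K := .of_algebraMap_eq fun x => by
    rw [IsScalarTower.algebraMap_apply kW O K]; rfl
  have hcF : c.IsSharpAt F := ⟨fun p hp => Subtype.ext ((hOF _).trans (hc.source p hp)),
    fun q hq => Subtype.ext (by
      have := hc.target q hq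
      rw [IsScalarTower.algebraMap_apply kW O K] at this
      exact this)⟩
  -- The chart is also sharp at `F`, so the dual basis gives derivations with values in `F` and not
  -- merely in `K`. The transcendence estimate needs forms with coefficients in `F`.
  let D : Fin d → Derivation kW O F := fun i => hcF.deriv ((Int.castAddHom F).comp (h i))
  have hDg : ∀ i j, D i (c.uMgp (g j) : O) =
      (if i = j then 1 else 0) * algebraMap O F (c.uMgp (g j) : O) := fun i j => by
    have := hcF.deriv_uMgp ((Int.castAddHom F).comp (h i)) (g j) (hg j)
    rw [hgb, AddMonoidHom.comp_apply, hhb] at this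
    refine this.trans ?_
    congr 1
    split_ifs <;> simp
  let D' : Fin d → Derivation kW O K := fun i =>
    ((IsScalarTower.toAlgHom O F K).toLinearMap).compDer (D i)
  have hD' : ∀ i x, D' i x = (D i x : K) := fun i x => rfl
  have hsum : ∀ (a : Fin d → K) x, (∑ i, a i • D' i) x = ∑ i, a i * D' i x := fun a x => by
    have := congr($(map_sum (Derivation.coeFnAddMonoidHom (R := kW) (A := O) (M := K))
      (fun i => a i • D' i) Finset.univ) x)
    rw [Finset.sum_apply] at this
    exact this
  let ρ : Fin d → L ⊕ J → F := fun i => Sum.elim (fun l => D i (y l)) (fun j => D i (z j))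
  -- A combination of the `D i` that vanishes on all coordinates is zero by unramifiedness;
  -- evaluated at the unit of `g j` it gives the coefficient `a j` times a nonzero element.
  have hρ : LinearIndependent F ρ := by
    rw [Fintype.linearIndependent_iff]
    intro a ha j
    have ha' : ∀ t, ∑ i, (a i : K) * (ρ i t : K) = 0 := fun t => by
      have := congr((($ha t : F) : K))
      simpa using this
    have h0 := hunr (∑ i, (a i : K) • D' i) (fun l => (hsum _ _).trans (ha' (Sum.inl l)))
      (fun j => (hsum _ _).trans (ha' (Sum.inr j)))
    have h1 := hsum (fun i => (a i : K)) (c.uMgp (g j) : O)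
    rw [h0] at h1
    simp only [hD', hDg] at h1
    rw [Finset.sum_eq_single j (fun i _ hij => by rw [if_neg hij]; simp) (by simp)] at h1
    rw [if_pos rfl, one_mul, hOF] at h1
    exact Subtype.ext ((mul_eq_zero.1 h1.symm).resolve_right (algebraMap_unit_ne_zero _))
  -- The operator to be normalised, applied to the `D i`. Injectivity of `A` provides a left inverse
  -- `B`, whose rows are the coefficients of the required derivations.
  let A : Matrix (Fin d) L K := fun i l => (D i (y l) : K) - ∑ j, U j l * (D i (z j) : K)
  have hA : LinearMap.ker A.mulVecLin = ⊥ := by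
    rw [LinearMap.ker_eq_bot']
    intro w hw
    refine eq_zero_of_algebraicIndependent (k := k) (fun l => algebraMap O K (y l))
      (fun j => algebraMap O K (z j)) U _ F hF (fun l => hmem _) (fun j => hmem _) hU ρ hρ w
      fun i => ?_
    have := congr($hw i)
    rw [Matrix.mulVecLin_apply, Matrix.mulVec, dotProduct] at this
    refine Eq.trans ?_ this
    exact Finset.sum_congr rfl fun l _ => mul_comm _ _
  obtain ⟨B', hB'⟩ := LinearMap.exists_leftInverse_of_injective A.mulVecLin hA
  let B := LinearMap.toMatrix' B'
  have hB : B * A = 1 := by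
    rw [← LinearMap.toMatrix'_toLin' A, ← LinearMap.toMatrix'_comp]
    exact (congrArg LinearMap.toMatrix' hB').trans LinearMap.toMatrix'_id
  refine ⟨∑ i, B l i • D' i, fun p => ?_, fun l' => ?_⟩
  · rw [hsum]
    refine Finset.sum_eq_zero fun i _ => ?_
    rw [hD', show D i (c.α p) = 0 from hcF.deriv_α _ p]
    simp
  · have := congr($hB l l')
    rw [Matrix.mul_apply, Matrix.one_apply] at this
    rw [hsum]
    have e : ∀ j, U j l' * (∑ i, B l i • D' i) (z j) = ∑ i, B l i * (U j l' * D' i (z j)) :=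
      fun j => by
        rw [hsum, Finset.mul_sum]
        exact Finset.sum_congr rfl fun i _ => mul_left_comm _ _ _
    rw [Finset.sum_congr rfl fun j _ => e j, Finset.sum_comm, ← Finset.sum_sub_distrib]
    rw [Finset.sum_congr rfl fun i _ => by rw [← Finset.mul_sum, ← mul_sub]]
    refine this.trans ?_
    simp only [eq_comm]

end ChartPair

/-! ### Points of projective space -/

section ProjPoints

namespace AlgebraicGeometry.Proj

variable {σ : Type*} {A : Type u} [CommRing A] [SetLike σ A] [AddSubgroupClass σ A] (𝒜 : ℕ → σ)
  [GradedRing 𝒜] {X : Scheme.{u}} (f : A →+* Γ(X, ⊤))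
  (hf : (HomogeneousIdeal.irrelevant 𝒜).toIdeal.map f = ⊤)

/-- The map on degree zero fractions induced by a homomorphism that inverts the denominator. -/
def awayLift {R : Type*} [CommRing R] (f : A →+* R) {t : A} (ht : IsUnit (f t)) :
    HomogeneousLocalization.Away 𝒜 t →+* R :=
  (IsLocalization.Away.lift (S := Localization.Away t) t ht).comp
    (algebraMap (HomogeneousLocalization.Away 𝒜 t) (Localization.Away t))

/-- The morphism is glued from pieces over the opens where a homogeneous element is invertible. When
`f t` is a unit, the piece for `t` is already all of `X`. -/
theorem fromOfGlobalSections_eq {t : A} {d : ℕ} (hd : 0 < d) (ht : t ∈ 𝒜 d) (hu : IsUnit (f t)) :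
    fromOfGlobalSections 𝒜 f hf =
      X.toSpecΓ ≫ Spec.map (CommRingCat.ofHom (awayLift 𝒜 f hu)) ≫ awayι 𝒜 t ht hd := by
  have htop : X.basicOpen (f t) = ⊤ := X.basicOpen_of_isUnit hu
  have hiso : IsIso (X.basicOpen (f t)).ι := by
    rw [htop, ← Scheme.topIso_hom]; infer_instance
  rw [← cancel_epi (X.basicOpen (f t)).ι]
  have h1 : (X.basicOpen (f t)).ι ≫ fromOfGlobalSections 𝒜 f hf =
      toBasicOpenOfGlobalSections 𝒜 f rfl hd ht ≫ (basicOpen 𝒜 t).ι :=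
    (openCoverOfMapIrrelevantEqTop 𝒜 f hf).ι_glueMorphisms _ _ ⟨_, _, hd, ht⟩
  let e : Localization.Away (f t) →+* Γ(X, ⊤) :=
    IsLocalization.Away.lift (f t) (g := RingHom.id _) hu
  have he : e.comp (algebraMap Γ(X, ⊤) (Localization.Away (f t))) = RingHom.id _ :=
    IsLocalization.Away.lift_comp _ _
  have hS : (X.isoOfEq (X.toSpecΓ_preimage_basicOpen (f t))).inv ≫ X.toSpecΓ ∣_ _ ≫
      (basicOpenIsoSpecAway (f t)).hom =
      (X.basicOpen (f t)).ι ≫ X.toSpecΓ ≫ Spec.map (CommRingCat.ofHom e) := by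
    have : Mono (Spec.map (CommRingCat.ofHom
      (algebraMap Γ(X, ⊤) (Localization.Away (f t))))) := inferInstance
    rw [← cancel_mono (Spec.map (CommRingCat.ofHom
      (algebraMap Γ(X, ⊤) (Localization.Away (f t)))))]
    simp only [Category.assoc, basicOpenIsoSpecAway_hom_SpecMap, ← Spec.map_comp,
      ← CommRingCat.ofHom_comp, he]
    refine (congrArg (fun q => (X.isoOfEq (X.toSpecΓ_preimage_basicOpen (f t))).inv ≫ q)
      (morphismRestrict_ι X.toSpecΓ (PrimeSpectrum.basicOpen (f t)))).trans ?_
    rw [Scheme.isoOfEq_inv_ι_assoc, CommRingCat.ofHom_id, Spec.map_id]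
    exact congrArg _ (Category.comp_id _).symm
  have hl : awayLift 𝒜 f hu = e.comp ((IsLocalization.map (M := .powers t) (T := .powers (f t)) _ f
      (by rw [← Submonoid.map_le_iff_le_comap, Submonoid.map_powers]) :
        Localization.Away t →+* Localization.Away (f t)).comp (algebraMap _ (Localization.Away t))) := by
    rw [awayLift, ← RingHom.comp_assoc]
    congr 1
    apply IsLocalization.ringHom_ext (M := .powers t)
    rw [RingHom.comp_assoc, IsLocalization.map_comp, ← RingHom.comp_assoc, he,
      IsLocalization.Away.lift_comp, RingHom.id_comp]
  rw [h1, hl, CommRingCat.ofHom_comp, Spec.map_comp, Category.assoc, ← reassoc_of% hS]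
  simp only [toBasicOpenOfGlobalSections, Category.assoc, basicOpenIsoSpec_inv_ι]

end AlgebraicGeometry.Proj

variable {k : Type u} [Field k]
attribute [local instance] MvPolynomial.gradedAlgebra

namespace ProjSpace

variable (k) {n : ℕ}

/-- The ring of functions on the standard affine chart of projective space. -/
abbrev AffRing (i : Fin (n + 1)) : Type u :=
  HomogeneousLocalization.Away (MvPolynomial.homogeneousSubmodule (Fin (n + 1)) k)
    (MvPolynomial.X i)

variable {k} in
/-- The affine coordinates on the standard chart. -/
def affCoord (i l : Fin (n + 1)) : AffRing k i :=
  HomogeneousLocalization.Away.mk _ (d := 1)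
    ((MvPolynomial.mem_homogeneousSubmodule _ _).2 (MvPolynomial.isHomogeneous_X k i)) 1
    (MvPolynomial.X l) ((MvPolynomial.mem_homogeneousSubmodule _ _).2
      (by simpa using MvPolynomial.isHomogeneous_X k l))

/-- The constants on the standard chart. -/
def affConst (i : Fin (n + 1)) : k →+* AffRing k i :=
  (HomogeneousLocalization.fromZeroRingHom _ _).comp
    (algebraMap k (MvPolynomial.homogeneousSubmodule (Fin (n + 1)) k 0))

/-- The standard chart of projective space. -/
def affι (i : Fin (n + 1)) : Spec (.of (AffRing k i)) ⟶ ProjSpace k n :=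
  Proj.awayι _ _ ((MvPolynomial.mem_homogeneousSubmodule _ _).2 (MvPolynomial.isHomogeneous_X k i))
    one_pos

variable {k}

/-- A fraction `F / X_i ^ d` with `F` homogeneous of degree `d` is `F` evaluated at the affine
coordinates, so constants and coordinates generate. -/
lemma affRing_hom_ext {T : Type*} [CommRing T] {i : Fin (n + 1)} {f g : AffRing k i →+* T}
    (h0 : ∀ a, f (affConst k i a) = g (affConst k i a))
    (h1 : ∀ l, f (affCoord i l) = g (affCoord i l)) : f = g := by
  let η : MvPolynomial (Fin (n + 1)) k →+* AffRing k i :=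
    MvPolynomial.eval₂Hom (affConst k i) (affCoord i)
  have hη : f.comp η = g.comp η := by
    apply MvPolynomial.ringHom_ext
    · intro a; simpa [η] using h0 a
    · intro l; simpa [η] using h1 l
  have key : ∀ (F : MvPolynomial (Fin (n + 1)) k) (d : ℕ), F.IsHomogeneous d →
      (η F).val * algebraMap (MvPolynomial (Fin (n + 1)) k)
        (Localization.Away (MvPolynomial.X (R := k) i)) (MvPolynomial.X i) ^ d =
        algebraMap _ (Localization.Away (MvPolynomial.X (R := k) i)) F := by
    intro F d hF
    let v : AffRing k i →+* Localization.Away (MvPolynomial.X (R := k) i) := algebraMap _ _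
    let a : MvPolynomial (Fin (n + 1)) k →+* Localization.Away (MvPolynomial.X (R := k) i) :=
      algebraMap _ _
    have hv : ∀ l, v (affCoord i l) * a (MvPolynomial.X i) = a (MvPolynomial.X l) := fun l => by
      change (affCoord i l).val * _ = _
      rw [affCoord, HomogeneousLocalization.Away.val_mk, Localization.mk_eq_mk']
      have := IsLocalization.mk'_spec (M := Submonoid.powers (MvPolynomial.X (R := k) i))
        (Localization.Away (MvPolynomial.X (R := k) i)) (MvPolynomial.X l)
        ⟨MvPolynomial.X i ^ 1, 1, rfl⟩
      simp only [pow_one] at this ⊢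
      exact this
    have hc : ∀ r, v (affConst k i r) = a (MvPolynomial.C r) := fun r => rfl
    change v (η F) * a _ ^ d = a F
    have e1 : v (η F) = ∑ s ∈ F.support, a (MvPolynomial.C (F.coeff s)) *
        ∏ l, v (affCoord i l) ^ s l := by
      change v (MvPolynomial.eval₂ _ _ F) = _
      rw [MvPolynomial.eval₂_eq', map_sum]
      simp only [map_mul, map_prod, map_pow, hc]
    have e2 : a F = ∑ s ∈ F.support, a (MvPolynomial.C (F.coeff s)) *
        ∏ l, a (MvPolynomial.X l) ^ s l := by
      conv_lhs => rw [← MvPolynomial.eval₂_eta F, MvPolynomial.eval₂_eq', map_sum]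
      simp only [map_mul, map_prod, map_pow]
    rw [e1, e2, Finset.sum_mul]
    refine Finset.sum_congr rfl fun s hs => ?_
    -- Homogeneity: every monomial that occurs absorbs exactly the factor `X_i ^ d`.
    have hd : ∑ l, s l = d := by
      rw [← Finsupp.degree_eq_sum]
      by_contra h
      exact (MvPolynomial.mem_support_iff.1 hs) (hF.coeff_eq_zero h)
    rw [mul_assoc, ← hd, ← Finset.prod_pow_eq_pow_sum, ← Finset.prod_mul_distrib]
    simp only [← mul_pow, hv]
  ext x
  obtain ⟨m, F, hF, rfl⟩ := HomogeneousLocalization.Away.mk_surjective _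
    ((MvPolynomial.mem_homogeneousSubmodule _ _).2 (MvPolynomial.isHomogeneous_X k i)) x
  have : HomogeneousLocalization.Away.mk _ ((MvPolynomial.mem_homogeneousSubmodule _ _).2 (MvPolynomial.isHomogeneous_X k i)) m F hF = η F := by
    apply HomogeneousLocalization.val_injective
    rw [HomogeneousLocalization.Away.val_mk]
    have := key F (m * 1) hF
    rw [Localization.mk_eq_mk', IsLocalization.mk'_eq_iff_eq_mul, ← this, mul_one, map_pow]
  rw [this]
  exact congr($hη F)

lemma awayLift_affCoord {R : Type u} [CommRing R] (φ : MvPolynomial (Fin (n + 1)) k →+* R)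
    {i : Fin (n + 1)} (hi : IsUnit (φ (MvPolynomial.X i))) (l : Fin (n + 1)) :
    Proj.awayLift _ φ hi (affCoord i l) * φ (MvPolynomial.X i) = φ (MvPolynomial.X l) := by
  change IsLocalization.Away.lift (S := Localization.Away (MvPolynomial.X i)) _ hi
    (affCoord i l).val * _ = _
  rw [affCoord, HomogeneousLocalization.Away.val_mk, Localization.mk_eq_mk']
  have := IsLocalization.mk'_spec (M := Submonoid.powers (MvPolynomial.X (R := k) i))
    (Localization.Away (MvPolynomial.X (R := k) i)) (MvPolynomial.X l)
    ⟨MvPolynomial.X i ^ 1, 1, rfl⟩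
  have := congr(IsLocalization.Away.lift (S := Localization.Away (MvPolynomial.X i)) _ hi $this)
  rw [map_mul, IsLocalization.Away.lift_eq, IsLocalization.Away.lift_eq] at this
  simpa using this

lemma awayLift_affConst {R : Type u} [CommRing R] (φ : MvPolynomial (Fin (n + 1)) k →+* R)
    {i : Fin (n + 1)} (hi : IsUnit (φ (MvPolynomial.X i))) (a : k) :
    Proj.awayLift _ φ hi (affConst k i a) = φ (MvPolynomial.C a) := by
  have : (affConst k i a).val = algebraMap (MvPolynomial (Fin (n + 1)) k)
    (Localization.Away (MvPolynomial.X (R := k) i)) (MvPolynomial.C a) := rfl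
  change IsLocalization.Away.lift (S := Localization.Away (MvPolynomial.X i)) _ hi
    (affConst k i a).val = _
  rw [this, IsLocalization.Away.lift_eq]

/-- A point with an invertible coordinate factors through a standard chart. -/
lemma ofVector_eq {R : Type u} [CommRing R] [Algebra k R] (x : Fin (n + 1) → R) (hx : ∃ i, x i = 1)
    (i : Fin (n + 1)) (hi : IsUnit (x i)) : ∃ ψ : AffRing k i →+* R,
      (∀ a, ψ (affConst k i a) = algebraMap k R a) ∧ (∀ l, ψ (affCoord i l) * x i = x l) ∧
      ofVector x hx = Spec.map (CommRingCat.ofHom ψ) ≫ affι k i := by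
  let γ : R →+* Γ(Spec (.of R), ⊤) := (Scheme.ΓSpecIso (.of R)).inv.hom
  let δ : Γ(Spec (.of R), ⊤) →+* R := (Scheme.ΓSpecIso (.of R)).hom.hom
  have hδγ : ∀ r, δ (γ r) = r := fun r => congr($((Scheme.ΓSpecIso (.of R)).inv_hom_id).hom r)
  have hev : ∀ l, evalHom (k := k) x (MvPolynomial.X l) = γ (x l) := fun l => by
    simp [evalHom, γ]
  have hu : IsUnit (evalHom (k := k) x (MvPolynomial.X i)) := by
    rw [hev]; exact hi.map γ
  refine ⟨δ.comp (Proj.awayLift _ (evalHom (k := k) x) hu), fun a => ?_, fun l => ?_, ?_⟩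
  · rw [RingHom.comp_apply, awayLift_affConst]
    have : evalHom (k := k) x (MvPolynomial.C a) = γ (algebraMap k R a) := by
      simp [evalHom, γ]
    rw [this, hδγ]
  · have := congr(δ $(awayLift_affCoord (evalHom (k := k) x) hu l))
    rwa [map_mul, hev, hev, hδγ, hδγ] at this
  · rw [ofVector, Proj.fromOfGlobalSections_eq _ _ _ one_pos
      ((MvPolynomial.mem_homogeneousSubmodule _ _).2 (MvPolynomial.isHomogeneous_X k i)) hu,
      CommRingCat.ofHom_comp, Spec.map_comp, Category.assoc]
    have : (Spec (.of R)).toSpecΓ = Spec.map (CommRingCat.ofHom δ) := by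
      rw [← cancel_mono (Spec.map (Scheme.ΓSpecIso (.of R)).inv), toSpecΓ_SpecMap_ΓSpecIso_inv]
      simp [δ]
    rw [this]
    rfl

end ProjSpace

end ProjPoints

/-! ### Comparison of the charts of projective space, the Grassmannian and the incidence scheme. -/

section IncidenceCharts

variable {k : Type u} [Field k] {n q : ℕ}
attribute [local instance] MvPolynomial.gradedAlgebra

namespace ProjSpace

lemma affCoord_self (i : Fin (n + 1)) : affCoord (k := k) i i = 1 := by
  apply HomogeneousLocalization.val_injective
  rw [affCoord, HomogeneousLocalization.Away.val_mk, HomogeneousLocalization.val_one,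
    Localization.mk_eq_mk']
  simp only [pow_one]
  exact IsLocalization.mk'_self (M := Submonoid.powers (MvPolynomial.X (R := k) i))
    (Localization.Away (MvPolynomial.X (R := k) i)) (Submonoid.mem_powers _)

instance (i : Fin (n + 1)) : IsOpenImmersion (affι k i) :=
  inferInstanceAs (IsOpenImmersion (Proj.awayι _ _ _ _))

lemma affι_toSpec (i : Fin (n + 1)) : affι k i ≫ toSpec k n =
    Spec.map (CommRingCat.ofHom (affConst k i)) := by
  rw [affι, toSpec, Proj.awayι_toSpecZero_assoc, ← Spec.map_comp, ← CommRingCat.ofHom_comp]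
  rfl

/-- Points of a standard chart at which another coordinate is invertible. -/
lemma SpecMap_affι_eq {R : Type u} [CommRing R] {i' : Fin (n + 1)} (φ : AffRing k i' →+* R)
    (i : Fin (n + 1)) (hi : IsUnit (φ (affCoord i' i))) : ∃ ψ : AffRing k i →+* R,
      (∀ a, ψ (affConst k i a) = φ (affConst k i' a)) ∧
      (∀ l, ψ (affCoord i l) * φ (affCoord i' i) = φ (affCoord i' l)) ∧
      Spec.map (CommRingCat.ofHom φ) ≫ affι k i' = Spec.map (CommRingCat.ofHom ψ) ≫ affι k i := by
  let _ : Algebra k R := (φ.comp (affConst k i')).toAlgebra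
  have h1 : φ (affCoord i' i') = 1 := by rw [affCoord_self, map_one]
  obtain ⟨ψ₁, h1c, h1l, e1⟩ := ofVector_eq (k := k) (fun l => φ (affCoord i' l)) ⟨i', h1⟩ i'
    (by rw [h1]; exact isUnit_one)
  obtain ⟨ψ₂, h2c, h2l, e2⟩ := ofVector_eq (k := k) (fun l => φ (affCoord i' l)) ⟨i', h1⟩ i hi
  have : φ = ψ₁ := affRing_hom_ext (fun a => (h1c a).symm) (fun l => by
    have := h1l l
    rw [h1, mul_one] at this
    exact this.symm)
  exact ⟨ψ₂, h2c, h2l, by rw [this, ← e1, e2]⟩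

lemma exists_mem_range_affι (x : ProjSpace k n) : ∃ i, x ∈ Set.range (affι k i) := by
  have h := Proj.iSup_basicOpen_eq_top' (MvPolynomial.homogeneousSubmodule (Fin (n + 1)) k)
    (fun i => MvPolynomial.X i) (fun i => ⟨1, (MvPolynomial.mem_homogeneousSubmodule _ _).2
      (MvPolynomial.isHomogeneous_X k i)⟩) (by
      rw [eq_top_iff]
      intro p _
      have hp : p ∈ Algebra.adjoin k (Set.range (MvPolynomial.X : Fin (n + 1) → _)) := by
        rw [MvPolynomial.adjoin_range_X]; trivial
      refine Algebra.adjoin_induction (fun x hx => Algebra.subset_adjoin hx) (fun r => ?_)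
        (fun x y _ _ hx hy => add_mem hx hy) (fun x y _ _ hx hy => mul_mem hx hy) hp
      exact Subalgebra.algebraMap_mem (Algebra.adjoin
        (MvPolynomial.homogeneousSubmodule (Fin (n + 1)) k 0) _)
        (algebraMap k (MvPolynomial.homogeneousSubmodule (Fin (n + 1)) k 0) r))
  have hx : x ∈ (⊤ : (ProjSpace k n).Opens) := trivial
  rw [← h, TopologicalSpace.Opens.mem_iSup] at hx
  obtain ⟨i, hi⟩ := hx
  refine ⟨i, ?_⟩
  rw [← Proj.opensRange_awayι _ _ ((MvPolynomial.mem_homogeneousSubmodule _ _).2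
    (MvPolynomial.isHomogeneous_X k i)) one_pos] at hi
  exact hi

end ProjSpace

namespace Grass

/-- A point of the chart at `I` at which the minor at `J` is invertible, in the chart at `J`. -/
lemma exists_SpecMap_ι_eq {R : Type u} [CommRing R] {I : Fin q ↪o Fin n} (φ : ChartRing k I →+* R)
    (J : Fin q ↪o Fin n) (hJ : IsUnit (((univMat k I).map φ).submatrix id J).det) :
    ∃ ψ : ChartRing k J →+* R, (∀ a, ψ (algebraMap k _ a) = φ (algebraMap k _ a)) ∧
      (univMat k J).map ψ = (((univMat k I).map φ).submatrix id J)⁻¹ * (univMat k I).map φ ∧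
      Spec.map (CommRingCat.ofHom φ) ≫ Grassmannian.ι k I =
        Spec.map (CommRingCat.ofHom ψ) ≫ Grassmannian.ι k J := by
  have hu : IsUnit (φ (minor k I J)) := by rwa [map_minor]
  let w : OverlapRing k I J →+* R := IsLocalization.Away.lift (minor k I J) hu
  have hw : w.comp (algebraMap _ _) = φ := IsLocalization.Away.lift_comp _ _
  refine ⟨w.comp (chartTrans k I J).toRingHom, fun a => ?_, ?_, ?_⟩
  · have h1 : (chartTrans k I J).toRingHom (algebraMap k _ a) =
        algebraMap (ChartRing k I) _ (algebraMap k _ a) :=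
      ((chartTrans k I J).commutes a).trans
        (IsScalarTower.algebraMap_apply k (ChartRing k I) (OverlapRing k I J) a)
    rw [RingHom.comp_apply, h1, ← RingHom.comp_apply, hw]
  · have h1 : (univMat k J).map (w.comp (chartTrans k I J).toRingHom) =
        (((univMat k J).map (chartTrans k I J).toRingHom)).map w := rfl
    have h2 : (overlapMat k I J).map w = (univMat k I).map φ := by rw [← hw]; rfl
    rw [h1, map_chartTrans, transMat, Matrix.map_mul, map_inv _ _ (isUnit_det_overlapMat I J), h2,
      ← h2]
    rfl
  · have hg := (glueData k q n).glue_condition ⟨I⟩ ⟨J⟩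
    change trans k I J ≫ incl k J I ≫ Grassmannian.ι k J = incl k I J ≫ Grassmannian.ι k I at hg
    rw [CommRingCat.ofHom_comp, Spec.map_comp, ← trans_incl, Category.assoc, Category.assoc, hg,
      ← Spec.map_comp_assoc, ← CommRingCat.ofHom_comp, hw]

/-- Specialise to a Vandermonde matrix renormalised at `I`: all its maximal minors are nonzero. The
distinct nodes are taken in `k(t)`, as `k` may be finite. -/
lemma minor_ne_zero (I J : Fin q ↪o Fin n) : minor k I J ≠ 0 := by
  let K := RatFunc k
  have hinf : Infinite K :=
    Infinite.of_injective _ (IsFractionRing.injective (Polynomial k) K)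
  obtain ⟨t⟩ : Nonempty (Fin n ↪ K) := ⟨Fin.valEmbedding.trans (Infinite.natEmbedding K)⟩
  let V : Matrix (Fin q) (Fin n) K := fun j l => t l ^ (j : ℕ)
  have hV : ∀ J : Fin q ↪o Fin n, IsUnit (V.submatrix id J).det := fun J => by
    have : V.submatrix id J = (Matrix.vandermonde fun j => t (J j)).transpose := by
      ext i j; rfl
    rw [this, Matrix.det_transpose, isUnit_iff_ne_zero, Matrix.det_vandermonde_ne_zero_iff]
    exact t.injective.comp J.injective
  let N : Matrix (Fin q) (Fin n) K := (V.submatrix id I)⁻¹ * V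
  let φ : ChartRing k I →ₐ[k] K := MvPolynomial.aeval fun p => N p.1 p.2
  have hN : (univMat k I).map φ.toRingHom = N := map_univMat I _ _
    (by rw [submatrix_mul_id, Matrix.nonsing_inv_mul _ (hV I)]) fun p => by simp [φ]
  intro h
  have h1 := map_minor (k := k) J φ.toRingHom
  rw [h, map_zero, hN, submatrix_mul_id, Matrix.det_mul] at h1
  exact ((Matrix.isUnit_nonsing_inv_det _ (hV I)).mul (hV J)).ne_zero h1.symm

end Grass

namespace Incidence

lemma map_point {R : Type*} [CommRing R] (I : Fin q ↪o Fin (n + 1)) (j : Fin q)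
    (χ : ChartRing (k := k) I j →+* R) (l : Fin (n + 1)) :
    χ (point I j l) = Matrix.vecMul (fun m => χ (coeff I j m))
      ((Grass.univMat k I).map (χ.comp MvPolynomial.C)) l := by
  simp [point, Matrix.vecMul, dotProduct]

lemma point_apply_self (I : Fin q ↪o Fin (n + 1)) (j m : Fin q) :
    point (k := k) I j (I m) = coeff I j m := by
  simp [point, Matrix.vecMul, dotProduct, Grass.univMat, apply_ite MvPolynomial.C]

/-- For a column in `I` the entry is `1` or a variable. For another column, specialising the row
vector to the `j`-th basis vector leaves a variable of the universal matrix. -/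
lemma point_ne_zero (I : Fin q ↪o Fin (n + 1)) (j : Fin q) (l : Fin (n + 1)) :
    point (k := k) I j l ≠ 0 := by
  by_cases hl : l ∈ Set.range I
  · obtain ⟨m, rfl⟩ := hl
    rw [point_apply_self, coeff]
    split_ifs
    · exact one_ne_zero
    · exact MvPolynomial.X_ne_zero _
  · intro h
    let χ : ChartRing (k := k) I j →+* Grass.ChartRing k I :=
      MvPolynomial.eval₂Hom (RingHom.id _) (fun _ => 0)
    have h1 := map_point I j χ l
    have h2 : χ.comp MvPolynomial.C = RingHom.id _ := by ext x <;> simp [χ]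
    have h3 : (fun m => χ (coeff I j m)) = Pi.single j 1 := by
      ext1 m
      by_cases hm : m = j
      · subst hm; simp [coeff]
      · simp [coeff, hm, χ]
    rw [h, map_zero, h2, h3, Matrix.single_one_vecMul] at h1
    have h4 : (Grass.univMat k I).map (RingHom.id _) j l = MvPolynomial.X (j, ⟨l, hl⟩) := by
      simp [Grass.univMat, hl, -Set.mem_range]
    exact MvPolynomial.X_ne_zero _ (h4.symm.trans h1.symm)

lemma exists_affHom (I : Fin q ↪o Fin (n + 1)) (j : Fin q) :
    ∃ ψ : ProjSpace.AffRing k (I j) →+* ChartRing (k := k) I j,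
      (∀ a, ψ (ProjSpace.affConst k (I j) a) = algebraMap k (ChartRing (k := k) I j) a) ∧
      (∀ l, ψ (ProjSpace.affCoord (I j) l) = point I j l) ∧
      ProjSpace.ofVector (point I j) ⟨I j, point_eq_one I j⟩ =
        Spec.map (CommRingCat.ofHom ψ) ≫ ProjSpace.affι k (I j) := by
  have h := point_eq_one (k := k) I j
  obtain ⟨ψ, h1, h2, h3⟩ := ProjSpace.ofVector_eq (k := k) (point (k := k) I j) ⟨I j, h⟩ (I j)
    (by rw [h]; exact isUnit_one)
  refine ⟨ψ, h1, fun l => ?_, h3⟩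
  have := h2 l
  rwa [h, mul_one] at this

/-- The map from an incidence chart to the standard chart of projective space, on functions. -/
def affHom (I : Fin q ↪o Fin (n + 1)) (j : Fin q) :
    ProjSpace.AffRing k (I j) →+* ChartRing (k := k) I j := (exists_affHom I j).choose

lemma affHom_const (I : Fin q ↪o Fin (n + 1)) (j : Fin q) (a : k) :
    affHom I j (ProjSpace.affConst k (I j) a) = algebraMap k (ChartRing (k := k) I j) a :=
  (exists_affHom I j).choose_spec.1 a

lemma affHom_coord (I : Fin q ↪o Fin (n + 1)) (j : Fin q) (l : Fin (n + 1)) :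
    affHom (k := k) I j (ProjSpace.affCoord (I j) l) = point I j l :=
  (exists_affHom I j).choose_spec.2.1 l

lemma chartMap_fst (I : Fin q ↪o Fin (n + 1)) (j : Fin q) :
    chartMap (k := k) I j ≫ pullback.fst _ _ =
      Spec.map (CommRingCat.ofHom (affHom I j)) ≫ ProjSpace.affι k (I j) :=
  (pullback.lift_fst _ _ _).trans (exists_affHom I j).choose_spec.2.2

lemma chartMap_snd (I : Fin q ↪o Fin (n + 1)) (j : Fin q) :
    chartMap (k := k) I j ≫ pullback.snd _ _ =
      Spec.map (CommRingCat.ofHom MvPolynomial.C) ≫ Grassmannian.ι k I :=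
  pullback.lift_snd _ _ _

/-- Comparison of two incidence charts. -/
lemma exists_chartMap_eq {R : Type u} [CommRing R] {I' : Fin q ↪o Fin (n + 1)} {j' : Fin q}
    (χ' : ChartRing (k := k) I' j' →+* R) (I : Fin q ↪o Fin (n + 1)) (j : Fin q)
    (hI : IsUnit (χ' (MvPolynomial.C (Grass.minor k I' I)))) (hj : IsUnit (χ' (point I' j' (I j)))) :
    ∃ χ : ChartRing (k := k) I j →+* R, Spec.map (CommRingCat.ofHom χ) ≫ chartMap I j =
      Spec.map (CommRingCat.ofHom χ') ≫ chartMap I' j' := by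
  have hI' : IsUnit (((Grass.univMat k I').map (χ'.comp MvPolynomial.C)).submatrix id I).det := by
    rw [← Grass.map_minor]; exact hI
  obtain ⟨φ, hφc, hφm, hφ⟩ := Grass.exists_SpecMap_ι_eq (χ'.comp MvPolynomial.C) I hI'
  set M' := (Grass.univMat k I').map (χ'.comp MvPolynomial.C) with hM'
  let c' : Fin q → R := fun m => χ' (coeff I' j' m)
  let s : R := (hj.unit⁻¹ : Rˣ)
  have hs : s * χ' (point I' j' (I j)) = 1 := hj.val_inv_mul
  -- In the new frame the row vector consists of the coordinates of the point at the columns of `I`;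
  -- the factor `s` makes the one at `I j` equal to `1`.
  let χ : ChartRing (k := k) I j →+* R := MvPolynomial.eval₂Hom φ
    (fun m => s * χ' (point I' j' (I m)))
  have hχC : χ.comp MvPolynomial.C = φ := RingHom.ext fun x => MvPolynomial.eval₂Hom_C _ _ _
  have hχc : ∀ m, χ (coeff I j m) = s * χ' (point I' j' (I m)) := fun m => by
    by_cases hm : m = j
    · subst hm
      rw [hs]; simp [coeff]
    · simp [coeff, hm, χ]
  have hp' : ∀ l, χ' (point I' j' l) = Matrix.vecMul c' M' l := map_point I' j' χ'
  have hχp : ∀ l, χ (point I j l) = s * χ' (point I' j' l) := fun l => by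
    rw [map_point, hχC, hφm]
    have e : (fun m => χ (coeff I j m)) = s • Matrix.vecMul c' (M'.submatrix id I) := by
      ext m
      rw [hχc, hp']
      rfl
    rw [e, Matrix.smul_vecMul, Matrix.vecMul_vecMul, ← Matrix.mul_assoc,
      Matrix.mul_nonsing_inv _ hI', Matrix.one_mul, hp']
    rfl
  refine ⟨χ, pullback.hom_ext ?_ ?_⟩
  · rw [Category.assoc, Category.assoc, chartMap_fst, chartMap_fst, ← Spec.map_comp_assoc,
      ← Spec.map_comp_assoc, ← CommRingCat.ofHom_comp, ← CommRingCat.ofHom_comp]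
    obtain ⟨ψ, h1, h2, h3⟩ := ProjSpace.SpecMap_affι_eq (χ'.comp (affHom I' j')) (I j) (by
      rw [RingHom.comp_apply, affHom_coord]; exact hj)
    rw [h3]
    congr 3
    apply ProjSpace.affRing_hom_ext
    · intro a
      rw [h1, RingHom.comp_apply, RingHom.comp_apply, affHom_const, affHom_const]
      have e1 : χ (algebraMap k _ a) = φ (algebraMap k _ a) := congr($hχC (algebraMap k _ a))
      rw [e1, hφc]
      rfl
    · intro l
      have e := h2 l
      rw [RingHom.comp_apply, RingHom.comp_apply, affHom_coord, affHom_coord] at e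
      rw [RingHom.comp_apply, affHom_coord, hχp, ← e, mul_left_comm, hs, mul_one]
  · rw [Category.assoc, Category.assoc, chartMap_snd, chartMap_snd, ← Spec.map_comp_assoc,
      ← Spec.map_comp_assoc, ← CommRingCat.ofHom_comp, ← CommRingCat.ofHom_comp, hχC, hφ]

/-- The image of the generic point of an incidence chart. -/
def generic (I : Fin q ↪o Fin (n + 1)) (j : Fin q) :
    ↥(pullback (ProjSpace.toSpec k n) (Grassmannian.toSpec k q (n + 1))) :=
  chartMap I j (genericPoint (Spec (.of (ChartRing (k := k) I j))))

lemma generic_specializes_chartMap (I : Fin q ↪o Fin (n + 1)) (j : Fin q)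
    (x : Spec (.of (ChartRing (k := k) I j))) : generic I j ⤳ chartMap I j x :=
  (genericPoint_specializes x).map (chartMap I j).continuous

lemma genericPoint_mem_range {D : Type u} [CommRing D] [IsDomain D] :
    genericPoint (Spec (.of D)) ∈
      Set.range (Spec.map (CommRingCat.ofHom (algebraMap D (FractionRing D)))) := by
  refine ⟨(⊥ : PrimeSpectrum _), ?_⟩
  rw [genericPoint_eq_bot_of_affine]
  refine PrimeSpectrum.ext (Ideal.ext fun a => ?_)
  change algebraMap _ _ a ∈ (⊥ : Ideal _) ↔ a ∈ (⊥ : Ideal D)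
  rw [Ideal.mem_bot, Ideal.mem_bot, IsFractionRing.to_map_eq_zero_iff]

/-- All minors and coordinates are nonzero, hence invertible over the function field of the second
chart, so its generic point lies in the first chart. -/
lemma generic_specializes (I I' : Fin q ↪o Fin (n + 1)) (j j' : Fin q) :
    generic (k := k) I j ⤳ generic I' j' := by
  let χ' : ChartRing (k := k) I' j' →+* FractionRing (ChartRing (k := k) I' j') := algebraMap _ _
  have hχ' : ∀ a, a ≠ 0 → IsUnit (χ' a) := fun a ha => by
    rw [isUnit_iff_ne_zero, Ne, IsFractionRing.to_map_eq_zero_iff]; exact ha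
  obtain ⟨χ, hχ⟩ := exists_chartMap_eq χ' I j
    (hχ' _ (by rw [Ne, MvPolynomial.C_eq_zero]; exact Grass.minor_ne_zero _ _))
    (hχ' _ (point_ne_zero _ _ _))
  obtain ⟨y, hy⟩ := genericPoint_mem_range (D := ChartRing (k := k) I' j')
  have h1 : generic (k := k) I' j' = chartMap I j (Spec.map (CommRingCat.ofHom χ) y) := by
    rw [generic, ← hy, ← Scheme.Hom.comp_apply, ← hχ, Scheme.Hom.comp_apply]
  rw [h1]
  exact generic_specializes_chartMap I j _

/-- By symmetry of the previous comparison; this is the irreducibility of the incidence scheme. -/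
lemma generic_eq (I I' : Fin q ↪o Fin (n + 1)) (j j' : Fin q) :
    generic (k := k) I j = generic I' j' :=
  ((generic_specializes I I' j j').antisymm (generic_specializes I' I j' j)).eq

end Incidence

end IncidenceCharts

/-! ### The incidence charts are open immersions. -/

/-- The scheme-theoretic image of a reduced scheme is reduced. -/
lemma AlgebraicGeometry.Scheme.Hom.isReduced_image {X Y : Scheme.{u}} (f : X ⟶ Y) [QuasiCompact f]
    [IsReduced X] : IsReduced f.image := by
  suffices ∀ x : f.image, _root_.IsReduced (f.image.presheaf.stalk x) from
    isReduced_of_isReduced_stalk _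
  intro x
  obtain ⟨_, ⟨U, hU : IsAffineOpen _, rfl⟩, hxU, -⟩ := Y.isBasis_affineOpens.exists_subset_of_mem_open
    (Set.mem_univ (f.imageι x)) isOpen_univ
  have hV : IsAffineOpen (f.imageι ⁻¹ᵁ U) := hU.preimage f.imageι
  have hred : _root_.IsReduced Γ(f.image, f.imageι ⁻¹ᵁ U) :=
    isReduced_of_injective _ (f.toImage_app_injective ⟨U, hU⟩)
  let : Algebra Γ(f.image, f.imageι ⁻¹ᵁ U) (f.image.presheaf.stalk x) :=
    TopCat.Presheaf.algebra_section_stalk f.image.presheaf (⟨x, hxU⟩ : ↥(f.imageι ⁻¹ᵁ U))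
  have := hV.isLocalization_stalk ⟨x, hxU⟩
  exact isReduced_localizationPreserves (hV.primeIdealOf ⟨x, hxU⟩).asIdeal.primeCompl
    (f.image.presheaf.stalk x) hred

lemma AlgebraicGeometry.Scheme.appTop_appTop_ΓSpecIso_inv {Y : Scheme.{u}} {A R : CommRingCat.{u}}
    (a : Spec R ⟶ Y) (f : Y ⟶ Spec A) (φ : A →+* R) (h : a ≫ f = Spec.map (CommRingCat.ofHom φ))
    (c : A) : a.appTop (f.appTop ((Scheme.ΓSpecIso A).inv c)) = (Scheme.ΓSpecIso R).inv (φ c) := by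
  have h1 := Scheme.Hom.comp_appTop a f
  rw [h] at h1
  refine (congr(($h1).hom ((Scheme.ΓSpecIso A).inv c))).symm.trans ?_
  exact congr(($(Scheme.ΓSpecIso_inv_naturality (CommRingCat.ofHom φ))).hom c).symm

section IncidenceCharts

variable {k : Type u} [Field k] {n q : ℕ}
attribute [local instance] MvPolynomial.gradedAlgebra

namespace Incidence

/-- All incidence charts together. -/
abbrev allCharts (k : Type u) [Field k] (n q : ℕ) :
    (∐ fun c : (Fin q ↪o Fin (n + 1)) × Fin q => Spec (.of (ChartRing (k := k) c.1 c.2))) ⟶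
      pullback (ProjSpace.toSpec k n) (Grassmannian.toSpec k q (n + 1)) :=
  Sigma.desc fun c => chartMap (k := k) c.1 c.2

/-- Makes `allCharts` quasi-compact, as the statements on scheme-theoretic images require. -/
instance : IsNoetherian
    (∐ fun c : (Fin q ↪o Fin (n + 1)) × Fin q => Spec (.of (ChartRing (k := k) c.1 c.2))) := by
  let 𝒰 := sigmaOpenCover fun c : (Fin q ↪o Fin (n + 1)) × Fin q =>
    Spec (.of (ChartRing (k := k) c.1 c.2))
  have : Finite 𝒰.I₀ := inferInstanceAs (Finite ((Fin q ↪o Fin (n + 1)) × Fin q))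
  have : ∀ i, IsAffine (𝒰.X i) := fun i =>
    inferInstanceAs (IsAffine (Spec (.of (ChartRing (k := k) i.1 i.2))))
  refine (isNoetherian_iff_of_finite_affine_openCover (𝒰 := 𝒰)).2 fun i => ?_
  exact isNoetherianRing_of_ringEquiv (ChartRing (k := k) i.1 i.2)
    (Scheme.ΓSpecIso (.of (ChartRing (k := k) i.1 i.2))).symm.commRingCatIsoToRingEquiv

instance : IsReduced
    (∐ fun c : (Fin q ↪o Fin (n + 1)) × Fin q => Spec (.of (ChartRing (k := k) c.1 c.2))) := by
  let 𝒰 := sigmaOpenCover fun c : (Fin q ↪o Fin (n + 1)) × Fin q =>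
    Spec (.of (ChartRing (k := k) c.1 c.2))
  have : ∀ i, IsReduced (𝒰.X i) := fun i =>
    inferInstanceAs (IsReduced (Spec (.of (ChartRing (k := k) i.1 i.2))))
  exact IsReduced.of_openCover _ 𝒰

instance : IsReduced (incidence k q n) := Scheme.Hom.isReduced_image (allCharts k n q)

/-- An incidence chart, as a morphism to the incidence scheme. -/
def chartι (I : Fin q ↪o Fin (n + 1)) (j : Fin q) :
    Spec (.of (ChartRing (k := k) I j)) ⟶ incidence k q n :=
  Sigma.ι (fun c : (Fin q ↪o Fin (n + 1)) × Fin q => Spec (.of (ChartRing (k := k) c.1 c.2)))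
    (I, j) ≫ (allCharts k n q).toImage

lemma chartι_emb (I : Fin q ↪o Fin (n + 1)) (j : Fin q) :
    chartι I j ≫ incidence.emb k q n = chartMap I j := by
  refine (Category.assoc _ _ _).trans ?_
  refine (congrArg (Sigma.ι (fun c : (Fin q ↪o Fin (n + 1)) × Fin q =>
    Spec (.of (ChartRing (k := k) c.1 c.2))) (I, j) ≫ ·)
      (Scheme.Hom.toImage_imageι (allCharts k n q))).trans ?_
  exact Sigma.ι_desc _ _

/-- The image is supported on the closure of the union of the charts, and all charts have the same
generic point. -/
lemma generic_specializes_emb (I : Fin q ↪o Fin (n + 1)) (j : Fin q) (y : incidence k q n) :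
    generic I j ⤳ incidence.emb k q n y := by
  have h1 : incidence.emb k q n y ∈ closure (Set.range (allCharts k n q)) := by
    rw [← Scheme.Hom.support_ker, ← Scheme.IdealSheafData.range_subschemeι]
    exact ⟨y, rfl⟩
  rw [specializes_iff_mem_closure]
  refine closure_minimal ?_ isClosed_closure h1
  rintro _ ⟨w, rfl⟩
  obtain ⟨⟨I', j'⟩, w, rfl⟩ := (sigmaOpenCover fun c : (Fin q ↪o Fin (n + 1)) × Fin q =>
    Spec (.of (ChartRing (k := k) c.1 c.2))).exists_eq w
  rw [← specializes_iff_mem_closure, generic_eq I I' j j']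
  have h2 : Sigma.ι (fun c : (Fin q ↪o Fin (n + 1)) × Fin q =>
    Spec (.of (ChartRing (k := k) c.1 c.2))) (I', j') ≫ allCharts k n q = chartMap I' j' :=
    Sigma.ι_desc _ _
  have h3 := generic_specializes_chartMap (k := k) I' j' w
  rw [← h2] at h3
  exact h3.trans (specializes_of_eq (Scheme.Hom.comp_apply (Sigma.ι (fun c : (Fin q ↪o Fin (n + 1)) × Fin q =>
    Spec (.of (ChartRing (k := k) c.1 c.2))) (I', j')) (allCharts k n q) w))

/-- For `q = 0`, that is for empty linear subspaces, there are no charts and so the image is empty.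
-/
lemma nonempty_of_incidence (y : incidence k q n) : Nonempty (Fin q) := by
  by_contra h
  rw [not_nonempty_iff] at h
  have h1 : incidence.emb k q n y ∈ closure (Set.range (allCharts k n q)) := by
    rw [← Scheme.Hom.support_ker, ← Scheme.IdealSheafData.range_subschemeι]
    exact ⟨y, rfl⟩
  obtain ⟨_, -, w, rfl⟩ := mem_closure_iff.1 h1 _ isOpen_univ trivial
  obtain ⟨⟨I', j'⟩, w, rfl⟩ := (sigmaOpenCover fun c : (Fin q ↪o Fin (n + 1)) × Fin q =>
    Spec (.of (ChartRing (k := k) c.1 c.2))).exists_eq w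
  exact h.elim j'

/-- The product of standard charts of projective space and of the Grassmannian. -/
def boxι (l : Fin (n + 1)) (I : Fin q ↪o Fin (n + 1)) :
    pullback (ProjSpace.affι k l ≫ ProjSpace.toSpec k n) (Grass.chartToSpec k I) ⟶
      pullback (ProjSpace.toSpec k n) (Grassmannian.toSpec k q (n + 1)) :=
  pullback.map _ _ _ _ (ProjSpace.affι k l) (Grassmannian.ι k I) (𝟙 _) (by simp)
    (by rw [Category.comp_id, Grassmannian.ι_toSpec])

instance (l : Fin (n + 1)) (I : Fin q ↪o Fin (n + 1)) : IsOpenImmersion (boxι (k := k) l I) := by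
  unfold boxι; infer_instance

lemma range_boxι (l : Fin (n + 1)) (I : Fin q ↪o Fin (n + 1)) :
    Set.range (boxι (k := k) l I) = 
      pullback.fst (ProjSpace.toSpec k n) (Grassmannian.toSpec k q (n + 1)) ⁻¹'
        Set.range (ProjSpace.affι k l) ∩
      pullback.snd (ProjSpace.toSpec k n) (Grassmannian.toSpec k q (n + 1)) ⁻¹'
        Set.range (Grassmannian.ι k I) :=
  Scheme.Pullback.range_map (ProjSpace.affι k l ≫ ProjSpace.toSpec k n) (Grass.chartToSpec k I)
    (ProjSpace.toSpec k n) (Grassmannian.toSpec k q (n + 1)) (ProjSpace.affι k l)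
    (Grassmannian.ι k I) (𝟙 _) (by simp)
    (by rw [Category.comp_id, Grassmannian.ι_toSpec])

/-- A chart of the incidence scheme as a closed subscheme of a product of standard charts. -/
def boxChart (I : Fin q ↪o Fin (n + 1)) (j : Fin q) : Spec (.of (ChartRing (k := k) I j)) ⟶
    pullback (ProjSpace.affι k (I j) ≫ ProjSpace.toSpec k n) (Grass.chartToSpec k I) :=
  pullback.lift (Spec.map (CommRingCat.ofHom (affHom I j)))
    (Spec.map (CommRingCat.ofHom MvPolynomial.C)) (by
      rw [ProjSpace.affι_toSpec, Grass.chartToSpec, ← Spec.map_comp, ← Spec.map_comp,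
        ← CommRingCat.ofHom_comp, ← CommRingCat.ofHom_comp]
      congr 2
      exact RingHom.ext fun a => affHom_const I j a)

lemma boxChart_boxι (I : Fin q ↪o Fin (n + 1)) (j : Fin q) :
    boxChart (k := k) I j ≫ boxι (I j) I = chartMap I j := by
  apply pullback.hom_ext
  · rw [chartMap_fst, boxChart, boxι, Category.assoc, pullback.map, pullback.lift_fst,
      pullback.lift_fst_assoc]
  · rw [chartMap_snd, boxChart, boxι, Category.assoc, pullback.map, pullback.lift_snd,
      pullback.lift_snd_assoc]

/-- Functions on the chart are generated by those of the Grassmannian chart and the variables of the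
row vector, and these variables are the affine coordinates at the columns of `I`. -/
instance (I : Fin q ↪o Fin (n + 1)) (j : Fin q) : IsClosedImmersion (boxChart (k := k) I j) := by
  have : IsAffine (pullback (ProjSpace.affι k (I j) ≫ ProjSpace.toSpec k n)
    (Grass.chartToSpec k I)) := inferInstance
  apply IsClosedImmersion.of_surjective_of_isAffine
  let e := (Scheme.ΓSpecIso (.of (ChartRing (k := k) I j))).inv.hom
  have hsurj : Function.Surjective e :=
    (Scheme.ΓSpecIso (.of (ChartRing (k := k) I j))).symm.commRingCatIsoToRingEquiv.surjective
  suffices ∀ r, e r ∈ (boxChart (k := k) I j).appTop.hom.range by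
    intro b
    obtain ⟨r, rfl⟩ := hsurj b
    exact this r
  have hA : ∀ a, e (affHom I j a) ∈ (boxChart (k := k) I j).appTop.hom.range := fun a =>
    ⟨_, Scheme.appTop_appTop_ΓSpecIso_inv (boxChart (k := k) I j) (pullback.fst _ _) (affHom I j)
      (pullback.lift_fst _ _ _) a⟩
  have hC : ∀ a, e (MvPolynomial.C a) ∈ (boxChart (k := k) I j).appTop.hom.range := fun a =>
    ⟨_, Scheme.appTop_appTop_ΓSpecIso_inv (boxChart (k := k) I j) (pullback.snd _ _) MvPolynomial.C
      (pullback.lift_snd _ _ _) a⟩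
  intro r
  induction r using MvPolynomial.induction_on with
  | C a => exact hC a
  | add a b ha hb => rw [map_add]; exact add_mem ha hb
  | mul_X a m ha =>
    rw [map_mul]
    refine mul_mem ha ?_
    have := hA (ProjSpace.affCoord (I j) (I m))
    rwa [affHom_coord, point_apply_self, coeff, dif_neg m.2] at this

/-- The relation `∑ (x (I j) / x l) * U j l = 1` on the incidence scheme. -/
def boxRel (l : Fin (n + 1)) (I : Fin q ↪o Fin (n + 1)) :
    Γ(pullback (ProjSpace.affι k l ≫ ProjSpace.toSpec k n) (Grass.chartToSpec k I), ⊤) :=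
  1 - ∑ j, (pullback.fst (ProjSpace.affι k l ≫ ProjSpace.toSpec k n)
      (Grass.chartToSpec k I)).appTop ((Scheme.ΓSpecIso (.of _)).inv (ProjSpace.affCoord l (I j))) *
    (pullback.snd (ProjSpace.affι k l ≫ ProjSpace.toSpec k n)
      (Grass.chartToSpec k I)).appTop ((Scheme.ΓSpecIso (.of _)).inv (Grass.univMat k I j l))

lemma appTop_boxRel {l : Fin (n + 1)} {I : Fin q ↪o Fin (n + 1)} {R : CommRingCat.{u}}
    (a : Spec R ⟶ pullback (ProjSpace.affι k l ≫ ProjSpace.toSpec k n) (Grass.chartToSpec k I))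
    {φ : ProjSpace.AffRing k l →+* R} {χ : Grass.ChartRing k I →+* R}
    (hφ : a ≫ pullback.fst _ _ = Spec.map (CommRingCat.ofHom φ))
    (hχ : a ≫ pullback.snd _ _ = Spec.map (CommRingCat.ofHom χ)) :
    a.appTop (boxRel l I) = (Scheme.ΓSpecIso R).inv
      (1 - ∑ j, φ (ProjSpace.affCoord l (I j)) * χ (Grass.univMat k I j l)) := by
  have h1 := Scheme.appTop_appTop_ΓSpecIso_inv a _ _ hφ
  have h2 := Scheme.appTop_appTop_ΓSpecIso_inv a _ _ hχ
  rw [boxRel, map_sub, map_sub, map_one, map_one, map_sum, map_sum]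
  refine congrArg _ (Finset.sum_congr rfl fun j _ => ?_)
  rw [map_mul, map_mul, h1, h2]

/-- The standard coordinates at the points of the incidence scheme. -/
theorem exists_mem_range_affι (y : incidence k q n) (I : Fin q ↪o Fin (n + 1))
    (hI : incidence.toGrass k q n y ∈ Set.range (Grassmannian.ι k I)) :
    ∃ j, incidence.toProj k q n y ∈ Set.range (ProjSpace.affι k (I j)) := by
  -- If all the coordinates at the columns of `I` vanish at `y`, then `boxRel` takes the value `1`
  -- there. But it vanishes at the generic point, which specialises to `y`, and nonvanishing is an
  -- open condition.
  by_contra! hcon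
  obtain ⟨l, hl⟩ := ProjSpace.exists_mem_range_affι (incidence.toProj k q n y)
  obtain ⟨j⟩ := nonempty_of_incidence y
  have hy : incidence.emb k q n y ∈ Set.range (boxι (k := k) l I) := by
    rw [range_boxι]; exact ⟨hl, hI⟩
  obtain ⟨w, hw⟩ := hy
  -- the relation vanishes at the generic point
  let K := FractionRing (ChartRing (k := k) I j)
  have hpl : algebraMap _ K (point (k := k) I j l) ≠ 0 := by
    rw [Ne, IsFractionRing.to_map_eq_zero_iff]; exact point_ne_zero _ _ _
  obtain ⟨ψ, hψc, hψl, hψ⟩ := ProjSpace.SpecMap_affι_eq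
    ((algebraMap (ChartRing (k := k) I j) K).comp (affHom I j)) l (by
      rw [RingHom.comp_apply, affHom_coord]; exact isUnit_iff_ne_zero.2 hpl)
  let χ : Grass.ChartRing k I →+* K := (algebraMap (ChartRing (k := k) I j) K).comp MvPolynomial.C
  let a : Spec (.of K) ⟶
      pullback (ProjSpace.affι k l ≫ ProjSpace.toSpec k n) (Grass.chartToSpec k I) :=
    pullback.lift (Spec.map (CommRingCat.ofHom ψ)) (Spec.map (CommRingCat.ofHom χ)) (by
      rw [ProjSpace.affι_toSpec, Grass.chartToSpec, ← Spec.map_comp, ← Spec.map_comp,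
        ← CommRingCat.ofHom_comp, ← CommRingCat.ofHom_comp]
      congr 2
      refine RingHom.ext fun x => (hψc x).trans ?_
      exact congrArg (algebraMap _ K) (affHom_const I j x))
  have ha : a ≫ boxι l I = Spec.map (CommRingCat.ofHom (algebraMap _ K)) ≫ chartMap I j := by
    apply pullback.hom_ext
    · rw [Category.assoc, Category.assoc, chartMap_fst, boxι, pullback.map, pullback.lift_fst,
        pullback.lift_fst_assoc, ← Spec.map_comp_assoc, ← CommRingCat.ofHom_comp, hψ]
    · rw [Category.assoc, Category.assoc, chartMap_snd, boxι, pullback.map, pullback.lift_snd,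
        pullback.lift_snd_assoc, ← Spec.map_comp_assoc, ← CommRingCat.ofHom_comp]
  have hag : a.appTop (boxRel l I) = 0 := by
    rw [appTop_boxRel a (pullback.lift_fst _ _ _) (pullback.lift_snd _ _ _)]
    refine (congrArg _ ?_).trans (map_zero _)
    rw [sub_eq_zero]
    apply mul_right_cancel₀ hpl
    rw [one_mul, Finset.sum_mul]
    have h1 : point (k := k) I j l = ∑ m, coeff I j m * MvPolynomial.C (Grass.univMat k I m l) := by
      simp [point, Matrix.vecMul, dotProduct]
    rw [h1, map_sum]
    refine Finset.sum_congr rfl fun m _ => ?_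
    have h2 := hψl (I m)
    rw [RingHom.comp_apply, RingHom.comp_apply, affHom_coord, affHom_coord, point_apply_self] at h2
    rw [map_mul, ← h2]
    refine Eq.trans ?_ (congrArg (ψ (ProjSpace.affCoord l (I m)) * χ (Grass.univMat k I m l) * ·)
      ((congrArg (algebraMap _ K) h1).trans (map_sum _ _ _)))
    exact mul_right_comm _ _ _
  obtain ⟨y₀, hy₀⟩ := genericPoint_mem_range (D := ChartRing (k := k) I j)
  have hsp : a y₀ ⤳ w := by
    rw [← (boxι (k := k) l I).isOpenEmbedding.isInducing.specializes_iff, hw,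
      ← Scheme.Hom.comp_apply, ha, Scheme.Hom.comp_apply, hy₀]
    exact generic_specializes_emb I j y
  -- the relation does not vanish at `w`
  let b := (pullback (ProjSpace.affι k l ≫ ProjSpace.toSpec k n)
    (Grass.chartToSpec k I)).fromSpecResidueField w
  obtain ⟨φ', hφ'⟩ := Spec.map_surjective (b ≫ pullback.fst _ _)
  obtain ⟨χ', hχ'⟩ := Spec.map_surjective (b ≫ pullback.snd _ _)
  have hφ0 : ∀ m, φ'.hom (ProjSpace.affCoord l (I m)) = 0 := fun m => by
    by_contra h
    obtain ⟨ψ', -, -, e⟩ := ProjSpace.SpecMap_affι_eq φ'.hom (I m) (isUnit_iff_ne_zero.2 h)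
    refine hcon m ?_
    obtain ⟨pt, hpt⟩ : w ∈ Set.range b := by
      rw [Scheme.range_fromSpecResidueField]; rfl
    refine ⟨Spec.map (CommRingCat.ofHom ψ') pt, ?_⟩
    rw [← Scheme.Hom.comp_apply]
    have e' : Spec.map (CommRingCat.ofHom ψ') ≫ ProjSpace.affι k (I m) =
      b ≫ boxι l I ≫ pullback.fst _ _ := by
      rw [← e]
      change Spec.map φ' ≫ _ = _
      rw [hφ', boxι, pullback.map, pullback.lift_fst, Category.assoc]
    rw [e', Scheme.Hom.comp_apply, Scheme.Hom.comp_apply, hpt, hw]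
    rfl
  have hbg : b.appTop (boxRel l I) = 1 := by
    rw [appTop_boxRel b (φ := φ'.hom) (χ := χ'.hom) hφ'.symm hχ'.symm]
    simp [hφ0]
  have hwg : w ∈ (pullback (ProjSpace.affι k l ≫ ProjSpace.toSpec k n)
      (Grass.chartToSpec k I)).basicOpen (boxRel l I) := by
    obtain ⟨pt, hpt⟩ : w ∈ Set.range b := by
      rw [Scheme.range_fromSpecResidueField]; rfl
    have : pt ∈ b ⁻¹ᵁ ((pullback (ProjSpace.affι k l ≫ ProjSpace.toSpec k n)
      (Grass.chartToSpec k I)).basicOpen (boxRel l I)) := by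
      rw [Scheme.preimage_basicOpen_top, hbg, Scheme.basicOpen_of_isUnit _ isUnit_one]
      trivial
    rw [← hpt]
    exact this
  have h0 : y₀ ∈ a ⁻¹ᵁ ((pullback (ProjSpace.affι k l ≫ ProjSpace.toSpec k n)
      (Grass.chartToSpec k I)).basicOpen (boxRel l I)) :=
    hsp.mem_open (Scheme.basicOpen _ _).isOpen hwg
  rw [Scheme.preimage_basicOpen_top, hag, Scheme.basicOpen_zero] at h0
  exact h0

/-- Let the target be the part of the incidence scheme inside a product of standard charts. The
chart is closed in that product, hence closed in the target, and it contains the generic point,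
which is dense. A surjective closed immersion into a reduced scheme is an isomorphism. -/
theorem isOpenImmersion_chartι (I : Fin q ↪o Fin (n + 1)) (j : Fin q) :
    IsOpenImmersion (chartι (k := k) I j) ∧ Set.range (chartι (k := k) I j) =
      incidence.toGrass k q n ⁻¹' Set.range (Grassmannian.ι k I) ∩
        incidence.toProj k q n ⁻¹' Set.range (ProjSpace.affι k (I j)) := by
  let a := pullback.fst (incidence.emb k q n) (boxι (I j) I)
  let b := pullback.snd (incidence.emb k q n) (boxι (I j) I)
  let t : Spec (.of (ChartRing (k := k) I j)) ⟶ pullback (incidence.emb k q n) (boxι (I j) I) :=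
    pullback.lift (chartι I j) (boxChart I j) (by rw [chartι_emb, boxChart_boxι])
  have hta : t ≫ a = chartι I j := pullback.lift_fst _ _ _
  have htb : t ≫ b = boxChart I j := pullback.lift_snd _ _ _
  have : IsClosedImmersion (incidence.emb k q n) :=
    inferInstanceAs (IsClosedImmersion (allCharts k n q).imageι)
  have hb : IsClosedImmersion b := inferInstance
  have hred : IsReduced (pullback (incidence.emb k q n) (boxι (k := k) (I j) I)) :=
    isReduced_of_isOpenImmersion a
  have htc : IsClosedImmersion t := by
    have : IsClosedImmersion (t ≫ b) := by rw [htb]; infer_instance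
    exact IsClosedImmersion.of_comp t b
  have hsurj : Surjective t := ⟨fun w => by
    have h1 : chartMap I j (genericPoint _) ⤳ boxι (I j) I (b w) := by
      rw [← Scheme.Hom.comp_apply, ← pullback.condition, Scheme.Hom.comp_apply]
      exact generic_specializes_emb I j (a w)
    rw [← boxChart_boxι, Scheme.Hom.comp_apply,
      (boxι (k := k) (I j) I).isOpenEmbedding.isInducing.specializes_iff] at h1
    obtain ⟨c, hc⟩ := h1.mem_closed (IsClosedImmersion.isClosedEmbedding
      (f := boxChart (k := k) I j)).isClosed_range ⟨_, rfl⟩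
    refine ⟨c, IsClosedImmersion.isClosedEmbedding (f := b) |>.injective ?_⟩
    rw [← Scheme.Hom.comp_apply, htb, hc]⟩
  have hiso := isIso_of_isClosedImmersion_of_surjective t
  rw [← hta]
  refine ⟨inferInstance, ?_⟩
  have h2 : Set.range (t ≫ a) = Set.range a := by
    refine Set.Subset.antisymm ?_ ?_
    · rintro _ ⟨w, rfl⟩
      exact ⟨t w, (Scheme.Hom.comp_apply _ _ _).symm⟩
    · rintro _ ⟨w, rfl⟩
      obtain ⟨w, rfl⟩ := hsurj.surj w
      exact ⟨w, Scheme.Hom.comp_apply _ _ _⟩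
  rw [h2, Scheme.Pullback.range_fst, range_boxι, Set.preimage_inter, Set.inter_comm]
  rfl

end Incidence

end IncidenceCharts

/-! ### Charts of the section scheme as polynomial rings. -/

section SectionCharts

variable {k : Type u} [Field k] {n q : ℕ}
attribute [local instance] MvPolynomial.gradedAlgebra

namespace Incidence

variable {A : Type u} [CommRing A] (I : Fin q ↪o Fin (n + 1)) (j₀ : Fin q)
  (ψ : ProjSpace.AffRing k (I j₀) →+* A)

/-- The coordinate ring of the chart of the section scheme over an affine open. -/
abbrev SectionRing (A : Type u) [CommRing A] (I : Fin q ↪o Fin (n + 1)) (j₀ : Fin q) : Type u :=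
  MvPolynomial ({j : Fin q // j ≠ j₀} × {l : Fin (n + 1) // l ∉ Set.range I}) A

open scoped Classical in
/-- The entries of the universal matrix on a chart of the section scheme. -/
def sectionEntry (p : Fin q × {l : Fin (n + 1) // l ∉ Set.range I}) : SectionRing A I j₀ :=
  if h : p.1 = j₀ then MvPolynomial.C (ψ (ProjSpace.affCoord (I j₀) p.2)) -
    ∑ j : {j : Fin q // j ≠ j₀},
      MvPolynomial.C (ψ (ProjSpace.affCoord (I j₀) (I j))) * MvPolynomial.X (j, p.2)
  else MvPolynomial.X (⟨p.1, h⟩, p.2)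

lemma sectionEntry_self (l : {l : Fin (n + 1) // l ∉ Set.range I}) :
    sectionEntry I j₀ ψ (j₀, l) = MvPolynomial.C (ψ (ProjSpace.affCoord (I j₀) l)) -
    ∑ j : {j : Fin q // j ≠ j₀},
      MvPolynomial.C (ψ (ProjSpace.affCoord (I j₀) (I j))) * MvPolynomial.X (j, l) :=
  dif_pos rfl

lemma sectionEntry_of_ne (j : {j : Fin q // j ≠ j₀}) (l : {l : Fin (n + 1) // l ∉ Set.range I}) :
    sectionEntry I j₀ ψ (j.1, l) = MvPolynomial.X (j, l) :=
  dif_neg j.2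

/-- The map from the chart of the Grassmannian to the chart of the section scheme, on functions. -/
def sectionHomGrass : Grass.ChartRing k I →+* SectionRing A I j₀ :=
  MvPolynomial.eval₂Hom (MvPolynomial.C.comp (ψ.comp (ProjSpace.affConst k (I j₀))))
    (sectionEntry I j₀ ψ)

/-- The map from the chart of the incidence scheme to the chart of the section scheme, on functions. -/
def sectionHom : ChartRing (k := k) I j₀ →+* SectionRing A I j₀ :=
  MvPolynomial.eval₂Hom (sectionHomGrass I j₀ ψ)
    (fun m => MvPolynomial.C (ψ (ProjSpace.affCoord (I j₀) (I m))))

lemma sectionHom_C (a : Grass.ChartRing k I) :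
    sectionHom I j₀ ψ (MvPolynomial.C a) = sectionHomGrass I j₀ ψ a :=
  MvPolynomial.eval₂Hom_C _ _ _

lemma sectionHomGrass_X (p : Fin q × {l : Fin (n + 1) // l ∉ Set.range I}) :
    sectionHomGrass I j₀ ψ (MvPolynomial.X p) = sectionEntry I j₀ ψ p :=
  MvPolynomial.eval₂Hom_X' _ _ _

lemma sectionHomGrass_const (a : k) : sectionHomGrass I j₀ ψ (algebraMap k _ a) =
    MvPolynomial.C (ψ (ProjSpace.affConst k (I j₀) a)) :=
  MvPolynomial.eval₂Hom_C _ _ _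

lemma sectionHom_coeff (m : Fin q) : sectionHom I j₀ ψ (coeff I j₀ m) =
    MvPolynomial.C (ψ (ProjSpace.affCoord (I j₀) (I m))) := by
  by_cases hm : m = j₀
  · subst hm
    rw [ProjSpace.affCoord_self, map_one, map_one, coeff, dif_pos rfl, map_one]
  · rw [coeff, dif_neg hm]
    exact MvPolynomial.eval₂Hom_X' _ _ _

/-- The incidence relation, solved for the entries of the `j₀`-th row. -/
lemma point_eq_add (l : {l : Fin (n + 1) // l ∉ Set.range I}) :
    point (k := k) I j₀ l = MvPolynomial.C (MvPolynomial.X (j₀, l)) +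
      ∑ j : {j : Fin q // j ≠ j₀}, coeff I j₀ j * MvPolynomial.C (MvPolynomial.X (j.1, l)) := by
  classical
  have h1 : point (k := k) I j₀ l =
      ∑ m, coeff I j₀ m * MvPolynomial.C (MvPolynomial.X (m, l)) := by
    simp only [point, Matrix.vecMul, dotProduct, Matrix.map_apply]
    refine Finset.sum_congr rfl fun m _ => ?_
    rw [Grass.univMat, dif_neg l.2]
  rw [h1, Fintype.sum_eq_add_sum_subtype_ne _ j₀]
  congr 1
  rw [coeff, dif_pos rfl, one_mul]

/-- The `j₀`-th row was defined by solving the incidence relation, so the point of the incidence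
chart is again the one given by `ψ`. -/
lemma sectionHom_affHom :
    (sectionHom I j₀ ψ).comp (affHom I j₀) = MvPolynomial.C.comp ψ := by
  apply ProjSpace.affRing_hom_ext
  · intro a
    rw [RingHom.comp_apply, RingHom.comp_apply, affHom_const]
    exact (sectionHom_C I j₀ ψ (algebraMap k _ a)).trans (sectionHomGrass_const I j₀ ψ a)
  · intro l
    rw [RingHom.comp_apply, RingHom.comp_apply, affHom_coord]
    by_cases hl : l ∈ Set.range I
    · obtain ⟨m, rfl⟩ := hl
      rw [point_apply_self, sectionHom_coeff]
    · have hs : ∀ j : {j : Fin q // j ≠ j₀}, sectionHom I j₀ ψ (coeff I j₀ j *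
          MvPolynomial.C (MvPolynomial.X (j.1, ⟨l, hl⟩))) =
          MvPolynomial.C (ψ (ProjSpace.affCoord (I j₀) (I j))) *
            MvPolynomial.X (j, ⟨l, hl⟩) := fun j => by
        rw [map_mul, sectionHom_coeff, sectionHom_C, sectionHomGrass_X, sectionEntry_of_ne]
      rw [point_eq_add I j₀ ⟨l, hl⟩, map_add, map_sum, sectionHom_C, sectionHomGrass_X,
        sectionEntry_self, Finset.sum_congr rfl fun j _ => hs j, sub_add_cancel]

/-- Solving the incidence relation for the `j₀`-th row shows that the incidence chart is an affine
space over the standard chart of projective space, with the entries of the other rows as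
coordinates. This description is preserved by base change along `ψ`. -/
theorem isPushout_sectionHom :
    IsPushout (CommRingCat.ofHom (affHom I j₀)) (CommRingCat.ofHom ψ)
      (CommRingCat.ofHom (sectionHom I j₀ ψ))
      (CommRingCat.ofHom (MvPolynomial.C (σ := {j : Fin q // j ≠ j₀} ×
        {l : Fin (n + 1) // l ∉ Set.range I}) (R := A))) := by
  have w : CommRingCat.ofHom (affHom I j₀) ≫ CommRingCat.ofHom (sectionHom I j₀ ψ) =
      CommRingCat.ofHom ψ ≫ CommRingCat.ofHom (MvPolynomial.C (σ := {j : Fin q // j ≠ j₀} ×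
        {l : Fin (n + 1) // l ∉ Set.range I}) (R := A)) := by
    rw [← CommRingCat.ofHom_comp, ← CommRingCat.ofHom_comp, sectionHom_affHom]
  refine ⟨⟨w⟩, ⟨PushoutCocone.isColimitAux' _ fun s => ?_⟩⟩
  let a : ChartRing (k := k) I j₀ →+* s.pt := s.inl.hom
  let b : A →+* s.pt := s.inr.hom
  have hab : ∀ x, a (affHom I j₀ x) = b (ψ x) := fun x => congr(($s.condition).hom x)
  -- The universal map is forced on the free rows; on the `j₀`-th row it agrees with `a` because of
  -- `point_eq_add`.
  let d : SectionRing A I j₀ →+* s.pt := MvPolynomial.eval₂Hom b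
    (fun p => a (MvPolynomial.C (MvPolynomial.X (p.1.1, p.2))))
  have hdC : ∀ x, d (MvPolynomial.C x) = b x := fun x => MvPolynomial.eval₂Hom_C _ _ _
  have hdX : ∀ p, d (MvPolynomial.X p) = a (MvPolynomial.C (MvPolynomial.X (p.1.1, p.2))) :=
    fun p => MvPolynomial.eval₂Hom_X' _ _ _
  have hc : ∀ m, b (ψ (ProjSpace.affCoord (I j₀) (I m))) = a (coeff I j₀ m) := fun m => by
    rw [← hab, affHom_coord, point_apply_self]
  have hda : d.comp (sectionHom I j₀ ψ) = a := by
    refine MvPolynomial.ringHom_ext' (MvPolynomial.ringHom_ext' ?_ ?_) ?_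
    · refine RingHom.ext fun x => ?_
      have h1 : sectionHom I j₀ ψ (MvPolynomial.C (MvPolynomial.C x)) =
          MvPolynomial.C (ψ (ProjSpace.affConst k (I j₀) x)) :=
        (sectionHom_C I j₀ ψ _).trans (sectionHomGrass_const I j₀ ψ x)
      refine (congrArg d h1).trans ((hdC _).trans ?_)
      rw [← hab, affHom_const]
      rfl
    · rintro ⟨j, l⟩
      refine (congrArg d ((sectionHom_C I j₀ ψ _).trans (sectionHomGrass_X I j₀ ψ _))).trans ?_
      by_cases hj : j = j₀
      · subst hj
        rw [sectionEntry_self, map_sub, map_sum, hdC, ← hab, affHom_coord, point_eq_add, map_add,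
          map_sum]
        refine sub_eq_of_eq_add (congrArg (_ + ·) (Finset.sum_congr rfl fun m _ => ?_))
        rw [map_mul, map_mul, hdC, hdX, hc]
      · exact (congrArg d (sectionEntry_of_ne I j₀ ψ ⟨j, hj⟩ l)).trans (hdX _)
    · intro m
      refine (congrArg d (MvPolynomial.eval₂Hom_X' _ _ _)).trans ((hdC _).trans ?_)
      rw [hc, coeff, dif_neg m.2]
  refine ⟨CommRingCat.ofHom d, ?_, ?_, ?_⟩
  · exact CommRingCat.hom_ext hda
  · exact CommRingCat.hom_ext (RingHom.ext hdC)
  · intro m h1 h2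
    refine CommRingCat.hom_ext (MvPolynomial.ringHom_ext (fun x => ?_) (fun p => ?_))
    · exact congr(($h2).hom x).trans (hdC x).symm
    · refine Eq.trans ?_ (hdX p).symm
      have h3 := congr(($h1).hom (MvPolynomial.C (MvPolynomial.X (p.1.1, p.2))))
      refine Eq.trans ?_ h3
      refine congrArg m.hom ?_
      exact ((sectionHom_C I j₀ ψ _).trans ((sectionHomGrass_X I j₀ ψ _).trans
        (sectionEntry_of_ne I j₀ ψ p.1 p.2))).symm

end Incidence

namespace sectionScheme

open Incidence

variable {X : Scheme.{u}} {f : X ⟶ ProjSpace k n} {A : Type u} [CommRing A]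

/-- The charts of the section scheme. -/
theorem exists_chart (I : Fin q ↪o Fin (n + 1)) (j₀ : Fin q)
    (ψ : ProjSpace.AffRing k (I j₀) →+* A) (g : Spec (.of A) ⟶ X) [IsOpenImmersion g]
    (hg : g ≫ f = Spec.map (CommRingCat.ofHom ψ) ≫ ProjSpace.affι k (I j₀)) :
    ∃ h : Spec (.of (SectionRing A I j₀)) ⟶ sectionScheme f q, IsOpenImmersion h ∧
      h ≫ toX f q = Spec.map (CommRingCat.ofHom MvPolynomial.C) ≫ g ∧
      h ≫ toGrass f q = Spec.map (CommRingCat.ofHom (sectionHomGrass I j₀ ψ)) ≫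
        Grassmannian.ι k I ∧
      Set.range h = toGrass f q ⁻¹' Set.range (Grassmannian.ι k I) ∩ toX f q ⁻¹' Set.range g := by
  obtain ⟨ho, hrange⟩ := isOpenImmersion_chartι (k := k) I j₀
  have hP := isPullback_SpecMap_of_isPushout _ _ _ _ (isPushout_sectionHom I j₀ ψ)
  have e₁ : Spec.map (CommRingCat.ofHom (affHom I j₀)) ≫ ProjSpace.affι k (I j₀) =
      chartι I j₀ ≫ incidence.toProj k q n := by
    rw [incidence.toProj, ← Category.assoc, chartι_emb, chartMap_fst]
  let m := pullback.map (Spec.map (CommRingCat.ofHom (affHom I j₀)))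
    (Spec.map (CommRingCat.ofHom ψ)) (incidence.toProj k q n) f (chartι I j₀) g
    (ProjSpace.affι k (I j₀)) e₁ hg.symm
  have hm : IsOpenImmersion m := inferInstance
  refine ⟨hP.isoPullback.hom ≫ m, inferInstance, ?_, ?_, ?_⟩
  · simp only [toX, m, pullback.map, Category.assoc, pullback.lift_snd]
    rw [← Category.assoc, hP.isoPullback_hom_snd]
  · have h1 : chartι I j₀ ≫ incidence.toGrass k q n =
        Spec.map (CommRingCat.ofHom MvPolynomial.C) ≫ Grassmannian.ι k I := by
      rw [incidence.toGrass, ← Category.assoc, chartι_emb, chartMap_snd]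
    simp only [toGrass, m, pullback.map, Category.assoc, pullback.lift_fst_assoc, h1]
    rw [← Category.assoc, hP.isoPullback_hom_fst, ← Spec.map_comp_assoc, ← CommRingCat.ofHom_comp]
    congr 3
    exact RingHom.ext fun a => sectionHom_C I j₀ ψ a
  · have h1 : Set.range (hP.isoPullback.hom ≫ m) = Set.range m := by
      refine Set.Subset.antisymm ?_ ?_
      · rintro _ ⟨w, rfl⟩
        exact ⟨hP.isoPullback.hom w, (Scheme.Hom.comp_apply _ _ _).symm⟩
      · rintro _ ⟨w, rfl⟩
        obtain ⟨w, rfl⟩ := hP.isoPullback.hom.surjective w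
        exact ⟨w, Scheme.Hom.comp_apply _ _ _⟩
    have h2 : Set.range m = pullback.fst (incidence.toProj k q n) f ⁻¹' Set.range (chartι I j₀) ∩
        pullback.snd (incidence.toProj k q n) f ⁻¹' Set.range g :=
      Scheme.Pullback.range_map _ _ _ _ _ _ _ _ _
    rw [h1, h2, hrange]
    ext z
    constructor
    · rintro ⟨⟨hz1, -⟩, hz3⟩
      exact ⟨by simpa [toGrass] using hz1, hz3⟩
    · rintro ⟨hz1, hz3⟩
      -- The condition on projective coordinates follows from the one on `X`, because `g ≫ f`
      -- factors through the standard chart.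
      refine ⟨⟨by simpa [toGrass] using hz1, ?_⟩, hz3⟩
      obtain ⟨a, ha⟩ := hz3
      change incidence.toProj k q n (pullback.fst (incidence.toProj k q n) f z) ∈ Set.range (ProjSpace.affι k (I j₀))
      rw [← Scheme.Hom.comp_apply, pullback.condition, Scheme.Hom.comp_apply]
      change f (toX f q z) ∈ Set.range (ProjSpace.affι k (I j₀))
      rw [← ha, ← Scheme.Hom.comp_apply, hg, Scheme.Hom.comp_apply]
      exact ⟨_, rfl⟩

end sectionScheme

end SectionCharts

/-! ### The small étale site, and units and charts of log structures. -/

section SmallEtaleSite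

variable {X : Scheme.{u}}

/-- A morphism of the small étale site from a morphism of schemes over `X`. -/
def etHom {V V' : X.Etale} (j : EtSpace V' ⟶ EtSpace V) (h : j ≫ etStr V = etStr V') : V' ⟶ V :=
  (Scheme.Etale.forgetFullyFaithful X).preimage (Over.homMk j h)

@[simp]
lemma etMor_etHom {V V' : X.Etale} (j : EtSpace V' ⟶ EtSpace V) (h : j ≫ etStr V = etStr V') :
    etMor (etHom j h) = j :=
  congrArg CommaMorphism.left ((Scheme.Etale.forgetFullyFaithful X).map_preimage _)

lemma etMor_w {V V' : X.Etale} (j : V' ⟶ V) : etMor j ≫ etStr V = etStr V' :=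
  Over.w ((Scheme.Etale.forget X).map j)

lemma etMor_w_assoc {V V' : X.Etale} (j : V' ⟶ V) {Z : Scheme.{u}} (h : X ⟶ Z) :
    etMor j ≫ etStr V ≫ h = etStr V' ≫ h := by
  rw [← etMor_w j, Category.assoc]

@[simp]
lemma etMor_id (V : X.Etale) : etMor (𝟙 V) = 𝟙 _ := by
  simp [etMor]

@[simp]
lemma etMor_comp {V V' V'' : X.Etale} (i : V'' ⟶ V') (j : V' ⟶ V) :
    etMor (i ≫ j) = etMor i ≫ etMor j := by
  simp [etMor]

instance {V V' : X.Etale} (j : V' ⟶ V) : Etale (etMor j) := by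
  have : Etale (etMor j ≫ etStr V) := by rw [etMor_w]; infer_instance
  exact Etale.of_comp (etMor j) (etStr V)

/-- The étale `X`-scheme given by an étale morphism to an étale `X`-scheme. -/
abbrev etOver (V : X.Etale) {V' : Scheme.{u}} (j : V' ⟶ EtSpace V) [Etale j] : X.Etale :=
  Scheme.Etale.mk (j ≫ etStr V)

/-- Its structure morphism. -/
abbrev etOverHom (V : X.Etale) {V' : Scheme.{u}} (j : V' ⟶ EtSpace V) [Etale j] :
    etOver V j ⟶ V :=
  etHom (V' := etOver V j) j rfl

end SmallEtaleSite

namespace LogStructure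

variable {X : Scheme.{u}} (M : LogStructure X)

lemma res_id {V : X.Etale} (m : M.Sec V) : M.res (𝟙 V) m = m := by
  change M.sheaf.obj.map (𝟙 V).op m = m
  rw [op_id, M.sheaf.obj.map_id]; rfl

lemma res_res {V V' V'' : X.Etale} (i : V'' ⟶ V') (j : V' ⟶ V) (m : M.Sec V) :
    M.res i (M.res j m) = M.res (i ≫ j) m := by
  change _ = M.sheaf.obj.map (i ≫ j).op m
  rw [op_comp, M.sheaf.obj.map_comp]; rfl

lemma α_res' {V V' : X.Etale} (j : V' ⟶ V) (m : M.Sec V) :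
    M.α V' (M.res j m) = (etMor j).appTop (M.α V m) := M.α_res j m

/-- Sections that agree locally are equal. -/
lemma sec_ext {V : X.Etale} {m m' : M.Sec V} (h : ∀ v : EtSpace V, ∃ (V' : X.Etale) (j : V' ⟶ V)
    (_ : v ∈ Set.range (etMor j)), M.res j m = M.res j m') : m = m' := by
  choose V' j hv hj using h
  have hS : Sieve.ofArrows V' j ∈ X.smallEtaleTopology V := by
    rw [Scheme.ofArrows_mem_smallEtaleTopology_iff]
    exact Set.eq_univ_of_forall fun v => Set.mem_iUnion.2 ⟨v, hv v⟩
  -- The sheaf condition concerns morphisms out of test objects. The free monoid on one generator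
  -- represents sections.
  let E : CommMonCat.{u} := .of (ULift.{u} (Multiplicative ℕ))
  let q (x : M.Sec V) : E ⟶ M.sheaf.obj.obj (op V) :=
    CommMonCat.ofHom ((powersHom _ x).comp MulEquiv.ulift.toMonoidHom)
  have hq (x : M.Sec V) : (q x).hom ⟨Multiplicative.ofAdd 1⟩ = x := pow_one x
  have hext : ∀ {W : CommMonCat.{u}} {a b : E ⟶ W},
      a.hom ⟨Multiplicative.ofAdd 1⟩ = b.hom ⟨Multiplicative.ofAdd 1⟩ → a = b := fun {W a b} h => by
    have : a.hom.comp MulEquiv.ulift.symm.toMonoidHom = b.hom.comp MulEquiv.ulift.symm.toMonoidHom :=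
      MonoidHom.ext_mnat h
    ext x
    exact congr($this x.down)
  have h1 : q m = q m' := by
    refine ((M.sheaf.property E).isSeparated _ hS).ext ?_
    rintro Y f ⟨_, a, _, ⟨v⟩, rfl⟩
    refine hext ?_
    change M.res (a ≫ j v) ((q m).hom _) = M.res (a ≫ j v) ((q m').hom _)
    rw [hq, hq, ← res_res, ← res_res, hj]
  rw [← hq m, ← hq m', h1]

variable {M}

lemma unit_ext {V : X.Etale} {a b : (M.Sec V)ˣ} (h : M.α V a = M.α V b) : a = b :=
  Units.ext ((M.existsUnique_unit V (Units.map (M.α V) b)).unique h rfl)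

/-- Take the section over the inverse function; the product lies over `1`, and there is only one
such section. -/
lemma isUnit_of_isUnit_α {V : X.Etale} {m : M.Sec V} (h : IsUnit (M.α V m)) : IsUnit m := by
  obtain ⟨m', hm', -⟩ := M.existsUnique_unit V h.unit⁻¹
  refine IsUnit.of_mul_eq_one m' ?_
  refine (M.existsUnique_unit V 1).unique ?_ (map_one _)
  rw [map_mul, hm', Units.val_one]
  exact h.mul_val_inv

variable (M) in
/-- The unit of the log structure given by a unit function. -/
def unitSec (V : X.Etale) (a : Γ(EtSpace V, ⊤)ˣ) : (M.Sec V)ˣ :=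
  (isUnit_of_isUnit_α (M := M) (m := (M.existsUnique_unit V a).choose) (by
    rw [(M.existsUnique_unit V a).choose_spec.1]; exact a.isUnit)).unit

lemma α_unitSec (V : X.Etale) (a : Γ(EtSpace V, ⊤)ˣ) : M.α V (M.unitSec V a) = a :=
  (M.existsUnique_unit V a).choose_spec.1

namespace IsChart

variable {P : Type u} [CommMonoid P] {V : X.Etale} {β : P →* M.Sec V}

lemma restrict (hβ : M.IsChart β) {V' : X.Etale} (j : V' ⟶ V) :
    M.IsChart ((M.res j).comp β) := by
  refine ⟨fun V₁ j₁ m v => ?_, fun V₁ j₁ p q a b v h => ?_⟩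
  · obtain ⟨V₂, i, hv, p, a, h⟩ := hβ.1 V₁ (j₁ ≫ j) m v
    refine ⟨V₂, i, hv, p, a, ?_⟩
    rw [MonoidHom.comp_apply, res_res, Category.assoc]
    exact h
  · simp only [MonoidHom.comp_apply, res_res] at h
    obtain ⟨V₂, i, hv, c, d, hc, hd, h1, h2⟩ := hβ.2 V₁ (j₁ ≫ j) p q a b v h
    refine ⟨V₂, i, hv, c, d, ?_, ?_, h1, ?_⟩
    · rw [MonoidHom.comp_apply, res_res, Category.assoc]; exact hc
    · rw [MonoidHom.comp_apply, res_res, Category.assoc]; exact hd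
    · rw [MonoidHom.comp_apply, res_res, MonoidHom.comp_apply, res_res, Category.assoc]; exact h2

/-- Units can be cancelled in the presence of a chart by a cancellative monoid. -/
lemma mul_unit_cancel [IsCancelMul P] (hβ : M.IsChart β) {V' : X.Etale} (j : V' ⟶ V)
    {m : M.Sec V'} {a b : (M.Sec V')ˣ} (h : m * a = m * b) : a = b := by
  refine Units.ext (M.sec_ext fun v => ?_)
  obtain ⟨V₁, i, ⟨v₁, rfl⟩, p, w, hm⟩ := hβ.1 V' j m v
  have h1 : M.res (i ≫ j) (β p) * ((w * Units.map (M.res i) a : (M.Sec V₁)ˣ) : M.Sec V₁) =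
      M.res (i ≫ j) (β p) * ((w * Units.map (M.res i) b : (M.Sec V₁)ˣ) : M.Sec V₁) := by
    rw [Units.val_mul, Units.val_mul, ← mul_assoc, ← mul_assoc, ← hm]
    change M.res i m * M.res i a = M.res i m * M.res i b
    rw [← map_mul, ← map_mul, h]
  obtain ⟨V₂, i', ⟨v₂, rfl⟩, c, d, hc, hd, h2, h3⟩ := hβ.2 V₁ (i ≫ j) p p _ _ v₁ h1
  obtain rfl := mul_left_cancel h2
  refine ⟨V₂, i' ≫ i, ⟨v₂, by rw [etMor_comp, Scheme.Hom.comp_apply]⟩, ?_⟩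
  have h4 := hc.mul_left_cancel h3
  rw [Units.val_mul, Units.val_mul, map_mul, map_mul] at h4
  have h5 := ((Units.map (M.res i') w).isUnit).mul_left_cancel h4
  change M.res i' (M.res i a) = M.res i' (M.res i b) at h5
  rwa [res_res, res_res] at h5

/-- A chart can be enlarged by units. -/
lemma prod_units (hβ : M.IsChart β) {L : Type u} [CommGroup L] (w : L →* (M.Sec V)ˣ) :
    M.IsChart ((β.comp (MonoidHom.fst P L)) *
      ((Units.coeHom _).comp (w.comp (MonoidHom.snd P L)))) := by
  have hval : ∀ (V' : X.Etale) (j : V' ⟶ V) (x : P × L),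
      M.res j (((β.comp (MonoidHom.fst P L)) *
        ((Units.coeHom _).comp (w.comp (MonoidHom.snd P L)))) x) =
      M.res j (β x.1) * ((Units.map (M.res j) (w x.2) : (M.Sec V')ˣ) : M.Sec V') := fun V' j x => by
    simp
  refine ⟨fun V₁ j₁ m v => ?_, fun V₁ j₁ p q a b v h => ?_⟩
  · obtain ⟨V₂, i, hv, p, a, h⟩ := hβ.1 V₁ j₁ m v
    refine ⟨V₂, i, hv, (p, 1), a, ?_⟩
    rw [hval, map_one, map_one, Units.val_one, mul_one]
    exact h
  · rw [hval, hval, mul_assoc, mul_assoc, ← Units.val_mul, ← Units.val_mul] at h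
    obtain ⟨V₂, i, hv, c, d, hc, hd, h1, h2⟩ := hβ.2 V₁ j₁ p.1 q.1 _ _ v h
    -- The second components are units in any case, and these values make the group parts of `p * c`
    -- and `q * d` equal to `1`.
    refine ⟨V₂, i, hv, (c, p.2⁻¹), (d, q.2⁻¹), ?_, ?_, ?_, ?_⟩
    · rw [hval]; exact hc.mul (Units.isUnit _)
    · rw [hval]; exact hd.mul (Units.isUnit _)
    · exact Prod.ext h1 ((mul_inv_cancel _).trans (mul_inv_cancel _).symm)
    · rw [hval, hval]
      have e : ∀ l : L, Units.map (M.res i) (Units.map (M.res j₁) (w l)) =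
          Units.map (M.res (i ≫ j₁)) (w l) := fun l => Units.ext (res_res M i j₁ _)
      have h3 : M.res (i ≫ j₁) (β d) * ((Units.map (M.res (i ≫ j₁)) (w p.2) *
          Units.map (M.res i) a : (M.Sec V₂)ˣ) : M.Sec V₂) =
          M.res (i ≫ j₁) (β c) * ((Units.map (M.res (i ≫ j₁)) (w q.2) *
          Units.map (M.res i) b : (M.Sec V₂)ˣ) : M.Sec V₂) := by
        rw [← e, ← e, ← map_mul, ← map_mul]; exact h2
      rw [map_inv, map_inv, map_inv, map_inv]
      set x := Units.map (M.res (i ≫ j₁)) (w p.2)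
      set y := Units.map (M.res (i ≫ j₁)) (w q.2)
      change M.res (i ≫ j₁) (β d) * ((y⁻¹ : (M.Sec V₂)ˣ) : M.Sec V₂) *
          (Units.map (M.res i) a : (M.Sec V₂)ˣ) =
        M.res (i ≫ j₁) (β c) * ((x⁻¹ : (M.Sec V₂)ˣ) : M.Sec V₂) *
          (Units.map (M.res i) b : (M.Sec V₂)ˣ)
      apply (x * y).isUnit.mul_left_cancel
      have e1 : ((x * y : (M.Sec V₂)ˣ) : M.Sec V₂) * (M.res (i ≫ j₁) (β d) *
          ((y⁻¹ : (M.Sec V₂)ˣ) : M.Sec V₂) * (Units.map (M.res i) a : (M.Sec V₂)ˣ)) =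
          M.res (i ≫ j₁) (β d) * ((x * Units.map (M.res i) a : (M.Sec V₂)ˣ) : M.Sec V₂) := by
        rw [mul_assoc, ← Units.val_mul, mul_left_comm, ← Units.val_mul]
        congr 2; group
      have e2 : ((x * y : (M.Sec V₂)ˣ) : M.Sec V₂) * (M.res (i ≫ j₁) (β c) *
          ((x⁻¹ : (M.Sec V₂)ˣ) : M.Sec V₂) * (Units.map (M.res i) b : (M.Sec V₂)ˣ)) =
          M.res (i ≫ j₁) (β c) * ((y * Units.map (M.res i) b : (M.Sec V₂)ˣ) : M.Sec V₂) := by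
        rw [mul_assoc, ← Units.val_mul, mul_left_comm, ← Units.val_mul, mul_comm x y]
        congr 2; group
      rw [e1, e2, h3]

end IsChart

end LogStructure

/-! ### Composition of morphisms of log schemes, and charts of inverse images. -/

namespace LogHom

variable {X Y Z : Scheme.{u}} {M : LogStructure X} {N : LogStructure Y} {K : LogStructure Z}
  {f : X ⟶ Y} {g : Y ⟶ Z} (φ : LogHom M N f)

lemma res_map {V V' : X.Etale} {W : Y.Etale} (a : EtSpace V ⟶ EtSpace W)
    (ha : a ≫ etStr W = etStr V ≫ f) (j : V' ⟶ V) (a' : EtSpace V' ⟶ EtSpace W)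
    (h : a' = etMor j ≫ a) (n : N.Sec W) :
    M.res j (φ.map a ha n) = φ.map a' (by rw [h, Category.assoc, ha, etMor_w_assoc]) n := by
  have := φ.map_res a ha a' (by rw [h, Category.assoc, ha, etMor_w_assoc]) j (𝟙 W)
    (by rw [etMor_id, Category.comp_id, h]) n
  rw [N.res_id] at this
  exact this.symm

lemma map_res' {V : X.Etale} {W W' : Y.Etale} (a : EtSpace V ⟶ EtSpace W')
    (ha : a ≫ etStr W' = etStr V ≫ f) (i : W' ⟶ W) (a' : EtSpace V ⟶ EtSpace W)
    (h : a' = a ≫ etMor i) (n : N.Sec W) :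
    φ.map a ha (N.res i n) = φ.map a' (by rw [h, Category.assoc, etMor_w, ha]) n := by
  have := φ.map_res a' (by rw [h, Category.assoc, etMor_w, ha]) a ha (𝟙 V) i
    (by rw [etMor_id, Category.id_comp, h]) n
  rw [M.res_id] at this
  exact this

/-- The composite is defined through a fibre product; by naturality it can be computed through any
étale scheme that factors the given morphism. -/
lemma comp_map (ψ : LogHom N K g) {h : X ⟶ Z} (w : f ≫ g = h) {V : X.Etale} {V₂ : Y.Etale}
    {W : Z.Etale} (a : EtSpace V ⟶ EtSpace W) (ha : a ≫ etStr W = etStr V ≫ h)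
    (b : EtSpace V ⟶ EtSpace V₂) (hb : b ≫ etStr V₂ = etStr V ≫ f)
    (c : EtSpace V₂ ⟶ EtSpace W) (hc : c ≫ etStr W = etStr V₂ ≫ g) (hbc : b ≫ c = a) (n : K.Sec W) :
    (φ.comp ψ w).map a ha n = φ.map b hb (ψ.map c hc n) := by
  let W' : Y.Etale := Scheme.Etale.mk (pullback.snd (etStr W) g)
  let t : V₂ ⟶ W' := etHom (V := W') (pullback.lift c (etStr V₂) hc) (pullback.lift_snd _ _ _)
  have ht : etMor t = pullback.lift c (etStr V₂) hc := etMor_etHom _ _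
  have e1 := ψ.res_map (V := W') (pullback.fst (etStr W) g) pullback.condition t c
    (by rw [ht]; exact (pullback.lift_fst _ _ _).symm) n
  rw [← e1]
  have hl : a ≫ etStr W = (etStr V ≫ f) ≫ g := by rw [ha, Category.assoc, w]
  refine (φ.map_res' b hb t (pullback.lift a (etStr V ≫ f) hl) ?_ _).symm
  rw [ht]
  apply pullback.hom_ext
  · rw [pullback.lift_fst]
    exact (hbc.symm.trans (congrArg (b ≫ ·) (pullback.lift_fst _ _ _).symm)).trans
      (Category.assoc _ _ _).symm
  · rw [pullback.lift_snd]
    exact (hb.symm.trans (congrArg (b ≫ ·) (pullback.lift_snd _ _ _).symm)).trans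
      (Category.assoc _ _ _).symm

end LogHom

section SmallEtaleSite

variable {X Y : Scheme.{u}}

/-- Étale neighbourhoods of the target can be lifted to the source. -/
lemma exists_etale_lift {V : X.Etale} {W W₂ : Y.Etale} (g : EtSpace V ⟶ EtSpace W) (i : W₂ ⟶ W)
    (v : EtSpace V) (hv : g v ∈ Set.range (etMor i)) : ∃ (V₂ : X.Etale) (j : V₂ ⟶ V)
      (g₂ : EtSpace V₂ ⟶ EtSpace W₂), v ∈ Set.range (etMor j) ∧ g₂ ≫ etMor i = etMor j ≫ g := by
  obtain ⟨w, hw⟩ := hv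
  obtain ⟨z, hz, -⟩ := Scheme.Pullback.exists_preimage_pullback v w hw.symm
  have h := etMor_etHom (V' := etOver V (pullback.fst g (etMor i))) (pullback.fst g (etMor i)) rfl
  exact ⟨etOver V (pullback.fst g (etMor i)), etOverHom V _, pullback.snd g (etMor i),
    ⟨z, congr($h z).trans hz⟩, pullback.condition.symm.trans (congrArg (· ≫ g) h).symm⟩

/-- Products in the small étale site. -/
lemma exists_etale_prod (W W' : Y.Etale) : ∃ (W₂ : Y.Etale) (i : W₂ ⟶ W) (i' : W₂ ⟶ W'),
    ∀ (V : Scheme.{u}) (a : V ⟶ EtSpace W) (a' : V ⟶ EtSpace W'), a ≫ etStr W = a' ≫ etStr W' →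
      ∃ b : V ⟶ EtSpace W₂, b ≫ etMor i = a ∧ b ≫ etMor i' = a' := by
  let W₂ : Y.Etale := Scheme.Etale.mk (pullback.fst (etStr W) (etStr W') ≫ etStr W)
  exact ⟨W₂, etHom (V' := W₂) (pullback.fst _ _) rfl,
    etHom (V' := W₂) (pullback.snd _ _) pullback.condition.symm, fun V a a' h =>
      ⟨pullback.lift a a' h,
        (congrArg (pullback.lift a a' h ≫ ·) (etMor_etHom (V' := W₂) _ _)).trans
          (pullback.lift_fst _ _ _),
        (congrArg (pullback.lift a a' h ≫ ·) (etMor_etHom (V' := W₂) _ _)).trans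
          (pullback.lift_snd _ _ _)⟩⟩

end SmallEtaleSite

namespace LogHom

variable {X Y : Scheme.{u}} {M : LogStructure X} {N : LogStructure Y} {f : X ⟶ Y}
  {φ : LogHom M N f}

/-- The image of a unit section. -/
abbrev mapUnits (φ : LogHom M N f) {V : X.Etale} {W : Y.Etale} (g : EtSpace V ⟶ EtSpace W)
    (hg : g ≫ etStr W = etStr V ≫ f) : (N.Sec W)ˣ →* (M.Sec V)ˣ := Units.map (φ.map g hg)

/-- The inverse image of a chart under a strict morphism is a chart. -/
theorem IsStrict.isChart (hφ : φ.IsStrict) {V : X.Etale} {W : Y.Etale} (a : EtSpace V ⟶ EtSpace W)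
    (ha : a ≫ etStr W = etStr V ≫ f) {P : Type u} [CommMonoid P] {β : P →* N.Sec W}
    (hβ : N.IsChart β) : M.IsChart ((φ.map a ha).comp β) := by
  refine ⟨fun V₁ j₁ m v => ?_, fun V₁ j₁ p q x y v h => ?_⟩
  · obtain ⟨V₂, j, ⟨v₂, rfl⟩, W', g', hg', n, b, h⟩ := hφ.1 V₁ m v
    obtain ⟨Wp, i₁, i₂, hp⟩ := exists_etale_prod W' W
    obtain ⟨t, ht₁, ht₂⟩ := hp _ g' (etMor j ≫ etMor j₁ ≫ a)
      (by simp only [hg', Category.assoc, ha, etMor_w_assoc])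
    obtain ⟨W₃, i, hw, r, c, hc⟩ := hβ.1 Wp i₂ (N.res i₁ n) (t v₂)
    obtain ⟨V₃, l, g₃, ⟨v₃, rfl⟩, hg₃⟩ := exists_etale_lift t i v₂ hw
    have hg₃' : g₃ ≫ etStr W₃ = etStr V₃ ≫ f := by
      rw [← etMor_w i, reassoc_of% hg₃, ← etMor_w i₁, reassoc_of% ht₁, hg', etMor_w_assoc]
    refine ⟨V₃, l ≫ j, ⟨v₃, by rw [etMor_comp, Scheme.Hom.comp_apply]⟩, r,
      φ.mapUnits g₃ hg₃' c * Units.map (M.res l) b, ?_⟩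
    have e1 : φ.map g₃ hg₃' (N.res i (N.res i₁ n)) = M.res l (φ.map g' hg' n) := by
      rw [N.res_res]
      refine (φ.map_res' g₃ hg₃' _ _ rfl n).trans (φ.res_map g' hg' l _ ?_ n).symm
      rw [etMor_comp, reassoc_of% hg₃, ht₁]
    have e2 : φ.map g₃ hg₃' (N.res (i ≫ i₂) (β r)) = M.res ((l ≫ j) ≫ j₁) (φ.map a ha (β r)) := by
      refine (φ.map_res' g₃ hg₃' _ _ rfl _).trans (φ.res_map a ha _ _ ?_ _).symm
      simp only [etMor_comp, reassoc_of% hg₃, ht₂, Category.assoc]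
    rw [← M.res_res, h, map_mul, Units.val_mul, ← mul_assoc, ← e1, hc, map_mul, e2]
    rfl
  · have h' := h
    rw [MonoidHom.comp_apply, MonoidHom.comp_apply, φ.res_map a ha j₁ _ rfl,
      φ.res_map a ha j₁ _ rfl] at h'
    obtain ⟨V₂, j, ⟨v₂, rfl⟩, W', i, g', hg', hgi, c, d, hc, hd, hcd, hxy⟩ :=
      hφ.2 V₁ W (etMor j₁ ≫ a) (by rw [Category.assoc, ha, etMor_w_assoc]) _ _ x y v h'
    -- the sections `c` and `d` in terms of the chart
    obtain ⟨W₁, i₁, hw₁, r, c', hc'⟩ := hβ.1 W' i c (g' v₂)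
    obtain ⟨V₃, l₁, g₁, ⟨v₃, rfl⟩, hg₁⟩ := exists_etale_lift g' i₁ v₂ hw₁
    obtain ⟨W₂, i₂, hw₂, s, d', hd'⟩ := hβ.1 W₁ (i₁ ≫ i) (N.res i₁ d) (g₁ v₃)
    obtain ⟨V₄, l₂, g₂, ⟨v₄, rfl⟩, hg₂⟩ := exists_etale_lift g₁ i₂ v₃ hw₂
    -- Strictness compares the two sections only after multiplication by `c` and `d`. With these
    -- written as `β r` and `β s` times units, the comparison becomes a relation in the chart of
    -- `N`, whose local injectivity applies.
    have hpq : N.res (i₂ ≫ i₁ ≫ i) (β (p * r)) * (Units.map (N.res i₂) c' : (N.Sec W₂)ˣ) =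
        N.res (i₂ ≫ i₁ ≫ i) (β (q * s)) * d' := by
      have := congrArg (N.res i₂) (congrArg (N.res i₁) hcd)
      simp only [map_mul, hc', hd', N.res_res] at this
      rw [map_mul, map_mul, map_mul, map_mul, mul_assoc, mul_assoc]
      exact this
    obtain ⟨W₃, i₃, hw₃, e, e', he, he', hee, hu⟩ := hβ.2 W₂ (i₂ ≫ i₁ ≫ i) _ _ _ _ (g₂ v₄) hpq
    obtain ⟨V₅, l₃, g₃, ⟨v₅, rfl⟩, hg₃⟩ := exists_etale_lift g₂ i₃ v₄ hw₃
    have hg₃' : g₃ ≫ etStr W₃ = etStr V₅ ≫ f := by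
      rw [← etMor_w i₃, reassoc_of% hg₃, ← etMor_w i₂, reassoc_of% hg₂, ← etMor_w i₁,
        reassoc_of% hg₁, hg', etMor_w_assoc, etMor_w_assoc, etMor_w_assoc]
    have hβres : ∀ z : P, M.res ((l₃ ≫ l₂ ≫ l₁ ≫ j) ≫ j₁) (φ.map a ha (β z)) =
        φ.map g₃ hg₃' (N.res (i₃ ≫ i₂ ≫ i₁ ≫ i) (β z)) := fun z => by
      refine (φ.res_map a ha _ _ ?_ _).trans (φ.map_res' g₃ hg₃' _ _ rfl _).symm
      simp only [etMor_comp, reassoc_of% hg₃, reassoc_of% hg₂, reassoc_of% hg₁, hgi, Category.assoc]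
    have hcres : ∀ z : N.Sec W', M.res (l₃ ≫ l₂ ≫ l₁) (φ.map g' hg' z) =
        φ.map g₃ hg₃' (N.res (i₃ ≫ i₂ ≫ i₁) z) := fun z => by
      refine (φ.res_map g' hg' _ _ ?_ _).trans (φ.map_res' g₃ hg₃' _ _ rfl _).symm
      simp only [etMor_comp, reassoc_of% hg₃, reassoc_of% hg₂, hg₁, Category.assoc]
    let ρ := φ.map g₃ hg₃'
    let B : P → M.Sec V₅ := fun z => ρ (N.res (i₃ ≫ i₂ ≫ i₁ ≫ i) (β z))
    have hB : ∀ z z', B (z * z') = B z * B z' := fun z z' => by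
      simp only [B, map_mul]
    let C' : (M.Sec V₅)ˣ := Units.map (ρ.comp (N.res (i₃ ≫ i₂))) c'
    let D' : (M.Sec V₅)ˣ := Units.map (ρ.comp (N.res i₃)) d'
    have hC : M.res (l₃ ≫ l₂ ≫ l₁) (φ.map g' hg' c) = B r * C' := by
      rw [hcres, ← Category.assoc, ← N.res_res, hc', map_mul, map_mul, N.res_res]
      simp only [Category.assoc]
      rfl
    have hD : M.res (l₃ ≫ l₂ ≫ l₁) (φ.map g' hg' d) = B s * D' := by
      rw [hcres, ← N.res_res, ← N.res_res, hd', map_mul, map_mul, N.res_res]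
      rfl
    have hBe : IsUnit (B e) := he.map ρ
    have hBe' : IsUnit (B e') := he'.map ρ
    have hu' : B e' * C' = B e * D' := by
      have h1 := congrArg ρ hu
      rw [map_mul, map_mul] at h1
      have e1 : (C' : M.Sec V₅) = ρ (N.res i₃ (Units.map (N.res i₂) c' : (N.Sec W₂)ˣ)) :=
        congrArg ρ (N.res_res _ _ _).symm
      rw [e1]
      exact h1
    have hxy' : B s * D' * M.res (l₃ ≫ l₂ ≫ l₁ ≫ j) x = B r * C' * M.res (l₃ ≫ l₂ ≫ l₁ ≫ j) y := by
      have h1 := congrArg (M.res (l₃ ≫ l₂ ≫ l₁)) hxy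
      rw [map_mul, map_mul, hC, hD, M.res_res, M.res_res] at h1
      simpa only [Category.assoc] using h1
    have hr : IsUnit (B r * C') := by rw [← hC]; exact hc.map _
    have hs : IsUnit (B s * D') := by rw [← hD]; exact hd.map _
    -- The witnesses combine the factors `r`, `s` from strictness with the factors `e`, `e'` from
    -- the chart of `N`.
    refine ⟨V₅, l₃ ≫ l₂ ≫ l₁ ≫ j, ⟨v₅, by simp only [etMor_comp, Scheme.Hom.comp_apply]⟩,
      r * e, s * e', ?_, ?_, ?_, ?_⟩
    · rw [MonoidHom.comp_apply, hβres]
      change IsUnit (B (r * e))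
      rw [hB]
      exact (isUnit_of_mul_isUnit_left hr).mul hBe
    · rw [MonoidHom.comp_apply, hβres]
      change IsUnit (B (s * e'))
      rw [hB]
      exact (isUnit_of_mul_isUnit_left hs).mul hBe'
    · rw [← mul_assoc, ← mul_assoc]; exact hee
    · rw [MonoidHom.comp_apply, hβres, MonoidHom.comp_apply, hβres]
      change B (s * e') * _ = B (r * e) * _
      rw [hB, hB]
      apply D'.isUnit.mul_left_cancel
      calc (D' : M.Sec V₅) * (B s * B e' * M.res (l₃ ≫ l₂ ≫ l₁ ≫ j) x)
          = (B s * D' * M.res (l₃ ≫ l₂ ≫ l₁ ≫ j) x) * B e' := by ac_rfl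
        _ = (B e' * C') * (B r * M.res (l₃ ≫ l₂ ≫ l₁ ≫ j) y) := by rw [hxy']; ac_rfl
        _ = _ := by rw [hu']; ac_rfl

end LogHom

/-! ### Monoid algebras and groups of products. -/

section ToSpecMonoidAlgebra

variable {P Q : Type u} [CommMonoid P] [CommMonoid Q]

/-- The morphism to `Spec ℤ[P]` given by a homomorphism from `P` to the global functions. -/
def AlgebraicGeometry.Scheme.toSpecMA {T : Scheme.{u}} (a : P →* Γ(T, ⊤)) :
    T ⟶ Spec (.of (MonoidAlgebra ℤ P)) :=
  T.toSpecΓ ≫ Spec.map (CommRingCat.ofHom (MonoidAlgebra.lift ℤ Γ(T, ⊤) P a).toRingHom)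

lemma LogStructure.toSpecMonoidAlgebra_eq {X : Scheme.{u}} (M : LogStructure X) {V : X.Etale}
    (β : P →* M.Sec V) : M.toSpecMonoidAlgebra β = Scheme.toSpecMA ((M.α V).comp β) := rfl

lemma MonoidAlgebra.intRingHom_ext {R : Type*} [Ring R] {f g : MonoidAlgebra ℤ P →+* R}
    (h : ∀ p, f (MonoidAlgebra.of ℤ P p) = g (MonoidAlgebra.of ℤ P p)) : f = g :=
  MonoidAlgebra.ringHom_ext (fun r => congr($((f.comp (MonoidAlgebra.singleOneRingHom (M := P)
    (R := ℤ))).ext_int (g.comp MonoidAlgebra.singleOneRingHom)) r)) h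

namespace AlgebraicGeometry.Scheme

lemma comp_toSpecMA {T' T : Scheme.{u}} (f : T' ⟶ T) (a : P →* Γ(T, ⊤)) :
    f ≫ toSpecMA a = toSpecMA ((f.appTop.hom : _ →* _).comp a) := by
  rw [toSpecMA, toSpecMA, ← Category.assoc, Scheme.toSpecΓ_naturality, Category.assoc,
    ← Spec.map_comp]
  congr 2
  refine CommRingCat.hom_ext (MonoidAlgebra.intRingHom_ext fun p => ?_)
  simp

lemma toSpecMA_specMap {T : Scheme.{u}} (a : P →* Γ(T, ⊤)) (θ : Q →* P) :
    toSpecMA a ≫ specMap θ = toSpecMA (a.comp θ) := by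
  rw [toSpecMA, toSpecMA, specMap, Category.assoc, ← Spec.map_comp]
  congr 2
  refine CommRingCat.hom_ext (MonoidAlgebra.intRingHom_ext fun p => ?_)
  simp

lemma SpecMap_eq_toSpecMA {R : CommRingCat.{u}} (a : MonoidAlgebra ℤ P →+* R) :
    Spec.map (CommRingCat.ofHom a) = toSpecMA (((Scheme.ΓSpecIso R).inv.hom : _ →* _).comp
      ((a : MonoidAlgebra ℤ P →* R).comp (MonoidAlgebra.of ℤ P))) := by
  have h : CommRingCat.ofHom (MonoidAlgebra.lift ℤ Γ(Spec R, ⊤) P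
      (((Scheme.ΓSpecIso R).inv.hom : _ →* _).comp
      ((a : MonoidAlgebra ℤ P →* R).comp (MonoidAlgebra.of ℤ P)))).toRingHom =
      CommRingCat.ofHom a ≫ (Scheme.ΓSpecIso R).inv := by
    refine CommRingCat.hom_ext (MonoidAlgebra.intRingHom_ext fun p => ?_)
    simp
  rw [toSpecMA, h, Spec.map_comp]
  erw [toSpecΓ_SpecMap_ΓSpecIso_inv_assoc]

end AlgebraicGeometry.Scheme

end ToSpecMonoidAlgebra

section GrothendieckGroupProd

variable {Q P L : Type u} [CommMonoid Q] [CommMonoid P] [CommGroup L]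

open Algebra.GrothendieckGroup

lemma gpMap_comp_apply {R : Type u} [CommMonoid R] (θ : Q →* P) (η : P →* R)
    (x : Algebra.GrothendieckGroup Q) : gpMap (η.comp θ) x = gpMap η (gpMap θ x) := by
  have : gpMap (η.comp θ) = (gpMap η).comp (gpMap θ) := hom_ext' fun q => by
    rw [MonoidHom.comp_apply, gpMap_of, gpMap_of, gpMap_of]; rfl
  exact congr($this x)

lemma gpMap_id_apply (x : Algebra.GrothendieckGroup P) : gpMap (MonoidHom.id P) x = x := by
  have : gpMap (MonoidHom.id P) = MonoidHom.id _ := hom_ext' fun q => by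
    rw [gpMap_of]; rfl
  exact congr($this x)

lemma gpMap_fst_inl (x : Algebra.GrothendieckGroup P) :
    gpMap (MonoidHom.fst P L) (gpMap (MonoidHom.inl P L) x) = x := by
  rw [← gpMap_comp_apply, MonoidHom.fst_comp_inl, gpMap_id_apply]

/-- The projection of the group of a product to a factor that is a group. -/
def gpSnd (P L : Type u) [CommMonoid P] [CommGroup L] :
    Algebra.GrothendieckGroup (P × L) →* L :=
  Algebra.GrothendieckGroup.lift (MonoidHom.snd P L)

lemma gpMap_inl_fst (x : Algebra.GrothendieckGroup (P × L)) (h : gpSnd P L x = 1) :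
    gpMap (MonoidHom.inl P L) (gpMap (MonoidHom.fst P L) x) = x := by
  obtain ⟨⟨p, l⟩, ⟨p', l'⟩, rfl⟩ := exists_eq_div x
  have hl : l = l' := by
    rw [map_div, gpSnd, lift_of, lift_of, div_eq_one] at h
    exact h
  subst hl
  rw [map_div, map_div, gpMap_of, gpMap_of, gpMap_of, gpMap_of, div_eq_div_iff_mul_eq_mul,
    ← map_mul, ← map_mul]
  congr 1
  simp [mul_comm]

variable (L) in
/-- Enlarging the target of a homomorphism by a torsion free group does not change the torsion of the
cokernel. -/
lemma card_torsion_inl [IsMulTorsionFree L] (θ : Q →* P) :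
    Nonempty (CommGroup.torsion (Algebra.GrothendieckGroup (P × L) ⧸
        (gpMap ((MonoidHom.inl P L).comp θ)).range) ≃
      CommGroup.torsion (Algebra.GrothendieckGroup P ⧸ (gpMap θ).range)) := by
  let a : Algebra.GrothendieckGroup (P × L) ⧸ (gpMap ((MonoidHom.inl P L).comp θ)).range →*
      Algebra.GrothendieckGroup P ⧸ (gpMap θ).range :=
    QuotientGroup.map _ _ (gpMap (MonoidHom.fst P L)) (by
      rintro _ ⟨q, rfl⟩
      exact ⟨q, by rw [gpMap_comp_apply, gpMap_fst_inl]⟩)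
  let b : Algebra.GrothendieckGroup P ⧸ (gpMap θ).range →*
      Algebra.GrothendieckGroup (P × L) ⧸ (gpMap ((MonoidHom.inl P L).comp θ)).range :=
    QuotientGroup.map _ _ (gpMap (MonoidHom.inl P L)) (by
      rintro _ ⟨q, rfl⟩
      exact ⟨q, by rw [gpMap_comp_apply]⟩)
  have hab : ∀ x, a (b x) = x := fun x => by
    obtain ⟨x, rfl⟩ := QuotientGroup.mk_surjective x
    exact congrArg QuotientGroup.mk (gpMap_fst_inl x)
  -- A power of a torsion element comes from `Q`, so it has trivial component in `L`; as `L` is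
  -- torsion free, the element itself has trivial component.
  have hba : ∀ x, IsOfFinOrder x → b (a x) = x := fun x hx => by
    obtain ⟨x, rfl⟩ := QuotientGroup.mk_surjective x
    refine congrArg QuotientGroup.mk (gpMap_inl_fst x ?_)
    obtain ⟨n, hn, h⟩ := isOfFinOrder_iff_pow_eq_one.1 hx
    have h1 : ((x ^ n : Algebra.GrothendieckGroup (P × L)) : Algebra.GrothendieckGroup (P × L) ⧸
      (gpMap ((MonoidHom.inl P L).comp θ)).range) = 1 := h
    rw [QuotientGroup.eq_one_iff] at h1
    obtain ⟨y, hy⟩ := h1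
    have h2 : gpSnd P L (gpMap ((MonoidHom.inl P L).comp θ) y) = 1 := by
      have : (gpSnd P L).comp (gpMap ((MonoidHom.inl P L).comp θ)) = 1 := hom_ext' fun q => by
        rw [MonoidHom.comp_apply, gpMap_of, gpSnd, lift_of]; rfl
      exact congr($this y)
    rw [hy, map_pow] at h2
    exact (pow_eq_one_iff_left hn.ne').1 h2
  exact ⟨{ toFun := fun x => ⟨a x, MonoidHom.isOfFinOrder a x.2⟩
           invFun := fun x => ⟨b x, MonoidHom.isOfFinOrder b x.2⟩
           left_inv := fun x => Subtype.ext (hba x x.2)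
           right_inv := fun x => Subtype.ext (hab x) }⟩

variable (L) in
lemma ker_gpMap_inl (θ : Q →* P) :
    (gpMap ((MonoidHom.inl P L).comp θ)).ker = (gpMap θ).ker := by
  ext x
  rw [MonoidHom.mem_ker, MonoidHom.mem_ker, gpMap_comp_apply]
  constructor
  · intro h
    rw [← gpMap_fst_inl (L := L) (gpMap θ x), h, map_one]
  · intro h
    rw [h, map_one]

end GrothendieckGroupProd

/-! ### Étale coordinates that are units. -/

section EtaleCoordinates

/-- An epimorphism of rings is formally unramified, and étaleness of a composite passes to the
second map when the first is unramified and of finite type. -/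
lemma RingHom.Etale.of_comp_of_epi {A B C : Type u} [CommRing A] [CommRing B] [CommRing C]
    {h : A →+* B} {g : B →+* C} (hgh : (g.comp h).Etale) (hh : h.FiniteType)
    (epi : ∀ {T : Type u} [CommRing T] (a b : B →+* T), a.comp h = b.comp h → a = b) : g.Etale := by
  algebraize [h, g, g.comp h]
  have : Algebra.FormallyUnramified A B := by
    rw [Algebra.FormallyUnramified.iff_comp_injective]
    intro T _ _ I _ a b _
    exact AlgHom.coe_ringHom_injective (epi _ _ (by rw [← RingHom.algebraMap_toAlgebra h,
      a.comp_algebraMap, b.comp_algebraMap]))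
  have h1 : Algebra.FormallyEtale B C := .of_restrictScalars (R := A)
  have h2 : Algebra.FinitePresentation B C := .of_restrict_scalars_finitePresentation A B C
  exact Algebra.Etale.mk h1 h2

/-- The homomorphism from a group algebra given by a family of units. -/
abbrev unitsHom {R S L : Type u} [CommRing R] [CommRing S] [CommGroup L] (f : R →+* S) (w : L →* Sˣ) :
    MonoidAlgebra R L →+* S :=
  MonoidAlgebra.liftNCRingHom f ((Units.coeHom S).comp w) (fun _ _ => Commute.all _ _)

lemma unitsHom_single {R S L : Type u} [CommRing R] [CommRing S] [CommGroup L] (f : R →+* S)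
    (w : L →* Sˣ) (l : L) (r : R) : unitsHom f w (MonoidAlgebra.single l r) = f r * w l :=
  MonoidAlgebra.liftNC_single _ _ _ _

/-- Standard smooth algebras have étale coordinates which are units, near any given prime. -/
theorem RingHom.IsStandardSmooth.exists_etale_units {R S : Type u} [CommRing R] [CommRing S]
    {f : R →+* S} (hf : f.IsStandardSmooth) (𝔭 : Ideal S) [𝔭.IsPrime] :
    ∃ (L : Type u) (_ : CommGroup L) (_ : IsMulTorsionFree L) (_ : Monoid.FG L) (s : S) (_ : s ∉ 𝔭)
      (w : L →* (Localization.Away s)ˣ),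
      (unitsHom ((algebraMap S (Localization.Away s)).comp f) w).Etale := by
  classical
  obtain ⟨n, g, hgC, hg⟩ := hf.exists_etale_mvPolynomial
  -- Coordinates that vanish at the prime are translated by `1`. After that all of them are
  -- invertible near the prime.
  let ε : Fin n → R := fun i => if g (MvPolynomial.X i) ∈ 𝔭 then 1 else 0
  let σ : MvPolynomial (Fin n) R →+* MvPolynomial (Fin n) R :=
    MvPolynomial.eval₂Hom MvPolynomial.C (fun i => MvPolynomial.X i + MvPolynomial.C (ε i))
  let σ' : MvPolynomial (Fin n) R →+* MvPolynomial (Fin n) R :=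
    MvPolynomial.eval₂Hom MvPolynomial.C (fun i => MvPolynomial.X i - MvPolynomial.C (ε i))
  have hσC : ∀ a, σ (MvPolynomial.C a) = MvPolynomial.C a := fun a => MvPolynomial.eval₂Hom_C _ _ _
  have hσX : ∀ i, σ (MvPolynomial.X i) = MvPolynomial.X i + MvPolynomial.C (ε i) :=
    fun i => MvPolynomial.eval₂Hom_X' _ _ _
  have hσ'C : ∀ a, σ' (MvPolynomial.C a) = MvPolynomial.C a :=
    fun a => MvPolynomial.eval₂Hom_C _ _ _
  have hσ'X : ∀ i, σ' (MvPolynomial.X i) = MvPolynomial.X i - MvPolynomial.C (ε i) :=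
    fun i => MvPolynomial.eval₂Hom_X' _ _ _
  have h1 : σ.comp σ' = RingHom.id _ := MvPolynomial.ringHom_ext
    (fun a => by rw [RingHom.comp_apply, hσ'C, hσC]; rfl)
    (fun i => by rw [RingHom.comp_apply, hσ'X, map_sub, hσC, hσX, add_sub_cancel_right]; rfl)
  have h2 : σ'.comp σ = RingHom.id _ := MvPolynomial.ringHom_ext
    (fun a => by rw [RingHom.comp_apply, hσC, hσ'C]; rfl)
    (fun i => by rw [RingHom.comp_apply, hσX, map_add, hσ'C, hσ'X, sub_add_cancel]; rfl)
  have hσ : σ.Etale := .of_bijective ⟨fun a b h => by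
    rw [← RingHom.id_apply a, ← RingHom.id_apply b, ← h2, RingHom.comp_apply, h]; rfl,
    fun a => ⟨σ' a, congr($h1 a)⟩⟩
  let x : Fin n → S := fun i => g (σ (MvPolynomial.X i))
  have hx : ∀ i, x i ∉ 𝔭 := fun i h => by
    simp only [x, hσX, map_add] at h
    rw [← RingHom.comp_apply, hgC] at h
    by_cases hi : g (MvPolynomial.X i) ∈ 𝔭
    · simp only [ε, if_pos hi, map_one] at h
      exact (Ideal.ne_top_iff_one 𝔭).1 (Ideal.IsPrime.ne_top ‹_›) ((𝔭.add_mem_iff_right hi).1 h)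
    · simp only [ε, if_neg hi, map_zero, add_zero] at h
      exact hi h
  let s : S := ∏ i, x i
  have hs : s ∉ 𝔭 := fun h => by
    obtain ⟨i, -, hi⟩ := Ideal.IsPrime.prod_mem_iff.1 h
    exact hx i hi
  let S' := Localization.Away s
  have hxu : ∀ i, IsUnit (algebraMap S S' (x i)) := fun i =>
    isUnit_of_dvd_unit (map_dvd _ (Finset.dvd_prod_of_mem x (Finset.mem_univ i)))
      (IsLocalization.Away.algebraMap_isUnit s)
  let L := Multiplicative (ULift.{u} (Fin n) → ℤ)
  let w : L →* S'ˣ := MonoidHom.mk' (fun l => ∏ i, (hxu i).unit ^ (l.toAdd ⟨i⟩)) fun a b => by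
    rw [← Finset.prod_mul_distrib]
    exact Finset.prod_congr rfl fun i _ => zpow_add _ _ _
  let e : Fin n → L := fun i => Multiplicative.ofAdd (Pi.single ⟨i⟩ 1)
  have hwe : ∀ i, w (e i) = (hxu i).unit := fun i => by
    change ∏ i', (hxu i').unit ^ ((Pi.single ⟨i⟩ 1 : ULift.{u} (Fin n) → ℤ) ⟨i'⟩) = _
    rw [Finset.prod_eq_single i]
    · rw [Pi.single_eq_same, zpow_one]
    · intro j _ hj
      rw [Pi.single_eq_of_ne (fun h => hj (congrArg ULift.down h)), zpow_zero]
    · simp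
  have hLgen : Subgroup.closure (Set.range e) = ⊤ := by
    rw [eq_top_iff]
    rintro l -
    have : l = ∏ i, e i ^ (l.toAdd ⟨i⟩) := by
      apply Multiplicative.toAdd.injective
      ext ⟨j⟩
      rw [toAdd_prod, Finset.sum_apply, Finset.sum_eq_single j]
      · change _ = (l.toAdd ⟨j⟩ • (Pi.single ⟨j⟩ 1 : ULift.{u} (Fin n) → ℤ)) ⟨j⟩
        rw [Pi.smul_apply, Pi.single_eq_same, smul_eq_mul, mul_one]
      · intro i _ hi
        change (l.toAdd ⟨i⟩ • (Pi.single ⟨i⟩ 1 : ULift.{u} (Fin n) → ℤ)) ⟨j⟩ = 0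
        rw [Pi.smul_apply, Pi.single_eq_of_ne (fun h => hi (congrArg ULift.down h).symm), smul_zero]
      · simp
    rw [this]
    exact Subgroup.prod_mem _ fun i _ => Subgroup.zpow_mem _ (Subgroup.subset_closure (Set.mem_range_self i)) _
  have hLfg : Monoid.FG L := by
    rw [← Group.fg_iff_monoid_fg, Group.fg_iff]
    exact ⟨_, hLgen, Set.finite_range e⟩
  refine ⟨L, inferInstance, inferInstance, hLfg, s, hs, w, ?_⟩
  -- The coordinates are now units, so the étale map from the polynomial ring factors through the
  -- Laurent polynomial ring, which is an epimorphic extension of the polynomial ring.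
  let h : MvPolynomial (Fin n) R →+* MonoidAlgebra R L := MvPolynomial.eval₂Hom
    MonoidAlgebra.singleOneRingHom (fun i => MonoidAlgebra.single (e i) 1)
  have hhX : ∀ i, h (MvPolynomial.X i) = MonoidAlgebra.single (e i) 1 :=
    fun i => MvPolynomial.eval₂Hom_X' _ _ _
  have hhC : ∀ a, h (MvPolynomial.C a) = MonoidAlgebra.single 1 a :=
    fun a => MvPolynomial.eval₂Hom_C _ _ _
  refine RingHom.Etale.of_comp_of_epi (h := h) ?_ ?_ ?_
  · have hcomp : (unitsHom ((algebraMap S S').comp f) w).comp h = (algebraMap S S').comp (g.comp σ) := by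
      refine MvPolynomial.ringHom_ext (fun a => ?_) (fun i => ?_)
      · rw [RingHom.comp_apply, hhC, unitsHom_single, map_one, Units.val_one, mul_one, ← hgC,
          RingHom.comp_apply, RingHom.comp_apply, RingHom.comp_apply, RingHom.comp_apply, hσC]
      · rw [RingHom.comp_apply, hhX, unitsHom_single, map_one, one_mul, hwe]
        rfl
    rw [hcomp]
    have : (algebraMap S S').Etale := by
      rw [RingHom.etale_algebraMap]
      exact Algebra.Etale.of_isLocalizationAway s
    exact RingHom.Etale.stableUnderComposition _ _
      (RingHom.Etale.stableUnderComposition _ _ hσ hg) this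
  · have h1 : (h.comp MvPolynomial.C).FiniteType := by
      have : h.comp MvPolynomial.C = algebraMap R (MonoidAlgebra R L) := RingHom.ext hhC
      rw [this, RingHom.finiteType_algebraMap]
      infer_instance
    exact h1.of_comp_finiteType
  · intro T _ a b hab
    refine MonoidAlgebra.ringHom_ext (fun r => ?_) (fun l => ?_)
    · rw [← hhC]; exact congr($hab _)
    · let a' : L →* T := (a : MonoidAlgebra R L →* T).comp (MonoidAlgebra.of R L)
      let b' : L →* T := (b : MonoidAlgebra R L →* T).comp (MonoidAlgebra.of R L)
      have hab' : a'.toHomUnits = b'.toHomUnits := by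
        refine MonoidHom.eq_of_eqOn_dense hLgen ?_
        rintro _ ⟨i, rfl⟩
        apply Units.ext
        change a (MonoidAlgebra.single (e i) 1) = b (MonoidAlgebra.single (e i) 1)
        rw [← hhX]; exact congr($hab _)
      exact congr(Units.val ($hab' l))

variable {P L R : Type u} [CommMonoid P] [CommGroup L] [CommRing R]

/-- The homomorphism `ℤ[P × L] → R[L]` induced by a homomorphism from `P` to `R`. -/
def prodHom (L : Type u) [CommGroup L] (a : P →* R) : MonoidAlgebra ℤ (P × L) →+* MonoidAlgebra R L :=
  (MonoidAlgebra.lift ℤ (MonoidAlgebra R L) (P × L)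
    ((((MonoidAlgebra.singleOneRingHom : R →+* MonoidAlgebra R L) : R →* MonoidAlgebra R L).comp
      (a.comp (MonoidHom.fst P L))) * ((MonoidAlgebra.of R L).comp (MonoidHom.snd P L)))).toRingHom

lemma prodHom_of (a : P →* R) (p : P) (l : L) : prodHom L a (MonoidAlgebra.of ℤ (P × L) (p, l)) =
    MonoidAlgebra.single 1 (a p) * MonoidAlgebra.single l 1 := by
  refine (MonoidAlgebra.lift_of _ _).trans ?_
  rfl

/-- `ℤ[P × L]` is the group algebra of `L` over `ℤ[P]`, and forming a group algebra commutes with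
base change. -/
theorem isPushout_prodHom (a : MonoidAlgebra ℤ P →+* R) :
    IsPushout (CommRingCat.ofHom (MonoidAlgebra.mapDomainRingHom ℤ (MonoidHom.inl P L)))
      (CommRingCat.ofHom a)
      (CommRingCat.ofHom (prodHom L ((a : MonoidAlgebra ℤ P →* R).comp (MonoidAlgebra.of ℤ P))))
      (CommRingCat.ofHom (MonoidAlgebra.singleOneRingHom (R := R) (M := L))) := by
  have hinl : ∀ p, MonoidAlgebra.mapDomainRingHom ℤ (MonoidHom.inl P L) (MonoidAlgebra.of ℤ P p) =
      MonoidAlgebra.of ℤ (P × L) (p, 1) := fun p => by simp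
  have hsingle : (MonoidAlgebra.single 1 1 : MonoidAlgebra R L) = 1 := rfl
  have w : CommRingCat.ofHom (MonoidAlgebra.mapDomainRingHom ℤ (MonoidHom.inl P L)) ≫
      CommRingCat.ofHom (prodHom L ((a : MonoidAlgebra ℤ P →* R).comp (MonoidAlgebra.of ℤ P))) =
      CommRingCat.ofHom a ≫ CommRingCat.ofHom (MonoidAlgebra.singleOneRingHom (R := R) (M := L)) := by
    refine CommRingCat.hom_ext (MonoidAlgebra.intRingHom_ext fun p => ?_)
    refine (congrArg (prodHom L _) (hinl p)).trans ?_
    rw [prodHom_of, hsingle, mul_one]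
    rfl
  refine ⟨⟨w⟩, ⟨PushoutCocone.isColimitAux' _ fun s => ?_⟩⟩
  let b : MonoidAlgebra ℤ (P × L) →+* s.pt := s.inl.hom
  let c : R →+* s.pt := s.inr.hom
  have hbc : ∀ p, b (MonoidAlgebra.of ℤ _ (p, 1)) = c (a (MonoidAlgebra.of ℤ _ p)) := fun p => by
    rw [← hinl]; exact congr(($s.condition).hom (MonoidAlgebra.of ℤ _ p))
  let v : L →* s.pt := ((b : MonoidAlgebra ℤ (P × L) →* s.pt).comp (MonoidAlgebra.of ℤ (P × L))).comp
    (MonoidHom.inr P L)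
  let d : MonoidAlgebra R L →+* s.pt := MonoidAlgebra.liftNCRingHom c v (fun _ _ => Commute.all _ _)
  have hd : ∀ l r, d (MonoidAlgebra.single l r) = c r * v l := fun l r =>
    MonoidAlgebra.liftNC_single _ _ _ _
  refine ⟨CommRingCat.ofHom d, ?_, ?_, ?_⟩
  · refine CommRingCat.hom_ext (MonoidAlgebra.intRingHom_ext fun ⟨p, l⟩ => ?_)
    refine (congrArg d (prodHom_of _ p l)).trans ?_
    rw [map_mul, hd, hd, map_one, map_one, mul_one, one_mul]
    change c (a (MonoidAlgebra.of ℤ _ p)) * b (MonoidAlgebra.of ℤ _ (1, l)) = b _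
    rw [← hbc, ← map_mul, ← map_mul, Prod.mk_mul_mk, mul_one, one_mul]
  · refine CommRingCat.hom_ext (RingHom.ext fun r => (hd 1 r).trans ?_)
    rw [map_one, mul_one]
  · intro m h1 h2
    refine CommRingCat.hom_ext (MonoidAlgebra.ringHom_ext (fun r => ?_) (fun l => ?_))
    · refine (congr(($h2).hom r)).trans ((hd 1 r).trans ?_).symm
      rw [map_one, mul_one]
    · refine Eq.trans ?_ ((congr(($h1).hom (MonoidAlgebra.of ℤ _ (1, l)))).trans
        ((hd l 1).trans ?_).symm)
      · refine congrArg m.hom ?_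
        refine Eq.trans ?_ (prodHom_of _ 1 l).symm
        rw [map_one, hsingle, one_mul]
      · rw [map_one, one_mul]
        rfl

end EtaleCoordinates

namespace AlgebraicGeometry.Scheme

/-- The global function on `Spec ℤ[P]` given by an element of `P`. -/
def monoidFun (P : Type u) [CommMonoid P] : P →* Γ(Spec (.of (MonoidAlgebra ℤ P)), ⊤) :=
  ((Scheme.ΓSpecIso (.of (MonoidAlgebra ℤ P))).inv.hom : _ →* _).comp (MonoidAlgebra.of ℤ P)

lemma toSpecMA_monoidFun {P : Type u} [CommMonoid P] {T : Scheme.{u}} (a : P →* Γ(T, ⊤)) (p : P) :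
    (toSpecMA a).appTop (monoidFun P p) = a p := by
  have h1 := Scheme.Hom.comp_appTop T.toSpecΓ (Spec.map (CommRingCat.ofHom
    (MonoidAlgebra.lift ℤ Γ(T, ⊤) P a).toRingHom))
  have h2 : (Scheme.ΓSpecIso (.of (MonoidAlgebra ℤ P))).inv ≫ (toSpecMA a).appTop =
      CommRingCat.ofHom (MonoidAlgebra.lift ℤ Γ(T, ⊤) P a).toRingHom := by
    rw [toSpecMA, h1, ← Category.assoc, ← Scheme.ΓSpecIso_inv_naturality, Category.assoc,
      Scheme.toSpecΓ_appTop, Iso.inv_hom_id, Category.comp_id]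
  refine (congr(($h2).hom (MonoidAlgebra.of ℤ P p))).trans ?_
  exact MonoidAlgebra.lift_of _ _

lemma toSpecMA_injective {P : Type u} [CommMonoid P] {T : Scheme.{u}} {a b : P →* Γ(T, ⊤)}
    (h : toSpecMA a = toSpecMA b) : a = b := by
  ext p
  rw [← toSpecMA_monoidFun a p, h, toSpecMA_monoidFun]

end AlgebraicGeometry.Scheme

namespace LogStructure

variable {X : Scheme.{u}} (M : LogStructure X)

/-- The units of the log structure given by unit functions. -/
def unitSecHom (V : X.Etale) : Γ(EtSpace V, ⊤)ˣ →* (M.Sec V)ˣ :=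
  MonoidHom.mk' (M.unitSec V) fun a b => unit_ext (by
    rw [α_unitSec, Units.val_mul, Units.val_mul, map_mul, α_unitSec, α_unitSec])

lemma α_unitSecHom (V : X.Etale) (a : Γ(EtSpace V, ⊤)ˣ) : M.α V (M.unitSecHom V a) = a :=
  α_unitSec V a

end LogStructure

/-! ### Smoothness over a tame chart implies log smoothness. -/

namespace LogHom

variable {X S : Scheme.{u}} {M : LogStructure X} {N : LogStructure S} {s : X ⟶ S}
  (φ : LogHom M N s)

lemma toSpecMonoidAlgebra_map {V : X.Etale} {W : S.Etale} (a : EtSpace V ⟶ EtSpace W)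
    (ha : a ≫ etStr W = etStr V ≫ s) {P : Type u} [CommMonoid P] (β : P →* N.Sec W) :
    M.toSpecMonoidAlgebra ((φ.map a ha).comp β) = a ≫ N.toSpecMonoidAlgebra β := by
  rw [LogStructure.toSpecMonoidAlgebra_eq, LogStructure.toSpecMonoidAlgebra_eq,
    Scheme.comp_toSpecMA]
  congr 1
  ext p
  exact φ.α_map a ha (β p)

variable {φ}

namespace Chart

variable {V : X.Etale} {W : S.Etale} {g : EtSpace V ⟶ EtSpace W}
    {hg : g ≫ etStr W = etStr V ≫ s} {Q P : Type u} [CommMonoid Q] [CommMonoid P]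
    (c : φ.Chart g hg Q P)

/-- The conditions on the monoids of a chart in the definition of log smoothness. -/
structure IsTame : Prop where
  fine_target : Monoid.FG Q ∧ IsCancelMul Q
  fine_source : Monoid.FG P ∧ IsCancelMul P
  finite_ker : Finite (gpMap c.hom).ker
  isUnit_card_ker : IsUnit (Nat.card (gpMap c.hom).ker : Γ(EtSpace W, ⊤))
  finite_torsion : Finite (CommGroup.torsion (Algebra.GrothendieckGroup P ⧸ (gpMap c.hom).range))
  isUnit_card_torsion :
    IsUnit (Nat.card (CommGroup.torsion (Algebra.GrothendieckGroup P ⧸ (gpMap c.hom).range)) :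
      Γ(EtSpace W, ⊤))

/-- The target of the morphism that is étale for a smooth chart. -/
abbrev base : Scheme.{u} := pullback (N.toSpecMonoidAlgebra c.target) (specMap c.hom)

lemma toSpecMonoidAlgebra_comm :
    g ≫ N.toSpecMonoidAlgebra c.target = M.toSpecMonoidAlgebra c.source ≫ specMap c.hom := by
  rw [← φ.toSpecMonoidAlgebra_map g hg, LogStructure.toSpecMonoidAlgebra_eq,
    LogStructure.toSpecMonoidAlgebra_eq, Scheme.toSpecMA_specMap]
  congr 1
  ext q
  exact congrArg (M.α V) (c.comm q).symm

/-- The morphism that is étale for a smooth chart. -/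
def toBase : EtSpace V ⟶ c.base :=
  pullback.lift g (M.toSpecMonoidAlgebra c.source) c.toSpecMonoidAlgebra_comm

/-- The projection to the base scheme. -/
def baseTo : c.base ⟶ S := pullback.fst _ _ ≫ etStr W

lemma toBase_fst : c.toBase ≫ pullback.fst _ _ = g := pullback.lift_fst _ _ _

lemma toBase_snd : c.toBase ≫ pullback.snd _ _ = M.toSpecMonoidAlgebra c.source :=
  pullback.lift_snd _ _ _

lemma toBase_baseTo : c.toBase ≫ c.baseTo = etStr V ≫ s := by
  rw [baseTo, ← Category.assoc, toBase_fst, hg]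

end Chart

variable (φ) in
/-- The schemes `Y → T` over `X → S` are, near `y` and étale locally on `Y`, smooth over the base change
to `T` of the base of a tame chart of `X → S`. -/
def SmoothOverChartAt {Y T : Scheme.{u}} (a : Y ⟶ X) (t : T ⟶ S) (b : Y ⟶ T) (y : Y) : Prop :=
  ∃ (V : X.Etale) (W : S.Etale) (g : EtSpace V ⟶ EtSpace W) (hg : g ≫ etStr W = etStr V ≫ s)
    (Q P : Type u) (_ : CommMonoid Q) (_ : CommMonoid P) (c : φ.Chart g hg Q P),
    c.IsTame ∧ ∃ (D : Scheme.{u}) (d : D ⟶ Y) (l : D ⟶ EtSpace V) (m : D ⟶ pullback t c.baseTo),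
      Etale d ∧ l ≫ etStr V = d ≫ a ∧ m ≫ pullback.fst _ _ = d ≫ b ∧
        m ≫ pullback.snd _ _ = l ≫ c.toBase ∧ Smooth m ∧ y ∈ Set.range d

/-- Log smoothness from smoothness over a chart. -/
theorem SmoothOverChartAt.logSmoothAt {Y T : Scheme.{u}} {a : Y ⟶ X} {t : T ⟶ S} {b : Y ⟶ T}
    {MY : LogStructure Y} {MT : LogStructure T} {i : LogHom MY M a} (hi : i.IsStrict)
    {τ : LogHom MT N t} (hτ : τ.IsStrict) {p : LogHom MY MT b} {w : Y ⟶ S} {h1 : b ≫ t = w}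
    {h2 : a ≫ s = w} (hp : p.comp τ h1 = i.comp φ h2) {Ω : Type u} [Field Ω] [IsSepClosed Ω]
    (x : Spec (.of Ω) ⟶ Y) (hx : φ.SmoothOverChartAt a t b (x default)) : p.LogSmoothAt x := by
  obtain ⟨V, W, g, hg, Q, P, _, _, c, hc, D, d, l, m, hd, hl, hm1, hm2, hm, y₀, hy₀⟩ := hx
  let W' : T.Etale := Scheme.Etale.mk (pullback.snd (etStr W) t)
  let target' : Q →* MT.Sec W' :=
    (τ.map (V := W') (pullback.fst (etStr W) t) pullback.condition).comp c.target
  have htarget' : MT.toSpecMonoidAlgebra target' =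
      pullback.fst (etStr W) t ≫ N.toSpecMonoidAlgebra c.target :=
    τ.toSpecMonoidAlgebra_map (V := W') _ _ _
  -- the base change of the base of the chart
  let ET := pullback (MT.toSpecMonoidAlgebra target') (specMap c.hom)
  let fstE : ET ⟶ pullback (etStr W) t :=
    pullback.fst (MT.toSpecMonoidAlgebra target') (specMap c.hom)
  let sndE : ET ⟶ Spec (.of (MonoidAlgebra ℤ P)) :=
    pullback.snd (MT.toSpecMonoidAlgebra target') (specMap c.hom)
  have hEcond : fstE ≫ MT.toSpecMonoidAlgebra target' = sndE ≫ specMap c.hom := pullback.condition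
  let r : ET ⟶ c.base := pullback.lift (fstE ≫ pullback.fst _ _) sndE (by
    rw [Category.assoc, ← htarget']; exact hEcond)
  have hr1 : r ≫ pullback.fst _ _ = fstE ≫ pullback.fst _ _ := pullback.lift_fst _ _ _
  have hr2 : r ≫ pullback.snd _ _ = sndE := pullback.lift_snd _ _ _
  have HE : IsPullback sndE fstE (specMap c.hom) (MT.toSpecMonoidAlgebra target') :=
    (IsPullback.of_hasPullback _ _).flip
  have H1 : IsPullback r fstE (pullback.fst _ _) (pullback.fst (etStr W) t) := by
    refine IsPullback.of_right (h₁₂ := pullback.snd _ _) (h₂₂ := N.toSpecMonoidAlgebra c.target)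
      ?_ hr1 (IsPullback.of_hasPullback _ _).flip
    rw [hr2, ← htarget']
    exact HE
  -- Pasting identifies the base of the inverse image chart over `T` with the base change of the
  -- base of `c`, so `m` becomes a smooth morphism to `ET`.
  have H2 : IsPullback (fstE ≫ pullback.snd _ _) r t c.baseTo :=
    (H1.paste_vert (IsPullback.of_hasPullback (etStr W) t)).flip
  let n : D ⟶ ET := m ≫ H2.isoPullback.inv
  have hn1 : n ≫ fstE ≫ pullback.snd _ _ = d ≫ b := by
    rw [Category.assoc, IsPullback.isoPullback_inv_fst, hm1]
  have hn2 : n ≫ r = l ≫ c.toBase := by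
    rw [Category.assoc, IsPullback.isoPullback_inv_snd, hm2]
  have hn3 : n ≫ fstE ≫ pullback.fst _ _ = l ≫ g := by
    rw [← hr1, ← Category.assoc, hn2, Category.assoc, Chart.toBase_fst]
  have hn4 : n ≫ sndE = l ≫ M.toSpecMonoidAlgebra c.source := by
    rw [← hr2, ← Category.assoc, hn2, Category.assoc, Chart.toBase_snd]
  have hns : Smooth n := inferInstance
  -- étale coordinates near `y₀`
  obtain ⟨U, hU, V₀, hV₀, hyV, e, hstd⟩ := Smooth.exists_isStandardSmooth n y₀
  let f : Γ(ET, U) →+* Γ(D, V₀) := (n.appLE U V₀ e).hom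
  obtain ⟨L, _, _, _, σ, hσ, wL, hwL⟩ := hstd.exists_etale_units (hV₀.primeIdealOf ⟨y₀, hyV⟩).asIdeal
  let R := Γ(ET, U)
  let S' := Localization.Away σ
  let fS : R →+* S' := (algebraMap _ S').comp f
  let ι : Spec (.of S') ⟶ D := Spec.map (CommRingCat.ofHom (algebraMap Γ(D, V₀) S')) ≫ hV₀.fromSpec
  have hιo : IsOpenImmersion (Spec.map (CommRingCat.ofHom (algebraMap Γ(D, V₀) S'))) :=
    inferInstance
  have hιo' : IsOpenImmersion ι := inferInstance
  have hιn : ι ≫ n = Spec.map (CommRingCat.ofHom fS) ≫ hU.fromSpec := by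
    rw [Category.assoc, ← IsAffineOpen.SpecMap_appLE_fromSpec n hU hV₀ e, ← Spec.map_comp_assoc]
    rfl
  obtain ⟨y₁, hy₁⟩ : y₀ ∈ Set.range ι := by
    have h3 : hV₀.primeIdealOf ⟨y₀, hyV⟩ ∈ Set.range
        (Spec.map (CommRingCat.ofHom (algebraMap Γ(D, V₀) S'))) := by
      change _ ∈ Set.range (PrimeSpectrum.comap (algebraMap Γ(D, V₀) S'))
      rw [PrimeSpectrum.localization_away_comap_range S' σ]
      exact hσ
    obtain ⟨y₁, hy₁⟩ := h3
    refine ⟨y₁, ?_⟩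
    rw [Scheme.Hom.comp_apply, hy₁]
    exact hV₀.fromSpec_primeIdealOf ⟨y₀, hyV⟩
  -- the chart
  let V' : Y.Etale := Scheme.Etale.mk (ι ≫ d)
  let g' : EtSpace V' ⟶ EtSpace W' := ι ≫ n ≫ fstE
  have hg' : g' ≫ etStr W' = etStr V' ≫ b := by
    refine (Category.assoc _ _ _).trans ?_
    refine (congrArg (ι ≫ ·) ((Category.assoc _ _ _).trans hn1)).trans ?_
    exact (Category.assoc _ _ _).symm
  have hl' : (ι ≫ l) ≫ etStr V = etStr V' ≫ a := by
    refine (Category.assoc _ _ _).trans ?_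
    rw [hl]
    exact (Category.assoc _ _ _).symm
  let source₀ : P →* MY.Sec V' := (i.map (V := V') (ι ≫ l) hl').comp c.source
  -- The étale coordinates are unit functions, hence units of the log structure, and can be adjoined
  -- to the chart as the factor `L`.
  let wM : L →* (MY.Sec V')ˣ := (MY.unitSecHom V').comp
    ((Units.map ((Scheme.ΓSpecIso (.of S')).inv.hom : S' →* Γ(Spec (.of S'), ⊤))).comp wL)
  let source' : P × L →* MY.Sec V' := (source₀.comp (MonoidHom.fst P L)) *
    ((Units.coeHom _).comp (wM.comp (MonoidHom.snd P L)))
  let hom' : Q →* P × L := (MonoidHom.inl P L).comp c.hom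
  have hcomm : ∀ q, source' (hom' q) = p.map g' hg' (target' q) := fun q => by
    have e1 : source' (hom' q) = source₀ (c.hom q) * ((wM 1 : (MY.Sec V')ˣ) : MY.Sec V') := rfl
    rw [e1, map_one, Units.val_one, mul_one]
    have e2 : source₀ (c.hom q) = i.map (V := V') (ι ≫ l) hl' (φ.map g hg (c.target q)) :=
      congrArg _ (c.comm q)
    have h3 : (ι ≫ l ≫ g) ≫ etStr W = etStr V' ≫ w := by
      have h4 : ι ≫ l ≫ g ≫ etStr W = ι ≫ d ≫ w := by
        rw [hg, ← Category.assoc l, hl]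
        exact congrArg (ι ≫ ·) ((Category.assoc _ _ _).trans (congrArg (d ≫ ·) h2))
      exact (Category.assoc _ _ _).trans ((congrArg (ι ≫ ·) (Category.assoc _ _ _)).trans
        (h4.trans (Category.assoc _ _ _).symm))
    have e3 := i.comp_map φ h2 (V := V') (ι ≫ l ≫ g) h3 (ι ≫ l) hl' g hg (Category.assoc _ _ _)
      (c.target q)
    rw [e2, ← e3, ← hp]
    refine p.comp_map τ h1 (V := V') (V₂ := W') (ι ≫ l ≫ g) h3 g' hg' (pullback.fst _ _)
      pullback.condition ?_ (c.target q)
    refine (Category.assoc _ _ _).trans ?_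
    refine congrArg (ι ≫ ·) ((Category.assoc _ _ _).trans hn3)
  let c' : p.Chart g' hg' Q (P × L) :=
    { source := source'
      target := target'
      hom := hom'
      isChart_source := (hi.isChart (V := V') _ hl' c.isChart_source).prod_units wM
      isChart_target := hτ.isChart (V := W') _ _ c.isChart_target
      comm := hcomm }
  -- A geometric point with separably closed field lifts along the étale neighbourhood.
  obtain ⟨v, hv, -⟩ := Scheme.exists_fac_of_etale_of_isSepClosed (ι ≫ d) x y₁
    (by rw [Scheme.Hom.comp_apply, hy₁, hy₀])
  refine ⟨V', W', g', hg', v, Q, P × L, inferInstance, inferInstance, c', hv, ?_⟩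
  have hcast : ∀ k : ℕ, IsUnit (k : Γ(EtSpace W, ⊤)) → IsUnit (k : Γ(EtSpace W', ⊤)) := fun k hk => by
    have := hk.map (pullback.fst (etStr W) t).appTop.hom
    rwa [map_natCast] at this
  have hfg := hc.fine_source.1
  have hcan := hc.fine_source.2
  have hker : (gpMap c'.hom).ker = (gpMap c.hom).ker := ker_gpMap_inl L c.hom
  obtain ⟨htor⟩ := card_torsion_inl L c.hom
  have hfin := hc.finite_torsion
  refine ⟨hc.fine_target, ⟨inferInstance, inferInstance⟩, ?_, ?_, ?_, ?_, ?_⟩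
  · rw [hker]; exact hc.finite_ker
  · rw [hker]; exact hcast _ hc.isUnit_card_ker
  · exact Finite.of_equiv _ htor.symm
  · have := hcast _ hc.isUnit_card_torsion
    rwa [← Nat.card_congr htor] at this
  -- étaleness
  obtain ⟨aP, haP⟩ := Spec.map_surjective (hU.fromSpec ≫ sndE)
  let E' := pullback (MT.toSpecMonoidAlgebra target') (specMap hom')
  let fst' : E' ⟶ pullback (etStr W) t :=
    pullback.fst (MT.toSpecMonoidAlgebra target') (specMap hom')
  let snd' : E' ⟶ Spec (.of (MonoidAlgebra ℤ (P × L))) :=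
    pullback.snd (MT.toSpecMonoidAlgebra target') (specMap hom')
  have hcond' : fst' ≫ MT.toSpecMonoidAlgebra target' = snd' ≫ specMap hom' := pullback.condition
  have hspec : specMap (MonoidHom.inl P L) ≫ specMap c.hom = specMap hom' := by
    rw [specMap, specMap, specMap, ← Spec.map_comp, ← CommRingCat.ofHom_comp]
    congr 2
    refine MonoidAlgebra.intRingHom_ext fun q => ?_
    simp [hom']
  let r' : E' ⟶ ET := pullback.lift fst' (snd' ≫ specMap (MonoidHom.inl P L)) (by
    rw [Category.assoc, hspec]; exact hcond')
  have hr'1 : r' ≫ fstE = fst' := pullback.lift_fst _ _ _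
  have hr'2 : r' ≫ sndE = snd' ≫ specMap (MonoidHom.inl P L) := pullback.lift_snd _ _ _
  -- Enlarging `P` to `P × L` multiplies the base by `Spec ℤ[L]`. Over the affine open `U` the new
  -- base is therefore the spectrum of the group algebra `R[L]`, to which the coordinates are étale.
  have H3 : IsPullback snd' r' (specMap (MonoidHom.inl P L)) sndE := by
    have HE' : IsPullback snd' fst' (specMap hom') (MT.toSpecMonoidAlgebra target') :=
      (IsPullback.of_hasPullback (MT.toSpecMonoidAlgebra target') (specMap hom')).flip
    have HE'' : IsPullback snd' (r' ≫ fstE) (specMap (MonoidHom.inl P L) ≫ specMap c.hom)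
        (MT.toSpecMonoidAlgebra target') := by
      have aux : ∀ f₁ (_ : f₁ = fst') f₂ (_ : f₂ = specMap hom'),
          IsPullback snd' f₁ f₂ (MT.toSpecMonoidAlgebra target') := by
        rintro _ rfl _ rfl
        exact HE'
      exact aux _ hr'1 _ hspec
    exact IsPullback.of_bot HE'' hr'2.symm HE
  have H4 := isPullback_SpecMap_of_isPushout _ _ _ _ (isPushout_prodHom (L := L) aP.hom)
  change IsPullback _ _ (specMap (MonoidHom.inl P L)) (Spec.map aP) at H4
  rw [haP] at H4
  let q : Spec (.of (MonoidAlgebra R L)) ⟶ E' := H3.lift _ _ (H4.w.trans (Category.assoc _ _ _).symm)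
  have hq1 : q ≫ snd' = Spec.map (CommRingCat.ofHom (prodHom L
      ((aP.hom : MonoidAlgebra ℤ P →* R).comp (MonoidAlgebra.of ℤ P)))) := H3.lift_fst _ _ _
  have hq2 : q ≫ r' = Spec.map (CommRingCat.ofHom (MonoidAlgebra.singleOneRingHom)) ≫ hU.fromSpec :=
    H3.lift_snd _ _ _
  have H5 : IsPullback q (Spec.map (CommRingCat.ofHom (MonoidAlgebra.singleOneRingHom))) r'
      hU.fromSpec := by
    refine IsPullback.of_right ?_ hq2 H3
    rw [hq1]
    exact H4
  have hqo : IsOpenImmersion q :=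
    MorphismProperty.of_isPullback (P := @IsOpenImmersion) H5.flip inferInstance
  let u : Spec (.of S') ⟶ Spec (.of (MonoidAlgebra R L)) :=
    Spec.map (CommRingCat.ofHom (unitsHom fS wL))
  have hu : Etale u := by
    rw [HasRingHomProperty.Spec_iff (P := @Etale)]
    exact hwL
  have hu1 : u ≫ Spec.map (CommRingCat.ofHom (MonoidAlgebra.singleOneRingHom)) =
      Spec.map (CommRingCat.ofHom fS) := by
    rw [← Spec.map_comp, ← CommRingCat.ofHom_comp]
    congr 2
    refine RingHom.ext fun z => (unitsHom_single fS wL 1 z).trans ?_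
    rw [map_one, Units.val_one, mul_one]
  have huq : Etale (u ≫ q) := inferInstance
  refine ⟨u ≫ q, ?_, ?_, huq⟩
  · change (u ≫ q) ≫ fst' = ι ≫ n ≫ fstE
    rw [← hr'1, ← Category.assoc ι, hιn, Category.assoc, reassoc_of% hq2, reassoc_of% hu1,
      Category.assoc]
  · change (u ≫ q) ≫ snd' = Scheme.toSpecMA ((MY.α V').comp source')
    refine (Category.assoc _ _ _).trans ((congrArg (u ≫ ·) hq1).trans
      ((Spec.map_comp _ _).symm.trans ?_))
    have hsp (h : MonoidAlgebra ℤ (P × L) →+* S') : Spec.map (CommRingCat.ofHom h) = _ :=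
      Scheme.SpecMap_eq_toSpecMA (R := .of S') h
    refine (hsp _).trans ?_
    refine congrArg Scheme.toSpecMA ?_
    -- On the factor `P` the equality of functions is deduced from that of the morphisms to `Spec
    -- ℤ[P]`.
    have h3 : Scheme.toSpecMA (((Scheme.ΓSpecIso (.of S')).inv.hom : S' →* Γ(Spec (.of S'), ⊤)).comp
        (((fS.comp aP.hom : MonoidAlgebra ℤ P →+* S') : MonoidAlgebra ℤ P →* S').comp
          (MonoidAlgebra.of ℤ P))) = Scheme.toSpecMA ((MY.α V').comp source₀) := by
      refine (Scheme.SpecMap_eq_toSpecMA (R := .of S') (fS.comp aP.hom)).symm.trans ?_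
      refine Eq.trans ?_ (i.toSpecMonoidAlgebra_map (V := V') (ι ≫ l) hl' c.source).symm
      have h5 : Spec.map (CommRingCat.ofHom (fS.comp aP.hom)) =
          ι ≫ l ≫ M.toSpecMonoidAlgebra c.source := by
        rw [← hn4, ← Category.assoc, hιn, Category.assoc, ← haP, ← Spec.map_comp]
        rfl
      exact h5.trans (Category.assoc _ _ _).symm
    have h4 := Scheme.toSpecMA_injective h3
    refine MonoidHom.ext fun ⟨z, z'⟩ => ?_
    have e1 : MY.α V' (source' (z, z')) = MY.α V' (source₀ z) * MY.α V' (wM z') := map_mul _ _ _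
    have e2 : MY.α V' (wM z') = (Scheme.ΓSpecIso (.of S')).inv.hom (wL z' : S') :=
      MY.α_unitSecHom V' _
    refine Eq.trans ?_ e1.symm
    rw [e2]
    refine Eq.trans ?_ (congrArg (· * (Scheme.ΓSpecIso (.of S')).inv.hom (wL z' : S')) congr($h4 z))
    refine Eq.trans ?_ (map_mul (Scheme.ΓSpecIso (.of S')).inv.hom _ _)
    refine congrArg (Scheme.ΓSpecIso (.of S')).inv.hom ?_
    refine (congrArg (unitsHom fS wL) (prodHom_of _ z z')).trans ?_
    rw [map_mul, unitsHom_single, unitsHom_single, map_one, map_one, Units.val_one, mul_one, one_mul]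
    rfl

end LogHom

namespace LogHom

variable {X S : Scheme.{u}} {M : LogStructure X} {N : LogStructure S} {s : X ⟶ S}
  {φ : LogHom M N s}

/-- Smoothness over a chart is stable under base change. -/
theorem SmoothOverChartAt.baseChange {Y T T' : Scheme.{u}} {a : Y ⟶ X} {t : T ⟶ S} {b : Y ⟶ T}
    {y : Y} (h : φ.SmoothOverChartAt a t b y) (L : T' ⟶ T) (y' : ↥(pullback b L))
    (hy : pullback.fst b L y' = y) :
    φ.SmoothOverChartAt (pullback.fst b L ≫ a) (L ≫ t) (pullback.snd b L) y' := by
  obtain ⟨V, W, g, hg, Q, P, _, _, c, hc, D, d, l, m, hd, hl, hm1, hm2, hm, y₀, hy₀⟩ := h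
  let ρ : pullback (L ≫ t) c.baseTo ⟶ pullback t c.baseTo :=
    pullback.lift (pullback.fst _ _ ≫ L) (pullback.snd _ _)
      (by rw [Category.assoc, pullback.condition])
  have hρ1 : ρ ≫ pullback.fst _ _ = pullback.fst _ _ ≫ L := pullback.lift_fst _ _ _
  have hρ2 : ρ ≫ pullback.snd _ _ = pullback.snd _ _ := pullback.lift_snd _ _ _
  -- The new target is the base change of the old one along `L`, so `m'` is a base change of the
  -- smooth morphism `m`.
  have H1 : IsPullback ρ (pullback.fst (L ≫ t) c.baseTo) (pullback.fst t c.baseTo) L := by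
    refine IsPullback.of_right (h₁₂ := pullback.snd t c.baseTo) (h₂₂ := t) (v₁₃ := c.baseTo) ?_
      hρ1 (IsPullback.of_hasPullback t c.baseTo).flip
    rw [hρ2]
    exact (IsPullback.of_hasPullback (L ≫ t) c.baseTo).flip
  have e1 : pullback.snd d (pullback.fst b L) ≫ pullback.snd b L ≫ L = pullback.fst _ _ ≫ d ≫ b := by
    rw [← pullback.condition, ← pullback.condition_assoc]
  have e2 : m ≫ pullback.snd _ _ ≫ c.baseTo = d ≫ b ≫ t := by
    rw [← pullback.condition, reassoc_of% hm1]
  let m' : pullback d (pullback.fst b L) ⟶ pullback (L ≫ t) c.baseTo :=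
    pullback.lift (pullback.snd _ _ ≫ pullback.snd _ _) (pullback.fst _ _ ≫ m ≫ pullback.snd _ _) (by
      rw [Category.assoc, Category.assoc, Category.assoc, e2, reassoc_of% e1])
  have hm'1 : m' ≫ pullback.fst _ _ = pullback.snd _ _ ≫ pullback.snd _ _ := pullback.lift_fst _ _ _
  have hm'2 : m' ≫ pullback.snd _ _ = pullback.fst _ _ ≫ m ≫ pullback.snd _ _ :=
    pullback.lift_snd _ _ _
  have hm'ρ : m' ≫ ρ = pullback.fst _ _ ≫ m := by
    apply pullback.hom_ext
    · rw [Category.assoc, Category.assoc, hρ1, reassoc_of% hm'1, hm1, ← pullback.condition,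
        pullback.condition_assoc]
    · rw [Category.assoc, Category.assoc, hρ2, hm'2]
  have H2 : IsPullback (pullback.fst d (pullback.fst b L)) m' m ρ := by
    refine IsPullback.of_bot (h₃₁ := L) (v₂₁ := pullback.fst (L ≫ t) c.baseTo)
      (v₂₂ := pullback.fst t c.baseTo) ?_ hm'ρ.symm H1
    rw [hm'1, hm1]
    exact (IsPullback.of_hasPullback d (pullback.fst b L)).paste_vert (IsPullback.of_hasPullback b L)
  refine ⟨V, W, g, hg, Q, P, _, _, c, hc, pullback d (pullback.fst b L), pullback.snd _ _,
    pullback.fst _ _ ≫ l, m', inferInstance, ?_, hm'1, ?_,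
    MorphismProperty.of_isPullback (P := @Smooth) H2 hm, ?_⟩
  · rw [Category.assoc, hl, pullback.condition_assoc]
  · rw [hm'2, hm2, Category.assoc]
  · obtain ⟨z, -, hz⟩ := Scheme.Pullback.exists_preimage_pullback (f := d)
      (g := pullback.fst b L) y₀ y' (by rw [hy₀, hy])
    exact ⟨z, hz⟩

end LogHom

/-! ### Comparison of a smooth chart with a sharp chart at a geometric point. -/

section GeometricPoints

variable {X : Scheme.{u}} {Ω : Type u} [Field Ω]

/-- Geometric points lift to étale neighbourhoods. -/
lemma exists_lift_geometric [IsSepClosed Ω] {V V' : X.Etale} (j : V' ⟶ V)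
    (v : Spec (.of Ω) ⟶ EtSpace V) (hv : v default ∈ Set.range (etMor j)) :
    ∃ v' : Spec (.of Ω) ⟶ EtSpace V', v' ≫ etMor j = v := by
  obtain ⟨y, hy⟩ := hv
  obtain ⟨l, hl, -⟩ := Scheme.exists_fac_of_etale_of_isSepClosed (etMor j) v y hy
  exact ⟨l, hl⟩

lemma appTop_point_ne_zero_of_isUnit {T : Scheme.{u}} (v : Spec (.of Ω) ⟶ T) {a : Γ(T, ⊤)}
    (ha : IsUnit a) : v.appTop a ≠ 0 := by
  have h1 : Nontrivial Γ(Spec (.of Ω), ⊤) :=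
    RingHom.domain_nontrivial (Scheme.ΓSpecIso (.of Ω)).hom.hom
  exact (ha.map v.appTop.hom).ne_zero

end GeometricPoints

namespace LogStructure

variable {X : Scheme.{u}} {M : LogStructure X} {Ω : Type u} [Field Ω] {V : X.Etale}
  {P P₁ : Type u} [CommMonoid P] [CommMonoid P₁]

/-- The chart defines a log point at the geometric point `v`. -/
def IsSharpChartAt (M : LogStructure X) {V : X.Etale} (β : P →* M.Sec V)
    (v : Spec (.of Ω) ⟶ EtSpace V) : Prop :=
  ∀ p : P, p ≠ 1 → v.appTop (M.α V (β p)) = 0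

namespace IsSharpChartAt

variable {β : P →* M.Sec V} {v : Spec (.of Ω) ⟶ EtSpace V}

lemma restrict (h : M.IsSharpChartAt β v) {V' : X.Etale} (j : V' ⟶ V)
    (v' : Spec (.of Ω) ⟶ EtSpace V') (hv : v' ≫ etMor j = v) :
    M.IsSharpChartAt ((M.res j).comp β) v' := fun p hp => by
  rw [MonoidHom.comp_apply, α_res', ← CommRingCat.comp_apply, ← Scheme.Hom.comp_appTop, hv]
  exact h p hp

lemma eq_one_of_isUnit (h : M.IsSharpChartAt β v) {p : P} (hp : IsUnit (β p)) : p = 1 := by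
  by_contra h1
  exact appTop_point_ne_zero_of_isUnit v (hp.map (M.α V)) (h p h1)

/-- The elements of a sharp chart are determined up to units. -/
lemma eq_of_mul_unit_eq [IsSepClosed Ω] (h : M.IsSharpChartAt β v) (hβ : M.IsChart β) {p q : P}
    {a b : (M.Sec V)ˣ} (e : β p * a = β q * b) : p = q := by
  obtain ⟨V₁, i, hv, c, d, hc, hd, h1, -⟩ := hβ.2 V (𝟙 V) p q a b (v default) (by rw [res_id, res_id, e])
  obtain ⟨v', hv'⟩ := exists_lift_geometric i v hv
  have h' := h.restrict i v' hv'
  rw [Category.comp_id] at hc hd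
  rw [h'.eq_one_of_isUnit hc, h'.eq_one_of_isUnit hd, mul_one, mul_one] at h1
  exact h1

end IsSharpChartAt

/-- Comparison of a chart with a sharp chart at a geometric point. -/
theorem IsChart.exists_comparison [IsSepClosed Ω] {β : P →* M.Sec V} {β₁ : P₁ →* M.Sec V}
    {v : Spec (.of Ω) ⟶ EtSpace V} (hβ : M.IsChart β) (hv : M.IsSharpChartAt β v)
    (hβ₁ : M.IsChart β₁) [Monoid.FG P₁] [IsCancelMul P₁] :
    ∃ (V' : X.Etale) (j : V' ⟶ V) (v' : Spec (.of Ω) ⟶ EtSpace V') (π : P₁ →* P)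
      (u : P₁ →* (M.Sec V')ˣ), v' ≫ etMor j = v ∧
      (∀ p, M.res j (β₁ p) = M.res j (β (π p)) * u p) ∧ Function.Surjective π ∧
      ∀ p p', π p = π p' → ∃ c d, π c = 1 ∧ π d = 1 ∧ p * c = p' * d := by
  -- a common neighbourhood for finitely many elements
  have key : ∀ S : Finset P₁, ∃ (V' : X.Etale) (j : V' ⟶ V) (v' : Spec (.of Ω) ⟶ EtSpace V'),
      v' ≫ etMor j = v ∧ ∀ p ∈ S, ∃ (r : P) (a : (M.Sec V')ˣ),
        M.res j (β₁ p) = M.res j (β r) * a := by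
    classical
    intro S
    induction S using Finset.induction_on with
    | empty => exact ⟨V, 𝟙 V, v, by rw [etMor_id]; exact Category.comp_id v, by simp⟩
    | insert p S _ ih =>
      obtain ⟨V', j, v', hv', h⟩ := ih
      obtain ⟨V₁, i, hi, r, a, e⟩ := hβ.1 V' j (M.res j (β₁ p)) (v' default)
      obtain ⟨v₁, hv₁⟩ := exists_lift_geometric i v' hi
      refine ⟨V₁, i ≫ j, v₁, by rw [etMor_comp, reassoc_of% hv₁, hv'], fun p' hp' => ?_⟩
      rcases Finset.mem_insert.1 hp' with rfl | hp'
      · exact ⟨r, a, by rw [← res_res, e]⟩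
      · obtain ⟨r, a, e⟩ := h p' hp'
        refine ⟨r, Units.map (M.res i) a, ?_⟩
        rw [← res_res, e, map_mul, res_res]
        rfl
  -- Finite generation of `P₁` allows one neighbourhood on which every element of the second chart
  -- is an element of the first times a unit.
  obtain ⟨S, hS⟩ := Monoid.FG.fg_top (M := P₁)
  obtain ⟨V', j, v', hv', h⟩ := key S
  have hall : ∀ p : P₁, ∃ (r : P) (a : (M.Sec V')ˣ), M.res j (β₁ p) = M.res j (β r) * a := by
    intro p
    have hp : p ∈ Submonoid.closure (S : Set P₁) := hS ▸ Submonoid.mem_top p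
    induction hp using Submonoid.closure_induction with
    | mem p hp => exact h p hp
    | one => exact ⟨1, 1, by simp⟩
    | mul p p' _ _ h1 h2 =>
      obtain ⟨r, a, e⟩ := h1
      obtain ⟨r', a', e'⟩ := h2
      refine ⟨r * r', a * a', ?_⟩
      rw [map_mul, map_mul, e, e', map_mul, map_mul, Units.val_mul]
      exact mul_mul_mul_comm _ _ _ _
  have hβ' := hβ.restrict j
  have hs := hv.restrict j v' hv'
  have huniq : ∀ {r r' : P} {a a' : (M.Sec V')ˣ},
      M.res j (β r) * a = M.res j (β r') * a' → r = r' := fun e => hs.eq_of_mul_unit_eq hβ' e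
  choose π u hu using hall
  have huniq' : ∀ {r : P} {p : P₁} {a : (M.Sec V')ˣ},
      M.res j (β₁ p) = M.res j (β r) * a → r = π p ∧ a = u p := fun {r p a} e => by
    have h1 := huniq (e.symm.trans (hu p))
    refine ⟨h1, hβ₁.mul_unit_cancel j (m := M.res j (β r)) ?_⟩
    rw [← e, hu p, h1]
  have hmul : ∀ p p', M.res j (β₁ (p * p')) = M.res j (β (π p * π p')) *
      (u p * u p' : (M.Sec V')ˣ) := fun p p' => by
    rw [map_mul, map_mul, hu p, hu p', map_mul β, map_mul (M.res j), Units.val_mul]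
    exact mul_mul_mul_comm _ _ _ _
  have hone : M.res j (β₁ 1) = M.res j (β 1) * (1 : (M.Sec V')ˣ) := by
    rw [map_one, map_one, map_one, map_one, Units.val_one, mul_one]
  let π' : P₁ →* P := ⟨⟨π, (huniq' hone).1.symm⟩, fun p p' => (huniq' (hmul p p')).1.symm⟩
  let u' : P₁ →* (M.Sec V')ˣ := ⟨⟨u, (huniq' hone).2.symm⟩, fun p p' => (huniq' (hmul p p')).2.symm⟩
  refine ⟨V', j, v', π', u', hv', hu, fun r => ?_, fun p p' e => ?_⟩
  -- Near `v`, the section given by `r` is a unit times some `β₁ p`. Sharpness determines the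
  -- element of `P`, so it must be `π p`.
  · obtain ⟨V₁, i, hi, p, a, e⟩ := hβ₁.1 V' j (M.res j (β r)) (v' default)
    obtain ⟨v₁, hv₁⟩ := exists_lift_geometric i v' hi
    refine ⟨p, ((hs.restrict i v₁ hv₁).eq_of_mul_unit_eq (hβ'.restrict i) (a := 1)
      (b := Units.map (M.res i) (u p) * a) ?_).symm⟩
    change M.res i (M.res j (β r)) * _ = M.res i (M.res j (β (π p))) * _
    rw [e, ← res_res, hu p, map_mul, Units.val_one, mul_one, Units.val_mul, mul_assoc]
    rfl
  · have e' : π p = π p' := e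
    have e1 : M.res j (β₁ p) * u p' = M.res j (β₁ p') * u p := by
      rw [hu, hu p', e', mul_assoc, mul_assoc, mul_comm (u p : M.Sec V')]
    obtain ⟨V₁, i, hi, c, d, hc, hd, h1, -⟩ := hβ₁.2 V' j p p' _ _ (v' default) e1
    obtain ⟨v₁, hv₁⟩ := exists_lift_geometric i v' hi
    have hπ : ∀ c, IsUnit (M.res (i ≫ j) (β₁ c)) → π c = 1 := fun c hc => by
      refine (hs.restrict i v₁ hv₁).eq_one_of_isUnit ?_
      rw [← res_res, hu, map_mul] at hc
      exact isUnit_of_mul_isUnit_left hc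
    exact ⟨c, d, hπ c hc, hπ d hd, h1⟩

end LogStructure

/-- Affine neighbourhoods of a point. -/
lemma exists_affine_nbhd_point {T : Scheme.{u}} {Ω : Type u} [Field Ω] (v : Spec (.of Ω) ⟶ T)
    (U : T.Opens) (hU : v default ∈ U) : ∃ (T' : Scheme.{u}) (e : T' ⟶ T) (v' : Spec (.of Ω) ⟶ T'),
      IsOpenImmersion e ∧ v' ≫ e = v ∧ IsAffine T' ∧ Set.range e ⊆ U := by
  obtain ⟨U', hU', hv, hle⟩ := exists_isAffineOpen_mem_and_subset hU
  have hr : Set.range v ⊆ Set.range U'.ι := by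
    rw [Scheme.Opens.range_ι]
    rintro _ ⟨y, rfl⟩
    rw [Subsingleton.elim y default]
    exact hv
  refine ⟨U', U'.ι, IsOpenImmersion.lift U'.ι v hr, inferInstance, IsOpenImmersion.lift_fac _ _ _,
    hU', ?_⟩
  rw [Scheme.Opens.range_ι]
  exact hle

/-- Affine étale neighbourhoods of a geometric point. -/
lemma exists_affine_etale_nbhd {X : Scheme.{u}} {Ω : Type u} [Field Ω] {V : X.Etale}
    (v : Spec (.of Ω) ⟶ EtSpace V) (U : (EtSpace V).Opens) (hU : v default ∈ U) :
    ∃ (V' : X.Etale) (j : V' ⟶ V) (v' : Spec (.of Ω) ⟶ EtSpace V'), v' ≫ etMor j = v ∧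
      IsAffine (EtSpace V') ∧ Set.range (etMor j) ⊆ U := by
  obtain ⟨T, e, v', he, hv, hT, hle⟩ := exists_affine_nbhd_point v U hU
  have h := etMor_etHom (V' := etOver V e) e rfl
  refine ⟨etOver V e, etOverHom V e, v', (congrArg (_ ≫ ·) h).trans hv, hT, ?_⟩
  rw [show etMor (etOverHom V e) = e from h]
  exact hle

namespace LogHom

variable {X S : Scheme.{u}} {M : LogStructure X} {N : LogStructure S} {s : X ⟶ S}
  {φ : LogHom M N s}

namespace Chart

variable {V V' : X.Etale} {W W' : S.Etale} {g : EtSpace V ⟶ EtSpace W}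
    {hg : g ≫ etStr W = etStr V ≫ s} {Q P Q₁ P₁ : Type u} [CommMonoid Q] [CommMonoid P]
    [CommMonoid Q₁] [CommMonoid P₁]

/-- Restriction of a chart. -/
def restrict (c : φ.Chart g hg Q P) (j : V' ⟶ V) (i : W' ⟶ W) (g' : EtSpace V' ⟶ EtSpace W')
    (hg' : g' ≫ etStr W' = etStr V' ≫ s) (h : g' ≫ etMor i = etMor j ≫ g) : φ.Chart g' hg' Q P where
  source := (M.res j).comp c.source
  target := (N.res i).comp c.target
  hom := c.hom
  isChart_source := c.isChart_source.restrict j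
  isChart_target := c.isChart_target.restrict i
  comm q := by
    rw [MonoidHom.comp_apply, MonoidHom.comp_apply, c.comm]
    exact (φ.map_res g hg g' hg' j i h _).symm

/-- The new base is étale over the old one, so étaleness of the composite to the old base cancels.
-/
lemma IsSmooth.restrict {c : φ.Chart g hg Q P} (hc : c.IsSmooth) (j : V' ⟶ V) (i : W' ⟶ W)
    (g' : EtSpace V' ⟶ EtSpace W') (hg' : g' ≫ etStr W' = etStr V' ≫ s)
    (h : g' ≫ etMor i = etMor j ≫ g) : (c.restrict j i g' hg' h).IsSmooth := by
  have hcast : ∀ k : ℕ, IsUnit (k : Γ(EtSpace W, ⊤)) → IsUnit (k : Γ(EtSpace W', ⊤)) := fun k hk => by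
    have := hk.map (etMor i).appTop.hom
    rwa [map_natCast] at this
  refine ⟨hc.fine_target, hc.fine_source, hc.finite_ker, hcast _ hc.isUnit_card_ker,
    hc.finite_torsion, hcast _ hc.isUnit_card_torsion, ?_⟩
  obtain ⟨e, he1, he2, he⟩ := hc.exists_etale
  let c' := c.restrict j i g' hg' h
  have ht : N.toSpecMonoidAlgebra c'.target = etMor i ≫ N.toSpecMonoidAlgebra c.target := by
    rw [LogStructure.toSpecMonoidAlgebra_eq, LogStructure.toSpecMonoidAlgebra_eq,
      Scheme.comp_toSpecMA]
    congr 1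
    ext q
    exact N.α_res' i _
  have hs : M.toSpecMonoidAlgebra c'.source = etMor j ≫ M.toSpecMonoidAlgebra c.source := by
    rw [LogStructure.toSpecMonoidAlgebra_eq, LogStructure.toSpecMonoidAlgebra_eq,
      Scheme.comp_toSpecMA]
    congr 1
    ext q
    exact M.α_res' j _
  let r : c'.base ⟶ c.base := pullback.lift (pullback.fst _ _ ≫ etMor i) (pullback.snd _ _) (by
    rw [Category.assoc, ← ht]
    exact pullback.condition)
  have hr1 : r ≫ pullback.fst _ _ = pullback.fst _ _ ≫ etMor i := pullback.lift_fst _ _ _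
  have hr2 : r ≫ pullback.snd _ _ = pullback.snd _ _ := pullback.lift_snd _ _ _
  have H1 : IsPullback r (pullback.fst _ _) (pullback.fst _ _) (etMor i) := by
    refine IsPullback.of_right (h₁₂ := pullback.snd _ _) (h₂₂ := N.toSpecMonoidAlgebra c.target)
      (v₁₃ := specMap c.hom) ?_ hr1 (IsPullback.of_hasPullback _ _).flip
    rw [hr2, ← ht]
    exact (IsPullback.of_hasPullback _ _).flip
  have hre : Etale r := MorphismProperty.of_isPullback (P := @Etale) H1.flip inferInstance
  have hcomp : c'.toBase ≫ r = etMor j ≫ e := by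
    apply pullback.hom_ext
    · rw [Category.assoc, hr1, ← Category.assoc, toBase_fst, h, Category.assoc, he1]
    · rw [Category.assoc, hr2, toBase_snd, hs, Category.assoc, he2]
  have : Etale (c'.toBase ≫ r) := by rw [hcomp]; infer_instance
  exact ⟨c'.toBase, c'.toBase_fst, c'.toBase_snd, Etale.of_comp _ r⟩

/-- The chart defines log points at the geometric point `v`. -/
structure IsSharpAt {Ω : Type u} [Field Ω] (c : φ.Chart g hg Q P) (v : Spec (.of Ω) ⟶ EtSpace V) :
    Prop where
  source : M.IsSharpChartAt c.source v
  target : N.IsSharpChartAt c.target (v ≫ g)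

lemma IsSharpAt.restrict {Ω : Type u} [Field Ω] {c : φ.Chart g hg Q P}
    {v : Spec (.of Ω) ⟶ EtSpace V} (hc : c.IsSharpAt v) (j : V' ⟶ V) (i : W' ⟶ W)
    (g' : EtSpace V' ⟶ EtSpace W') (hg' : g' ≫ etStr W' = etStr V' ≫ s)
    (h : g' ≫ etMor i = etMor j ≫ g) (v' : Spec (.of Ω) ⟶ EtSpace V') (hv : v' ≫ etMor j = v) :
    (c.restrict j i g' hg' h).IsSharpAt v' :=
  ⟨hc.source.restrict j v' hv, hc.target.restrict i _ (by
    rw [Category.assoc, h, ← Category.assoc, hv])⟩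

/-- The chart `c` is a quotient of `c₁` up to units. -/
structure Comparison (c₁ : φ.Chart g hg Q₁ P₁) (c : φ.Chart g hg Q P) where
  π : P₁ →* P
  πQ : Q₁ →* Q
  u : P₁ →* (M.Sec V)ˣ
  uQ : Q₁ →* (N.Sec W)ˣ
  source_eq (p : P₁) : c₁.source p = c.source (π p) * u p
  target_eq (q : Q₁) : c₁.target q = c.target (πQ q) * uQ q
  π_surjective : Function.Surjective π
  πQ_surjective : Function.Surjective πQ
  exists_of_π_eq (p p' : P₁) : π p = π p' → ∃ c d, π c = 1 ∧ π d = 1 ∧ p * c = p' * d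
  exists_of_πQ_eq (q q' : Q₁) : πQ q = πQ q' → ∃ c d, πQ c = 1 ∧ πQ d = 1 ∧ q * c = q' * d

namespace Comparison

variable {c₁ : φ.Chart g hg Q₁ P₁} {c : φ.Chart g hg Q P} (r : Comparison c₁ c)
  {Ω : Type u} [Field Ω] [IsSepClosed Ω] {v : Spec (.of Ω) ⟶ EtSpace V}

include r in
lemma mul_unit_eq (q : Q₁) : c.source (r.π (c₁.hom q)) * r.u (c₁.hom q) =
    c.source (c.hom (r.πQ q)) * φ.mapUnits g hg (r.uQ q) := by
  rw [← r.source_eq, c₁.comm, r.target_eq, map_mul, c.comm]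
  rfl

lemma π_hom (hc : c.IsSharpAt v) (q : Q₁) : r.π (c₁.hom q) = c.hom (r.πQ q) :=
  hc.source.eq_of_mul_unit_eq c.isChart_source (r.mul_unit_eq q)

/-- Once the parts in `P` agree, the units can be compared, because units cancel in a log structure
with a chart by a cancellative monoid. -/
lemma u_hom [IsCancelMul P₁] (hc : c.IsSharpAt v) (q : Q₁) :
    r.u (c₁.hom q) = φ.mapUnits g hg (r.uQ q) := by
  refine c₁.isChart_source.mul_unit_cancel (𝟙 V) (m := c.source (c.hom (r.πQ q))) ?_
  rw [← r.mul_unit_eq, r.π_hom hc]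

end Comparison

end Chart

/-- Around a geometric point, a sharp chart and a smooth chart can be compared. -/
theorem exists_comparison {Ω : Type u} [Field Ω] [IsSepClosed Ω] {x : Spec (.of Ω) ⟶ X}
    (hx : φ.SharpAt x) (hx₁ : φ.LogSmoothAt x) (U : X.Opens) (hU : x default ∈ U) :
    ∃ (V : X.Etale) (W : S.Etale) (g : EtSpace V ⟶ EtSpace W) (hg : g ≫ etStr W = etStr V ≫ s)
      (v : Spec (.of Ω) ⟶ EtSpace V) (Q P Q₁ P₁ : Type u) (_ : CommMonoid Q) (_ : CommMonoid P)
      (_ : CommMonoid Q₁) (_ : CommMonoid P₁) (c : φ.Chart g hg Q P) (c₁ : φ.Chart g hg Q₁ P₁),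
      v ≫ etStr V = x ∧ IsAffine (EtSpace V) ∧ IsAffine (EtSpace W) ∧
      Set.range (etStr V) ⊆ U ∧ c.IsSharpAt v ∧ c₁.IsSmooth ∧ Nonempty (c₁.Comparison c) := by
  obtain ⟨V₁, W₁, g₁, hg₁, v₁, Q, P, _, _, c, hv₁, hcP, hcQ⟩ := hx
  obtain ⟨V₂, W₂, g₂, hg₂, v₂, Q₁, P₁, _, _, c₁, hv₂, hc₁⟩ := hx₁
  have hc : c.IsSharpAt v₁ := ⟨hcP, hcQ⟩
  obtain ⟨V₃, a, b, hV₃⟩ := exists_etale_prod V₁ V₂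
  obtain ⟨W₃, a', b', hW₃⟩ := exists_etale_prod W₁ W₂
  obtain ⟨v₃, hv₃, -⟩ := hV₃ _ v₁ v₂ (by rw [hv₁, hv₂])
  obtain ⟨g₃, hga, hgb⟩ := hW₃ _ (etMor a ≫ g₁) (etMor b ≫ g₂) (by
    rw [Category.assoc, Category.assoc, hg₁, hg₂, etMor_w_assoc, etMor_w_assoc])
  have hg₃ : g₃ ≫ etStr W₃ = etStr V₃ ≫ s := by
    rw [← etMor_w a', ← Category.assoc, hga, Category.assoc, hg₁, etMor_w_assoc]
  let d := c.restrict a a' g₃ hg₃ hga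
  let d₁ := c₁.restrict b b' g₃ hg₃ hgb
  have hd : d.IsSharpAt v₃ := hc.restrict a a' g₃ hg₃ hga v₃ hv₃
  have hd₁ : d₁.IsSmooth := hc₁.restrict b b' g₃ hg₃ hgb
  have hfgQ := hd₁.fine_target.1
  have hcanQ := hd₁.fine_target.2
  have hfgP := hd₁.fine_source.1
  have hcanP := hd₁.fine_source.2
  -- The target is compared and shrunk first; the source is then shrunk over it, and restriction
  -- preserves what was achieved.
  obtain ⟨W₄, i₄, w₄, πQ, uQ, hw₄, htarget, hπQ, hπQ'⟩ :=
    d.isChart_target.exists_comparison hd.target d₁.isChart_target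
  obtain ⟨W₅, i₅, w₅, hw₅, hW₅, -⟩ := exists_affine_etale_nbhd w₄ ⊤ trivial
  obtain ⟨V₄, j₄, g₄, hv₄, hg₄⟩ := exists_etale_lift g₃ (i₅ ≫ i₄) (v₃ default) ⟨w₅ default, by
    rw [← Scheme.Hom.comp_apply, ← Scheme.Hom.comp_apply, etMor_comp, reassoc_of% hw₅, hw₄]⟩
  obtain ⟨v₄, hv₄⟩ := exists_lift_geometric j₄ v₃ hv₄
  obtain ⟨V₅, j₅, v₅, π, u, hv₅, hsource, hπ, hπ'⟩ :=
    (d.isChart_source.restrict j₄).exists_comparison (hd.source.restrict j₄ v₄ hv₄)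
      (d₁.isChart_source.restrict j₄)
  obtain ⟨V₆, j₆, v₆, hv₆, hV₆, hU₆⟩ := exists_affine_etale_nbhd v₅ (etStr V₅ ⁻¹ᵁ U) (by
    change (v₅ ≫ etStr V₅) default ∈ U
    rwa [← etMor_w j₅, reassoc_of% hv₅, ← etMor_w j₄, reassoc_of% hv₄, ← etMor_w a,
      reassoc_of% hv₃, hv₁])
  let g₆ : EtSpace V₆ ⟶ EtSpace W₅ := etMor j₆ ≫ etMor j₅ ≫ g₄
  have h₆ : g₆ ≫ etMor (i₅ ≫ i₄) = etMor (j₆ ≫ j₅ ≫ j₄) ≫ g₃ := by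
    rw [etMor_comp j₆, etMor_comp j₅, Category.assoc, Category.assoc, Category.assoc, hg₄,
      Category.assoc]
  have hg₆ : g₆ ≫ etStr W₅ = etStr V₆ ≫ s := by
    rw [← etMor_w (i₅ ≫ i₄), ← Category.assoc, h₆, Category.assoc, hg₃, etMor_w_assoc]
  have hv : v₆ ≫ etMor (j₆ ≫ j₅ ≫ j₄) = v₃ := by
    rw [etMor_comp, etMor_comp, reassoc_of% hv₆, reassoc_of% hv₅, hv₄]
  refine ⟨V₆, W₅, g₆, hg₆, v₆, Q, P, Q₁, P₁, _, _, _, _,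
    d.restrict (j₆ ≫ j₅ ≫ j₄) (i₅ ≫ i₄) g₆ hg₆ h₆, d₁.restrict (j₆ ≫ j₅ ≫ j₄) (i₅ ≫ i₄) g₆ hg₆ h₆,
    ?_, hV₆, hW₅, ?_, hd.restrict _ _ _ _ _ _ hv, hd₁.restrict _ _ _ _ _, ⟨?_⟩⟩
  · rw [← etMor_w (j₆ ≫ j₅ ≫ j₄), reassoc_of% hv, ← etMor_w a, reassoc_of% hv₃, hv₁]
  · rw [← etMor_w j₆]
    rintro _ ⟨y, rfl⟩
    rw [Scheme.Hom.comp_apply]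
    exact hU₆ ⟨y, rfl⟩
  · exact
      { π := π
        πQ := πQ
        u := (Units.map (M.res j₆)).comp u
        uQ := (Units.map (N.res i₅)).comp uQ
        source_eq := fun p => by
          have := congrArg (M.res j₆) (hsource p)
          rw [map_mul] at this
          simp only [MonoidHom.comp_apply, M.res_res] at this
          exact this
        target_eq := fun q => by
          have := congrArg (N.res i₅) (htarget q)
          rw [map_mul, N.res_res, N.res_res] at this
          exact this
        π_surjective := hπ
        πQ_surjective := hπQ
        exists_of_π_eq := hπ'
        exists_of_πQ_eq := hπQ' }

end LogHom

/-! ### From charts of log schemes to rings. -/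

/-- Infinitesimal lifting for étale ring homomorphisms. -/
lemma RingHom.Etale.exists_lift {R A B C : Type u} [CommRing R] [CommRing A] [CommRing B]
    [CommRing C] {ε : R →+* A} (hε : ε.Etale) (t : R →+* B) (g : B →+* C)
    (hg : Function.Surjective g) (hg' : ∀ x y, g x = 0 → g y = 0 → x * y = 0) (f : A →+* C)
    (h : f.comp ε = g.comp t) : ∃ ψ : A →+* B, g.comp ψ = f ∧ ψ.comp ε = t := by
  let _ := ε.toAlgebra
  let _ := t.toAlgebra
  let _ := (g.comp t).toAlgebra
  have hε' : Algebra.Etale R A := hε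
  let f' : A →ₐ[R] C := { f with commutes' := fun x => congr($h x) }
  let g' : B →ₐ[R] C := { g with commutes' := fun x => rfl }
  have hker : IsNilpotent (RingHom.ker (g' : B →+* C)) := by
    refine ⟨2, ?_⟩
    rw [pow_two, Ideal.zero_eq_bot, eq_bot_iff, Ideal.mul_le]
    exact fun x hx y hy => hg' x y hx hy
  refine ⟨(Algebra.FormallySmooth.liftOfSurjective f' g' hg hker).toRingHom, ?_, ?_⟩
  · exact RingHom.ext fun x => Algebra.FormallySmooth.liftOfSurjective_apply f' g' hg hker x
  · exact RingHom.ext fun x => (Algebra.FormallySmooth.liftOfSurjective f' g' hg hker).commutes x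

namespace AlgebraicGeometry.Scheme

variable {P Q : Type u} [CommMonoid P] [CommMonoid Q]

lemma specMap_monoidFun (θ : Q →* P) (q : Q) :
    (specMap θ).appTop (monoidFun Q q) = monoidFun P (θ q) := by
  have h := Scheme.ΓSpecIso_inv_naturality
    (CommRingCat.ofHom (MonoidAlgebra.mapDomainRingHom ℤ θ))
  refine (congr(($h).hom (MonoidAlgebra.of ℤ Q q))).symm.trans ?_
  refine congrArg (Scheme.ΓSpecIso (.of (MonoidAlgebra ℤ P))).inv.hom ?_
  exact MonoidAlgebra.mapDomain_single

lemma monoidFun_hom_ext {A : CommRingCat.{u}} {f g : Γ(Spec (.of (MonoidAlgebra ℤ P)), ⊤) ⟶ A}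
    (h : ∀ p, f (monoidFun P p) = g (monoidFun P p)) : f = g := by
  rw [← cancel_epi (Scheme.ΓSpecIso (.of (MonoidAlgebra ℤ P))).inv]
  exact CommRingCat.hom_ext (MonoidAlgebra.intRingHom_ext h)

lemma exists_monoidFun_hom {A : CommRingCat.{u}} (b : P →* A) :
    ∃ f : Γ(Spec (.of (MonoidAlgebra ℤ P)), ⊤) ⟶ A, ∀ p, f (monoidFun P p) = b p := by
  refine ⟨(Scheme.ΓSpecIso (.of (MonoidAlgebra ℤ P))).hom ≫
    CommRingCat.ofHom (MonoidAlgebra.lift ℤ A P b).toRingHom, fun p => ?_⟩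
  refine (congrArg (MonoidAlgebra.lift ℤ A P b) ?_).trans (MonoidAlgebra.lift_of b p)
  exact congr(($((Scheme.ΓSpecIso (.of (MonoidAlgebra ℤ P))).inv_hom_id)).hom
    (MonoidAlgebra.of ℤ P p))

end AlgebraicGeometry.Scheme

namespace LogHom.Chart

open Scheme

variable {X S : Scheme.{u}} {M : LogStructure X} {N : LogStructure S} {s : X ⟶ S}
  {φ : LogHom M N s} {V : X.Etale} {W : S.Etale} {g : EtSpace V ⟶ EtSpace W}
    {hg : g ≫ etStr W = etStr V ≫ s} {Q P Q₁ P₁ : Type u} [CommMonoid Q] [CommMonoid P]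
    [CommMonoid Q₁] [CommMonoid P₁] (c : φ.Chart g hg Q P)

/-- Functions on the base coming from the target. -/
def baseFun : Γ(EtSpace W, ⊤) →+* Γ(c.base, ⊤) :=
  (pullback.fst (N.toSpecMonoidAlgebra c.target) (specMap c.hom)).appTop.hom

/-- Functions on the base coming from the monoid. -/
def baseMonoidFun : P →* Γ(c.base, ⊤) :=
  ((pullback.snd (N.toSpecMonoidAlgebra c.target) (specMap c.hom)).appTop.hom : _ →* _).comp
    (monoidFun P)

lemma target_monoidFun (q : Q) : (N.toSpecMonoidAlgebra c.target).appTop (monoidFun Q q) =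
    N.α W (c.target q) := toSpecMA_monoidFun _ q

lemma baseFun_target (q : Q) : c.baseFun (N.α W (c.target q)) = c.baseMonoidFun (c.hom q) := by
  have h := congrArg Scheme.Hom.appTop
    (pullback.condition (f := N.toSpecMonoidAlgebra c.target) (g := specMap c.hom))
  rw [Scheme.Hom.comp_appTop, Scheme.Hom.comp_appTop] at h
  have h1 := congr(($h).hom (monoidFun Q q))
  refine (congrArg c.baseFun (c.target_monoidFun q)).symm.trans (h1.trans ?_)
  exact congrArg (pullback.snd (N.toSpecMonoidAlgebra c.target) (specMap c.hom)).appTop.hom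
    (specMap_monoidFun c.hom q)

lemma toBase_baseFun (x : Γ(EtSpace W, ⊤)) : c.toBase.appTop (c.baseFun x) = g.appTop x := by
  have h := congrArg Scheme.Hom.appTop c.toBase_fst
  rw [Scheme.Hom.comp_appTop] at h
  exact congr(($h).hom x)

lemma toBase_baseMonoidFun (p : P) :
    c.toBase.appTop (c.baseMonoidFun p) = M.α V (c.source p) := by
  have h := congrArg Scheme.Hom.appTop c.toBase_snd
  rw [Scheme.Hom.comp_appTop] at h
  exact (congr(($h).hom (monoidFun P p))).trans (toSpecMA_monoidFun _ p)

lemma IsSmooth.etale_toBase {c : φ.Chart g hg Q P} (hc : c.IsSmooth) : Etale c.toBase := by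
  obtain ⟨e, he1, he2, he⟩ := hc.exists_etale
  have : e = c.toBase := pullback.hom_ext (he1.trans c.toBase_fst.symm)
    (he2.trans c.toBase_snd.symm)
  exact this ▸ he

variable [IsAffine (EtSpace W)]

lemma isPushout_base : IsPushout (N.toSpecMonoidAlgebra c.target).appTop (specMap c.hom).appTop
    (CommRingCat.ofHom c.baseFun)
    (pullback.snd (N.toSpecMonoidAlgebra c.target) (specMap c.hom)).appTop :=
  isPushout_appTop_of_isPullback (IsPullback.of_hasPullback _ _)

variable {c}

lemma base_hom_ext {T : Type u} [CommRing T] {f f' : Γ(c.base, ⊤) →+* T}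
    (h : ∀ x, f (c.baseFun x) = f' (c.baseFun x))
    (h' : ∀ p, f (c.baseMonoidFun p) = f' (c.baseMonoidFun p)) : f = f' := by
  have : CommRingCat.ofHom f = CommRingCat.ofHom f' := by
    refine c.isPushout_base.hom_ext (CommRingCat.hom_ext (RingHom.ext h)) ?_
    exact monoidFun_hom_ext h'
  exact congr(($this).hom)

variable (c) in
lemma exists_base_hom {T : Type u} [CommRing T] (a : Γ(EtSpace W, ⊤) →+* T) (b : P →* T)
    (h : ∀ q, a (N.α W (c.target q)) = b (c.hom q)) :
    ∃ f : Γ(c.base, ⊤) →+* T, (∀ x, f (c.baseFun x) = a x) ∧ ∀ p, f (c.baseMonoidFun p) = b p := by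
  obtain ⟨b', hb'⟩ := exists_monoidFun_hom (A := .of T) b
  have hw : (N.toSpecMonoidAlgebra c.target).appTop ≫ CommRingCat.ofHom a =
      (specMap c.hom).appTop ≫ b' := by
    refine monoidFun_hom_ext fun q => ?_
    refine (congrArg a (c.target_monoidFun q)).trans ((h q).trans ?_)
    exact ((congrArg b'.hom (specMap_monoidFun c.hom q)).trans (hb' _)).symm
  refine ⟨(c.isPushout_base.desc _ _ hw).hom, fun x => ?_, fun p => ?_⟩
  · exact congr(($(c.isPushout_base.inl_desc _ _ hw)).hom x)
  · exact (congr(($(c.isPushout_base.inr_desc _ _ hw)).hom (monoidFun P p))).trans (hb' p)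

variable [IsAffine (EtSpace V)]

lemma IsSmooth.etale_appTop (hc : c.IsSmooth) : c.toBase.appTop.hom.Etale := by
  have := hc.etale_toBase
  exact HasRingHomProperty.appTop (P := @Etale) c.toBase this

/-- The rings and monoids of two charts that can be compared. -/
def Comparison.chartPair {c₁ : φ.Chart g hg Q₁ P₁} (r : c₁.Comparison c) (hc₁ : c₁.IsSmooth)
    {Ω : Type u} [Field Ω] [IsSepClosed Ω] {v : Spec (.of Ω) ⟶ EtSpace V} (hc : c.IsSharpAt v) :
    letI := g.appTop.hom.toAlgebra
    ChartPair Γ(EtSpace W, ⊤) Γ(EtSpace V, ⊤) P₁ Q₁ P Q :=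
  letI := g.appTop.hom.toAlgebra
  have hcan := hc₁.fine_source.2
  { θ₁ := c₁.hom
    θ := c.hom
    π := r.π
    πQ := r.πQ
    π_θ₁ := r.π_hom hc
    π_surjective := r.π_surjective
    πQ_surjective := r.πQ_surjective
    αN₁ := (N.α W).comp c₁.target
    αN := (N.α W).comp c.target
    α₁ := (M.α V).comp c₁.source
    α := (M.α V).comp c.source
    uM := (Units.map (M.α V)).comp r.u
    uN := (Units.map (N.α W)).comp r.uQ
    α₁_eq := fun p => (congrArg (M.α V) (r.source_eq p)).trans (map_mul _ _ _)
    αN₁_eq := fun q => (congrArg (N.α W) (r.target_eq q)).trans (map_mul _ _ _)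
    uM_θ₁ := fun q => (congrArg (fun z : (M.Sec V)ˣ => M.α V z) (r.u_hom hc q)).trans
      (φ.α_map g hg _)
    α_θ := fun q => (congrArg (M.α V) (c.comm q)).trans (φ.α_map g hg _)
    exists_of_π_eq := r.exists_of_π_eq
    exists_of_πQ_eq := r.exists_of_πQ_eq
    -- The maps `a` and `b` define a map on the base ring of the smooth chart, and `Γ(EtSpace V, ⊤)`
    -- is étale over that ring.
    exists_lift := fun {T T'} _ _ g₀ hg₀ hg₀' f a b hab ha hb => by
      obtain ⟨t, ht1, ht2⟩ := c₁.exists_base_hom a b hab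
      obtain ⟨ψ, hψ1, hψ2⟩ := hc₁.etale_appTop.exists_lift t g₀ hg₀ hg₀' f
        (base_hom_ext (fun x => by
          rw [RingHom.comp_apply, RingHom.comp_apply, ht1, ha]
          exact congrArg f (c₁.toBase_baseFun x)) (fun p => by
          rw [RingHom.comp_apply, RingHom.comp_apply, ht2, hb]
          exact congrArg f (c₁.toBase_baseMonoidFun p)))
      refine ⟨ψ, fun x => congr($hψ1 x), fun x => ?_, fun p => ?_⟩
      · rw [← ht1, ← hψ2]
        exact congrArg ψ (c₁.toBase_baseFun x).symm
      · rw [← ht2, ← hψ2]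
        exact congrArg ψ (c₁.toBase_baseMonoidFun p).symm }

end LogHom.Chart

/-! ### Derivations and algebraic dependence for unramified maps. -/

section Unramified

/-- Unramified algebras do not enlarge the algebraic span. -/
lemma mem_algebraicSpan_of_unramified {k K R O : Type u} [Field k] [Field K] [Algebra k K]
    [CommRing R] [CommRing O] {ε : R →+* O} (hε : ε.FormallyUnramified) (hε' : ε.FiniteType)
    (f : O →+* K) {S : Set K} (hR : ∀ r, f (ε r) ∈ algebraicSpan k S) (x : O) :
    f x ∈ algebraicSpan k S := by
  let _ := ε.toAlgebra
  have h1 : Algebra.FormallyUnramified R O := hε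
  have h2 : Algebra.FiniteType R O := hε'
  let L := algebraicSpan k S
  let ρ : R →+* L := (f.comp ε).codRestrict L hR
  let _ : Algebra R L := ρ.toAlgebra
  let _ : Algebra R K := (f.comp ε).toAlgebra
  have : IsScalarTower R L K := IsScalarTower.of_algebraMap_eq fun _ => rfl
  let f' : O →ₐ[R] K := { f with commutes' := fun _ => rfl }
  let g : TensorProduct R L O →ₐ[L] K :=
    Algebra.TensorProduct.lift (Algebra.ofId L K) f' fun _ _ => Commute.all _ _
  -- An unramified algebra of finite type over a field is finite, so the image of `x` is algebraic
  -- over `L`, which is algebraically closed in `K`.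
  have hfin : Module.Finite L (TensorProduct R L O) := Algebra.FormallyUnramified.finite_of_free _ _
  have hint : IsIntegral L ((1 : L) ⊗ₜ[R] x) := Algebra.IsIntegral.isIntegral _
  have hg : g ((1 : L) ⊗ₜ[R] x) = f x := by
    rw [Algebra.TensorProduct.lift_tmul, map_one, one_mul]
    rfl
  have halg : IsAlgebraic L (f x) := by
    rw [← hg]
    exact (hint.map g).isAlgebraic
  let R' : Subalgebra k K :=
    { L.toSubring with algebraMap_mem' := algebraMap_mem_algebraicSpan S }
  exact mem_algebraicSpan_of_isAlgebraic (R := R') (fun _ h => h) halg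

/-- Vanishing on the image of `ψ` makes `D` linear over `A₀`, and the relative differentials are
zero. -/
lemma Derivation.eq_zero_of_formallyUnramified {A₀ k O K : Type u} [CommRing A₀] [CommRing k]
    [CommRing O] [CommRing K] [Algebra k O] [Algebra k K] [Algebra O K]
    {ψ : A₀ →+* O} (hψ : ψ.FormallyUnramified) (D : Derivation k O K) (h : ∀ a, D (ψ a) = 0) :
    D = 0 := by
  let _ := ψ.toAlgebra
  have : Algebra.FormallyUnramified A₀ O := hψ
  let _ : Algebra A₀ K := ((algebraMap O K).comp ψ).toAlgebra
  have : IsScalarTower A₀ O K := IsScalarTower.of_algebraMap_eq fun _ => rfl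
  let D₀ : O →ₗ[A₀] K :=
    { toFun := D
      map_add' := map_add D
      map_smul' := fun a x => by
        rw [Algebra.smul_def, D.leibniz]
        change ψ a • D x + x • D (ψ a) = _
        rw [h, smul_zero, add_zero]
        exact algebraMap_smul O a (D x) }
  let D' : Derivation A₀ O K := Derivation.mk' D₀ fun x y => D.leibniz x y
  have h0 : D' = 0 := by
    rw [← D'.liftKaehlerDifferential_comp,
      Subsingleton.elim D'.liftKaehlerDifferential 0]
    ext
    rfl
  ext x
  exact congr($h0 x)

/-- The homomorphism to dual numbers given by a derivation. -/
def Derivation.toTrivSqZeroExt {k O K : Type u} [CommRing k] [CommRing O] [CommRing K] [Algebra k O]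
    [Algebra k K] [Algebra O K] (D : Derivation k O K) : O →+* TrivSqZeroExt K K :=
  RingHom.mk' { toFun := fun x => TrivSqZeroExt.inl (algebraMap O K x) + TrivSqZeroExt.inr (D x)
                map_one' := by simp
                map_mul' := fun x y => by
                  ext
                  · simp
                  · simp only [map_mul, D.leibniz, TrivSqZeroExt.snd_add, TrivSqZeroExt.snd_inl,
                      TrivSqZeroExt.snd_inr, TrivSqZeroExt.snd_mul, TrivSqZeroExt.fst_add,
                      TrivSqZeroExt.fst_inl, TrivSqZeroExt.fst_inr, zero_add, add_zero,
                      op_smul_eq_smul, algebraMap_smul] }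
    fun x y => by
      ext
      · simp
      · simp

end Unramified

section AffineCoordinates

variable {k : Type u} [Field k] {n q : ℕ}
attribute [local instance] MvPolynomial.gradedAlgebra

/-- A derivation vanishes on the affine coordinate ring if it vanishes on the coordinates. -/
lemma Derivation.apply_affRing_eq_zero {k₀ O K : Type u} [CommRing k₀] [CommRing O] [CommRing K]
    [Algebra k₀ O] [Algebra k₀ K] [Algebra O K] (D : Derivation k₀ O K) {i : Fin (n + 1)}
    (ψ : ProjSpace.AffRing k i →+* O) (hk : ∀ a, D (ψ (ProjSpace.affConst k i a)) = 0)
    (hc : ∀ l, D (ψ (ProjSpace.affCoord i l)) = 0) (a : ProjSpace.AffRing k i) : D (ψ a) = 0 := by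
  have key : ∀ x, D x = 0 → D.toTrivSqZeroExt x =
      (TrivSqZeroExt.inl (algebraMap O K x) : TrivSqZeroExt K K) := fun x hx => by
    change (TrivSqZeroExt.inl (algebraMap O K x) + TrivSqZeroExt.inr (D x) : TrivSqZeroExt K K) = _
    rw [hx, TrivSqZeroExt.inr_zero, add_zero]
  -- A derivation is a ring homomorphism to the dual numbers, and homomorphisms from the affine
  -- coordinate ring are determined by constants and coordinates.
  have h : D.toTrivSqZeroExt.comp ψ = (TrivSqZeroExt.inlHom K K).comp ((algebraMap O K).comp ψ) := by
    apply ProjSpace.affRing_hom_ext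
    · exact fun a => key _ (hk a)
    · exact fun a => key _ (hc a)
  have h1 := congrArg TrivSqZeroExt.snd congr($h a)
  have h2 : (D.toTrivSqZeroExt (ψ a)).snd = D (ψ a) := by
    change (TrivSqZeroExt.inl (algebraMap O K (ψ a)) + TrivSqZeroExt.inr (D (ψ a)) :
      TrivSqZeroExt K K).snd = _
    rw [TrivSqZeroExt.snd_add, TrivSqZeroExt.snd_inl, TrivSqZeroExt.snd_inr, zero_add]
  exact h2.symm.trans (h1.trans (TrivSqZeroExt.snd_inl _ _))

namespace Incidence

open scoped Classical in
/-- If a prime of the chart of the section scheme lies over the generic point, its coefficients are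
algebraically independent. -/
lemma algebraicIndependent_of_generic {A K : Type u} [CommRing A] [Field K] [Algebra k K]
    (I : Fin q ↪o Fin (n + 1)) (j₀ : Fin q) (ψ : ProjSpace.AffRing k (I j₀) →+* A)
    (f : SectionRing A I j₀ →+* K)
    (hk : ∀ a, f (MvPolynomial.C (ψ (ProjSpace.affConst k (I j₀) a))) = algebraMap k K a)
    (hf : Function.Injective (f.comp (sectionHomGrass I j₀ ψ))) :
    AlgebraicIndependent k (Sum.elim
      (fun l : {l : Fin (n + 1) // l ∉ Set.range I} => f (sectionEntry I j₀ ψ (j₀, l)))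
      (fun p : {j : Fin q // j ≠ j₀} × {l : Fin (n + 1) // l ∉ Set.range I} =>
        f (MvPolynomial.X p))) := by
  let F : Grass.ChartRing k I →ₐ[k] K :=
    { f.comp (sectionHomGrass I j₀ ψ) with
      commutes' := fun a => (congrArg f (sectionHomGrass_const I j₀ ψ a)).trans (hk a) }
  have h1 : AlgebraicIndependent k fun p => F (MvPolynomial.X p) := by
    have h2 := (MvPolynomial.algebraicIndependent_X (Fin q × {l : Fin (n + 1) // l ∉ Set.range I})
      k).map' (f := F) hf
    exact h2
  let e : {l : Fin (n + 1) // l ∉ Set.range I} ⊕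
      ({j : Fin q // j ≠ j₀} × {l : Fin (n + 1) // l ∉ Set.range I}) →
      Fin q × {l : Fin (n + 1) // l ∉ Set.range I} :=
    Sum.elim (fun l => (j₀, l)) (fun p => (p.1.1, p.2))
  have he : Function.Injective e := by
    rintro (l | ⟨j, l⟩) (l' | ⟨j', l'⟩) h
    · exact congrArg Sum.inl congr(($h).2)
    · exact absurd congr(($h).1).symm j'.2
    · exact absurd congr(($h).1) j.2
    · exact congrArg Sum.inr (Prod.ext (Subtype.ext congr(($h).1)) congr(($h).2))
  convert h1.comp e he using 1
  ext (l | ⟨j, l⟩)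
  · exact (congrArg f (sectionHomGrass_X I j₀ ψ (j₀, l))).symm
  · refine ((congrArg f (sectionHomGrass_X I j₀ ψ (j.1, l))).trans ?_).symm
    rw [sectionEntry_of_ne]
    rfl

end Incidence

end AffineCoordinates

/-! ### The smoothness criterion over the generic point of the Grassmannian. -/

section GenericSmoothness

variable {k : Type u} [Field k] {n q : ℕ}
attribute [local instance] MvPolynomial.gradedAlgebra

namespace Incidence

/-- The map from the product of the chart of the Grassmannian with a scheme to the chart of the section
scheme, on functions. -/
def sectionHomProd {A B : Type u} [CommRing A] [CommRing B] (I : Fin q ↪o Fin (n + 1)) (j₀ : Fin q)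
    (ψ : ProjSpace.AffRing k (I j₀) →+* A) (β : B →+* A) :
    MvPolynomial (Fin q × {l : Fin (n + 1) // l ∉ Set.range I}) B →+* SectionRing A I j₀ :=
  MvPolynomial.eval₂Hom (MvPolynomial.C.comp β) (sectionEntry I j₀ ψ)

end Incidence

open Incidence

/-- Elements of an étale algebra over a field are algebraic. -/
lemma RingHom.Etale.isAlgebraic {k A K : Type u} [Field k] [CommRing A] [Field K] [Algebra k K]
    {κ : k →+* A} (hκ : κ.Etale) (f : A →+* K) (h : ∀ a, f (κ a) = algebraMap k K a) (x : A) :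
    IsAlgebraic k (f x) := by
  let _ := κ.toAlgebra
  have : Algebra.Etale k A := hκ
  have : Module.Finite k A := Algebra.FormallyUnramified.finite_of_free _ _
  let f' : A →ₐ[k] K := { f with commutes' := h }
  exact ((Algebra.IsIntegral.isIntegral (R := k) x).map f').isAlgebraic

open scoped Classical in
/-- The smoothness criterion at points over the generic point of the Grassmannian. -/
theorem ChartPair.isSmoothAt_of_generic {kW O P₁ Q₁ P Q : Type u} [CommRing kW] [CommRing O]
    [Algebra kW O] [CommMonoid P₁] [CommMonoid Q₁] [CommMonoid P] [CommMonoid Q] [IsCancelMul P₁]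
    [Monoid.FG P₁] (c : ChartPair kW O P₁ Q₁ P Q) {κW : k →+* kW} (hκW : κW.Etale)
    {R : Type u} [CommRing R] {ε : R →+* O} (hε : ε.Etale)
    (hR : ∀ T : Subring O, (∀ x, algebraMap kW O x ∈ T) → (∀ p, c.α₁ p ∈ T) → ∀ r, ε r ∈ T)
    (I : Fin q ↪o Fin (n + 1)) (j₀ : Fin q) {ψ : ProjSpace.AffRing k (I j₀) →+* O}
    (hψ : ψ.FormallyUnramified)
    (hψk : ∀ a, ψ (ProjSpace.affConst k (I j₀) a) = algebraMap kW O (κW a))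
    (𝔷 : Ideal (SectionRing O I j₀)) [𝔷.IsPrime] (hc : c.IsSharpAt 𝔷.ResidueField)
    (hθ : (gpMap c.θ₁).IsTame 𝔷.ResidueField)
    (hgen : ∀ a, sectionHomGrass I j₀ ψ a ∈ 𝔷 → a = 0)
    {B : Type u} [CommRing B] (bB : kW →+* B) (aB : P →* B)
    (hB : ∀ {T : Type u} [CommRing T] (f g : B →+* T), (∀ x, f (bB x) = g (bB x)) →
      (∀ p, f (aB p) = g (aB p)) → f = g)
    (hab : ∀ q, bB (c.αN q) = aB (c.θ q)) (β : B →+* O) (hβ1 : ∀ x, β (bB x) = algebraMap kW O x)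
    (hβ2 : ∀ p, β (aB p) = c.α p) (hfp : (sectionHomProd I j₀ ψ β).FinitePresentation) :
    letI := (sectionHomProd I j₀ ψ β).toAlgebra
    Algebra.IsSmoothAt (MvPolynomial (Fin q × {l : Fin (n + 1) // l ∉ Set.range I}) B) 𝔷 := by
  let _ := (sectionHomProd I j₀ ψ β).toAlgebra
  have hfp' : Algebra.FinitePresentation
    (MvPolynomial (Fin q × {l : Fin (n + 1) // l ∉ Set.range I}) B) (SectionRing O I j₀) := hfp
  have hεft : ε.FiniteType := by
    let _ := ε.toAlgebra
    have : Algebra.Etale R O := hε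
    exact (inferInstance : Algebra.FiniteType R O)
  let K := 𝔷.ResidueField
  let F : SectionRing O I j₀ →+* K := algebraMap _ _
  have hF : ∀ x, F (MvPolynomial.C x) = algebraMap O K x := fun x => rfl
  let _ : Algebra k K := ((algebraMap kW K).comp κW).toAlgebra
  have hkK : ∀ a, F (MvPolynomial.C (ψ (ProjSpace.affConst k (I j₀) a))) = algebraMap k K a := by
    intro a
    rw [hψk, hF, ← IsScalarTower.algebraMap_apply]
    rfl
  have hker : ∀ x, F x = 0 ↔ x ∈ 𝔷 := fun x => Ideal.algebraMap_residueField_eq_zero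
  have hinj : Function.Injective (F.comp (sectionHomGrass I j₀ ψ)) := by
    rw [injective_iff_map_eq_zero]
    exact fun a ha => hgen a ((hker _).1 ha)
  have hU := algebraicIndependent_of_generic I j₀ ψ F hkK hinj
  have hkW : ∀ x : kW, IsAlgebraic k (algebraMap kW K x) := hκW.isAlgebraic _ fun _ => rfl
  have hO : ∀ x : O, IsAlgebraic (Algebra.adjoin k (Set.range (algebraMap kW K) ∪
      Set.range fun p => algebraMap O K (c.α₁ p))) (algebraMap O K x) := fun x => by
    rw [← mem_algebraicSpan]
    -- The base ring of the smooth chart is generated by `kW` and `P₁`, and `O` is étale over it,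
    -- hence algebraic over these elements in `K`.
    refine mem_algebraicSpan_of_unramified (k := k) hε.formallyUnramified hεft
      (algebraMap O K) (fun r => ?_) x
    refine hR ((algebraicSpan k _).toSubring.comap (algebraMap O K)) (fun x => ?_) (fun p => ?_) r
    · refine subset_algebraicSpan _ (Or.inl ⟨x, ?_⟩)
      exact IsScalarTower.algebraMap_apply kW O K x
    · exact subset_algebraicSpan _ (Or.inr ⟨p, rfl⟩)
  refine c.isSmoothAt 𝔷 hc hθ (fun l => ψ (ProjSpace.affCoord (I j₀) l))
    (fun j => ψ (ProjSpace.affCoord (I j₀) (I j))) ?_ (MvPolynomial.C.comp bB)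
    (((MvPolynomial.C :
      B →+* MvPolynomial (Fin q × {l : Fin (n + 1) // l ∉ Set.range I}) B) : B →* _).comp aB) (fun j l => MvPolynomial.X (j.1, l))
    (fun l => MvPolynomial.X (j₀, l)) ?_ ?_ ?_ ?_ ?_ ?_
  · refine hc.exists_derivation_family (k := k) hkW hO _ _ (fun D h1 h2 => ?_)
      (fun j l => F (MvPolynomial.X (j, l))) ?_
    -- The coordinate at `I j₀` is the constant `1`, so the `y` and `z` are all the remaining affine
    -- coordinates.
    · refine D.eq_zero_of_formallyUnramified hψ (D.apply_affRing_eq_zero ψ (fun a => ?_) fun l => ?_)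
      · rw [hψk, D.map_algebraMap]
      · by_cases hl : l ∈ Set.range I
        · obtain ⟨j, rfl⟩ := hl
          by_cases hj : j = j₀
          · rw [hj, ProjSpace.affCoord_self, map_one, D.map_one_eq_zero]
          · exact h2 ⟨j, hj⟩
        · exact h1 ⟨l, hl⟩
    · convert hU using 2
      ext l
      rw [sectionEntry_self, map_sub, map_sum]
      refine congrArg (_ - ·) (Finset.sum_congr rfl fun j _ => ?_)
      rw [map_mul]
      rfl
  · intro T _ f g h1 h2 h3 h4
    refine MvPolynomial.ringHom_ext (fun b => ?_) (fun ⟨j, l⟩ => ?_)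
    · exact congr($(hB (f.comp MvPolynomial.C) (g.comp MvPolynomial.C) h1 h2) b)
    · by_cases hj : j = j₀
      · rw [hj]; exact h4 l
      · exact h3 ⟨j, hj⟩ l
  · exact fun q => congrArg MvPolynomial.C (hab q)
  · exact fun x => (MvPolynomial.eval₂Hom_C _ _ _).trans (congrArg MvPolynomial.C (hβ1 x))
  · exact fun p => (MvPolynomial.eval₂Hom_C _ _ _).trans (congrArg MvPolynomial.C (hβ2 p))
  · exact fun j l => (MvPolynomial.eval₂Hom_X' _ _ _).trans (sectionEntry_of_ne I j₀ ψ j l)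
  · exact fun l => (MvPolynomial.eval₂Hom_X' _ _ _).trans (sectionEntry_self I j₀ ψ l)

end GenericSmoothness

/-! ### Smoothness over charts of log schemes over a field. -/

section ChartsOverField

variable {k : Type u} [Field k] {n q : ℕ}
attribute [local instance] MvPolynomial.gradedAlgebra

/-- Constants as functions on a scheme over a field. -/
def AlgebraicGeometry.Scheme.Hom.const {T : Scheme.{u}} (t : T ⟶ Spec (.of k)) : k →+* Γ(T, ⊤) :=
  t.appTop.hom.comp (Scheme.ΓSpecIso (.of k)).inv.hom

lemma AlgebraicGeometry.Scheme.Hom.appTop_const {T T' : Scheme.{u}} (f : T' ⟶ T)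
    (t : T ⟶ Spec (.of k)) {t' : T' ⟶ Spec (.of k)} (h : f ≫ t = t') (a : k) :
    f.appTop (t.const a) = t'.const a := by
  subst h
  rw [Scheme.Hom.const, Scheme.Hom.const, Scheme.Hom.comp_appTop]
  rfl

lemma AlgebraicGeometry.Scheme.Hom.etale_const {T : Scheme.{u}} [IsAffine T] (t : T ⟶ Spec (.of k))
    [Etale t] : t.const.Etale :=
  RingHom.Etale.respectsIso.2 t.appTop.hom (Scheme.ΓSpecIso (.of k)).symm.commRingCatIsoToRingEquiv
    (HasRingHomProperty.appTop (P := @Etale) t inferInstance)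

lemma AlgebraicGeometry.Scheme.Hom.finiteType_const {T : Scheme.{u}} [IsAffine T]
    (t : T ⟶ Spec (.of k)) [LocallyOfFiniteType t] : t.const.FiniteType :=
  RingHom.finiteType_respectsIso.2 t.appTop.hom
    (Scheme.ΓSpecIso (.of k)).symm.commRingCatIsoToRingEquiv
    (HasRingHomProperty.appTop (P := @LocallyOfFiniteType) t inferInstance)

lemma locallyOfFiniteType_specMap {P Q : Type u} [CommMonoid P] [CommMonoid Q] [Monoid.FG P]
    (θ : Q →* P) : LocallyOfFiniteType (specMap θ) := by
  rw [specMap, HasRingHomProperty.Spec_iff (P := @LocallyOfFiniteType)]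
  refine RingHom.FiniteType.of_comp_finiteType (f := algebraMap ℤ (MonoidAlgebra ℤ Q)) ?_
  have : (MonoidAlgebra.mapDomainRingHom ℤ θ).comp (algebraMap ℤ (MonoidAlgebra ℤ Q)) =
    algebraMap ℤ (MonoidAlgebra ℤ P) := RingHom.ext_int _ _
  change ((MonoidAlgebra.mapDomainRingHom ℤ θ).comp (algebraMap ℤ (MonoidAlgebra ℤ Q))).FiniteType
  rw [this]
  exact (RingHom.finiteType_algebraMap).2 inferInstance

namespace LogHom.Chart

open Incidence

variable {X : Scheme.{u}} {s : X ⟶ Spec (.of k)} [LocallyOfFiniteType s] {M : LogStructure X}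
  {N : LogStructure (Spec (.of k))} {φ : LogHom M N s} {V : X.Etale} {W : (Spec (.of k)).Etale}
  {g : EtSpace V ⟶ EtSpace W} {hg : g ≫ etStr W = etStr V ≫ s} {Q P Q₁ P₁ : Type u}
  [CommMonoid Q] [CommMonoid P] [CommMonoid Q₁] [CommMonoid P₁]
  [IsAffine (EtSpace V)] [IsAffine (EtSpace W)]
  {c : φ.Chart g hg Q P} {c₁ : φ.Chart g hg Q₁ P₁}

variable (c) in
-- The source is of finite type over `k` and the target is finitely presented over `k`, since `k` is
-- Noetherian.
lemma finitePresentation_sectionHomProd [Monoid.FG P] (I : Fin q ↪o Fin (n + 1)) (j₀ : Fin q)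
    (ψ : ProjSpace.AffRing k (I j₀) →+* Γ(EtSpace V, ⊤)) :
    (sectionHomProd I j₀ ψ c.toBase.appTop.hom).FinitePresentation := by
  have h0 := locallyOfFiniteType_specMap c.hom
  have h1 : LocallyOfFiniteType c.baseTo := by
    rw [baseTo]; infer_instance
  have h2 := (c.baseTo).finiteType_const
  let C₁ : Γ(c.base, ⊤) →+*
    MvPolynomial (Fin q × {l : Fin (n + 1) // l ∉ Set.range I}) Γ(c.base, ⊤) := MvPolynomial.C
  let C₂ : Γ(EtSpace V, ⊤) →+* SectionRing Γ(EtSpace V, ⊤) I j₀ := MvPolynomial.C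
  have h3 : C₁.FiniteType := (RingHom.finiteType_algebraMap).2 inferInstance
  have h4 : C₂.FiniteType := (RingHom.finiteType_algebraMap).2 inferInstance
  have h5 := (etStr V ≫ s).finiteType_const
  refine RingHom.FinitePresentation.of_comp_finiteType (C₁.comp c.baseTo.const) ?_ (h3.comp h2)
  have h6 : (sectionHomProd I j₀ ψ c.toBase.appTop.hom).comp (C₁.comp c.baseTo.const) =
      C₂.comp (etStr V ≫ s).const := by
    refine RingHom.ext fun a => ?_
    refine (MvPolynomial.eval₂Hom_C _ _ _).trans (congrArg C₂ ?_)
    exact Scheme.Hom.appTop_const c.toBase c.baseTo c.toBase_baseTo a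
  rw [h6]
  exact RingHom.FinitePresentation.of_finiteType.1 (h4.comp h5)

/-- Tameness and smoothness over the base of the sharp chart, over the generic point of the
Grassmannian. -/
theorem Comparison.isTame_and_isSmoothAt (r : c₁.Comparison c) (hc₁ : c₁.IsSmooth)
    {Ω : Type u} [Field Ω] [IsSepClosed Ω] {v : Spec (.of Ω) ⟶ EtSpace V} (hc : c.IsSharpAt v)
    (I : Fin q ↪o Fin (n + 1)) (j₀ : Fin q)
    {ψ : ProjSpace.AffRing k (I j₀) →+* Γ(EtSpace V, ⊤)} (hψ : ψ.FormallyUnramified)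
    (hψk : ∀ a, ψ (ProjSpace.affConst k (I j₀) a) = (etStr V ≫ s).const a)
    (𝔷 : Ideal (SectionRing Γ(EtSpace V, ⊤) I j₀)) [𝔷.IsPrime]
    (hv : ∀ x : Γ(EtSpace V, ⊤), v.appTop x = 0 → MvPolynomial.C x ∈ 𝔷)
    (hgen : ∀ a, sectionHomGrass I j₀ ψ a ∈ 𝔷 → a = 0) :
    c.IsTame ∧
    letI := (sectionHomProd I j₀ ψ c.toBase.appTop.hom).toAlgebra
    Algebra.IsSmoothAt (MvPolynomial (Fin q × {l : Fin (n + 1) // l ∉ Set.range I}) Γ(c.base, ⊤))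
      𝔷 := by
  let _ := g.appTop.hom.toAlgebra
  have hfgP₁ := hc₁.fine_source.1
  have hfgQ₁ := hc₁.fine_target.1
  have hcanP₁ := hc₁.fine_source.2
  have hcanQ₁ := hc₁.fine_target.2
  let cp := r.chartPair hc₁ hc
  have hfgP := cp.fg_source
  have hfgQ := cp.fg_target
  let O := Γ(EtSpace V, ⊤)
  let K := 𝔷.ResidueField
  have hK : ∀ x : O, v.appTop x = 0 → algebraMap O K x = 0 := fun x hx =>
    Ideal.algebraMap_residueField_eq_zero.2 (hv x hx)
  -- Functions that vanish at the geometric point also vanish in `K`, because the prime of the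
  -- section ring lies over the image of that point.
  have hsharp : cp.IsSharpAt K := by
    refine ⟨fun p hp => hK _ (hc.source p hp), fun q hq => ?_⟩
    refine (IsScalarTower.algebraMap_apply Γ(EtSpace W, ⊤) O K _).trans (hK _ ?_)
    have := hc.target q hq
    rw [Scheme.Hom.comp_appTop] at this
    exact this
  have hne : ∀ m : ℕ, IsUnit (m : Γ(EtSpace W, ⊤)) → (m : K) ≠ 0 := fun m hm => by
    have := (hm.map (algebraMap Γ(EtSpace W, ⊤) K)).ne_zero
    rwa [map_natCast] at this
  -- Over a field `k`, an integer that is nonzero in `K` is nonzero in `k`, hence invertible on `W`.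
  have hunit : ∀ m : ℕ, (m : K) ≠ 0 → IsUnit (m : Γ(EtSpace W, ⊤)) := fun m hm => by
    have h1 : (m : k) ≠ 0 := fun h => hm (by
      have := congrArg ((algebraMap Γ(EtSpace W, ⊤) K).comp (etStr W).const) h
      rwa [map_natCast, map_zero] at this)
    have := h1.isUnit.map (etStr W).const
    rwa [map_natCast] at this
  have htame₁ : (gpMap cp.θ₁).IsTame K := ⟨hc₁.finite_ker, hne _ hc₁.isUnit_card_ker,
    hc₁.finite_torsion, hne _ hc₁.isUnit_card_torsion⟩
  have htame : (gpMap c.hom).IsTame K := hsharp.isTame htame₁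
  refine ⟨⟨⟨hfgQ, cp.isCancelMul_target⟩, ⟨hfgP, cp.isCancelMul_source⟩, htame.finite_ker,
    hunit _ htame.card_ker_ne_zero, htame.finite_torsion, hunit _ htame.card_torsion_ne_zero⟩, ?_⟩
  refine cp.isSmoothAt_of_generic (etStr W).etale_const hc₁.etale_appTop (fun T h1 h2 => ?_) I j₀
    hψ (fun a => ?_) 𝔷 hsharp htame₁ hgen c.baseFun c.baseMonoidFun (fun f f' => base_hom_ext)
    c.baseFun_target c.toBase.appTop.hom c.toBase_baseFun c.toBase_baseMonoidFun
    (c.finitePresentation_sectionHomProd I j₀ ψ)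
  -- A subring that contains the functions from `W` and from `P₁` receives a map from the base ring,
  -- by its universal property.
  · let gT : Γ(EtSpace W, ⊤) →+* T := g.appTop.hom.codRestrict T h1
    let aT : P₁ →* T := ((M.α V).comp c₁.source).codRestrict T h2
    obtain ⟨f, hf1, hf2⟩ := c₁.exists_base_hom gT aT fun q => Subtype.ext
      ((φ.α_map g hg (c₁.target q)).symm.trans (congrArg (M.α V) (c₁.comm q)).symm)
    have hf : T.subtype.comp f = c₁.toBase.appTop.hom := base_hom_ext
      (fun x => (congrArg T.subtype (hf1 x)).trans (c₁.toBase_baseFun x).symm)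
      (fun p => (congrArg T.subtype (hf2 p)).trans (c₁.toBase_baseMonoidFun p).symm)
    exact fun x => congr($hf x) ▸ (f x).2
  · rw [hψk]
    exact (Scheme.Hom.appTop_const g (etStr W) hg a).symm

end LogHom.Chart

end ChartsOverField

lemma MvPolynomial.isPushout_map {σ : Type} {k B : Type u} [CommRing k] [CommRing B] (γ : k →+* B) :
    IsPushout (CommRingCat.ofHom (algebraMap k (MvPolynomial σ k))) (CommRingCat.ofHom γ)
      (CommRingCat.ofHom (MvPolynomial.map (σ := σ) γ))
      (CommRingCat.ofHom (MvPolynomial.C (σ := σ) (R := B))) := by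
  let _ := γ.toAlgebra
  let _ : Algebra (MvPolynomial σ k) (MvPolynomial σ B) := MvPolynomial.algebraMvPolynomial
  have : IsScalarTower k (MvPolynomial σ k) (MvPolynomial σ B) :=
    IsScalarTower.of_algebraMap_eq fun x => (MvPolynomial.map_C γ x).symm
  exact CommRingCat.isPushout_of_isPushout k (MvPolynomial σ k) B (MvPolynomial σ B)

section ChartsOverField

variable {k : Type u} [Field k] {n q : ℕ}
attribute [local instance] MvPolynomial.gradedAlgebra

lemma AlgebraicGeometry.Scheme.Hom.specMap_const {T : Scheme.{u}} [IsAffine T]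
    (t : T ⟶ Spec (.of k)) : Spec.map (CommRingCat.ofHom t.const) = T.isoSpec.inv ≫ t := by
  have h1 : CommRingCat.ofHom t.const = (Scheme.ΓSpecIso (.of k)).inv ≫ t.appTop := rfl
  rw [h1, Spec.map_comp, Iso.eq_inv_comp, Scheme.isoSpec, asIso_hom,
    ← Scheme.toSpecΓ_naturality_assoc]
  erw [toSpecΓ_SpecMap_ΓSpecIso_inv]
  rw [Category.comp_id]

namespace Grassmannian

open Grass

/-- Products of affine schemes with the charts of the Grassmannian. -/
lemma exists_chart_prod {T : Scheme.{u}} [IsAffine T] (t : T ⟶ Spec (.of k))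
    (I : Fin q ↪o Fin (n + 1)) :
    ∃ μ : Spec (.of (MvPolynomial (Fin q × {l : Fin (n + 1) // l ∉ Set.range I}) Γ(T, ⊤))) ⟶
        pullback (toSpec k q (n + 1)) t,
      IsOpenImmersion μ ∧
      μ ≫ pullback.fst _ _ = Spec.map (CommRingCat.ofHom (MvPolynomial.map t.const)) ≫ ι k I ∧
      μ ≫ pullback.snd _ _ = Spec.map (CommRingCat.ofHom MvPolynomial.C) ≫ T.isoSpec.inv := by
  have H0 := isPullback_SpecMap_of_isPushout _ _ _ _ (MvPolynomial.isPushout_map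
    (σ := Fin q × {l : Fin (n + 1) // l ∉ Set.range I}) t.const)
  have H1 : IsPullback (Spec.map (CommRingCat.ofHom (MvPolynomial.C
      (σ := Fin q × {l : Fin (n + 1) // l ∉ Set.range I}) (R := Γ(T, ⊤)))) ≫ T.isoSpec.inv)
      (Spec.map (CommRingCat.ofHom (MvPolynomial.map t.const))) t (ι k I ≫ toSpec k q (n + 1)) := by
    rw [ι_toSpec]
    refine H0.flip.of_iso (Iso.refl _) T.isoSpec.symm (Iso.refl _) (Iso.refl _) ?_ ?_ ?_ ?_
    · simp
    · simp
    · rw [Iso.refl_hom, Category.comp_id, Scheme.Hom.specMap_const]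
      rfl
    · rw [Iso.refl_hom, Iso.refl_hom, Category.comp_id, Category.id_comp]
  let μ := pullback.lift (f := toSpec k q (n + 1)) (g := t)
    (Spec.map (CommRingCat.ofHom (MvPolynomial.map
      (σ := Fin q × {l : Fin (n + 1) // l ∉ Set.range I}) t.const)) ≫ ι k I)
    (Spec.map (CommRingCat.ofHom MvPolynomial.C) ≫ T.isoSpec.inv)
    (by rw [Category.assoc]; exact H1.w.symm)
  have hμ1 : μ ≫ pullback.fst _ _ = _ := pullback.lift_fst _ _ _
  have hμ2 : μ ≫ pullback.snd _ _ = _ := pullback.lift_snd _ _ _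
  have H2 : IsPullback μ (Spec.map (CommRingCat.ofHom (MvPolynomial.map t.const)))
      (pullback.fst _ _) (ι k I) := by
    refine IsPullback.of_right (h₁₂ := pullback.snd _ _) (h₂₂ := toSpec k q (n + 1)) (v₁₃ := t) ?_
      hμ1 (IsPullback.of_hasPullback _ _).flip
    rw [hμ2]
    exact H1
  exact ⟨μ, MorphismProperty.of_isPullback (P := @IsOpenImmersion) H2.flip inferInstance, hμ1, hμ2⟩

end Grassmannian

namespace LogHom.Chart

open Incidence

variable {X : Scheme.{u}} {s : X ⟶ Spec (.of k)} [LocallyOfFiniteType s] {M : LogStructure X}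
  {N : LogStructure (Spec (.of k))} {φ : LogHom M N s} {V : X.Etale} {W : (Spec (.of k)).Etale}
  {g : EtSpace V ⟶ EtSpace W} {hg : g ≫ etStr W = etStr V ≫ s} {Q P : Type u}
  [CommMonoid Q] [CommMonoid P] [IsAffine (EtSpace V)] [IsAffine (EtSpace W)]
  {c : φ.Chart g hg Q P}

/-- Smoothness at a prime of the chart of the section scheme, in terms of schemes. -/
theorem IsTame.smoothOverChartAt (hc : c.IsTame) (I : Fin q ↪o Fin (n + 1)) (j₀ : Fin q)
    {ψ : ProjSpace.AffRing k (I j₀) →+* Γ(EtSpace V, ⊤)}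
    (hψk : ∀ a, ψ (ProjSpace.affConst k (I j₀) a) = (etStr V ≫ s).const a)
    (𝔷 : PrimeSpectrum (SectionRing Γ(EtSpace V, ⊤) I j₀))
    (hsm : letI := (sectionHomProd I j₀ ψ c.toBase.appTop.hom).toAlgebra
      Algebra.IsSmoothAt (MvPolynomial (Fin q × {l : Fin (n + 1) // l ∉ Set.range I}) Γ(c.base, ⊤))
        𝔷.asIdeal)
    {H : Scheme.{u}} {a : H ⟶ X} {b : H ⟶ Grassmannian k q (n + 1)}
    (d : Spec (.of (SectionRing Γ(EtSpace V, ⊤) I j₀)) ⟶ H) [Etale d]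
    (hd1 : d ≫ a = Spec.map (CommRingCat.ofHom MvPolynomial.C) ≫ (EtSpace V).isoSpec.inv ≫ etStr V)
    (hd2 : d ≫ b = Spec.map (CommRingCat.ofHom (sectionHomGrass I j₀ ψ)) ≫ Grassmannian.ι k I) :
    φ.SmoothOverChartAt a (Grassmannian.toSpec k q (n + 1)) b (d 𝔷) := by
  let _ := (sectionHomProd I j₀ ψ c.toBase.appTop.hom).toAlgebra
  have hfgP := hc.fine_source.1
  let R₀ := MvPolynomial (Fin q × {l : Fin (n + 1) // l ∉ Set.range I}) Γ(c.base, ⊤)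
  let A := SectionRing Γ(EtSpace V, ⊤) I j₀
  have hfp : Algebra.FinitePresentation R₀ A := c.finitePresentation_sectionHomProd I j₀ ψ
  -- Smoothness at the prime holds on a principal open neighbourhood, which serves as the étale
  -- scheme over the section scheme.
  obtain ⟨σ, hσ, hsmooth⟩ := Algebra.IsSmoothAt.exists_notMem_smooth (R := R₀) 𝔷.asIdeal
  let loc : Spec (.of (Localization.Away σ)) ⟶ Spec (.of A) :=
    Spec.map (CommRingCat.ofHom (algebraMap A (Localization.Away σ)))
  have hloc : IsOpenImmersion loc :=
    inferInstanceAs (IsOpenImmersion (Spec.map (CommRingCat.ofHom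
      (algebraMap A (Localization.Away σ)))))
  obtain ⟨w, hw⟩ : 𝔷 ∈ Set.range loc := by
    change _ ∈ Set.range (PrimeSpectrum.comap (algebraMap A (Localization.Away σ)))
    rw [PrimeSpectrum.localization_away_comap_range (Localization.Away σ) σ]
    exact hσ
  let l : Spec (.of A) ⟶ EtSpace V :=
    Spec.map (CommRingCat.ofHom MvPolynomial.C) ≫ (EtSpace V).isoSpec.inv
  obtain ⟨μ, hμ, hμ1, hμ2⟩ := Grassmannian.exists_chart_prod (q := q) (n := n) c.baseTo I
  let ρ : Spec (.of A) ⟶ Spec (.of R₀) :=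
    Spec.map (CommRingCat.ofHom (sectionHomProd I j₀ ψ c.toBase.appTop.hom))
  have hρ1 : ρ ≫ μ ≫ pullback.fst _ _ = d ≫ b := by
    rw [hμ1, hd2, ← Spec.map_comp_assoc, ← CommRingCat.ofHom_comp]
    congr 3
    refine MvPolynomial.ringHom_ext (fun z => ?_) (fun p => ?_)
    · refine (congrArg (sectionHomProd I j₀ ψ c.toBase.appTop.hom) (MvPolynomial.map_C _ z)).trans ?_
      refine (MvPolynomial.eval₂Hom_C _ _ _).trans ?_
      refine Eq.trans ?_ (sectionHomGrass_const I j₀ ψ z).symm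
      rw [hψk]
      exact congrArg MvPolynomial.C (Scheme.Hom.appTop_const c.toBase c.baseTo c.toBase_baseTo z)
    · refine (congrArg (sectionHomProd I j₀ ψ c.toBase.appTop.hom) (MvPolynomial.map_X _ p)).trans ?_
      exact (MvPolynomial.eval₂Hom_X' _ _ _).trans (sectionHomGrass_X I j₀ ψ p).symm
  have hρ2 : ρ ≫ μ ≫ pullback.snd _ _ = l ≫ c.toBase := by
    rw [hμ2, Category.assoc, ← Scheme.isoSpec_inv_naturality, ← Spec.map_comp_assoc,
      ← Spec.map_comp_assoc]
    congr 2
    refine CommRingCat.hom_ext (RingHom.ext fun z => ?_)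
    exact MvPolynomial.eval₂Hom_C _ _ _
  have hsm' : Smooth (loc ≫ ρ) := by
    rw [← Spec.map_comp, HasRingHomProperty.Spec_iff (P := @Smooth)]
    have h : (algebraMap R₀ (Localization.Away σ)).Smooth :=
      (RingHom.smooth_algebraMap (R := R₀) (S := Localization.Away σ)).2 hsmooth
    rw [IsScalarTower.algebraMap_eq R₀ A] at h
    exact h
  refine ⟨V, W, g, hg, Q, P, _, _, c, hc, Spec (.of (Localization.Away σ)), loc ≫ d, loc ≫ l,
    (loc ≫ ρ) ≫ μ, inferInstance, ?_, ?_, ?_, inferInstance, w, ?_⟩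
  · rw [Category.assoc, Category.assoc, Category.assoc, hd1]
  · rw [Category.assoc, Category.assoc, Category.assoc, hρ1]
  · rw [Category.assoc, Category.assoc, Category.assoc, hρ2]
  · rw [Scheme.Hom.comp_apply, hw]

end LogHom.Chart

end ChartsOverField

/-! ### Smoothness along the generic fibre of the section scheme. -/

section ChartsOverField

open Incidence

variable {k : Type u} [Field k] {n q : ℕ}
attribute [local instance] MvPolynomial.gradedAlgebra

namespace sectionScheme

/-- By pasting fibre products; it transports the problem to an étale neighbourhood of a point of
`X`. -/
lemma isPullback_comp {X X' : Scheme.{u}} (e : X' ⟶ X) (f : X ⟶ ProjSpace k n) :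
    ∃ ε : sectionScheme (e ≫ f) q ⟶ sectionScheme f q,
      IsPullback ε (toX (e ≫ f) q) (toX f q) e ∧ ε ≫ toGrass f q = toGrass (e ≫ f) q := by
  let ε : sectionScheme (e ≫ f) q ⟶ sectionScheme f q :=
    pullback.lift (pullback.fst _ _) (pullback.snd _ _ ≫ e) (by
      rw [Category.assoc]; exact pullback.condition)
  have h1 : ε ≫ pullback.fst _ _ = pullback.fst _ _ := pullback.lift_fst _ _ _
  have h2 : ε ≫ pullback.snd _ _ = pullback.snd _ _ ≫ e := pullback.lift_snd _ _ _
  refine ⟨ε, ?_, ?_⟩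
  · refine (IsPullback.of_bot (v₁₁ := ε) (v₂₁ := pullback.fst _ _) (v₂₂ := f)
      (h₃₁ := incidence.toProj k q n) ?_ h2.symm (IsPullback.of_hasPullback _ _).flip).flip
    rw [h1]
    exact (IsPullback.of_hasPullback (incidence.toProj k q n) (e ≫ f)).flip
  · rw [toGrass, toGrass, ← Category.assoc, h1]

end sectionScheme

lemma exists_geometric_point {X : Scheme.{u}} (x : X) : ∃ (Ω : Type u) (_ : Field Ω)
    (_ : IsSepClosed Ω) (v : Spec (.of Ω) ⟶ X), v default = x := by
  refine ⟨AlgebraicClosure (X.residueField x), inferInstance, inferInstance,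
    Spec.map (CommRingCat.ofHom (algebraMap (X.residueField x) _)) ≫ X.fromSpecResidueField x, ?_⟩
  have : ∀ y, (X.fromSpecResidueField x) y = x := fun y => by
    have : (X.fromSpecResidueField x) y ∈ Set.range (X.fromSpecResidueField x) := ⟨y, rfl⟩
    rwa [Scheme.range_fromSpecResidueField] at this
  rw [Scheme.Hom.comp_apply]
  exact this _

namespace sectionScheme

lemma exists_mem_range_affι {X : Scheme.{u}} (f : X ⟶ ProjSpace k n) (z : sectionScheme f q)
    (I : Fin q ↪o Fin (n + 1)) (hI : toGrass f q z ∈ Set.range (Grassmannian.ι k I)) :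
    ∃ j, f (toX f q z) ∈ Set.range (ProjSpace.affι k (I j)) := by
  let w : sectionScheme f q ⟶ incidence k q n := pullback.fst _ _
  have hw : w ≫ incidence.toProj k q n = toX f q ≫ f := pullback.condition
  obtain ⟨j, hj⟩ := Incidence.exists_mem_range_affι (k := k) (w z) I (by
    rw [← Scheme.Hom.comp_apply]; exact hI)
  refine ⟨j, ?_⟩
  rwa [← Scheme.Hom.comp_apply, ← hw]

/-- Over the generic point of the Grassmannian, the section scheme is smooth over charts. -/
theorem smoothOverChartAt_of_generic {X : Scheme.{u}}
    {s : X ⟶ Spec (.of k)} [LocallyOfFiniteType s] {M : LogStructure X}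
    {N : LogStructure (Spec (.of k))} {φ : LogHom M N s} (hsharp : φ.IsSharp)
    (hsmooth : φ.LogSmooth) {f : X ⟶ ProjSpace k n} (hf : f ≫ ProjSpace.toSpec k n = s)
    [FormallyUnramified f] (I : Fin q ↪o Fin (n + 1)) (z : sectionScheme f q)
    (hz : toGrass f q z = Grassmannian.ι k I (⊥ : PrimeSpectrum (Grass.ChartRing k I))) :
    φ.SmoothOverChartAt (toX f q) (Grassmannian.toSpec k q (n + 1)) (toGrass f q) z := by
  obtain ⟨j₀, hj₀⟩ := exists_mem_range_affι f z I ⟨_, hz.symm⟩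
  obtain ⟨Ω, _, _, x, hx⟩ := exists_geometric_point (toX f q z)
  obtain ⟨V, W, g, hg, v, Q, P, Q₁, P₁, _, _, _, _, c, c₁, hv, hVa, hWa, hU, hc, hc₁, ⟨r⟩⟩ :=
    LogHom.exists_comparison (hsharp Ω x) (hsmooth Ω x)
      (f ⁻¹ᵁ (ProjSpace.affι k (I j₀)).opensRange) (by rw [hx]; exact hj₀)
  let A := Γ(EtSpace V, ⊤)
  let e : Spec (.of A) ⟶ X := (EtSpace V).isoSpec.inv ≫ etStr V
  let ψ' : Spec (.of A) ⟶ Spec (.of (ProjSpace.AffRing k (I j₀))) :=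
    IsOpenImmersion.lift (ProjSpace.affι k (I j₀)) (e ≫ f) (by
      rintro _ ⟨y, rfl⟩
      rw [Scheme.Hom.comp_apply, Scheme.Hom.comp_apply]
      exact hU ⟨_, rfl⟩)
  have hψ' : ψ' ≫ ProjSpace.affι k (I j₀) = e ≫ f := IsOpenImmersion.lift_fac _ _ _
  obtain ⟨ψ₀, hψ₀⟩ := Spec.map_surjective ψ'
  let ψ : ProjSpace.AffRing k (I j₀) →+* A := ψ₀.hom
  -- Unramifiedness of `f` survives composition with the étale map `e` and passes to the first
  -- factor.
  have hψ : ψ.FormallyUnramified := by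
    have h1 : FormallyUnramified (ψ' ≫ ProjSpace.affι k (I j₀)) := by
      have : FormallyUnramified e := inferInstance
      rw [hψ']
      exact MorphismProperty.comp_mem (W := @FormallyUnramified) _ _ this inferInstance
    have h2 : FormallyUnramified ψ' := FormallyUnramified.of_comp _ (ProjSpace.affι k (I j₀))
    rw [← hψ₀] at h2
    exact (HasRingHomProperty.Spec_iff (P := @FormallyUnramified)).1 h2
  have hψk : ∀ a, ψ (ProjSpace.affConst k (I j₀) a) = (etStr V ≫ s).const a := by
    have h1 : Spec.map (CommRingCat.ofHom (ψ.comp (ProjSpace.affConst k (I j₀)))) =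
        Spec.map (CommRingCat.ofHom (etStr V ≫ s).const) := by
      rw [Scheme.Hom.specMap_const, CommRingCat.ofHom_comp, Spec.map_comp, ← ProjSpace.affι_toSpec]
      have h2 : Spec.map (CommRingCat.ofHom ψ) = ψ' := hψ₀
      rw [h2, ← Category.assoc, hψ', Category.assoc, hf, Category.assoc]
    exact fun a => congr(($(Spec.map_injective h1)).hom a)
  obtain ⟨h, hho, h1, h2, hr⟩ := exists_chart (f := e ≫ f) I j₀ ψ (𝟙 _)
    (by rw [Category.id_comp, ← hψ', ← hψ₀]; rfl)
  obtain ⟨ε, hε, hεG⟩ := isPullback_comp (q := q) e f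
  have hεet : Etale ε := MorphismProperty.of_isPullback (P := @Etale) hε.flip inferInstance
  let p₀ : Spec (.of Ω) ⟶ Spec (.of A) := v ≫ (EtSpace V).isoSpec.hom
  have hp₀ : e (p₀ default) = toX f q z := by
    rw [← Scheme.Hom.comp_apply, ← hx, ← hv]
    have : p₀ ≫ e = v ≫ etStr V := by
      rw [Category.assoc, Iso.hom_inv_id_assoc]
    rw [this]
  -- A point over both `z` and the geometric point `v`; at its image the chart `c` is sharp.
  obtain ⟨z', hz'1, hz'2⟩ : ∃ z', ε z' = z ∧ toX (e ≫ f) q z' = p₀ default := by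
    obtain ⟨w, hw1, hw2⟩ := Scheme.Pullback.exists_preimage_pullback (f := toX f q) (g := e) z
      (p₀ default) hp₀.symm
    refine ⟨hε.isoPullback.inv w, ?_, ?_⟩
    · rw [← Scheme.Hom.comp_apply, hε.isoPullback_inv_fst, hw1]
    · rw [← Scheme.Hom.comp_apply, hε.isoPullback_inv_snd, hw2]
  have hz'G : toGrass (e ≫ f) q z' =
      Grassmannian.ι k I (⊥ : PrimeSpectrum (Grass.ChartRing k I)) := by
    rw [← hεG, Scheme.Hom.comp_apply, hz'1, hz]
  obtain ⟨𝔷, h𝔷⟩ : z' ∈ Set.range h := by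
    rw [hr]
    exact ⟨⟨_, hz'G.symm⟩, ⟨_, rfl⟩⟩
  have hcomap : Spec.map (CommRingCat.ofHom (sectionHomGrass I j₀ ψ)) 𝔷 =
      (⊥ : PrimeSpectrum (Grass.ChartRing k I)) := by
    refine (Grassmannian.ι k I).isOpenEmbedding.injective ?_
    rw [← hz'G, ← h𝔷, ← Scheme.Hom.comp_apply, ← Scheme.Hom.comp_apply, h2]
  have hgen : ∀ a, sectionHomGrass I j₀ ψ a ∈ 𝔷.asIdeal → a = 0 := fun a ha => by
    have : a ∈ (Spec.map (CommRingCat.ofHom (sectionHomGrass I j₀ ψ)) 𝔷).asIdeal := ha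
    rw [hcomap] at this
    exact this
  have hC : Spec.map (CommRingCat.ofHom MvPolynomial.C) 𝔷 = p₀ default := by
    rw [← hz'2, ← h𝔷, ← Scheme.Hom.comp_apply, h1, Category.comp_id]
  -- The prime under the point of the section chart is the kernel of evaluation at `v`, by the
  -- choice of `z'`.
  have hvz : ∀ x : A, v.appTop x = 0 → MvPolynomial.C x ∈ 𝔷.asIdeal := fun x hx => by
    change x ∈ (Spec.map (CommRingCat.ofHom MvPolynomial.C) 𝔷).asIdeal
    rw [hC]
    have h3 : p₀ = (Spec (.of Ω)).toSpecΓ ≫ Spec.map v.appTop := Scheme.toSpecΓ_naturality v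
    rw [h3, Scheme.Hom.comp_apply]
    have h4 : ∀ y : PrimeSpectrum Γ(Spec (.of Ω), ⊤),
        x ∈ (PrimeSpectrum.comap v.appTop.hom y).asIdeal := fun y => by
      rw [PrimeSpectrum.comap_asIdeal, Ideal.mem_comap]
      exact (congrArg (· ∈ y.asIdeal) hx).mpr (Ideal.zero_mem _)
    exact h4 _
  have hp : 𝔷.asIdeal.IsPrime := PrimeSpectrum.isPrime 𝔷
  obtain ⟨htame, hsm⟩ := r.isTame_and_isSmoothAt hc₁ hc I j₀ hψ hψk 𝔷.asIdeal hvz hgen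
  have := htame.smoothOverChartAt I j₀ hψk 𝔷 hsm (a := toX f q) (b := toGrass f q) (h ≫ ε)
    (by rw [Category.assoc, hε.w, ← Category.assoc, h1, Category.comp_id])
    (by rw [Category.assoc, hεG, h2])
  rw [Scheme.Hom.comp_apply, h𝔷, hz'1] at this
  exact this

end sectionScheme

end ChartsOverField

/-! ### Spreading out from the generic point of the Grassmannian. -/

namespace LogHom

/-- The locus of smoothness over charts is open. -/
lemma isOpen_setOf_smoothOverChartAt {X S : Scheme.{u}} {s : X ⟶ S} {M : LogStructure X}
    {N : LogStructure S} (φ : LogHom M N s) {Y T : Scheme.{u}} (a : Y ⟶ X) (t : T ⟶ S)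
    (b : Y ⟶ T) : IsOpen {y | φ.SmoothOverChartAt a t b y} := by
  rw [isOpen_iff_forall_mem_open]
  rintro y ⟨V, W, g, hg, Q, P, _, _, c, hc, D, d, l, m, hd, hl, hm1, hm2, hm, hy⟩
  refine ⟨Set.range d, ?_, d.isOpenMap.isOpen_range, hy⟩
  exact fun y' hy' => ⟨V, W, g, hg, Q, P, _, _, c, hc, D, d, l, m, hd, hl, hm1, hm2, hm, hy'⟩

end LogHom

/-- A closed subset of a spectrum that misses the generic fibre over a domain lies above a proper
closed subset. -/
lemma PrimeSpectrum.exists_ne_zero_of_isClosed {R B : Type u} [CommRing R] [IsDomain R]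
    [CommRing B] (φ : R →+* B) {Z : Set (PrimeSpectrum B)} (hZ : IsClosed Z)
    (h : ∀ z ∈ Z, ∃ a, φ a ∈ z.asIdeal ∧ a ≠ 0) : ∃ a ≠ 0, ∀ z ∈ Z, φ a ∈ z.asIdeal := by
  let π := (Ideal.Quotient.mk (vanishingIdeal Z)).comp φ
  by_contra! hcon
  have hinj : Function.Injective π := by
    rw [injective_iff_map_eq_zero]
    intro a ha
    by_contra ha0
    obtain ⟨z, hz, haz⟩ := hcon a ha0
    exact haz ((mem_vanishingIdeal _ _).1 (Ideal.Quotient.eq_zero_iff_mem.1 ha) z hz)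
  -- If no nonzero element works, `R` embeds in the functions on `Z`, so a prime of that ring
  -- contracts to zero. As `Z` is closed this gives a point of `Z` in the generic fibre.
  obtain ⟨p, hp, hp'⟩ := Ideal.exists_comap_eq_of_mem_minimalPrimes_of_injective hinj (⊥ : Ideal R)
    (by rw [IsDomain.minimalPrimes_eq_singleton_bot]; rfl)
  let z : PrimeSpectrum B := ⟨p.comap (Ideal.Quotient.mk _), inferInstance⟩
  have hz : z ∈ Z := by
    rw [← hZ.closure_eq, ← zeroLocus_vanishingIdeal_eq_closure]
    intro b hb
    change Ideal.Quotient.mk _ b ∈ p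
    rw [Ideal.Quotient.eq_zero_iff_mem.2 hb]
    exact p.zero_mem
  obtain ⟨a, ha, ha0⟩ := h z hz
  refine ha0 ?_
  have : a ∈ p.comap π := ha
  rwa [hp'] at this

section ChartsOverField

open Incidence

variable {k : Type u} [Field k] {n q : ℕ}
attribute [local instance] MvPolynomial.gradedAlgebra

lemma Grassmannian.exists_mem_range_ι (y : Grassmannian k q (n + 1)) :
    ∃ I, y ∈ Set.range (ι k I) := by
  obtain ⟨⟨I⟩, y, rfl⟩ := (Grass.glueData k q (n + 1)).ι_jointly_surjective y
  exact ⟨I, y, rfl⟩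

namespace sectionScheme

variable {X : Scheme.{u}} {f : X ⟶ ProjSpace k n}

/-- An open subset of the section scheme that contains the generic fibre contains, above an affine
open subset, the fibres over a dense open subset of a chart. -/
lemma exists_ne_zero_of_affineOpen {Z : Set (sectionScheme f q)} (hZ : IsOpen Z)
    (I : Fin q ↪o Fin (n + 1))
    (h : ∀ z, toGrass f q z = Grassmannian.ι k I (⊥ : PrimeSpectrum (Grass.ChartRing k I)) → z ∈ Z)
    (j : Fin q) {U : X.Opens} (hUa : IsAffineOpen U)
    (hU : U ≤ f ⁻¹ᵁ (ProjSpace.affι k (I j)).opensRange) :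
    ∃ a : Grass.ChartRing k I, a ≠ 0 ∧ ∀ (z : sectionScheme f q)
      (y : PrimeSpectrum (Grass.ChartRing k I)), toX f q z ∈ U →
      toGrass f q z = Grassmannian.ι k I y → a ∉ y.asIdeal → z ∈ Z := by
  let A := Γ(X, U)
  let g : Spec (.of A) ⟶ X := hUa.fromSpec
  have hgo : IsOpenImmersion g := inferInstanceAs (IsOpenImmersion hUa.fromSpec)
  let ψ' : Spec (.of A) ⟶ Spec (.of (ProjSpace.AffRing k (I j))) :=
    IsOpenImmersion.lift (ProjSpace.affι k (I j)) (g ≫ f) (by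
      rintro _ ⟨y, rfl⟩
      rw [Scheme.Hom.comp_apply]
      have : g y ∈ Set.range hUa.fromSpec := ⟨y, rfl⟩
      rw [hUa.range_fromSpec] at this
      exact hU this)
  have hψ' : ψ' ≫ ProjSpace.affι k (I j) = g ≫ f := IsOpenImmersion.lift_fac _ _ _
  obtain ⟨ψ₀, hψ₀⟩ := Spec.map_surjective ψ'
  let ψ : ProjSpace.AffRing k (I j) →+* A := ψ₀.hom
  obtain ⟨e, heo, h1, h2, hr⟩ := exists_chart (f := f) I j ψ g (by rw [← hψ', ← hψ₀]; rfl)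
  have hG : ∀ (𝔷 : PrimeSpectrum (SectionRing A I j)), toGrass f q (e 𝔷) = Grassmannian.ι k I
      (PrimeSpectrum.comap (sectionHomGrass I j ψ) 𝔷) := fun 𝔷 => congr($h2 𝔷)
  -- The complement of `Z` is closed and misses the generic fibre, so it lies over the zero locus of
  -- some `a ≠ 0`.
  obtain ⟨a, ha, ha'⟩ := PrimeSpectrum.exists_ne_zero_of_isClosed (sectionHomGrass I j ψ)
    (Z := (e ⁻¹' Z)ᶜ) (hZ.preimage e.continuous).isClosed_compl (fun 𝔷 h𝔷 => by
      by_contra! hcon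
      refine h𝔷 (h _ ((hG 𝔷).trans (congrArg _ (PrimeSpectrum.ext ?_))))
      exact eq_bot_iff.2 fun a ha => hcon a ha)
  refine ⟨a, ha, fun z y hz hy hay => ?_⟩
  obtain ⟨𝔷, rfl⟩ : z ∈ Set.range e := by
    rw [hr]
    refine ⟨⟨_, hy.symm⟩, ?_⟩
    change toX f q z ∈ Set.range hUa.fromSpec
    rw [hUa.range_fromSpec]
    exact hz
  by_contra hcon
  refine hay ?_
  have := (Grassmannian.ι k I).isOpenEmbedding.injective (hy.symm.trans (hG 𝔷))
  rw [this]
  exact ha' 𝔷 hcon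

/-- An open subset of the section scheme that contains the generic fibre contains the fibres over a
dense open subset of each chart. -/
lemma exists_ne_zero_of_isOpen [IsNoetherian X] {Z : Set (sectionScheme f q)} (hZ : IsOpen Z)
    (I : Fin q ↪o Fin (n + 1))
    (h : ∀ z, toGrass f q z = Grassmannian.ι k I (⊥ : PrimeSpectrum (Grass.ChartRing k I)) → z ∈ Z) :
    ∃ a : Grass.ChartRing k I, a ≠ 0 ∧ ∀ (z : sectionScheme f q)
      (y : PrimeSpectrum (Grass.ChartRing k I)),
      toGrass f q z = Grassmannian.ι k I y → a ∉ y.asIdeal → z ∈ Z := by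
  -- Finitely many affine opens suffice since `X` is Noetherian, so the functions obtained on them
  -- can be multiplied.
  have hfin : ∀ j : Fin q, ∃ 𝒰 : Set X.affineOpens, 𝒰.Finite ∧
      f ⁻¹ᵁ (ProjSpace.affι k (I j)).opensRange = ⨆ U ∈ 𝒰, (U : X.Opens) := fun j =>
    isCompact_iff_finite_and_eq_biUnion_affineOpens.1 (TopologicalSpace.NoetherianSpace.isCompact _)
  choose 𝒰 h𝒰 hcov using hfin
  have (j : Fin q) := (h𝒰 j).fintype
  choose a ha ha' using fun (p : Σ j, 𝒰 j) => exists_ne_zero_of_affineOpen hZ I h p.1 p.2.1.2 (by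
    rw [hcov]; exact le_biSup (fun U : X.affineOpens => (U : X.Opens)) p.2.2)
  refine ⟨∏ p, a p, Finset.prod_ne_zero_iff.2 fun p _ => ha p, fun z y hz hy => ?_⟩
  obtain ⟨j, hj⟩ := exists_mem_range_affι f z I ⟨y, hz.symm⟩
  have hj' : toX f q z ∈ f ⁻¹ᵁ (ProjSpace.affι k (I j)).opensRange := hj
  rw [hcov] at hj'
  simp only [TopologicalSpace.Opens.mem_iSup] at hj'
  obtain ⟨U, hU, hzU⟩ := hj'
  exact ha' ⟨j, U, hU⟩ z y hzU hz fun hmem => hy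
    (Ideal.mem_of_dvd _ (Finset.dvd_prod_of_mem a (Finset.mem_univ _)) hmem)

/-- An open subset of the section scheme that contains the generic fibre contains the fibres over a
dense open subset of the Grassmannian. -/
theorem exists_dense_of_isOpen [IsNoetherian X] {Z : Set (sectionScheme f q)} (hZ : IsOpen Z)
    (h : ∀ (I : Fin q ↪o Fin (n + 1)) (z : sectionScheme f q), toGrass f q z =
      Grassmannian.ι k I (⊥ : PrimeSpectrum (Grass.ChartRing k I)) → z ∈ Z) :
    ∃ U : (Grassmannian k q (n + 1)).Opens, Dense (U : Set (Grassmannian k q (n + 1))) ∧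
      ∀ z, toGrass f q z ∈ U → z ∈ Z := by
  choose a ha ha' using fun I => exists_ne_zero_of_isOpen hZ I (h I)
  refine ⟨⟨⋃ I, Grassmannian.ι k I '' (PrimeSpectrum.basicOpen (a I)).1, isOpen_iUnion fun I =>
    (Grassmannian.ι k I).isOpenEmbedding.isOpenMap _ (PrimeSpectrum.basicOpen (a I)).2⟩, ?_, ?_⟩
  · rw [dense_iff_inter_open]
    rintro O hO ⟨y, hy⟩
    obtain ⟨I, y, rfl⟩ := Grassmannian.exists_mem_range_ι y
    have h1 : IsOpen (X := PrimeSpectrum (Grass.ChartRing k I)) (Grassmannian.ι k I ⁻¹' O) :=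
      hO.preimage (Grassmannian.ι k I).continuous
    -- Each chart is irreducible, so a nonempty open subset meets the nonempty principal open of `a
    -- I`.
    obtain ⟨w, hw, hw'⟩ := nonempty_preirreducible_inter h1 (PrimeSpectrum.basicOpen (a I)).2
      ⟨y, hy⟩ ⟨⊥, ha I⟩
    exact ⟨_, hw, Set.mem_iUnion.2 ⟨I, w, hw', rfl⟩⟩
  · intro z hz
    obtain ⟨I, y, hy, hyz⟩ := Set.mem_iUnion.1 hz
    exact ha' I z y hyz.symm hy

end sectionScheme

end ChartsOverField

end

/-! ### The main theorem. -/

/-- **Bertini theorem for log smoothness.** -/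
theorem mainTheorem1 {k : Type u} [Field k] (Q : Type u) [CommMonoid Q] [IsCancelMul Q] [Monoid.FG Q]
    (N : LogStructure (Spec (.of k))) (hN : IsLogPoint N Q)
    (X : Scheme.{u}) (s : X ⟶ Spec (.of k)) [LocallyOfFiniteType s] [QuasiCompact s]
    (M : LogStructure X) (φ : LogHom M N s) (hsharp : φ.IsSharp) (hsmooth : φ.LogSmooth)
    (n r : ℕ) (hr : r ≤ n + 1)
    (f : X ⟶ ProjSpace k n) (hf : f ≫ ProjSpace.toSpec k n = s) [FormallyUnramified f]
    -- the inverse image log structures on the Grassmannian and on the incidence scheme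
    (MG : LogStructure (Grassmannian k (n + 1 - r) (n + 1)))
    (πG : LogHom MG N (Grassmannian.toSpec k (n + 1 - r) (n + 1))) (hπG : πG.IsStrict)
    (MH : LogStructure (sectionScheme f (n + 1 - r)))
    (πH : LogHom MH M (sectionScheme.toX f (n + 1 - r))) (hπH : πH.IsStrict)
    -- the projection from the incidence scheme to the Grassmannian as a morphism of log schemes
    (p : LogHom MH MG (sectionScheme.toGrass f (n + 1 - r)))
    (hp : p.comp πG rfl = πH.comp φ (sectionScheme.comm (n + 1 - r) hf)) :
    ∃ U : (Grassmannian k (n + 1 - r) (n + 1)).Opens,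
      Dense (U : Set (Grassmannian k (n + 1 - r) (n + 1))) ∧
      p.LogSmoothOver U ∧
      -- for every linear subspace `L` in `U`, over an extension field `K` of `k`, the linear section of
      -- `X` by `L` with the inverse image log structure is log smooth over the log point `(K, Q)`
      ∀ (K : Type u) [Field K] (L : Spec (.of K) ⟶ Grassmannian k (n + 1 - r) (n + 1)),
        Set.range L ⊆ U →
        ∀ (NK : LogStructure (Spec (.of K)))
          (ν : LogHom NK N (L ≫ Grassmannian.toSpec k (n + 1 - r) (n + 1))),
          ν.IsStrict →
        ∀ (ML : LogStructure (pullback (sectionScheme.toGrass f (n + 1 - r)) L))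
          (i : LogHom ML M (pullback.fst (sectionScheme.toGrass f (n + 1 - r)) L ≫
            sectionScheme.toX f (n + 1 - r))),
          i.IsStrict →
        ∀ χ : LogHom ML NK (pullback.snd (sectionScheme.toGrass f (n + 1 - r)) L),
          χ.comp ν rfl = i.comp φ (sectionScheme.fiber_comm (n + 1 - r) hf L) →
          χ.LogSmooth := by
  have : IsNoetherian X :=
    { LocallyOfFiniteType.isLocallyNoetherian s with
      toCompactSpace := QuasiCompact.compactSpace_of_compactSpace s }
  obtain ⟨U, hU, hgood⟩ := sectionScheme.exists_dense_of_isOpen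
    (φ.isOpen_setOf_smoothOverChartAt (sectionScheme.toX f (n + 1 - r))
      (Grassmannian.toSpec k (n + 1 - r) (n + 1)) (sectionScheme.toGrass f (n + 1 - r)))
    (fun I z hz => sectionScheme.smoothOverChartAt_of_generic hsharp hsmooth hf I z hz)
  refine ⟨U, hU, fun Ω _ _ x hx => ?_, fun K _ L hL NK ν hν ML i hi χ hχ Ω _ _ x => ?_⟩
  · refine LogHom.SmoothOverChartAt.logSmoothAt hπH hπG hp x (hgood _ (hx ⟨default, ?_⟩))
    rw [Scheme.Hom.comp_apply]
  -- For a single linear section, the smoothness over a chart obtained over `U` is base changed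
  -- along `L`, and only then converted to log smoothness.
  · refine LogHom.SmoothOverChartAt.logSmoothAt hi hν hχ x
      ((hgood _ ?_).baseChange L (x default) rfl)
    rw [← Scheme.Hom.comp_apply, pullback.condition, Scheme.Hom.comp_apply]
    exact hL ⟨_, rfl⟩
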